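/- Let $(M^6,g,J)$ be a connected Gray manifold, i.e. a connected $6$-dimensional strict nearly Kähler manifold: an almost Hermitian manifold with $(\nabla^g_XJ)X=0$ for all $X$ and $\nabla^gJ\not\equiv0$, where $\nabla^g$ is the Levi-Civita connection. Completeness is not assumed. Let $\nabla^\tau=\nabla^g+\tau$, $\tau_XY=-\tfrac12J(\nabla^g_XJ)Y$, be the canonical Hermitian connection. Suppose that $\mathfrak{hol}(\nabla^\tau)\subseteq\mathfrak s(\mathfrak u(1)\oplus\mathfrak u(2))$, i.e. that at some point $q\in M$ there is a complex line $L\subset T_qM$ with $\mathfrak{hol}_q(\nabla^\tau)\subseteq\mathfrak s(\mathfrak u(L)\oplus\mathfrak u(L^\perp))$. Let $p\in M$, and let $P\colon T_qM\to T_pM$ be the $\nabla^\tau$-parallel transport along a piecewise smooth curve from $q$ to $p$ (such curves exist). Then there is a connected open neighbourhood $U$ of $p$ with the following properties. 1. There is a $\nabla^\tau$-parallel distribution $\mathcal V$ on $U$ with $\mathcal V_p=P(L)$. 2. There are an oriented Riemannian $4$-manifold $(N,g_N)$ (in fact an open subset $N$ of $\mathbb R^4$ with its standard orientation and a smooth Riemannian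 metric) and a surjective Riemannian submersion $\pi\colon (U,g)\to(N,g_N)$ with connected fibres and $\ker d\pi=\mathcal V$; that is, $(N,g_N)$ is the leaf space of $\mathcal V$ on $U$. 3. $(N,g_N)$ is Einstein with positive scalar curvature, and its Weyl tensor is anti-self-dual ($W^+=0$). 4. Let $Z=\{(x,j): x\in N,\ j\in\mathrm{SO}(T_xN),\ j^2=-\mathrm{Id},\ j \text{ induces the orientation of } N\}$ be the twistor space of $N$, with projection $\pi_Z\colon Z\to N$, and let $TZ=\mathcal H_Z\oplus\mathcal V_Z$, where $\mathcal V_Z=\ker d\pi_Z$ (so that $\mathcal V_{Z,(x,j)}=\{A\in\mathfrak{so}(T_xN): Aj+jA=0\}$) and $\mathcal H_Z$ is the horizontal distribution induced by the Levi-Civita connection of $g_N$. For $\lambda>0$ let $g_\lambda$ be the metric on $Z$ that equals $\pi_Z^*g_N$ on $\mathcal H_Z$ and $-\lambda^{-1}\operatorname{tr}(AB)$ on $\mathcal V_Z$, with $\mathcal H_Z\perp\mathcal V_Z$. Let $J^-$ be the almost complex structure on $Z$ that at $(x,j)$ is the lift of $j$ on $\mathcal H_Z$ and $A\mapsto -j\circ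 A$ on $\mathcal V_Z$. Then for the constant $\lambda=\tfrac23\mathrm{scal}_{g_N}>0$ there is a diffeomorphism $F$ from $U$ onto an open subset of $Z$ with $\pi_Z\circ F=\pi$, $F^*g_\lambda=g$ and $dF\circ J=J^-\circ dF$. Thus $(M,g,J)$ is locally isomorphic to the nearly Kähler twistor space $(Z,g_\lambda,J^-)$ over an anti-self-dual Einstein $4$-manifold. -/

import Mathlib

set_option maxSynthPendingDepth 3

open scoped Manifold ContDiff Topology

noncomputable section

namespace GrayTwistor

/-- Endomorphisms of `E`; the product is composition. -/
abbrev EndV (E : Type*) [NormedAddCommGroup E] [NormedSpace ℝ E] := E →L[ℝ] E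

/-- Bilinear forms on `E`. -/
abbrev Bil (E : Type*) [NormedAddCommGroup E] [NormedSpace ℝ E] := E →L[ℝ] E →L[ℝ] ℝ

/-- `ℝ⁴` -/
abbrev R4 := EuclideanSpace ℝ (Fin 4)

/-- The standard basis of `ℝ⁴`, which defines its orientation. -/
abbrev stdBasis : Module.Basis (Fin 4) ℝ R4 := (EuclideanSpace.basisFun (Fin 4) ℝ).toBasis

section Coordinates

variable {E : Type*} [NormedAddCommGroup E] [NormedSpace ℝ E]

/-! ### Riemannian geometry on open subsets of a finite-dimensional vector space `E` -/

/-- `G` is a smooth Riemannian metric on the set `Ω ⊆ E`. -/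
structure IsMetricOn (G : E → Bil E) (Ω : Set E) : Prop where
  smooth : ContDiffOn ℝ ∞ G Ω
  symm : ∀ x ∈ Ω, ∀ u v, G x u v = G x v u
  pos : ∀ x ∈ Ω, ∀ u, u ≠ 0 → 0 < G x u u

/-- Christoffel symbols of the Levi-Civita connection: `christoffel G x u v = Γₓ(u, v)` is the vector
with `G(Γ(u,v), w) = ½ ((∂ᵤG)(v,w) + (∂ᵥG)(u,w) - (∂_wG)(u,v))` for all `w`. -/
def christoffel (G : E → Bil E) (x : E) : E →L[ℝ] EndV E :=
  let D : E →L[ℝ] Bil E := fderiv ℝ G x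
  let D' : E →L[ℝ] Bil E := ContinuousLinearMap.flip D
  let D'' : E →L[ℝ] Bil E :=
    (ContinuousLinearMap.flipₗᵢ ℝ E E ℝ).toContinuousLinearEquiv.toContinuousLinearMap.comp D'
  (1 / 2 : ℝ) •
    (ContinuousLinearMap.compL ℝ E (E →L[ℝ] ℝ) E (ContinuousLinearMap.inverse (G x))).comp
      (D + D' - D'')

/-- Covariant derivative `∇ᵤA = ∂ᵤA + [Γ(u), A]` of an endomorphism field `A`, for the connection
with connection form `Γ`. -/
def covDerivEnd (Γ : E → E →L[ℝ] EndV E) (A : E → EndV E) (x u : E) : EndV E :=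
  fderiv ℝ A x u + (Γ x u * A x - A x * Γ x u)

/-- Riemann curvature `R(u,v) = [∇ᵤ, ∇ᵥ]` for constant vector fields `u`, `v`. -/
def curvature (G : E → Bil E) (x u v : E) : EndV E :=
  fderiv ℝ (christoffel G) x u v - fderiv ℝ (christoffel G) x v u
    + (christoffel G x u * christoffel G x v - christoffel G x v * christoffel G x u)

/-- `Rm(u,v,w,z) = G(R(u,v)w, z)`. -/
def curvature4 (G : E → Bil E) (x u v w z : E) : ℝ := G x (curvature G x u v w) z

/-- `Ric(u,v) = tr (w ↦ R(w,u)v)`. -/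
def ricci (G : E → Bil E) (x u v : E) : ℝ :=
  LinearMap.trace ℝ E
    { toFun := fun w => curvature G x w u v
      map_add' := fun a b => by simp [curvature, add_mul, mul_add]; abel
      map_smul' := fun r a => by simp [curvature, smul_sub, smul_add] }

/-- Scalar curvature `gⁱʲ Ricᵢⱼ`. -/
def scal [FiniteDimensional ℝ E] (G : E → Bil E) (x : E) : ℝ :=
  ∑ i, ricci G x (Module.finBasis ℝ E i)
    (ContinuousLinearMap.inverse (G x)
      (LinearMap.toContinuousLinearMap ((Module.finBasis ℝ E).coord i)))

/-- Kulkarni–Nomizu product, with the sign for which the unit sphere has `Rm = ½ g ∧ g`. -/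
def kulkarniNomizu (h k : E → E → ℝ) (u v w z : E) : ℝ :=
  h u z * k v w + h v w * k u z - h u w * k v z - h v z * k u w

/-- Weyl curvature of a metric in dimension four. -/
def weyl [FiniteDimensional ℝ E] (G : E → Bil E) (x u v w z : E) : ℝ :=
  curvature4 G x u v w z
    - (1 / 2) * kulkarniNomizu (ricci G x) (fun a b => G x a b) u v w z
    + (scal G x / 12) * kulkarniNomizu (fun a b => G x a b) (fun a b => G x a b) u v w z

/-- `f` is a `B`-orthonormal frame, positive for the orientation of the basis `b`. -/
def IsOrientedOrthonormal (b : Module.Basis (Fin 4) ℝ E) (B : Bil E) (f : Fin 4 → E) : Prop :=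
  (∀ i j, B (f i) (f j) = if i = j then 1 else 0) ∧ 0 < b.det f

/-- The Weyl tensor is anti-self-dual on `Ω` (with the orientation of `b`): it annihilates the self-dual
bivectors, which are spanned by the `f₀ ∧ f₁ + f₂ ∧ f₃` with `f` a positive orthonormal frame. -/
def IsAntiSelfDualOn [FiniteDimensional ℝ E] (b : Module.Basis (Fin 4) ℝ E) (G : E → Bil E)
    (Ω : Set E) : Prop :=
  ∀ x ∈ Ω, ∀ f, IsOrientedOrthonormal b (G x) f →
    ∀ u v, weyl G x (f 0) (f 1) u v + weyl G x (f 2) (f 3) u v = 0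

/-- Einstein metrics. -/
def IsEinsteinOn (G : E → Bil E) (Ω : Set E) : Prop :=
  ∃ k : ℝ, ∀ x ∈ Ω, ∀ u v, ricci G x u v = k * G x u v

/-! ### The twistor space of an oriented Riemannian four-manifold

The base is an open set `Ω` of a four-dimensional vector space `E`, oriented by the basis `b`, with a
Riemannian metric `G`; then `End(TΩ) = Ω × End(E)`. -/

/-- The twistor space: pairs `(x, j)` with `j` an orthogonal complex structure on `TₓΩ` inducing the
given orientation (every basis `(u, ju, v, jv)` is positive). -/
def twistorSpace (b : Module.Basis (Fin 4) ℝ E) (G : E → Bil E) (Ω : Set E) : Set (E × EndV E) :=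
  {z | z.1 ∈ Ω ∧ (∀ u v, G z.1 (z.2 u) (z.2 v) = G z.1 u v) ∧ z.2 * z.2 = -1 ∧
    ∀ u v : E, 0 ≤ b.det ![u, z.2 u, v, z.2 v]}

/-- The horizontal lift of `v` to `z = (x, j)`: the velocity at `z` of a curve in the twistor space that
is obtained by Levi-Civita parallel transport of `j` along a curve with velocity `v`. -/
def horizontalLift (G : E → Bil E) (z : E × EndV E) (v : E) : E × EndV E :=
  (v, -(christoffel G z.1 v * z.2 - z.2 * christoffel G z.1 v))

/-- The vertical component of a tangent vector of the twistor space: an endomorphism of `TₓΩ` which is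
skew and anticommutes with `j`. -/
def verticalPart (G : E → Bil E) (z ξ : E × EndV E) : EndV E :=
  (ξ - horizontalLift G z ξ.1).2

/-- The metric `g_λ` on the twistor space: `G` on horizontal vectors, `-λ⁻¹ tr(AB)` on vertical ones,
and the two distributions are orthogonal. -/
def twistorMetric (G : E → Bil E) (lam : ℝ) (z ξ η : E × EndV E) : ℝ :=
  G z.1 ξ.1 η.1 +
    lam⁻¹ * (-LinearMap.trace ℝ E (verticalPart G z ξ * verticalPart G z η).toLinearMap)

/-- The almost complex structure `J⁻` of the twistor space: at `(x, j)` it is the horizontal lift of `j`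
on horizontal vectors and `A ↦ -jA` on vertical vectors. -/
def twistorJminus (G : E → Bil E) (z ξ : E × EndV E) : E × EndV E :=
  horizontalLift G z (z.2 ξ.1) + (0, -(z.2 * verticalPart G z ξ))

end Coordinates

/-! ### Almost Hermitian manifolds -/

section Manifold

variable {E : Type*} [NormedAddCommGroup E] [NormedSpace ℝ E]
  {M : Type*} [TopologicalSpace M] [ChartedSpace E M] [IsManifold 𝓘(ℝ, E) ∞ M]

/-- Smooth Riemannian metrics on `M`. -/
abbrev RiemMetric (E : Type*) [NormedAddCommGroup E] [NormedSpace ℝ E] (M : Type*)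
    [TopologicalSpace M] [ChartedSpace E M] [IsManifold 𝓘(ℝ, E) ∞ M] :=
  Bundle.ContMDiffRiemannianMetric 𝓘(ℝ, E) ∞ E (fun x : M => TangentSpace 𝓘(ℝ, E) x)

/-- Fields of endomorphisms of the tangent spaces of `M`. -/
abbrev EndField (E : Type*) [NormedAddCommGroup E] [NormedSpace ℝ E] (M : Type*)
    [TopologicalSpace M] [ChartedSpace E M] :=
  (x : M) → TangentSpace 𝓘(ℝ, E) x →L[ℝ] TangentSpace 𝓘(ℝ, E) x

/-- Differential at `x` of the chart around `c`. -/
def dChart (c x : M) : TangentSpace 𝓘(ℝ, E) x →L[ℝ] E :=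
  mfderiv 𝓘(ℝ, E) 𝓘(ℝ, E) (extChartAt 𝓘(ℝ, E) c) x

/-- Differential at `y` of the inverse of the chart around `c`. -/
def dChartInv (c : M) (y : E) :
    E →L[ℝ] TangentSpace 𝓘(ℝ, E) ((extChartAt 𝓘(ℝ, E) c).symm y) :=
  mfderiv 𝓘(ℝ, E) 𝓘(ℝ, E) (extChartAt 𝓘(ℝ, E) c).symm y

/-- The metric in the chart around `c`. -/
def chartMetric (g : RiemMetric E M) (c : M) (y : E) : Bil E :=
  let B : Bil E := g.inner ((extChartAt 𝓘(ℝ, E) c).symm y)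
  let ψ : EndV E := dChartInv c y
  B.bilinearComp ψ ψ

/-- An endomorphism field in the chart around `c`. -/
def chartEnd (J : EndField E M) (c : M) (y : E) : EndV E :=
  (dChart c ((extChartAt 𝓘(ℝ, E) c).symm y)).comp
    ((J ((extChartAt 𝓘(ℝ, E) c).symm y)).comp (dChartInv c y))

/-- `∇ᵍᵤJ` in the chart around `c`. -/
def nablaJ (g : RiemMetric E M) (J : EndField E M) (c : M) (y u : E) : EndV E :=
  covDerivEnd (christoffel (chartMetric g c)) (chartEnd J c) y u

/-- `(g, J)` is a (smooth) almost Hermitian structure. -/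
structure IsAlmostHermitian (g : RiemMetric E M) (J : EndField E M) : Prop where
  smooth : ContMDiff 𝓘(ℝ, E) (𝓘(ℝ, E).prod 𝓘(ℝ, E →L[ℝ] E)) ∞
    (fun x : M => Bundle.TotalSpace.mk' (E →L[ℝ] E)
      (E := fun x : M => TangentSpace 𝓘(ℝ, E) x →L[ℝ] TangentSpace 𝓘(ℝ, E) x) x (J x))
  sq : ∀ (x : M) (v : TangentSpace 𝓘(ℝ, E) x), J x (J x v) = -v
  compat : ∀ (x : M) (v w : TangentSpace 𝓘(ℝ, E) x), g.inner x (J x v) (J x w) = g.inner x v w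

/-- Nearly Kähler: almost Hermitian with `(∇ᵍᵤJ)u = 0`. -/
structure IsNearlyKahler (g : RiemMetric E M) (J : EndField E M) : Prop extends
    IsAlmostHermitian g J where
  nearly : ∀ (c : M), ∀ y ∈ (extChartAt 𝓘(ℝ, E) c).target, ∀ u, nablaJ g J c y u u = 0

/-- Strict nearly Kähler: nearly Kähler and not Kähler, i.e. `∇ᵍJ` is not identically zero.
In dimension six these are the Gray manifolds. -/
structure IsStrictNearlyKahler (g : RiemMetric E M) (J : EndField E M) : Prop extends
    IsNearlyKahler g J where
  strict : ∃ c : M, ∃ y ∈ (extChartAt 𝓘(ℝ, E) c).target, ∃ u, nablaJ g J c y u ≠ 0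

/-- The canonical Hermitian connection `∇^τ = ∇ᵍ + τ`, `τᵤ = -½ J ∘ ∇ᵍᵤJ`: its connection form in the
chart around `c`. -/
def canonicalForm (g : RiemMetric E M) (J : EndField E M) (c : M) (y u : E) : EndV E :=
  christoffel (chartMetric g c) y u - (1 / 2 : ℝ) • (chartEnd J c y * nablaJ g J c y u)

/-! ### Parallel transport and holonomy of the canonical connection -/

/-- `X` is a `∇^τ`-parallel vector field along the curve `γ`: at every time, in the chart around the
current point, its component vector `ξ` satisfies `ξ' + ω(γ')ξ = 0`. -/
def IsParallelAlong (g : RiemMetric E M) (J : EndField E M) (γ : ℝ → M)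
    (X : (t : ℝ) → TangentSpace 𝓘(ℝ, E) (γ t)) : Prop :=
  ∀ t : ℝ, HasDerivAt (fun s => dChart (γ t) (γ s) (X s))
    (-(canonicalForm g J (γ t) (extChartAt 𝓘(ℝ, E) (γ t) (γ t))
        (deriv (fun s => extChartAt 𝓘(ℝ, E) (γ t) (γ s)) t) (dChart (γ t) (γ t) (X t)))) t

/-- `P : TₓM → T_yM` is the `∇^τ`-parallel transport along some piecewise smooth curve from `x` to `y`. -/
inductive IsTransport (g : RiemMetric E M) (J : EndField E M) :
    (x y : M) → (TangentSpace 𝓘(ℝ, E) x →L[ℝ] TangentSpace 𝓘(ℝ, E) y) → Prop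
  | segment (γ : ℝ → M) (hγ : ContMDiff 𝓘(ℝ, ℝ) 𝓘(ℝ, E) ∞ γ)
      (P : TangentSpace 𝓘(ℝ, E) (γ 0) →L[ℝ] TangentSpace 𝓘(ℝ, E) (γ 1))
      (hP : ∀ v, ∃ X : (t : ℝ) → TangentSpace 𝓘(ℝ, E) (γ t),
        IsParallelAlong g J γ X ∧ X 0 = v ∧ X 1 = P v) :
      IsTransport g J (γ 0) (γ 1) P
  | comp {x y z : M} {P : TangentSpace 𝓘(ℝ, E) x →L[ℝ] TangentSpace 𝓘(ℝ, E) y}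
      {Q : TangentSpace 𝓘(ℝ, E) y →L[ℝ] TangentSpace 𝓘(ℝ, E) z}
      (hP : IsTransport g J x y P) (hQ : IsTransport g J y z Q) :
      IsTransport g J x z (Q.comp P)

/-- The holonomy algebra `hol_p(∇^τ)`: the Lie algebra of the holonomy group at `p`, that is, the
velocities at the identity of the `C¹` curves in the group of parallel transports around loops at `p`. -/
def holonomyAlgebra (g : RiemMetric E M) (J : EndField E M) (p : M) :
    Set (TangentSpace 𝓘(ℝ, E) p →L[ℝ] TangentSpace 𝓘(ℝ, E) p) :=
  {A | ∃ c : ℝ → E →L[ℝ] E, ContDiff ℝ 1 c ∧ (∀ t, IsTransport g J p p (c t)) ∧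
    c 0 = ContinuousLinearMap.id ℝ E ∧ deriv c 0 = A}

/-- The Lie algebra `s(u(L) ⊕ u(L^⊥))` of the skew-Hermitian endomorphisms of `T_pM` that have complex
trace zero and preserve the complex subspace `L` (hence also `L^⊥`). The complex trace of a real
endomorphism `A` commuting with `J` is `½ (tr A - i tr (JA))`. -/
def specialUnitarySplit (g : RiemMetric E M) (J : EndField E M) (p : M)
    (L : Submodule ℝ (TangentSpace 𝓘(ℝ, E) p)) :
    Set (TangentSpace 𝓘(ℝ, E) p →L[ℝ] TangentSpace 𝓘(ℝ, E) p) :=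
  {A | (∀ v w, g.inner p (A v) w = -g.inner p v (A w)) ∧ (∀ v, A (J p v) = J p (A v)) ∧
    LinearMap.trace ℝ (TangentSpace 𝓘(ℝ, E) p) A.toLinearMap = 0 ∧
    LinearMap.trace ℝ (TangentSpace 𝓘(ℝ, E) p) ((J p).comp A).toLinearMap = 0 ∧
    ∀ v ∈ L, A v ∈ L}

/-- `L` is a complex line in `T_pM`. -/
def IsComplexLine (J : EndField E M) (p : M) (L : Submodule ℝ (TangentSpace 𝓘(ℝ, E) p)) : Prop :=
  Module.finrank ℝ L = 2 ∧ ∀ v ∈ L, J p v ∈ L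

/-- The distribution `D` is `∇^τ`-parallel on `U`: it is preserved by parallel transport along curves in
`U`. -/
def IsParallelDistributionOn (g : RiemMetric E M) (J : EndField E M) (U : Set M)
    (D : (x : M) → Submodule ℝ (TangentSpace 𝓘(ℝ, E) x)) : Prop :=
  ∀ γ : ℝ → M, ContMDiff 𝓘(ℝ, ℝ) 𝓘(ℝ, E) ∞ γ → (∀ t, γ t ∈ U) →
    ∀ X : (t : ℝ) → TangentSpace 𝓘(ℝ, E) (γ t), IsParallelAlong g J γ X →
      X 0 ∈ D (γ 0) → ∀ t, X t ∈ D (γ t)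

/-! ### The local submersion and local isomorphisms with the twistor space -/

/-- `π : U → Ω` is a Riemannian submersion onto `(Ω, G)` whose fibres are the leaves in `U` of the
distribution `D`; thus `(Ω, G)` is the leaf space of `D` on `U`. -/
structure IsLeafSpaceSubmersion (g : RiemMetric E M) (U : Set M)
    (D : (x : M) → Submodule ℝ (TangentSpace 𝓘(ℝ, E) x))
    (G : R4 → Bil R4) (Ω : Set R4) (π : M → R4) : Prop where
  smooth : ContMDiffOn 𝓘(ℝ, E) 𝓘(ℝ, R4) ∞ π U
  image : π '' U = Ω
  surj : ∀ x ∈ U, Function.Surjective (mfderiv 𝓘(ℝ, E) 𝓘(ℝ, R4) π x)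
  vertical : ∀ x ∈ U, ∀ v : TangentSpace 𝓘(ℝ, E) x,
    mfderiv 𝓘(ℝ, E) 𝓘(ℝ, R4) π x v = 0 ↔ v ∈ D x
  horizontal : ∀ x ∈ U, ∀ u v : TangentSpace 𝓘(ℝ, E) x,
    (∀ w ∈ D x, g.inner x u w = 0) → (∀ w ∈ D x, g.inner x v w = 0) →
      G (π x) (mfderiv 𝓘(ℝ, E) 𝓘(ℝ, R4) π x u) (mfderiv 𝓘(ℝ, E) 𝓘(ℝ, R4) π x v) = g.inner x u v
  fibres : ∀ y ∈ Ω, IsConnected (U ∩ π ⁻¹' {y})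

/-- `F` restricts to an isomorphism of almost Hermitian manifolds from `(U, g, J)` onto an open subset of
the twistor space `(Z, g_λ, J⁻)` of `(Ω, G)`: it is smooth, it maps `U` onto the open subset `Z ∩ W`
of `Z` with a smooth inverse `Φ`, and its differential intertwines the metrics and the almost complex
structures. -/
structure IsTwistorIsomorphism (g : RiemMetric E M) (J : EndField E M) (U : Set M)
    (G : R4 → Bil R4) (Ω : Set R4) (lam : ℝ) (F : M → R4 × EndV R4) : Prop where
  smooth : ContMDiffOn 𝓘(ℝ, E) 𝓘(ℝ, R4 × EndV R4) ∞ F U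
  diffeo : ∃ (W : Set (R4 × EndV R4)) (Φ : R4 × EndV R4 → M), IsOpen W ∧
    F '' U = twistorSpace stdBasis G Ω ∩ W ∧ ContMDiffOn 𝓘(ℝ, R4 × EndV R4) 𝓘(ℝ, E) ∞ Φ W ∧
    ∀ x ∈ U, Φ (F x) = x
  isometry : ∀ x ∈ U, ∀ u v : TangentSpace 𝓘(ℝ, E) x,
    twistorMetric G lam (F x) (mfderiv 𝓘(ℝ, E) 𝓘(ℝ, R4 × EndV R4) F x u)
      (mfderiv 𝓘(ℝ, E) 𝓘(ℝ, R4 × EndV R4) F x v) = g.inner x u v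
  holomorphic : ∀ x ∈ U, ∀ u : TangentSpace 𝓘(ℝ, E) x,
    mfderiv 𝓘(ℝ, E) 𝓘(ℝ, R4 × EndV R4) F x (J x u) =
      twistorJminus G (F x) (mfderiv 𝓘(ℝ, E) 𝓘(ℝ, R4 × EndV R4) F x u)

end Manifold

end GrayTwistor

end

open GrayTwistor

set_option maxSynthPendingDepth 3
open scoped Manifold ContDiff Topology
noncomputable section
namespace GrayTwistor

-- The canonical connection `∇^τ` preserves `g` and `J`, and on a nearly Kähler manifold its torsion
-- `-J(∇J)` is totally skew and `J`-antilinear. The frame at `p` is transported along coordinate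
-- segments. The resulting connection form at `y` in the direction `v` is, up to sign, the velocity
-- of the transports around the thin loops `p → y → y + sv → p`; it therefore lies in the holonomy
-- algebra, carried from `q` to `p` by `P` (`exists_adaptedGauge`). So there is a unitary coframe
-- `θ₁, θ₂, θ₃` near `p`, with `θ₁ = θ₂ = 0` defining `𝒱`, a connection matrix with entries `a, b,
-- -b̄, c` on `θ₁, θ₂` and `-(a + c)` on `θ₃`, and a single torsion function `f`: `dθ₁ = -(a∧θ₁ +
-- b∧θ₂) + f θ̄₂∧θ̄₃`, and similarly for `θ₂, θ₃`.
--
-- Differentiating these equations gives `df = 0` (`IsMovingFrame.fderiv_f`) and `da + dc =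
-- |f|²(θ₁∧θ̄₁ + θ₂∧θ̄₂)` on vectors orthogonal to `𝒱` (`IsMovingFrame.extd_trace`). Since `f = 0`
-- is equivalent to `∇J = 0`, the zero set of `∇J` is open and closed, and strictness makes `f`
-- nonzero everywhere.
--
-- The forms `dθ₁, dθ₂` vanish on pairs of vectors of `𝒱`, so `𝒱` is integrable and there are
-- coordinates `(k, d) ∈ ℝ⁴ × ℂ` whose fibres `k = const` are the leaves (`exists_integral_leaves`).
-- The decisive observation is that the torsion terms of `dθ₁, dθ₂` can be absorbed into the
-- connection: `d(θ₁, θ₂) = -ω∧(θ₁, θ₂)`, where `ω` is skew with complex-linear entries `a, b, c`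
-- and antilinear entry `f θ̄₃`. Skewness along the fibres makes `|θ₁|² + |θ₂|²` descend to a metric
-- on the leaf space `N`; vanishing torsion makes `ω` the pull-back of its Levi-Civita connection
-- (`IsLeafFrame.fderiv_hor`).
--
-- At a point `z` over `x ∈ N`, multiplication by `i` in the coframe is an orthogonal complex
-- structure `j_z` on `TₓN`. Its covariant derivative is the commutator of `ω` with `i`, which sees
-- only `f θ̄₃` (`IsLeafFrame.fderiv_cs`). As `f ≠ 0`, the map `z ↦ (x, j_z)` is a local
-- diffeomorphism to the twistor space (`IsLeafFrame.exists_diffeo`). The vertical part of its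
-- differential has squared norm `16|f|²|θ₃|²` before scaling, so `λ = 16|f|²`, and the conjugate on
-- `θ₃` is the reason why `J` corresponds to `J⁻`.
--
-- The formula for `da + dc` says `tr(R(u,v) j_z) = 4|f|² g_N(j_z u, v)`. The curvature `R` of `N`
-- is the same along a fibre, so this relation may be differentiated in `z`; it then holds for every
-- self-dual endomorphism (`IsLeafFrame.trace_curvature_selfDual`). With the first Bianchi identity
-- this gives `Ric = 6|f|² g_N` and `W⁺ = 0`. Hence `scal = 24|f|²` and `λ = ⅔ scal`.

universe u

local notation "cj" => starRingEnd ℂ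

/-! ### Smooth inverse functions -/

section Inverse

variable {E F : Type*} [NormedAddCommGroup E] [NormedSpace ℝ E] [CompleteSpace E]
  [NormedAddCommGroup F] [NormedSpace ℝ F]

/-- The inverse is smooth wherever the derivative of `f` is invertible, which is an open condition.
Restricting to that set gives smoothness on the whole target and not only at the image of `x`. -/
theorem exists_smooth_inverse {f : E → F} {s : Set E} (hs : IsOpen s) (hf : ContDiffOn ℝ ∞ f s)
    {x : E} (hx : x ∈ s) (e : E ≃L[ℝ] F) (he : HasFDerivAt f (e : E →L[ℝ] F) x) :
    ∃ Φ : OpenPartialHomeomorph E F, x ∈ Φ.source ∧ Φ.source ⊆ s ∧ (∀ y, Φ y = f y) ∧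
      ContDiffOn ℝ ∞ Φ.symm Φ.target := by
  have hfx : ContDiffAt ℝ ∞ f x := hf.contDiffAt (hs.mem_nhds hx)
  have hc : ContinuousOn (fderiv ℝ f) s := hf.continuousOn_fderiv_of_isOpen hs (by simp)
  have ho : IsOpen (s ∩ fderiv ℝ f ⁻¹' Set.range ((↑) : (E ≃L[ℝ] F) → E →L[ℝ] F)) :=
    hc.isOpen_inter_preimage hs ContinuousLinearEquiv.isOpen
  let Φ₀ := hfx.toOpenPartialHomeomorph f he (by simp)
  let Φ := Φ₀.restrOpen _ ho
  have hsrc : Φ.source = Φ₀.source ∩ (s ∩ fderiv ℝ f ⁻¹' Set.range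
      ((↑) : (E ≃L[ℝ] F) → E →L[ℝ] F)) := rfl
  refine ⟨Φ, ?_, ?_, fun y => rfl, ?_⟩
  · rw [hsrc]
    exact ⟨hfx.mem_toOpenPartialHomeomorph_source he (by simp), hx, e, he.fderiv.symm⟩
  · rw [hsrc]; exact fun y hy => hy.2.1
  · intro a ha
    have hy : Φ.symm a ∈ Φ.source := Φ.map_target ha
    rw [hsrc] at hy
    obtain ⟨-, hys, e', he'⟩ := hy
    have hd : ContDiffAt ℝ ∞ f (Φ.symm a) := hf.contDiffAt (hs.mem_nhds hys)
    have h1 : HasFDerivAt Φ (e' : E →L[ℝ] F) (Φ.symm a) := by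
      rw [he']; exact (hd.differentiableAt (by simp)).hasFDerivAt
    exact (Φ.contDiffAt_symm ha h1 hd).contDiffWithinAt

end Inverse

/-! ### Superposition operators on spaces of continuous maps -/

section Superposition

variable {X : Type*} [TopologicalSpace X] [CompactSpace X]
  {F H : Type*} [NormedAddCommGroup F] [NormedSpace ℝ F] [NormedAddCommGroup H] [NormedSpace ℝ H]

/-- Pointwise application as a continuous bilinear map. -/
def applyC (X : Type*) [TopologicalSpace X] [CompactSpace X]
    (F H : Type*) [NormedAddCommGroup F] [NormedSpace ℝ F] [NormedAddCommGroup H]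
    [NormedSpace ℝ H] : C(X, F →L[ℝ] H) →L[ℝ] C(X, F) →L[ℝ] C(X, H) :=
  LinearMap.mkContinuous₂
    (LinearMap.mk₂ ℝ (fun A γ => (⟨fun x => A x (γ x), by fun_prop⟩ : C(X, H)))
      (fun _ _ _ => by ext; simp) (fun _ _ _ => by ext; simp)
      (fun _ _ _ => by ext; simp) (fun _ _ _ => by ext; simp)) 1 (by
    intro A γ
    rw [one_mul]
    refine (ContinuousMap.norm_le _ (by positivity)).2 fun x => ?_
    exact (ContinuousLinearMap.le_opNorm _ _).trans
      (mul_le_mul (A.norm_coe_le_norm x) (γ.norm_coe_le_norm x) (norm_nonneg _) (norm_nonneg _)))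

@[simp] theorem applyC_apply (A : C(X, F →L[ℝ] H)) (γ : C(X, F)) (x : X) :
    applyC X F H A γ x = A x (γ x) := rfl

/-- The mean value inequality is applied on the segment from `γ x` to `γ x + η x`. The estimate is
uniform in `x` because `γ ↦ f' ∘ γ` is continuous for the supremum norm, so no local compactness of
`F` is needed. -/
theorem hasFDerivAt_postcomp {f : C(F, H)} {f' : C(F, F →L[ℝ] H)}
    (hf : ∀ y, HasFDerivAt f (f' y) y) (γ : C(X, F)) :
    HasFDerivAt (fun γ : C(X, F) => f.comp γ) (applyC X F H (f'.comp γ)) γ := by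
  rw [hasFDerivAt_iff_isLittleO_nhds_zero, Asymptotics.isLittleO_iff]
  intro ε hε
  have hc : Continuous fun γ : C(X, F) => f'.comp γ := f'.continuous_postcomp
  obtain ⟨δ, hδ, h⟩ := Metric.continuousAt_iff.1 hc.continuousAt ε hε
  filter_upwards [Metric.ball_mem_nhds (0 : C(X, F)) hδ] with η hη
  rw [mem_ball_zero_iff] at hη
  refine (ContinuousMap.norm_le _ (by positivity)).2 fun x => ?_
  have key := Convex.norm_image_sub_le_of_norm_hasFDerivWithin_le' (f := f) (f' := fun y => f' y)
    (φ := f' (γ x)) (C := ε) (s := segment ℝ (γ x) (γ x + η x)) (x := γ x) (y := γ x + η x)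
    (fun y _ => (hf y).hasFDerivWithinAt) ?_ (convex_segment _ _) (left_mem_segment _ _ _)
    (right_mem_segment _ _ _)
  · simp only [add_sub_cancel_left] at key
    refine le_trans ?_ (key.trans (mul_le_mul_of_nonneg_left (η.norm_coe_le_norm x) hε.le))
    simp
  · rintro y ⟨a, b, ha, hb, hab, rfl⟩
    -- A point of the segment is the value at `x` of the curve `γ + b • η`, which is within `δ` of
    -- `γ`.
    have h1 : dist (γ + b • η) γ < δ := by
      rw [dist_eq_norm, add_sub_cancel_left, norm_smul, Real.norm_of_nonneg hb]
      nlinarith [norm_nonneg η]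
    have h2 := ContinuousMap.dist_apply_le_dist (f := f'.comp (γ + b • η)) (g := f'.comp γ) x
    have h3 : a • γ x + b • (γ x + η x) = (γ + b • η) x := by
      have : a = 1 - b := by linarith
      subst this
      simp only [ContinuousMap.add_apply, ContinuousMap.smul_apply]; module
    rw [h3, ← dist_eq_norm]
    exact h2.trans (h h1).le

/-- The derivative of postcomposition with `f` is postcomposition with `f'` followed by the linear
map `applyC`, so induction applies. The target must vary in the induction, and it shares the
universe of `F` so that `F →L[ℝ] H` is again an admissible target. -/
theorem contDiff_postcomp_nat {F : Type u} [NormedAddCommGroup F] [NormedSpace ℝ F] (n : ℕ) :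
    ∀ {H : Type u} [NormedAddCommGroup H] [NormedSpace ℝ H] (f : C(F, H)), ContDiff ℝ n f →
      ContDiff ℝ n (fun γ : C(X, F) => f.comp γ) := by
  induction n with
  | zero => exact fun f _ => contDiff_zero.2 f.continuous_postcomp
  | succ n ih =>
    intro H _ _ f hf
    have hf' := contDiff_succ_iff_fderiv.1 (by exact_mod_cast hf : ContDiff ℝ ((n : WithTop ℕ∞) + 1) f)
    let f' : C(F, F →L[ℝ] H) := ⟨fderiv ℝ f, hf'.2.2.continuous⟩
    have hd : ∀ γ : C(X, F), HasFDerivAt (fun γ : C(X, F) => f.comp γ)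
        (applyC X F H (f'.comp γ)) γ :=
      hasFDerivAt_postcomp fun y => (hf'.1 y).hasFDerivAt
    have : ContDiff ℝ ((n : WithTop ℕ∞) + 1) (fun γ : C(X, F) => f.comp γ) := by
      refine contDiff_succ_iff_fderiv.2 ⟨fun γ => (hd γ).differentiableAt, by simp, ?_⟩
      rw [show fderiv ℝ (fun γ : C(X, F) => f.comp γ) = fun γ => applyC X F H (f'.comp γ) from
        funext fun γ => (hd γ).fderiv]
      exact (applyC X F H).contDiff.comp (ih f' hf'.2.2)
    exact_mod_cast this

theorem contDiff_postcomp {F H : Type u} [NormedAddCommGroup F] [NormedSpace ℝ F]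
    [NormedAddCommGroup H] [NormedSpace ℝ H] (f : C(F, H)) (hf : ContDiff ℝ ∞ f) :
    ContDiff ℝ ∞ (fun γ : C(X, F) => f.comp γ) :=
  contDiff_infty.2 fun n => contDiff_postcomp_nat n f (contDiff_infty.1 hf n)

end Superposition

/-! ### Ordinary differential equations depending smoothly on initial values -/

section ODE

open unitInterval MeasureTheory

variable {F : Type u} [NormedAddCommGroup F] [NormedSpace ℝ F]

/-- Extension of a curve on `[0,1]` to the real line, constant outside `[0,1]`. -/
def extendI (γ : C(I, F)) (t : ℝ) : F := γ (Set.projIcc 0 1 zero_le_one t)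

theorem continuous_extendI (γ : C(I, F)) : Continuous (extendI γ) := by
  unfold extendI; exact γ.continuous.comp continuous_projIcc

theorem extendI_coe (γ : C(I, F)) (s : I) : extendI γ s = γ s := by
  simp [extendI]

/-- The primitive vanishing at `0`, as an operator on continuous curves. -/
def primitiveI (F : Type u) [NormedAddCommGroup F] [NormedSpace ℝ F] :
    C(I, F) →L[ℝ] C(I, F) :=
  LinearMap.mkContinuous
    { toFun := fun γ => ⟨fun s => ∫ τ in (0 : ℝ)..s, extendI γ τ,
        (intervalIntegral.continuous_primitive
          (fun a b => (continuous_extendI γ).intervalIntegrable a b) 0).comp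
            continuous_subtype_val⟩
      map_add' := fun γ η => by
        ext s
        simp only [ContinuousMap.coe_mk, ContinuousMap.add_apply]
        rw [← intervalIntegral.integral_add ((continuous_extendI γ).intervalIntegrable _ _)
          ((continuous_extendI η).intervalIntegrable _ _)]
        rfl
      map_smul' := fun r γ => by
        ext s
        simp only [ContinuousMap.coe_mk, ContinuousMap.smul_apply, RingHom.id_apply]
        rw [← intervalIntegral.integral_smul]
        rfl } 1 (by
    intro γ
    rw [one_mul]
    refine (ContinuousMap.norm_le _ (norm_nonneg _)).2 fun s => ?_
    have h := intervalIntegral.norm_integral_le_of_norm_le_const (a := 0) (b := (s : ℝ))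
      (f := extendI γ) (C := ‖γ‖) (fun x _ => γ.norm_coe_le_norm _)
    refine h.trans ?_
    rw [sub_zero, abs_of_nonneg s.2.1]
    exact mul_le_of_le_one_right (norm_nonneg _) s.2.2)

theorem primitiveI_apply (γ : C(I, F)) (s : I) :
    primitiveI F γ s = ∫ τ in (0 : ℝ)..s, extendI γ τ := rfl

/-- Constant curves. -/
def constI (F : Type u) [NormedAddCommGroup F] [NormedSpace ℝ F] : F →L[ℝ] C(I, F) :=
  LinearMap.mkContinuous
    { toFun := fun x => ContinuousMap.const I x
      map_add' := fun _ _ => by ext; simp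
      map_smul' := fun _ _ => by ext; simp } 1 (by
    intro x
    rw [one_mul]
    exact (ContinuousMap.norm_le _ (norm_nonneg _)).2 fun s => le_rfl)

@[simp] theorem constI_apply (x : F) (s : I) : constI F x s = x := rfl

/-- A curve satisfying an integral equation satisfies the differential equation. -/
theorem hasDerivWithinAt_of_integral [CompleteSpace F] {γ η : C(I, F)} {x : F}
    (h : γ = constI F x + primitiveI F η) {s : ℝ} (hs : s ∈ Set.Icc (0 : ℝ) 1) :
    HasDerivWithinAt (extendI γ) (extendI η s) (Set.Icc 0 1) s := by
  have h1 : HasDerivAt (fun s => x + ∫ τ in (0 : ℝ)..s, extendI η τ) (extendI η s) s :=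
    ((continuous_extendI η).integral_hasStrictDerivAt 0 s).hasDerivAt.const_add x
  have h2 : ∀ t ∈ Set.Icc (0 : ℝ) 1, extendI γ t = x + ∫ τ in (0 : ℝ)..t, extendI η τ := by
    intro t ht
    rw [h, extendI, Set.projIcc_of_mem zero_le_one ht]
    rfl
  exact h1.hasDerivWithinAt.congr h2 (h2 s hs)

/-- A function that is smooth near a point agrees near that point with a globally smooth one. -/
theorem exists_contDiff_eqOn_ball [FiniteDimensional ℝ F] {H : Type*} [NormedAddCommGroup H]
    [NormedSpace ℝ H] {f : F → H} {W : Set F} (hW : IsOpen W) (hf : ContDiffOn ℝ ∞ f W)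
    {x₀ : F} (hx : x₀ ∈ W) :
    ∃ g : F → H, ContDiff ℝ ∞ g ∧ ∃ r > 0, Metric.ball x₀ r ⊆ W ∧
      Set.EqOn g f (Metric.ball x₀ r) := by
  obtain ⟨R, hR, hRW⟩ := Metric.isOpen_iff.1 hW x₀ hx
  let b : ContDiffBump x₀ := ⟨R / 4, R / 2, by positivity, by linarith⟩
  refine ⟨fun x => b x • f x, ?_, R / 4, by positivity,
    (Metric.ball_subset_ball (by linarith)).trans hRW, fun x hx => ?_⟩
  · rw [contDiff_iff_contDiffAt]
    intro x
    by_cases hxW : x ∈ W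
    · exact b.contDiff.contDiffAt.smul (hf.contDiffAt (hW.mem_nhds hxW))
    · have hx' : x ∉ Metric.closedBall x₀ (R / 2) := fun h =>
        hxW (hRW (Metric.closedBall_subset_ball (by linarith) h))
      refine (contDiffAt_const (c := (0 : H))).congr_of_eventuallyEq ?_
      filter_upwards [Metric.isClosed_closedBall.isOpen_compl.mem_nhds hx'] with y hy
      have : b y = 0 := b.zero_of_le_dist (by
        simp only [Set.mem_compl_iff, Metric.mem_closedBall, not_le] at hy; exact hy.le)
      simp [this]
  · have : b x = 1 := b.one_of_mem_closedBall (Metric.ball_subset_closedBall hx)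
    simp [this]

/-- The solutions on `[0,1]` of `γ' = ε f(γ)`, for small `ε`, depend smoothly on the initial value, and
their derivatives solve the linearised equation. -/
theorem exists_smooth_solution [FiniteDimensional ℝ F] {f : F → F} {W : Set F} (hW : IsOpen W)
    (hf : ContDiffOn ℝ ∞ f W) {x₀ : F} (hx : x₀ ∈ W) :
    ∃ ε : ℝ, 0 < ε ∧ ∃ V : Set F, IsOpen V ∧ x₀ ∈ V ∧ ∃ γ : F → C(I, F), ContDiffOn ℝ ∞ γ V ∧
      ∀ x ∈ V, (∀ s, extendI (γ x) s ∈ W) ∧ γ x 0 = x ∧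
        (∀ s ∈ Set.Icc (0 : ℝ) 1, HasDerivWithinAt (extendI (γ x)) (ε • f (extendI (γ x) s))
          (Set.Icc 0 1) s) ∧
        ∀ w, fderiv ℝ γ x w 0 = w ∧ ∀ s ∈ Set.Icc (0 : ℝ) 1,
          HasDerivWithinAt (extendI (fderiv ℝ γ x w))
            (ε • fderiv ℝ f (extendI (γ x) s) (extendI (fderiv ℝ γ x w) s)) (Set.Icc 0 1) s := by
  -- Postcomposition has to be defined on all curves, so `f` is replaced by a global smooth `g`. The
  -- solutions are kept in the ball where `g = f` (`hnear`).
  obtain ⟨g, hg, r, hr, hrW, hgf⟩ := exists_contDiff_eqOn_ball hW hf hx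
  let gc : C(F, F) := ⟨g, hg.continuous⟩
  have hg' := contDiff_infty_iff_fderiv.1 hg
  let gc' : C(F, F →L[ℝ] F) := ⟨fderiv ℝ g, hg'.2.continuous⟩
  let N : C(I, F) → C(I, F) := fun γ => gc.comp γ
  have hN : ContDiff ℝ ∞ N := contDiff_postcomp gc hg
  have hN' : ∀ γ, HasFDerivAt N (applyC I F F (gc'.comp γ)) γ :=
    hasFDerivAt_postcomp fun y => (hg'.1 y).hasFDerivAt
  -- The third component is the defect of the integral equation. At `ε = 0` the constant curve has
  -- no defect and the derivative is triangular with identities on the diagonal, hence invertible.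
  -- The inverse function theorem in the space of curves then yields solutions for small `ε`, smooth
  -- in the initial value.
  let Θ : F × ℝ × C(I, F) → F × ℝ × C(I, F) := fun z =>
    (z.1, z.2.1, z.2.2 - constI F z.1 - z.2.1 • primitiveI F (N z.2.2))
  have hΘ : ContDiff ℝ ∞ Θ := by
    refine contDiff_fst.prodMk ((contDiff_fst.comp contDiff_snd).prodMk ?_)
    refine ((contDiff_snd.comp contDiff_snd).sub ((constI F).contDiff.comp contDiff_fst)).sub
      ((contDiff_fst.comp contDiff_snd).smul ?_)
    exact (primitiveI F).contDiff.comp (hN.comp (contDiff_snd.comp contDiff_snd))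
  let z₀ : F × ℝ × C(I, F) := (x₀, 0, constI F x₀)
  let c₀ : C(I, F) := primitiveI F (N (constI F x₀))
  let e : (F × ℝ × C(I, F)) ≃L[ℝ] (F × ℝ × C(I, F)) :=
    ContinuousLinearEquiv.equivOfInverse
      ((ContinuousLinearMap.fst ℝ F (ℝ × C(I, F))).prod
        (((ContinuousLinearMap.fst ℝ ℝ C(I, F)).comp (ContinuousLinearMap.snd ℝ F _)).prod
          ((ContinuousLinearMap.snd ℝ ℝ C(I, F)).comp (ContinuousLinearMap.snd ℝ F _)
            - (constI F).comp (ContinuousLinearMap.fst ℝ F _)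
            - ((ContinuousLinearMap.fst ℝ ℝ C(I, F)).comp
                (ContinuousLinearMap.snd ℝ F _)).smulRight c₀)))
      ((ContinuousLinearMap.fst ℝ F (ℝ × C(I, F))).prod
        (((ContinuousLinearMap.fst ℝ ℝ C(I, F)).comp (ContinuousLinearMap.snd ℝ F _)).prod
          ((ContinuousLinearMap.snd ℝ ℝ C(I, F)).comp (ContinuousLinearMap.snd ℝ F _)
            + (constI F).comp (ContinuousLinearMap.fst ℝ F _)
            + ((ContinuousLinearMap.fst ℝ ℝ C(I, F)).comp
                (ContinuousLinearMap.snd ℝ F _)).smulRight c₀)))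
      (fun z => by ext <;> simp <;> abel) (fun z => by ext <;> simp <;> abel)
  have he : HasFDerivAt Θ (e : (F × ℝ × C(I, F)) →L[ℝ] _) z₀ := by
    have h1 : HasFDerivAt (fun z : F × ℝ × C(I, F) => z.1)
      (ContinuousLinearMap.fst ℝ F (ℝ × C(I, F))) z₀ := hasFDerivAt_fst
    have h2 : HasFDerivAt (fun z : F × ℝ × C(I, F) => z.2.1)
        ((ContinuousLinearMap.fst ℝ ℝ C(I, F)).comp (ContinuousLinearMap.snd ℝ F _)) z₀ :=
      ((ContinuousLinearMap.fst ℝ ℝ C(I, F)).comp (ContinuousLinearMap.snd ℝ F _)).hasFDerivAt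
    have h3 : HasFDerivAt (fun z : F × ℝ × C(I, F) => z.2.2)
        ((ContinuousLinearMap.snd ℝ ℝ C(I, F)).comp (ContinuousLinearMap.snd ℝ F _)) z₀ :=
      ((ContinuousLinearMap.snd ℝ ℝ C(I, F)).comp (ContinuousLinearMap.snd ℝ F _)).hasFDerivAt
    have h4 := ((primitiveI F).hasFDerivAt.comp z₀ ((hN' z₀.2.2).comp z₀ h3))
    have h5 := h1.prodMk (h2.prodMk ((h3.sub ((constI F).hasFDerivAt.comp z₀ h1)).sub
      (h2.smul h4)))
    refine h5.congr_fderiv ?_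
    ext z <;> simp [e, z₀, c₀]
  obtain ⟨Φ, hΦ₀, -, hΦ, hΦs⟩ := exists_smooth_inverse isOpen_univ hΘ.contDiffOn
    (Set.mem_univ z₀) e he
  have hΘz : Θ z₀ = (x₀, 0, 0) := by simp [Θ, z₀]
  have hΦt : (x₀, 0, 0) ∈ Φ.target := by
    rw [← hΘz, ← hΦ]; exact Φ.map_source hΦ₀
  have hΦz : Φ.symm (x₀, 0, 0) = z₀ := by
    rw [← hΘz, ← hΦ]; exact Φ.left_inv hΦ₀
  -- the set of admissible initial data
  let Sol : F × ℝ → C(I, F) := fun y => (Φ.symm (y.1, y.2, 0)).2.2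
  let emb : F × ℝ → F × ℝ × C(I, F) := fun y => (y.1, y.2, 0)
  have hemb : ContDiff ℝ ∞ emb := contDiff_fst.prodMk (contDiff_snd.prodMk contDiff_const)
  have hSol : ContDiffOn ℝ ∞ Sol (emb ⁻¹' Φ.target) :=
    (contDiff_snd.comp contDiff_snd).comp_contDiffOn (hΦs.comp hemb.contDiffOn fun y hy => hy)
  have hTo : IsOpen (emb ⁻¹' Φ.target) := Φ.open_target.preimage hemb.continuous
  have hopen : IsOpen (emb ⁻¹' Φ.target ∩ Sol ⁻¹' Metric.ball (constI F x₀) r) :=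
    hSol.continuousOn.isOpen_inter_preimage hTo Metric.isOpen_ball
  have hmem : (x₀, (0 : ℝ)) ∈ emb ⁻¹' Φ.target ∩ Sol ⁻¹' Metric.ball (constI F x₀) r := by
    refine ⟨hΦt, ?_⟩
    simp [Sol, hΦz, z₀, hr]
  obtain ⟨δ, hδ, hball⟩ := Metric.isOpen_iff.1 hopen _ hmem
  -- One fixed time scale `δ / 2` serves all initial values in the ball.
  have hsub : ∀ x ∈ Metric.ball x₀ δ, (x, δ / 2) ∈
      emb ⁻¹' Φ.target ∩ Sol ⁻¹' Metric.ball (constI F x₀) r := by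
    intro x hx
    apply hball
    rw [Metric.mem_ball, Prod.dist_eq, max_lt_iff]
    refine ⟨hx, ?_⟩
    simp only [dist_zero_right, Real.norm_eq_abs]
    rw [abs_of_pos (by positivity)]; linarith
  have hγ : ContDiffOn ℝ ∞ (fun x => Sol (x, δ / 2)) (Metric.ball x₀ δ) :=
    hSol.comp (contDiff_id.prodMk contDiff_const).contDiffOn fun x hx => (hsub x hx).1
  have heq : ∀ x ∈ Metric.ball x₀ δ, Sol (x, δ / 2) =
      constI F x + primitiveI F ((δ / 2) • N (Sol (x, δ / 2))) := by
    intro x hx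
    have h1 := Φ.right_inv (hsub x hx).1
    rw [hΦ] at h1
    have h2 : (Φ.symm (x, δ / 2, 0)).1 = x := congrArg Prod.fst h1
    have h3 : (Φ.symm (x, δ / 2, 0)).2.1 = δ / 2 := congrArg (fun z => z.2.1) h1
    have h4 : Sol (x, δ / 2) - constI F (Φ.symm (x, δ / 2, 0)).1 -
      (Φ.symm (x, δ / 2, 0)).2.1 • primitiveI F (N (Sol (x, δ / 2))) = 0 :=
      congrArg (fun z => z.2.2) h1
    rw [h2, h3, sub_sub, sub_eq_zero] at h4
    rw [map_smul]; exact h4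
  have hnear : ∀ x ∈ Metric.ball x₀ δ, ∀ s, extendI (Sol (x, δ / 2)) s ∈ Metric.ball x₀ r := by
    intro x hx s
    have h1 : dist (Sol (x, δ / 2)) (constI F x₀) < r := (hsub x hx).2
    exact (ContinuousMap.dist_apply_le_dist (f := Sol (x, δ / 2)) (g := constI F x₀) _).trans_lt h1
  refine ⟨δ / 2, by positivity, Metric.ball x₀ δ, Metric.isOpen_ball, Metric.mem_ball_self hδ,
    fun x => Sol (x, δ / 2), hγ, fun x hx => ⟨fun s => hrW (hnear x hx s), ?_, fun s hs => ?_,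
    fun w => ?_⟩⟩
  · have h1 : Sol (x, δ / 2) 0 = (constI F x + primitiveI F ((δ / 2) • N (Sol (x, δ / 2)))) 0 :=
      congrArg (fun η : C(I, F) => η 0) (heq x hx)
    change Sol (x, δ / 2) 0 = x
    rw [h1]
    simp [primitiveI_apply]
  · have h1 := hasDerivWithinAt_of_integral (heq x hx) hs
    rw [← hgf (hnear x hx s)]
    exact h1
  · have hd : HasFDerivAt (fun x => Sol (x, δ / 2)) (fderiv ℝ (fun x => Sol (x, δ / 2)) x) x :=
      ((hγ.contDiffAt (Metric.isOpen_ball.mem_nhds hx)).differentiableAt (by simp)).hasFDerivAt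
    have hd' := ((constI F).hasFDerivAt (x := x)).add ((primitiveI F).hasFDerivAt.comp x
      (((hN' _).comp x hd).const_smul (δ / 2)))
    have hev : (fun x => Sol (x, δ / 2)) =ᶠ[𝓝 x] fun x => constI F x +
        primitiveI F ((δ / 2) • N (Sol (x, δ / 2))) := by
      filter_upwards [Metric.isOpen_ball.mem_nhds hx] with y hy using heq y hy
    -- Differentiating the integral equation in the initial value gives the integral form of the
    -- linearised equation.
    have h1 : fderiv ℝ (fun x => Sol (x, δ / 2)) x w = constI F w + primitiveI F ((δ / 2) •
        applyC I F F (gc'.comp (Sol (x, δ / 2))) (fderiv ℝ (fun x => Sol (x, δ / 2)) x w)) := by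
      have h2 := (hd'.congr_of_eventuallyEq hev).fderiv
      conv_lhs => rw [h2]
      simp
    refine ⟨?_, fun s hs => ?_⟩
    · rw [h1]; simp [primitiveI_apply]
    · have h2 := hasDerivWithinAt_of_integral h1 hs
      have h3 : fderiv ℝ f (extendI (Sol (x, δ / 2)) s) = fderiv ℝ g (extendI (Sol (x, δ / 2)) s) :=
        ((hgf.eventuallyEq_of_mem (Metric.isOpen_ball.mem_nhds (hnear x hx s))).fderiv_eq).symm
      rw [h3]
      exact h2

/-- Uniqueness for linear equations on `[0,1]`. -/
theorem linearODE_unique {A : ℝ → F →L[ℝ] F} (hA : ContinuousOn A (Set.Icc 0 1)) {Y Z : ℝ → F}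
    (hY : ∀ s ∈ Set.Icc (0 : ℝ) 1, HasDerivWithinAt Y (A s (Y s)) (Set.Icc 0 1) s)
    (hZ : ∀ s ∈ Set.Icc (0 : ℝ) 1, HasDerivWithinAt Z (A s (Z s)) (Set.Icc 0 1) s)
    (h0 : Y 0 = Z 0) : Set.EqOn Y Z (Set.Icc 0 1) := by
  obtain ⟨C, hC⟩ := isCompact_Icc.exists_bound_of_continuousOn hA
  have hmono : ∀ {Y : ℝ → F} {y : F} {t : ℝ}, t ∈ Set.Ico (0 : ℝ) 1 →
      HasDerivWithinAt Y y (Set.Icc 0 1) t → HasDerivWithinAt Y y (Set.Ici t) t :=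
    fun ht h => h.mono_of_mem_nhdsWithin (Icc_mem_nhdsGE_of_mem ht)
  refine ODE_solution_unique_of_mem_Icc_right (v := fun t z => A t z) (K := C.toNNReal)
    (s := fun _ => Set.univ) (fun t ht => ?_) (fun t ht => (hY t ht).continuousWithinAt)
    (fun t ht => hmono ht (hY t (Set.Ico_subset_Icc_self ht))) (fun _ _ => trivial)
    (fun t ht => (hZ t ht).continuousWithinAt)
    (fun t ht => hmono ht (hZ t (Set.Ico_subset_Icc_self ht))) (fun _ _ => trivial) h0
  have h1 : LipschitzWith ‖A t‖₊ (A t) := (A t).lipschitz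
  refine (h1.weaken ?_).lipschitzOnWith
  rw [← NNReal.coe_le_coe, coe_nnnorm]
  exact (hC t (Set.Ico_subset_Icc_self ht)).trans (Real.le_coe_toNNReal C)

theorem eq_of_hasDerivWithinAt_zero {Y : ℝ → F}
    (hY : ∀ s ∈ Set.Icc (0 : ℝ) 1, HasDerivWithinAt Y 0 (Set.Icc 0 1) s) {s : ℝ}
    (hs : s ∈ Set.Icc (0 : ℝ) 1) : Y s = Y 0 :=
  constant_of_derivWithin_zero (fun t ht => (hY t ht).differentiableWithinAt)
    (fun t ht => (hY t (Set.Ico_subset_Icc_self ht)).derivWithin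
      (uniqueDiffOn_Icc zero_lt_one t (Set.Ico_subset_Icc_self ht))) s hs

/-- Local integrability of a distribution spanned by the graphs of `S x : D → K`. -/
theorem exists_integral_leaves {K D : Type u} [NormedAddCommGroup K] [NormedSpace ℝ K]
    [FiniteDimensional ℝ K] [NormedAddCommGroup D] [NormedSpace ℝ D] [FiniteDimensional ℝ D]
    {S : K × D → D →L[ℝ] K} {W : Set (K × D)} (hW : IsOpen W) (hS : ContDiffOn ℝ ∞ S W)
    (h0 : (0, 0) ∈ W)
    (hint : ∀ x ∈ W, ∀ d e, fderiv ℝ S x (S x d, d) e = fderiv ℝ S x (S x e, e) d) :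
    ∃ V : Set (K × D), IsOpen V ∧ (0, 0) ∈ V ∧ ∃ Φ : K × D → K, ContDiffOn ℝ ∞ Φ V ∧
      (∀ z ∈ V, (Φ z, z.2) ∈ W ∧ ∀ w, fderiv ℝ Φ z (0, w) = S (Φ z, z.2) w) ∧
      ∀ k, (k, 0) ∈ V → Φ (k, 0) = k := by
  -- Leaves are traced along rays of `D`. The state is (position in `K`, parameter in `D`, constant
  -- direction), and the position moves by `S` applied to the direction.
  let f : K × D × D → K × D × D := fun x => (S (x.1, x.2.1) x.2.2, x.2.2, 0)
  let p : K × D × D →L[ℝ] K × D := (ContinuousLinearMap.fst ℝ K (D × D)).prod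
    ((ContinuousLinearMap.fst ℝ D D).comp (ContinuousLinearMap.snd ℝ K (D × D)))
  let p₃ : K × D × D →L[ℝ] D :=
    (ContinuousLinearMap.snd ℝ D D).comp (ContinuousLinearMap.snd ℝ K (D × D))
  have hpW : IsOpen (p ⁻¹' W) := hW.preimage p.continuous
  have hSp : ContDiffOn ℝ ∞ (fun x => S (p x)) (p ⁻¹' W) :=
    hS.comp p.contDiff.contDiffOn fun x hx => hx
  have hf : ContDiffOn ℝ ∞ f (p ⁻¹' W) :=
    (hSp.clm_apply p₃.contDiff.contDiffOn).prodMk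
      (p₃.contDiff.contDiffOn.prodMk contDiffOn_const)
  have hf' : ∀ x ∈ p ⁻¹' W, ∀ w : K × D × D, fderiv ℝ f x w =
      (fderiv ℝ S (p x) (p w) x.2.2 + S (p x) w.2.2, w.2.2, 0) := by
    intro x hx w
    have h1 : HasFDerivAt S (fderiv ℝ S (p x)) (p x) :=
      ((hS.contDiffAt (hW.mem_nhds hx)).differentiableAt (by simp)).hasFDerivAt
    have h2 := (h1.comp x p.hasFDerivAt).clm_apply (p₃.hasFDerivAt (x := x))
    have h3 := h2.prodMk ((p₃.hasFDerivAt (x := x)).prodMk (hasFDerivAt_const (0 : D) x))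
    have h4 : HasFDerivAt f _ x := h3
    rw [h4.fderiv]
    simp [p₃, add_comm]
  obtain ⟨ε, hε, V₀, hV₀, h0V, γ, hγ, hsol⟩ := exists_smooth_solution hpW hf
    (x₀ := (0, 0, 0)) h0
  -- The factor `ε⁻¹` undoes the time scale of the solutions, so that the ray with direction `z.2`
  -- reaches the parameter `z.2` exactly at time `1`.
  let ι : K × D →L[ℝ] K × D × D := (ContinuousLinearMap.fst ℝ K D).prod
    ((0 : K × D →L[ℝ] D).prod (ε⁻¹ • ContinuousLinearMap.snd ℝ K D))
  have hι : ∀ z : K × D, ι z = (z.1, 0, ε⁻¹ • z.2) := fun z => rfl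
  let V : Set (K × D) := ι ⁻¹' V₀
  have hV : IsOpen V := hV₀.preimage ι.continuous
  let ev : C(I, K × D × D) →L[ℝ] K :=
    (ContinuousLinearMap.fst ℝ K (D × D)).comp (ContinuousMap.evalCLM ℝ 1)
  let Φ : K × D → K := fun z => ev (γ (ι z))
  have hγι : ContDiffOn ℝ ∞ (fun z => γ (ι z)) V :=
    hγ.comp ι.contDiff.contDiffOn fun z hz => hz
  have hinit : ∀ x ∈ V₀, extendI (γ x) 0 = x := by
    intro x hx
    have := extendI_coe (γ x) 0
    rw [(hsol x hx).2.1] at this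
    simpa using this
  -- the second and third components of the solutions
  have hfst : ∀ x ∈ V₀, ∀ s ∈ Set.Icc (0 : ℝ) 1, (extendI (γ x) s).2.2 = x.2.2 := by
    intro x hx s hs
    have hd : ∀ s ∈ Set.Icc (0 : ℝ) 1,
        HasDerivWithinAt (fun s => p₃ (extendI (γ x) s)) 0 (Set.Icc 0 1) s := by
      intro s hs
      have := p₃.hasFDerivAt.comp_hasDerivWithinAt s ((hsol x hx).2.2.1 s hs)
      exact this.congr_deriv (by simp [p₃, f])
    have h2 := eq_of_hasDerivWithinAt_zero hd hs
    rw [hinit x hx] at h2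
    exact h2
  have hsnd : ∀ x ∈ V₀, ∀ s ∈ Set.Icc (0 : ℝ) 1,
      (extendI (γ x) s).2.1 = x.2.1 + (ε * s) • x.2.2 := by
    intro x hx s hs
    let p₂ : K × D × D →L[ℝ] D :=
      (ContinuousLinearMap.fst ℝ D D).comp (ContinuousLinearMap.snd ℝ K (D × D))
    have hd : ∀ s ∈ Set.Icc (0 : ℝ) 1, HasDerivWithinAt
        (fun s => p₂ (extendI (γ x) s) - (ε * s) • x.2.2) 0 (Set.Icc 0 1) s := by
      intro s hs
      have h1 := p₂.hasFDerivAt.comp_hasDerivWithinAt s ((hsol x hx).2.2.1 s hs)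
      have h2 : HasDerivWithinAt (fun s : ℝ => (ε * s) • x.2.2) (ε • x.2.2) (Set.Icc 0 1) s := by
        have := (((hasDerivAt_id s).const_mul ε).smul_const x.2.2).hasDerivWithinAt
          (s := Set.Icc 0 1)
        simpa using this
      refine (h1.sub h2).congr_deriv ?_
      have := hfst x hx s hs
      simp [p₂, f, this]
    have h2 := eq_of_hasDerivWithinAt_zero hd hs
    simp only [hinit x hx, mul_zero, zero_smul, sub_zero] at h2
    rw [sub_eq_iff_eq_add] at h2
    exact h2
  refine ⟨V, hV, by simpa [V, hι] using h0V, Φ, ev.contDiff.comp_contDiffOn hγι, ?_, ?_⟩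
  · intro z hz
    have h1mem : (1 : ℝ) ∈ Set.Icc (0 : ℝ) 1 := ⟨zero_le_one, le_rfl⟩
    have h1 : extendI (γ (ι z)) 1 = γ (ι z) 1 := by
      have := extendI_coe (γ (ι z)) 1
      simpa using this
    have hpos : ∀ s ∈ Set.Icc (0 : ℝ) 1, p (extendI (γ (ι z)) s) =
        ((extendI (γ (ι z)) s).1, s • z.2) := by
      intro s hs
      have h2 := hsnd _ hz s hs
      rw [hι] at h2
      simp only [zero_add, smul_smul] at h2
      rw [show ε * s * ε⁻¹ = s by field_simp] at h2
      exact Prod.ext rfl h2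
    have hΦ1 : p (extendI (γ (ι z)) 1) = (Φ z, z.2) := by
      rw [hpos 1 h1mem, one_smul, h1]; rfl
    have hmem := (hsol _ hz).1
    refine ⟨by rw [← hΦ1]; exact hmem 1, fun w => ?_⟩
    let w' : K × D × D := (0, 0, ε⁻¹ • w)
    have hΦd : fderiv ℝ Φ z (0, w) = ev (fderiv ℝ γ (ι z) w') := by
      have hd : HasFDerivAt γ (fderiv ℝ γ (ι z)) (ι z) :=
        ((hγ.contDiffAt (hV₀.mem_nhds hz)).differentiableAt (by simp)).hasFDerivAt
      have h2 : HasFDerivAt Φ (ev.comp ((fderiv ℝ γ (ι z)).comp ι)) z :=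
        ev.hasFDerivAt.comp z (hd.comp z ι.hasFDerivAt)
      rw [h2.fderiv]
      simp [hι, w']
    obtain ⟨hw0, hwd⟩ := (hsol _ hz).2.2.2 w'
    let A : ℝ → (K × D × D) →L[ℝ] (K × D × D) := fun s => ε • fderiv ℝ f (extendI (γ (ι z)) s)
    have hA : ContinuousOn A (Set.Icc 0 1) := by
      refine ContinuousOn.const_smul ?_ ε
      exact (hf.continuousOn_fderiv_of_isOpen hpW (by simp)).comp
        (continuous_extendI _).continuousOn fun s _ => hmem s
    -- The variation of the rays in the direction `w` solves the linearised equation with zero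
    -- initial position. By the symmetry `hint`, which is the integrability condition, `s • S w`
    -- solves it too. Uniqueness at `s = 1` gives `∂Φ(0, w) = S w`.
    let Z : ℝ → K × D × D := fun s =>
      (s • S (p (extendI (γ (ι z)) s)) w, s • w, ε⁻¹ • w)
    have hZ : ∀ s ∈ Set.Icc (0 : ℝ) 1, HasDerivWithinAt Z (A s (Z s)) (Set.Icc 0 1) s := by
      intro s hs
      have hSd : HasFDerivAt S (fderiv ℝ S (p (extendI (γ (ι z)) s))) (p (extendI (γ (ι z)) s)) :=
        ((hS.contDiffAt (hW.mem_nhds (hmem s))).differentiableAt (by simp)).hasFDerivAt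
      have h2 := hSd.comp_hasDerivWithinAt s
        (p.hasFDerivAt.comp_hasDerivWithinAt s ((hsol _ hz).2.2.1 s hs))
      have h3 := h2.clm_apply (hasDerivWithinAt_const s (Set.Icc (0 : ℝ) 1) w)
      have h4 := (hasDerivWithinAt_id s (Set.Icc (0 : ℝ) 1)).smul h3
      have h5 := h4.prodMk (((hasDerivWithinAt_id s (Set.Icc (0 : ℝ) 1)).smul_const w).prodMk
        (hasDerivWithinAt_const s (Set.Icc (0 : ℝ) 1) (ε⁻¹ • w)))
      refine h5.congr_deriv ?_
      have he : (extendI (γ (ι z)) s).2.2 = ε⁻¹ • z.2 := hfst _ hz s hs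
      have hi := hint _ (hmem s) z.2 w
      simp only [A, Z, smul_apply, hf' _ (hmem s), he]
      have hp1 : p (s • S (p (extendI (γ (ι z)) s)) w, s • w, ε⁻¹ • w) =
          s • (S (p (extendI (γ (ι z)) s)) w, w) := rfl
      have hp2 : p (ε • f (extendI (γ (ι z)) s)) = (S (p (extendI (γ (ι z)) s)) z.2, z.2) := by
        have : p (f (extendI (γ (ι z)) s)) =
            (S (p (extendI (γ (ι z)) s)) (ε⁻¹ • z.2), ε⁻¹ • z.2) := by
          rw [← he]; rfl
        rw [map_smul, this, map_smul, Prod.smul_mk, smul_smul, smul_smul,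
          mul_inv_cancel₀ hε.ne', one_smul, one_smul]
      rw [hp1, hp2, map_smul (fderiv ℝ S (p (extendI (γ (ι z)) s)))]
      simp only [Function.comp_apply, id_eq, hi, map_zero, add_zero, one_smul, zero_add, map_smul,
        smul_apply, Prod.smul_mk, smul_add, smul_smul, smul_zero,
        mul_inv_cancel₀ hε.ne']
      rw [show ε * (ε⁻¹ * s) = s by field_simp]
    have hYZ := linearODE_unique hA (fun s hs => hwd s hs) hZ (by
      have := extendI_coe (fderiv ℝ γ (ι z) w') 0
      rw [hw0] at this
      simpa [Z, w'] using this) h1mem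
    have h6 : extendI (fderiv ℝ γ (ι z) w') 1 = fderiv ℝ γ (ι z) w' 1 := by
      have := extendI_coe (fderiv ℝ γ (ι z) w') 1
      simpa using this
    rw [hΦd, ← hΦ1]
    change (fderiv ℝ γ (ι z) w' 1).1 = _
    rw [← h6, hYZ]
    simp [Z]
  · intro k hk
    have hz : ((k, 0, 0) : K × D × D) ∈ V₀ := by simpa [V, hι] using hk
    have hd : ∀ s ∈ Set.Icc (0 : ℝ) 1,
        HasDerivWithinAt (extendI (γ (k, 0, 0))) 0 (Set.Icc 0 1) s := by
      intro s hs
      refine ((hsol _ hz).2.2.1 s hs).congr_deriv ?_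
      simp [f, hfst _ hz s hs]
    have h1 := eq_of_hasDerivWithinAt_zero hd (s := 1) ⟨zero_le_one, le_rfl⟩
    rw [hinit _ hz] at h1
    have h2 := extendI_coe (γ (k, 0, 0)) 1
    change (γ (ι (k, 0)) 1).1 = k
    rw [show ι (k, 0) = (k, 0, 0) by simp [hι], ← h2]
    simp [h1]

end ODE

theorem two_le_infty : (2 : WithTop ℕ∞) ≤ ∞ :=
  WithTop.coe_le_coe.2 (le_top : (2 : ℕ∞) ≤ ⊤)

/-! ### Levi-Civita connections -/

section LeviCivita

variable {E : Type*} [NormedAddCommGroup E] [NormedSpace ℝ E] [FiniteDimensional ℝ E]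

theorem exists_equiv_of_pos {B : Bil E} (hB : ∀ u, u ≠ 0 → 0 < B u u) :
    ∃ e : E ≃L[ℝ] (E →L[ℝ] ℝ), (e : E →L[ℝ] E →L[ℝ] ℝ) = B := by
  have hinj : Function.Injective B.toLinearMap := by
    rw [← LinearMap.ker_eq_bot, LinearMap.ker_eq_bot']
    intro u hu
    by_contra h
    have h1 := hB u h
    have h2 : B u = 0 := hu
    simp [h2] at h1
  have hd : Module.finrank ℝ E = Module.finrank ℝ (E →L[ℝ] ℝ) := by
    rw [← (LinearMap.toContinuousLinearMap (𝕜 := ℝ) (E := E) (F' := ℝ)).finrank_eq]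
    exact (Subspace.dual_finrank_eq (K := ℝ) (V := E)).symm
  exact ⟨(LinearEquiv.ofInjectiveOfFinrankEq B.toLinearMap hinj hd).toContinuousLinearEquiv, rfl⟩

theorem apply_inverse_of_pos {B : Bil E} (hB : ∀ u, u ≠ 0 → 0 < B u u) (φ : E →L[ℝ] ℝ) :
    B (ContinuousLinearMap.inverse B φ) = φ := by
  obtain ⟨e, rfl⟩ := exists_equiv_of_pos hB
  simp

theorem eq_of_inner_eq {B : Bil E} (hB : ∀ u, u ≠ 0 → 0 < B u u) {u v : E}
    (h : ∀ w, B u w = B v w) : u = v := by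
  by_contra hne
  have h1 := hB (u - v) (sub_ne_zero.2 hne)
  have h2 := h (u - v)
  simp only [map_sub, sub_apply] at h1 h2
  linarith

theorem christoffel_inner {G : E → Bil E} {x : E} (hB : ∀ u, u ≠ 0 → 0 < G x u u) (u v w : E) :
    G x (christoffel G x u v) w =
      (1 / 2) * (fderiv ℝ G x u v w + fderiv ℝ G x v u w - fderiv ℝ G x w u v) := by
  have : christoffel G x u v = (1 / 2 : ℝ) • ContinuousLinearMap.inverse (G x)
      (fderiv ℝ G x u v + (ContinuousLinearMap.flip (fderiv ℝ G x)) u v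
        - ContinuousLinearMap.flip (ContinuousLinearMap.flip (fderiv ℝ G x) u) v) := rfl
  rw [this, map_smul, apply_inverse_of_pos hB]
  simp

/-- Uniqueness of the Levi-Civita connection. -/
theorem christoffel_unique {G : E → Bil E} {x : E} (hB : ∀ u, u ≠ 0 → 0 < G x u u)
    (hs : ∀ u v, G x u v = G x v u) {Γ : E → E → E} (hΓ : ∀ u v, Γ u v = Γ v u)
    (hm : ∀ u v w, fderiv ℝ G x u v w = G x (Γ u v) w + G x v (Γ u w)) (u v : E) :
    christoffel G x u v = Γ u v := by
  refine eq_of_inner_eq hB fun w => ?_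
  rw [christoffel_inner hB, hm, hm, hm, hΓ v u, hΓ w u, hΓ w v, hs v, hs u (Γ v w)]
  ring

/-! ### The Levi-Civita connection of a smooth metric. -/

namespace IsMetricOn

variable {G : E → Bil E} {Ω : Set E}

theorem differentiableAt (hG : IsMetricOn G Ω) (hΩ : IsOpen Ω) {x : E} (hx : x ∈ Ω) :
    DifferentiableAt ℝ G x :=
  (hG.smooth.contDiffAt (hΩ.mem_nhds hx)).differentiableAt (by simp)

theorem fderiv_symm (hG : IsMetricOn G Ω) (hΩ : IsOpen Ω) {x : E} (hx : x ∈ Ω) (u v w : E) :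
    fderiv ℝ G x u v w = fderiv ℝ G x u w v := by
  have h1 : ∀ v w, HasFDerivAt (fun y => G y v w)
      ((ContinuousLinearMap.apply ℝ ℝ w).comp
        ((ContinuousLinearMap.apply ℝ (E →L[ℝ] ℝ) v).comp (fderiv ℝ G x))) x := fun v w =>
    (ContinuousLinearMap.apply ℝ ℝ w).hasFDerivAt.comp x
      ((ContinuousLinearMap.apply ℝ (E →L[ℝ] ℝ) v).hasFDerivAt.comp x
        (hG.differentiableAt hΩ hx).hasFDerivAt)
  have h2 : (fun y => G y v w) =ᶠ[𝓝 x] fun y => G y w v := by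
    filter_upwards [hΩ.mem_nhds hx] with y hy using hG.symm y hy v w
  have h3 := ((h1 w v).congr_of_eventuallyEq h2).unique (h1 v w)
  have := congrArg (fun L : E →L[ℝ] ℝ => L u) h3
  simpa using this.symm

theorem christoffel_symm (hG : IsMetricOn G Ω) (hΩ : IsOpen Ω) {x : E} (hx : x ∈ Ω) (u v : E) :
    christoffel G x u v = christoffel G x v u := by
  refine eq_of_inner_eq (hG.pos x hx) fun w => ?_
  rw [christoffel_inner (hG.pos x hx), christoffel_inner (hG.pos x hx),
    hG.fderiv_symm hΩ hx w u v]
  ring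

theorem fderiv_eq (hG : IsMetricOn G Ω) (hΩ : IsOpen Ω) {x : E} (hx : x ∈ Ω) (u v w : E) :
    fderiv ℝ G x u v w = G x (christoffel G x u v) w + G x v (christoffel G x u w) := by
  rw [hG.symm x hx v, christoffel_inner (hG.pos x hx), christoffel_inner (hG.pos x hx),
    hG.fderiv_symm hΩ hx u w v, hG.fderiv_symm hΩ hx w u v, hG.fderiv_symm hΩ hx v u w]
  ring

theorem contDiffOn_christoffel (hG : IsMetricOn G Ω) (hΩ : IsOpen Ω) :
    ContDiffOn ℝ ∞ (christoffel G) Ω := by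
  have hD : ContDiffOn ℝ ∞ (fderiv ℝ G) Ω := hG.smooth.fderiv_of_isOpen hΩ (by simp)
  have hinv : ContDiffOn ℝ ∞ (fun x => ContinuousLinearMap.inverse (G x)) Ω := by
    intro x hx
    obtain ⟨e, he⟩ := exists_equiv_of_pos (hG.pos x hx)
    have h1 : ContDiffAt ℝ ∞ ContinuousLinearMap.inverse (G x) := he ▸ contDiffAt_map_inverse e
    exact h1.comp_contDiffWithinAt x (hG.smooth x hx)
  have hD' : ContDiffOn ℝ ∞ (fun x => ContinuousLinearMap.flip (fderiv ℝ G x)) Ω :=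
    (ContinuousLinearMap.flipₗᵢ ℝ E E (E →L[ℝ] ℝ)).toContinuousLinearEquiv.contDiff.comp_contDiffOn
      hD
  unfold christoffel
  refine ContDiffOn.const_smul (1 / 2 : ℝ) ?_
  refine ContDiffOn.clm_comp ?_ ((hD.add hD').sub ?_)
  · exact (ContinuousLinearMap.compL ℝ E (E →L[ℝ] ℝ) E).contDiff.comp_contDiffOn hinv
  · exact contDiffOn_const.clm_comp hD'

end IsMetricOn

/-- Transformation law of the Christoffel symbols. -/
theorem christoffel_map {G G' : E → Bil E} {Ω Ω' : Set E} (hG : IsMetricOn G Ω)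
    (hG' : IsMetricOn G' Ω') (hΩ' : IsOpen Ω') {φ : E → E} {y : E} (hy : y ∈ Ω)
    (hy' : φ y ∈ Ω') (hφ : ContDiffAt ℝ ∞ φ y) (hbij : Function.Bijective (fderiv ℝ φ y))
    (h : G =ᶠ[𝓝 y] fun z => (G' (φ z)).bilinearComp (fderiv ℝ φ z) (fderiv ℝ φ z)) (u v : E) :
    fderiv ℝ φ y (christoffel G y u v) =
      christoffel G' (φ y) (fderiv ℝ φ y u) (fderiv ℝ φ y v) + fderiv ℝ (fderiv ℝ φ) y u v := by
  have hφd : HasFDerivAt φ (fderiv ℝ φ y) y := (hφ.differentiableAt (by simp)).hasFDerivAt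
  have hφ' : ContDiffAt ℝ ∞ (fderiv ℝ φ) y := hφ.fderiv_right (by simp)
  have hφ'd : HasFDerivAt (fderiv ℝ φ) (fderiv ℝ (fderiv ℝ φ) y) y :=
    (hφ'.differentiableAt (by simp)).hasFDerivAt
  have hsymm : ∀ u v, fderiv ℝ (fderiv ℝ φ) y u v = fderiv ℝ (fderiv ℝ φ) y v u :=
    fun u v =>
      (hφ.isSymmSndFDerivAt (by rw [minSmoothness_of_isRCLikeNormedField]; exact two_le_infty)) u v
  let e : E ≃ E := Equiv.ofBijective _ hbij
  have he : ∀ w, fderiv ℝ φ y (e.symm w) = w := fun w => e.apply_symm_apply w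
  have hderiv : ∀ u v w, fderiv ℝ G y u v w =
      fderiv ℝ G' (φ y) (fderiv ℝ φ y u) (fderiv ℝ φ y v) (fderiv ℝ φ y w)
        + G' (φ y) (fderiv ℝ (fderiv ℝ φ) y u v) (fderiv ℝ φ y w)
        + G' (φ y) (fderiv ℝ φ y v) (fderiv ℝ (fderiv ℝ φ) y u w) := by
    intro u v w
    have h1 : HasFDerivAt (fun y => G y v w)
      ((ContinuousLinearMap.apply ℝ ℝ w).comp
        ((ContinuousLinearMap.apply ℝ (E →L[ℝ] ℝ) v).comp (fderiv ℝ G y))) y := by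
      have hd : DifferentiableAt ℝ G y := by
        refine DifferentiableAt.congr_of_eventuallyEq ?_ h
        have h2 : DifferentiableAt ℝ (fun z => G' (φ z)) y :=
          (hG'.differentiableAt hΩ' hy').comp y hφd.differentiableAt
        have h3 : DifferentiableAt ℝ (fun z => (((G' (φ z)).comp (fderiv ℝ φ z)).flip.comp
            (fderiv ℝ φ z)).flip) y := by
          have h4 := (ContinuousLinearMap.flipₗᵢ ℝ E E ℝ).toContinuousLinearEquiv.differentiable
          exact (h4 _).comp y (((h4 _).comp y (h2.clm_comp hφ'd.differentiableAt)).clm_comp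
            hφ'd.differentiableAt)
        refine h3.congr_of_eventuallyEq (Filter.Eventually.of_forall fun z => ?_)
        ext a b
        simp
      exact (ContinuousLinearMap.apply ℝ ℝ w).hasFDerivAt.comp y
        ((ContinuousLinearMap.apply ℝ (E →L[ℝ] ℝ) v).hasFDerivAt.comp y hd.hasFDerivAt)
    have h2 : HasFDerivAt (fun z => G' (φ z) (fderiv ℝ φ z v) (fderiv ℝ φ z w)) _ y :=
      (((hG'.differentiableAt hΩ' hy').hasFDerivAt.comp y hφd).clm_apply
        (hφ'd.clm_apply (hasFDerivAt_const v y))).clm_apply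
          (hφ'd.clm_apply (hasFDerivAt_const w y))
    have h3 : (fun z => G z v w) =ᶠ[𝓝 y] fun z => G' (φ z) (fderiv ℝ φ z v) (fderiv ℝ φ z w) := by
      filter_upwards [h] with z hz
      rw [hz]; rfl
    have h4 := congrArg (fun L : E →L[ℝ] ℝ => L u) (h1.unique (h2.congr_of_eventuallyEq h3))
    simp at h4
    rw [h4]
    ring
  have hGy : ∀ u v, G y u v = G' (φ y) (fderiv ℝ φ y u) (fderiv ℝ φ y v) := by
    intro u v
    rw [h.eq_of_nhds]; rfl
  -- The transformed symbols are symmetric and compatible with `G`, so uniqueness identifies them.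
  have key := christoffel_unique (hG.pos y hy) (hG.symm y hy)
    (Γ := fun u v => e.symm (christoffel G' (φ y) (fderiv ℝ φ y u) (fderiv ℝ φ y v)
      + fderiv ℝ (fderiv ℝ φ) y u v))
    (fun u v => by
      rw [hG'.christoffel_symm hΩ' hy', hsymm])
    (fun u v w => by
      rw [hderiv, hGy, hGy, he, he, hG'.fderiv_eq hΩ' hy']
      simp only [map_add, add_apply]
      ring) u v
  rw [key, he]

end LeviCivita

/-! ### Almost Hermitian structures on open sets -/

section Hermitian

variable {E : Type*} [NormedAddCommGroup E] [NormedSpace ℝ E] [FiniteDimensional ℝ E]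

/-- `(G, J)` is an almost Hermitian structure on `Ω`. -/
structure IsHermitianOn (G : E → Bil E) (J : E → EndV E) (Ω : Set E) : Prop extends
    IsMetricOn G Ω where
  smoothJ : ContDiffOn ℝ ∞ J Ω
  sq : ∀ x ∈ Ω, J x * J x = -1
  compat : ∀ x ∈ Ω, ∀ u v, G x (J x u) (J x v) = G x u v

/-- The covariant derivative of `J`, as a linear map. -/
def nablaL (G : E → Bil E) (J : E → EndV E) (y : E) : E →L[ℝ] EndV E :=
  fderiv ℝ J y + (((ContinuousLinearMap.mul ℝ (EndV E)).flip (J y)).comp (christoffel G y)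
    - (ContinuousLinearMap.mul ℝ (EndV E) (J y)).comp (christoffel G y))

/-- The connection form of the canonical Hermitian connection, as a linear map. -/
def canonicalL (G : E → Bil E) (J : E → EndV E) (y : E) : E →L[ℝ] EndV E :=
  christoffel G y - (1 / 2 : ℝ) • (ContinuousLinearMap.mul ℝ (EndV E) (J y)).comp (nablaL G J y)

theorem nablaL_apply (G : E → Bil E) (J : E → EndV E) (y u : E) :
    nablaL G J y u = fderiv ℝ J y u + (christoffel G y u * J y - J y * christoffel G y u) := rfl

theorem canonicalL_apply (G : E → Bil E) (J : E → EndV E) (y u : E) :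
    canonicalL G J y u = christoffel G y u - (1 / 2 : ℝ) • (J y * nablaL G J y u) := rfl

/-! ### Algebraic properties of `∇J` and of the canonical connection. -/

namespace IsHermitianOn

variable {G : E → Bil E} {J : E → EndV E} {Ω : Set E}

theorem differentiableAtJ (h : IsHermitianOn G J Ω) (hΩ : IsOpen Ω) {x : E} (hx : x ∈ Ω) :
    DifferentiableAt ℝ J x :=
  (h.smoothJ.contDiffAt (hΩ.mem_nhds hx)).differentiableAt (by simp)

theorem J_J (h : IsHermitianOn G J Ω) {x : E} (hx : x ∈ Ω) (u : E) : J x (J x u) = -u := by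
  have := congrArg (fun A : EndV E => A u) (h.sq x hx)
  simpa using this

theorem J_skew (h : IsHermitianOn G J Ω) {x : E} (hx : x ∈ Ω) (u v : E) :
    G x (J x u) v = -G x u (J x v) := by
  rw [← h.compat x hx u (J x v), h.J_J hx]
  simp

theorem contDiffOn_nablaL (h : IsHermitianOn G J Ω) (hΩ : IsOpen Ω) :
    ContDiffOn ℝ ∞ (nablaL G J) Ω := by
  have hΓ := h.contDiffOn_christoffel hΩ
  refine (h.smoothJ.fderiv_of_isOpen hΩ (by simp)).add (ContDiffOn.sub ?_ ?_)
  · exact ((ContinuousLinearMap.mul ℝ (EndV E)).flip.contDiff.comp_contDiffOn h.smoothJ).clm_comp hΓ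
  · exact ((ContinuousLinearMap.mul ℝ (EndV E)).contDiff.comp_contDiffOn h.smoothJ).clm_comp hΓ

theorem contDiffOn_canonicalL (h : IsHermitianOn G J Ω) (hΩ : IsOpen Ω) :
    ContDiffOn ℝ ∞ (canonicalL G J) Ω :=
  (h.contDiffOn_christoffel hΩ).sub (ContDiffOn.const_smul (1 / 2 : ℝ)
    (((ContinuousLinearMap.mul ℝ (EndV E)).contDiff.comp_contDiffOn h.smoothJ).clm_comp
      (h.contDiffOn_nablaL hΩ)))

/-- This is the covariant derivative of `J² = -1`. -/
theorem nablaL_anticomm (h : IsHermitianOn G J Ω) (hΩ : IsOpen Ω) {x : E} (hx : x ∈ Ω) (u : E) :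
    nablaL G J x u * J x = -(J x * nablaL G J x u) := by
  have hJ := (h.differentiableAtJ hΩ hx).hasFDerivAt
  have h1 : HasFDerivAt (fun y => J y * J y) _ x := hJ.mul' hJ
  have h2 : (fun y => J y * J y) =ᶠ[𝓝 x] fun _ => -1 := by
    filter_upwards [hΩ.mem_nhds hx] with y hy using h.sq y hy
  have h3 := congrArg (fun L : E →L[ℝ] EndV E => L u)
    (h1.unique ((hasFDerivAt_const (-1 : EndV E) x).congr_of_eventuallyEq h2))
  simp at h3
  have hsq := h.sq x hx
  rw [nablaL_apply]
  simp only [add_mul, sub_mul, mul_add, mul_sub]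
  rw [mul_assoc (christoffel G x u), hsq, ← mul_assoc (J x) (J x), hsq,
    mul_assoc (J x) (christoffel G x u)]
  simp only [mul_neg, neg_mul, mul_one, one_mul]
  linear_combination (norm := module) h3

/-- This is the derivative of `G(Jv, w) + G(v, Jw) = 0`, with the derivative of `G` rewritten
through the Christoffel symbols. -/
theorem nablaL_skew (h : IsHermitianOn G J Ω) (hΩ : IsOpen Ω) {x : E} (hx : x ∈ Ω) (u v w : E) :
    G x (nablaL G J x u v) w = -G x v (nablaL G J x u w) := by
  have hJ := (h.differentiableAtJ hΩ hx).hasFDerivAt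
  have hG := (h.toIsMetricOn.differentiableAt hΩ hx).hasFDerivAt
  have h1 : HasFDerivAt (fun y => G y (J y v) w + G y v (J y w)) _ x :=
    ((hG.clm_apply (hJ.clm_apply (hasFDerivAt_const v x))).clm_apply
      (hasFDerivAt_const w x)).add
    ((hG.clm_apply (hasFDerivAt_const v x)).clm_apply (hJ.clm_apply (hasFDerivAt_const w x)))
  have h2 : (fun y => G y (J y v) w + G y v (J y w)) =ᶠ[𝓝 x] fun _ => 0 := by
    filter_upwards [hΩ.mem_nhds hx] with y hy
    rw [h.J_skew hy]; ring
  have h3 := congrArg (fun L : E →L[ℝ] ℝ => L u)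
    (h1.unique ((hasFDerivAt_const (0 : ℝ) x).congr_of_eventuallyEq h2))
  simp at h3
  rw [h.toIsMetricOn.fderiv_eq hΩ hx, h.toIsMetricOn.fderiv_eq hΩ hx] at h3
  rw [nablaL_apply]
  simp only [add_apply, sub_apply, map_add, map_sub, mul_apply_eq_comp]
  rw [h.J_skew hx (christoffel G x u v) w]
  have h4 := h.J_skew hx v (christoffel G x u w)
  linarith

/-- The canonical connection is metric. -/
theorem canonicalL_metric (h : IsHermitianOn G J Ω) (hΩ : IsOpen Ω) {x : E} (hx : x ∈ Ω)
    (u v w : E) : fderiv ℝ G x u v w =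
      G x (canonicalL G J x u v) w + G x v (canonicalL G J x u w) := by
  rw [h.toIsMetricOn.fderiv_eq hΩ hx, canonicalL_apply]
  simp only [sub_apply, map_sub, smul_apply, map_smul, mul_apply_eq_comp, smul_eq_mul]
  -- The correction `J ∇J` is skew because `J` and `∇J` are skew and anticommute, so it does not
  -- affect compatibility with the metric.
  have h1 := h.J_skew hx (nablaL G J x u v) w
  have h2 := h.nablaL_skew hΩ hx u v (J x w)
  have h3 := congrArg (fun A : EndV E => A w) (h.nablaL_anticomm hΩ hx u)
  simp only [mul_apply_eq_comp, neg_apply] at h3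
  rw [h3, map_neg] at h2
  rw [h1, h2]
  ring

/-- The canonical connection is Hermitian. -/
theorem canonicalL_complex (h : IsHermitianOn G J Ω) (hΩ : IsOpen Ω) {x : E} (hx : x ∈ Ω) (u : E) :
    fderiv ℝ J x u + (canonicalL G J x u * J x - J x * canonicalL G J x u) = 0 := by
  have h1 := nablaL_apply G J x u
  have h2 := h.nablaL_anticomm hΩ hx u
  have h3 := h.sq x hx
  rw [canonicalL_apply]
  -- The commutator of `-½ J ∇J` with `J` is `-∇J`, which is what the factor `½` is for.
  have h4 : J x * nablaL G J x u * J x = nablaL G J x u := by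
    rw [mul_assoc, h2, mul_neg, ← mul_assoc, h3]; simp
  have h5 : J x * (J x * nablaL G J x u) = -nablaL G J x u := by
    rw [← mul_assoc, h3]; simp
  simp only [sub_mul, mul_sub, smul_mul_assoc, mul_smul_comm, h4, h5]
  rw [show fderiv ℝ J x u + (christoffel G x u * J x - (1 / 2 : ℝ) • nablaL G J x u -
    (J x * christoffel G x u - (1 / 2 : ℝ) • -nablaL G J x u)) =
    (fderiv ℝ J x u + (christoffel G x u * J x - J x * christoffel G x u)) - nablaL G J x u by
      module, ← h1, sub_self]

end IsHermitianOn

/-- The second derivatives of `φ` in the transformation law of the Christoffel symbols cancel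
against those that arise from differentiating the intertwining relation for `J`. Thus `∇J` is a
tensor. -/
theorem nablaL_map {G G' : E → Bil E} {J J' : E → EndV E} {Ω Ω' : Set E}
    (h : IsHermitianOn G J Ω) (h' : IsHermitianOn G' J' Ω') (hΩ : IsOpen Ω) (hΩ' : IsOpen Ω')
    {φ : E → E} {y : E} (hy : y ∈ Ω)
    (hy' : φ y ∈ Ω') (hφ : ContDiffAt ℝ ∞ φ y) (hbij : Function.Bijective (fderiv ℝ φ y))
    (hG : G =ᶠ[𝓝 y] fun z => (G' (φ z)).bilinearComp (fderiv ℝ φ z) (fderiv ℝ φ z))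
    (hJ : ∀ᶠ z in 𝓝 y, ∀ v, fderiv ℝ φ z (J z v) = J' (φ z) (fderiv ℝ φ z v)) (u v : E) :
    fderiv ℝ φ y (nablaL G J y u v) =
      nablaL G' J' (φ y) (fderiv ℝ φ y u) (fderiv ℝ φ y v) := by
  have hφd : HasFDerivAt φ (fderiv ℝ φ y) y := (hφ.differentiableAt (by simp)).hasFDerivAt
  have hφ' : ContDiffAt ℝ ∞ (fderiv ℝ φ) y := hφ.fderiv_right (by simp)
  have hφ'd : HasFDerivAt (fderiv ℝ φ) (fderiv ℝ (fderiv ℝ φ) y) y :=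
    (hφ'.differentiableAt (by simp)).hasFDerivAt
  have h1 : HasFDerivAt (fun z => fderiv ℝ φ z (J z v)) _ y :=
    hφ'd.clm_apply ((h.differentiableAtJ hΩ hy).hasFDerivAt.clm_apply (hasFDerivAt_const v y))
  have h2 : HasFDerivAt (fun z => J' (φ z) (fderiv ℝ φ z v)) _ y :=
    ((h'.differentiableAtJ hΩ' hy').hasFDerivAt.comp y hφd).clm_apply
      (hφ'd.clm_apply (hasFDerivAt_const v y))
  have h3 : (fun z => fderiv ℝ φ z (J z v)) =ᶠ[𝓝 y] fun z => J' (φ z) (fderiv ℝ φ z v) := by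
    filter_upwards [hJ] with z hz using hz v
  have h4 := congrArg (fun L : E →L[ℝ] E => L u) (h1.unique (h2.congr_of_eventuallyEq h3))
  simp at h4
  have hc := christoffel_map h.toIsMetricOn h'.toIsMetricOn hΩ' hy hy' hφ hbij hG
  have hJy := hJ.self_of_nhds
  rw [nablaL_apply, nablaL_apply]
  simp only [add_apply, sub_apply, map_add, map_sub, mul_apply_eq_comp]
  rw [hJy, hc, hc, hJy, map_add]
  linear_combination (norm := module) h4

/-- The canonical form differs from the Christoffel symbols by a tensor, hence has the same
inhomogeneous term. -/
theorem canonicalL_map {G G' : E → Bil E} {J J' : E → EndV E} {Ω Ω' : Set E}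
    (h : IsHermitianOn G J Ω) (h' : IsHermitianOn G' J' Ω') (hΩ : IsOpen Ω) (hΩ' : IsOpen Ω')
    {φ : E → E} {y : E} (hy : y ∈ Ω)
    (hy' : φ y ∈ Ω') (hφ : ContDiffAt ℝ ∞ φ y) (hbij : Function.Bijective (fderiv ℝ φ y))
    (hG : G =ᶠ[𝓝 y] fun z => (G' (φ z)).bilinearComp (fderiv ℝ φ z) (fderiv ℝ φ z))
    (hJ : ∀ᶠ z in 𝓝 y, ∀ v, fderiv ℝ φ z (J z v) = J' (φ z) (fderiv ℝ φ z v)) (u v : E) :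
    fderiv ℝ φ y (canonicalL G J y u v) =
      canonicalL G' J' (φ y) (fderiv ℝ φ y u) (fderiv ℝ φ y v)
        + fderiv ℝ (fderiv ℝ φ) y u v := by
  rw [canonicalL_apply, canonicalL_apply]
  simp only [sub_apply, smul_apply, map_sub, map_smul, mul_apply_eq_comp]
  rw [christoffel_map h.toIsMetricOn h'.toIsMetricOn hΩ' hy hy' hφ hbij hG, hJ.self_of_nhds,
    nablaL_map h h' hΩ hΩ' hy hy' hφ hbij hG hJ]
  abel

end Hermitian

/-! ### Charts -/

section Charts

variable {E : Type*} [NormedAddCommGroup E] [NormedSpace ℝ E]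
  {M : Type*} [TopologicalSpace M] [ChartedSpace E M] [IsManifold 𝓘(ℝ, E) ∞ M]

/-- The differential of a chart, as an endomorphism of the model space. -/
def dC (c x : M) : EndV E := dChart c x

/-- The differential of the inverse of a chart, as an endomorphism of the model space. -/
def dCI (c : M) (y : E) : EndV E := dChartInv c y

instance isManifold_one : IsManifold 𝓘(ℝ, E) 1 M := .of_le (n := ∞) (by simp)

theorem dC_dCI {c : M} {y : E} (hy : y ∈ (extChartAt 𝓘(ℝ, E) c).target) (v : E) :
    dC c ((extChartAt 𝓘(ℝ, E) c).symm y) (dCI c y v) = v := by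
  have h := mfderiv_extChartAt_comp_mfderivWithin_extChartAt_symm (I := 𝓘(ℝ, E)) hy
  simp only [modelWithCornersSelf_coe, Set.range_id, mfderivWithin_univ] at h
  exact congrArg (fun L : E →L[ℝ] E => L v) h

theorem dCI_dC {c : M} {y : E} (hy : y ∈ (extChartAt 𝓘(ℝ, E) c).target) (v : E) :
    dCI c y (dC c ((extChartAt 𝓘(ℝ, E) c).symm y) v) = v := by
  have h := mfderivWithin_extChartAt_symm_comp_mfderiv_extChartAt (I := 𝓘(ℝ, E)) hy
  simp only [modelWithCornersSelf_coe, Set.range_id, mfderivWithin_univ] at h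
  exact congrArg (fun L : E →L[ℝ] E => L v) h

theorem dCI_dC' {c x : M} (hx : x ∈ (extChartAt 𝓘(ℝ, E) c).source) (v : E) :
    dCI c (extChartAt 𝓘(ℝ, E) c x) (dC c x v) = v := by
  have h := dCI_dC ((extChartAt 𝓘(ℝ, E) c).map_source hx) v
  rwa [(extChartAt 𝓘(ℝ, E) c).left_inv hx] at h

theorem dC_dCI' {c x : M} (hx : x ∈ (extChartAt 𝓘(ℝ, E) c).source) (v : E) :
    dC c x (dCI c (extChartAt 𝓘(ℝ, E) c x) v) = v := by
  have h := dC_dCI ((extChartAt 𝓘(ℝ, E) c).map_source hx) v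
  rwa [(extChartAt 𝓘(ℝ, E) c).left_inv hx] at h

theorem dC_self (x : M) (v : E) : dC x x v = v := by
  have h := mfderiv_extChartAt_self (I := 𝓘(ℝ, E)) (x := x)
  exact congrArg (fun L : E →L[ℝ] E => L v) h

/-- The change of charts. -/
def transition (c c' : M) (y : E) : E :=
  extChartAt 𝓘(ℝ, E) c' ((extChartAt 𝓘(ℝ, E) c).symm y)

theorem isOpen_transition_source (c c' : M) : IsOpen ((extChartAt 𝓘(ℝ, E) c).target ∩
    (extChartAt 𝓘(ℝ, E) c).symm ⁻¹' (extChartAt 𝓘(ℝ, E) c').source) :=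
  (continuousOn_extChartAt_symm c).isOpen_inter_preimage (isOpen_extChartAt_target c)
    (isOpen_extChartAt_source c')

theorem contDiffOn_transition (c c' : M) : ContDiffOn ℝ ∞ (transition (E := E) c c')
    ((extChartAt 𝓘(ℝ, E) c).target ∩
      (extChartAt 𝓘(ℝ, E) c).symm ⁻¹' (extChartAt 𝓘(ℝ, E) c').source) := by
  have h := contDiffOn_ext_coord_change (I := 𝓘(ℝ, E)) (n := ∞) c' c
  exact h.mono fun y hy => by simpa [PartialEquiv.trans_source] using hy

theorem fderiv_transition {c c' : M} {y : E} (hy : y ∈ (extChartAt 𝓘(ℝ, E) c).target)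
    (hy' : (extChartAt 𝓘(ℝ, E) c).symm y ∈ (extChartAt 𝓘(ℝ, E) c').source) :
    fderiv ℝ (transition c c') y = (dC c' ((extChartAt 𝓘(ℝ, E) c).symm y)).comp (dCI c y) := by
  have h1 : MDifferentiableAt 𝓘(ℝ, E) 𝓘(ℝ, E) (extChartAt 𝓘(ℝ, E) c')
      ((extChartAt 𝓘(ℝ, E) c).symm y) :=
    mdifferentiableAt_extChartAt (by rwa [extChartAt_source] at hy')
  have h2 : MDifferentiableAt 𝓘(ℝ, E) 𝓘(ℝ, E) (extChartAt 𝓘(ℝ, E) c).symm y := by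
    have := mdifferentiableWithinAt_extChartAt_symm (I := 𝓘(ℝ, E)) hy
    simp only [modelWithCornersSelf_coe, Set.range_id] at this
    exact mdifferentiableWithinAt_univ.1 this
  have h3 := mfderiv_comp y h1 h2
  rw [mfderiv_eq_fderiv] at h3
  exact h3

theorem dCI_transition {c c' : M} {y : E} (hy : y ∈ (extChartAt 𝓘(ℝ, E) c).target)
    (hy' : (extChartAt 𝓘(ℝ, E) c).symm y ∈ (extChartAt 𝓘(ℝ, E) c').source) (v : E) :
    dCI c' (transition c c' y) (fderiv ℝ (transition c c') y v) = dCI c y v := by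
  rw [fderiv_transition hy hy']
  exact dCI_dC' hy' _

theorem bijective_fderiv_transition {c c' : M} {y : E} (hy : y ∈ (extChartAt 𝓘(ℝ, E) c).target)
    (hy' : (extChartAt 𝓘(ℝ, E) c).symm y ∈ (extChartAt 𝓘(ℝ, E) c').source) :
    Function.Bijective (fderiv ℝ (transition c c') y) := by
  rw [fderiv_transition hy hy']
  refine ⟨fun u v huv => ?_, fun v => ⟨dC c ((extChartAt 𝓘(ℝ, E) c).symm y)
    (dCI c' (transition c c' y) v), ?_⟩⟩
  · have h1 : dC c' ((extChartAt 𝓘(ℝ, E) c).symm y) (dCI c y u) =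
      dC c' ((extChartAt 𝓘(ℝ, E) c).symm y) (dCI c y v) := huv
    have h2 := congrArg (dCI c' (transition c c' y)) h1
    unfold transition at h2
    rw [dCI_dC' hy', dCI_dC' hy'] at h2
    rw [← dC_dCI hy u, ← dC_dCI hy v, h2]
  · change dC c' ((extChartAt 𝓘(ℝ, E) c).symm y) (dCI c y (dC c _ _)) = v
    rw [dCI_dC hy]
    exact dC_dCI' hy' v

theorem transition_symm {c c' : M} {y : E}
    (hy' : (extChartAt 𝓘(ℝ, E) c).symm y ∈ (extChartAt 𝓘(ℝ, E) c').source) :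
    (extChartAt 𝓘(ℝ, E) c').symm (transition c c' y) = (extChartAt 𝓘(ℝ, E) c).symm y :=
  (extChartAt 𝓘(ℝ, E) c').left_inv hy'

/-- The metric, as a bilinear form on the model space. -/
def innerE (g : RiemMetric E M) (x : M) : Bil E := g.inner x

/-- The endomorphism field, as endomorphisms of the model space. -/
def endE (J : EndField E M) (x : M) : EndV E := J x

theorem chartMetric_apply (g : RiemMetric E M) (c : M) (y u v : E) :
    chartMetric g c y u v =
      innerE g ((extChartAt 𝓘(ℝ, E) c).symm y) (dCI c y u) (dCI c y v) := rfl

theorem chartEnd_apply (J : EndField E M) (c : M) (y u : E) :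
    chartEnd J c y u = dC c ((extChartAt 𝓘(ℝ, E) c).symm y)
      (endE J ((extChartAt 𝓘(ℝ, E) c).symm y) (dCI c y u)) := rfl

theorem chartMetric_transition (g : RiemMetric E M) {c c' : M} {y : E}
    (hy : y ∈ (extChartAt 𝓘(ℝ, E) c).target)
    (hy' : (extChartAt 𝓘(ℝ, E) c).symm y ∈ (extChartAt 𝓘(ℝ, E) c').source) :
    chartMetric g c y = (chartMetric g c' (transition c c' y)).bilinearComp
      (fderiv ℝ (transition c c') y) (fderiv ℝ (transition c c') y) := by
  ext u v
  rw [chartMetric_apply, ContinuousLinearMap.bilinearComp_apply, chartMetric_apply,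
    transition_symm hy', dCI_transition hy hy', dCI_transition hy hy']

theorem chartEnd_transition (J : EndField E M) {c c' : M} {y : E}
    (hy : y ∈ (extChartAt 𝓘(ℝ, E) c).target)
    (hy' : (extChartAt 𝓘(ℝ, E) c).symm y ∈ (extChartAt 𝓘(ℝ, E) c').source) (v : E) :
    fderiv ℝ (transition c c') y (chartEnd J c y v) =
      chartEnd J c' (transition c c' y) (fderiv ℝ (transition c c') y v) := by
  rw [chartEnd_apply, chartEnd_apply, transition_symm hy', dCI_transition hy hy',
    fderiv_transition hy hy']
  change dC c' _ (dCI c y (dC c _ _)) = _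
  rw [dCI_dC hy]

/-- A bridge between the trivialisations of the tangent bundle, in which smoothness of `g` and `J`
is expressed, and the chart differentials, in which the geometry is computed. -/
theorem symmL_eq_dCI {c x : M} (hx : x ∈ (extChartAt 𝓘(ℝ, E) c).source) (v : E) :
    ((trivializationAt E (TangentSpace 𝓘(ℝ, E)) c).symmL ℝ x v : E) =
      dCI c (extChartAt 𝓘(ℝ, E) c x) v := by
  have h := TangentBundle.symmL_trivializationAt (I := 𝓘(ℝ, E)) (x₀ := c) (x := x)
    (by rwa [extChartAt_source] at hx)
  simp only [modelWithCornersSelf_coe, Set.range_id, mfderivWithin_univ] at h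
  exact congrArg (fun L : E →L[ℝ] E => L v) h

theorem continuousLinearMapAt_eq_dC {c x : M} (hx : x ∈ (extChartAt 𝓘(ℝ, E) c).source) (v : E) :
    ((trivializationAt E (TangentSpace 𝓘(ℝ, E)) c).continuousLinearMapAt ℝ x v : E) =
      dC c x v := by
  have h := TangentBundle.continuousLinearMapAt_trivializationAt (I := 𝓘(ℝ, E)) (x₀ := c) (x := x)
    (by rwa [extChartAt_source] at hx)
  exact congrArg (fun L : E →L[ℝ] E => L v) h

/-- The coordinate vector fields of a chart are smooth. -/
theorem contMDiffOn_coordField (c : M) (v : E) :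
    ContMDiffOn 𝓘(ℝ, E) (𝓘(ℝ, E).prod 𝓘(ℝ, E)) ∞
      (fun x => Bundle.TotalSpace.mk' E (E := TangentSpace (M := M) 𝓘(ℝ, E)) x
        ((trivializationAt E (TangentSpace 𝓘(ℝ, E)) c).symmL ℝ x v))
      (extChartAt 𝓘(ℝ, E) c).source := by
  have hs : (extChartAt 𝓘(ℝ, E) c).source =
      (trivializationAt E (TangentSpace (M := M) 𝓘(ℝ, E)) c).baseSet := by
    rw [extChartAt_source, TangentBundle.trivializationAt_baseSet]
  rw [hs]
  have h := (trivializationAt E (TangentSpace (M := M) 𝓘(ℝ, E)) c).contMDiffOn_section_baseSet_iff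
    (IB := 𝓘(ℝ, E)) (n := ∞) (s := fun x => (trivializationAt E
      (TangentSpace (M := M) 𝓘(ℝ, E)) c).symmL ℝ x v)
  rw [h]
  refine (contMDiffOn_const (c := v)).congr fun x hx => ?_
  have h2 := (trivializationAt E (TangentSpace (M := M) 𝓘(ℝ, E)) c).continuousLinearMapAt_symmL
    (R := ℝ) hx v
  refine Eq.trans ?_ h2
  rw [Bundle.Trivialization.continuousLinearMapAt_apply,
    Bundle.Trivialization.coe_linearMapAt_of_mem _ hx]

theorem contDiffOn_chartMetric [FiniteDimensional ℝ E] (g : RiemMetric E M) (c : M) :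
    ContDiffOn ℝ ∞ (chartMetric g c) (extChartAt 𝓘(ℝ, E) c).target := by
  rw [contDiffOn_clm_apply]
  intro u
  rw [contDiffOn_clm_apply]
  intro v
  have h1 : ContMDiffOn 𝓘(ℝ, E) (𝓘(ℝ, E).prod 𝓘(ℝ, ℝ)) ∞ (fun x => Bundle.TotalSpace.mk' ℝ
      (E := Bundle.Trivial M ℝ) x (g.inner x
        ((trivializationAt E (TangentSpace 𝓘(ℝ, E)) c).symmL ℝ x u)
        ((trivializationAt E (TangentSpace 𝓘(ℝ, E)) c).symmL ℝ x v)))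
      (extChartAt 𝓘(ℝ, E) c).source := by
    apply ContMDiffOn.clm_bundle_apply₂ (F₁ := E) (F₂ := E)
    · exact g.contMDiff.contMDiffOn
    · exact contMDiffOn_coordField c u
    · exact contMDiffOn_coordField c v
  have h2 : ContMDiffOn 𝓘(ℝ, E) 𝓘(ℝ, ℝ) ∞ (fun x => innerE g x
      (dCI c (extChartAt 𝓘(ℝ, E) c x) u) (dCI c (extChartAt 𝓘(ℝ, E) c x) v))
      (extChartAt 𝓘(ℝ, E) c).source := by
    intro x hx
    have h3 := h1 x hx
    simp only [Bundle.contMDiffWithinAt_totalSpace] at h3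
    refine h3.2.congr (fun x' hx' => ?_) ?_
    · rw [← symmL_eq_dCI hx', ← symmL_eq_dCI hx']; rfl
    · rw [← symmL_eq_dCI hx, ← symmL_eq_dCI hx]; rfl
  have h4 := h2.comp (contMDiffOn_extChartAt_symm (n := ∞) c)
    (fun y hy => (extChartAt 𝓘(ℝ, E) c).map_target hy)
  rw [contMDiffOn_iff_contDiffOn] at h4
  refine h4.congr fun y hy => ?_
  simp only [Function.comp_apply]
  rw [(extChartAt 𝓘(ℝ, E) c).right_inv hy]
  rfl

theorem contDiffOn_chartEnd [FiniteDimensional ℝ E] {g : RiemMetric E M} {J : EndField E M}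
    (hJ : IsAlmostHermitian g J) (c : M) :
    ContDiffOn ℝ ∞ (chartEnd J c) (extChartAt 𝓘(ℝ, E) c).target := by
  rw [contDiffOn_clm_apply]
  intro u
  have h1 : ContMDiffOn 𝓘(ℝ, E) (𝓘(ℝ, E).prod 𝓘(ℝ, E)) ∞ (fun x => Bundle.TotalSpace.mk' E
      (E := TangentSpace (M := M) 𝓘(ℝ, E)) x (J x
        ((trivializationAt E (TangentSpace 𝓘(ℝ, E)) c).symmL ℝ x u)))
      (extChartAt 𝓘(ℝ, E) c).source := by
    apply ContMDiffOn.clm_bundle_apply (F₁ := E) (F₂ := E)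
    · exact hJ.smooth.contMDiffOn
    · exact contMDiffOn_coordField c u
  have hs : (extChartAt 𝓘(ℝ, E) c).source =
      (trivializationAt E (TangentSpace (M := M) 𝓘(ℝ, E)) c).baseSet := by
    rw [extChartAt_source, TangentBundle.trivializationAt_baseSet]
  have h2 : ContMDiffOn 𝓘(ℝ, E) 𝓘(ℝ, E) ∞ (fun x => dC c x (endE J x
      (dCI c (extChartAt 𝓘(ℝ, E) c x) u))) (extChartAt 𝓘(ℝ, E) c).source := by
    have h3 := h1
    rw [hs, (trivializationAt E (TangentSpace (M := M) 𝓘(ℝ, E)) c).contMDiffOn_section_baseSet_iff]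
      at h3
    rw [hs]
    refine h3.congr fun x hx => ?_
    have hx' : x ∈ (extChartAt 𝓘(ℝ, E) c).source := by rwa [hs]
    rw [← symmL_eq_dCI hx', ← continuousLinearMapAt_eq_dC hx']
    rw [Bundle.Trivialization.continuousLinearMapAt_apply,
      Bundle.Trivialization.coe_linearMapAt_of_mem _ hx]
    rfl
  have h4 := h2.comp (contMDiffOn_extChartAt_symm (n := ∞) c)
    (fun y hy => (extChartAt 𝓘(ℝ, E) c).map_target hy)
  rw [contMDiffOn_iff_contDiffOn] at h4
  refine h4.congr fun y hy => ?_
  simp only [Function.comp_apply]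
  rw [(extChartAt 𝓘(ℝ, E) c).right_inv hy]
  rfl

/-- In every chart, an almost Hermitian structure is given by an almost Hermitian structure on an open
subset of the model space. -/
theorem IsAlmostHermitian.isHermitianOn [FiniteDimensional ℝ E] {g : RiemMetric E M}
    {J : EndField E M} (hJ : IsAlmostHermitian g J) (c : M) :
    IsHermitianOn (chartMetric g c) (chartEnd J c) (extChartAt 𝓘(ℝ, E) c).target where
  smooth := contDiffOn_chartMetric g c
  symm y hy u v := by
    rw [chartMetric_apply, chartMetric_apply]; exact g.symm _ _ _
  pos y hy u hu := by
    rw [chartMetric_apply]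
    refine g.pos _ _ fun h => hu ?_
    rw [← dC_dCI hy u]
    have h' : dCI c y u = 0 := h
    rw [h', map_zero]
  smoothJ := contDiffOn_chartEnd hJ c
  sq y hy := by
    ext u
    change chartEnd J c y (chartEnd J c y u) = -u
    rw [chartEnd_apply, chartEnd_apply, dCI_dC hy]
    have h := hJ.sq ((extChartAt 𝓘(ℝ, E) c).symm y) (dCI c y u)
    have h' : endE J ((extChartAt 𝓘(ℝ, E) c).symm y)
      (endE J ((extChartAt 𝓘(ℝ, E) c).symm y) (dCI c y u)) = -dCI c y u := h
    rw [h', map_neg, dC_dCI hy]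
  compat y hy u v := by
    rw [chartMetric_apply, chartMetric_apply, chartEnd_apply, chartEnd_apply, dCI_dC hy,
      dCI_dC hy]
    exact hJ.compat _ _ _

theorem canonicalForm_eq (g : RiemMetric E M) (J : EndField E M) (c : M) (y u : E) :
    canonicalForm g J c y u = canonicalL (chartMetric g c) (chartEnd J c) y u := rfl

theorem nablaJ_eq (g : RiemMetric E M) (J : EndField E M) (c : M) (y u : E) :
    nablaJ g J c y u = nablaL (chartMetric g c) (chartEnd J c) y u := rfl

/-! ### Change of charts for `∇J` and for the canonical connection. -/

section

variable [FiniteDimensional ℝ E] {g : RiemMetric E M} {J : EndField E M}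

theorem eventually_mem_transition {c c' : M} {y : E} (hy : y ∈ (extChartAt 𝓘(ℝ, E) c).target)
    (hy' : (extChartAt 𝓘(ℝ, E) c).symm y ∈ (extChartAt 𝓘(ℝ, E) c').source) :
    ∀ᶠ z in 𝓝 y, z ∈ (extChartAt 𝓘(ℝ, E) c).target ∧
      (extChartAt 𝓘(ℝ, E) c).symm z ∈ (extChartAt 𝓘(ℝ, E) c').source :=
  (isOpen_transition_source c c').mem_nhds ⟨hy, hy'⟩

theorem contDiffAt_transition {c c' : M} {y : E} (hy : y ∈ (extChartAt 𝓘(ℝ, E) c).target)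
    (hy' : (extChartAt 𝓘(ℝ, E) c).symm y ∈ (extChartAt 𝓘(ℝ, E) c').source) :
    ContDiffAt ℝ ∞ (transition (E := E) c c') y :=
  (contDiffOn_transition c c').contDiffAt ((isOpen_transition_source c c').mem_nhds ⟨hy, hy'⟩)

theorem IsAlmostHermitian.nablaJ_transition (hJ : IsAlmostHermitian g J) {c c' : M} {y : E}
    (hy : y ∈ (extChartAt 𝓘(ℝ, E) c).target)
    (hy' : (extChartAt 𝓘(ℝ, E) c).symm y ∈ (extChartAt 𝓘(ℝ, E) c').source) (u v : E) :
    fderiv ℝ (transition c c') y (nablaJ g J c y u v) =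
      nablaJ g J c' (transition c c' y) (fderiv ℝ (transition c c') y u)
        (fderiv ℝ (transition c c') y v) := by
  rw [nablaJ_eq, nablaJ_eq]
  refine nablaL_map (hJ.isHermitianOn c) (hJ.isHermitianOn c') (isOpen_extChartAt_target c)
    (isOpen_extChartAt_target c') hy ((extChartAt 𝓘(ℝ, E) c').map_source hy')
    (contDiffAt_transition hy hy') (bijective_fderiv_transition hy hy') ?_ ?_ u v
  · filter_upwards [eventually_mem_transition hy hy'] with z hz
      using chartMetric_transition g hz.1 hz.2
  · filter_upwards [eventually_mem_transition hy hy'] with z hz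
      using chartEnd_transition J hz.1 hz.2

theorem IsAlmostHermitian.canonicalForm_transition (hJ : IsAlmostHermitian g J) {c c' : M} {y : E}
    (hy : y ∈ (extChartAt 𝓘(ℝ, E) c).target)
    (hy' : (extChartAt 𝓘(ℝ, E) c).symm y ∈ (extChartAt 𝓘(ℝ, E) c').source) (u v : E) :
    fderiv ℝ (transition c c') y (canonicalForm g J c y u v) =
      canonicalForm g J c' (transition c c' y) (fderiv ℝ (transition c c') y u)
        (fderiv ℝ (transition c c') y v) + fderiv ℝ (fderiv ℝ (transition c c')) y u v := by
  rw [canonicalForm_eq, canonicalForm_eq]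
  refine canonicalL_map (hJ.isHermitianOn c) (hJ.isHermitianOn c') (isOpen_extChartAt_target c)
    (isOpen_extChartAt_target c') hy ((extChartAt 𝓘(ℝ, E) c').map_source hy')
    (contDiffAt_transition hy hy') (bijective_fderiv_transition hy hy') ?_ ?_ u v
  · filter_upwards [eventually_mem_transition hy hy'] with z hz
      using chartMetric_transition g hz.1 hz.2
  · filter_upwards [eventually_mem_transition hy hy'] with z hz
      using chartEnd_transition J hz.1 hz.2

end

end Charts

/-! ### Linear transport along segments -/

section Segments

/-- Transport along segments, for a connection form `Γ` on an open subset of `E`. -/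
theorem exists_segment_transport {E : Type u} [NormedAddCommGroup E] [NormedSpace ℝ E]
    [FiniteDimensional ℝ E] {Γ : E → E →L[ℝ] EndV E} {Ω : Set E} (hΩ : IsOpen Ω)
    (hΓ : ContDiffOn ℝ ∞ Γ Ω) {y₀ : E} (hy₀ : y₀ ∈ Ω) :
    ∃ r > 0, Metric.ball y₀ r ⊆ Ω ∧ ∃ (A : E × E → EndV E) (α : E × E → ℝ → EndV E),
      ContDiffOn ℝ ∞ A (Metric.ball y₀ r ×ˢ Metric.ball y₀ r) ∧
      (∀ y₁ ∈ Metric.ball y₀ r, ∀ y₂ ∈ Metric.ball y₀ r,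
        α (y₁, y₂) 0 = 1 ∧ α (y₁, y₂) 1 = A (y₁, y₂) ∧
        ∀ s ∈ Set.Icc (0 : ℝ) 1, HasDerivWithinAt (α (y₁, y₂))
          (-(Γ (y₁ + s • (y₂ - y₁)) (y₂ - y₁) * α (y₁, y₂) s)) (Set.Icc 0 1) s) ∧
      ∀ y ∈ Metric.ball y₀ r, A (y, y) = 1 ∧
        ∀ v, fderiv ℝ (fun z => A (y, z)) y v = -Γ y v := by
  -- An autonomous system for (point, constant velocity, transport): the last component solves `A' =
  -- -Γ(v)A` along the segment.
  let f : (E × E × EndV E) → (E × E × EndV E) := fun z => (z.2.1, 0, -(Γ z.1 z.2.1 * z.2.2))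
  let p₁ : (E × E × EndV E) →L[ℝ] E := ContinuousLinearMap.fst ℝ E (E × EndV E)
  let p₂ : (E × E × EndV E) →L[ℝ] E := (ContinuousLinearMap.fst ℝ E (EndV E)).comp
    (ContinuousLinearMap.snd ℝ E (E × EndV E))
  let p₃ : (E × E × EndV E) →L[ℝ] EndV E := (ContinuousLinearMap.snd ℝ E (EndV E)).comp
    (ContinuousLinearMap.snd ℝ E (E × EndV E))
  have hW : IsOpen (p₁ ⁻¹' Ω) := hΩ.preimage p₁.continuous
  have hΓp : ContDiffOn ℝ ∞ (fun z => Γ (p₁ z)) (p₁ ⁻¹' Ω) :=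
    hΓ.comp p₁.contDiff.contDiffOn fun z hz => hz
  have hf : ContDiffOn ℝ ∞ f (p₁ ⁻¹' Ω) :=
    p₂.contDiff.contDiffOn.prodMk (contDiffOn_const.prodMk
      (((hΓp.clm_apply p₂.contDiff.contDiffOn).mul p₃.contDiff.contDiffOn).neg))
  -- At velocity zero the linearisation contains no derivative of `Γ`, since `Γ` is linear in the
  -- velocity.
  have hf' : ∀ y ∈ Ω, ∀ w : (E × E × EndV E), fderiv ℝ f (y, 0, 1) w = (w.2.1, 0, -(Γ y w.2.1)) := by
    intro y hy w
    have h1 : HasFDerivAt Γ (fderiv ℝ Γ y) (p₁ (y, 0, 1)) :=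
      ((hΓ.contDiffAt (hΩ.mem_nhds hy)).differentiableAt (by simp)).hasFDerivAt
    have h2 := ((h1.comp (y, 0, 1) p₁.hasFDerivAt).clm_apply
      (p₂.hasFDerivAt (x := ((y, 0, 1) : (E × E × EndV E))))).mul' (p₃.hasFDerivAt (x := ((y, 0, 1) : (E × E × EndV E))))
    have h3 := (p₂.hasFDerivAt (x := ((y, 0, 1) : (E × E × EndV E)))).prodMk
      ((hasFDerivAt_const (0 : E) ((y, 0, 1) : (E × E × EndV E))).prodMk h2.neg)
    have h4 : HasFDerivAt f _ ((y, 0, 1) : (E × E × EndV E)) := h3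
    rw [h4.fderiv]
    simp [p₂, p₃, p₁]
  obtain ⟨ε, hε, V₀, hV₀, h0V, γ, hγ, hsol⟩ := exists_smooth_solution hW hf
    (x₀ := ((y₀, 0, 1) : (E × E × EndV E))) hy₀
  -- The velocity is divided by `ε` to compensate the time scale, so that `y₂` is reached at time
  -- `1`.
  let ι : E × E → (E × E × EndV E) := fun z => (z.1, ε⁻¹ • (z.2 - z.1), 1)
  have hι : ContDiff ℝ ∞ ι :=
    contDiff_fst.prodMk (((contDiff_snd.sub contDiff_fst).const_smul ε⁻¹).prodMk contDiff_const)
  have hV : IsOpen (ι ⁻¹' V₀) := hV₀.preimage hι.continuous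
  have hmem : (y₀, y₀) ∈ ι ⁻¹' V₀ := by simpa [ι] using h0V
  obtain ⟨r₁, hr₁, hb₁⟩ := Metric.isOpen_iff.1 hV _ hmem
  obtain ⟨r₂, hr₂, hb₂⟩ := Metric.isOpen_iff.1 hΩ _ hy₀
  let r := min r₁ r₂
  have hr : 0 < r := lt_min hr₁ hr₂
  have hbV : ∀ y₁ ∈ Metric.ball y₀ r, ∀ y₂ ∈ Metric.ball y₀ r, ι (y₁, y₂) ∈ V₀ := by
    intro y₁ h₁ y₂ h₂
    apply hb₁
    rw [Metric.mem_ball, Prod.dist_eq, max_lt_iff]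
    exact ⟨lt_of_lt_of_le h₁ (min_le_left _ _), lt_of_lt_of_le h₂ (min_le_left _ _)⟩
  have hbΩ : Metric.ball y₀ r ⊆ Ω := (Metric.ball_subset_ball (min_le_right _ _)).trans hb₂
  have hinit : ∀ x ∈ V₀, extendI (γ x) 0 = x := by
    intro x hx
    have := extendI_coe (γ x) 0
    rw [(hsol x hx).2.1] at this
    simpa using this
  have hsnd : ∀ x ∈ V₀, ∀ s ∈ Set.Icc (0 : ℝ) 1, (extendI (γ x) s).2.1 = x.2.1 := by
    intro x hx s hs
    have hd : ∀ s ∈ Set.Icc (0 : ℝ) 1,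
        HasDerivWithinAt (fun s => p₂ (extendI (γ x) s)) 0 (Set.Icc 0 1) s := by
      intro s hs
      have := p₂.hasFDerivAt.comp_hasDerivWithinAt s ((hsol x hx).2.2.1 s hs)
      exact this.congr_deriv (by simp [p₂, f])
    have h2 := eq_of_hasDerivWithinAt_zero hd hs
    rw [hinit x hx] at h2
    exact h2
  have hfst : ∀ x ∈ V₀, ∀ s ∈ Set.Icc (0 : ℝ) 1,
      (extendI (γ x) s).1 = x.1 + (ε * s) • x.2.1 := by
    intro x hx s hs
    have hd : ∀ s ∈ Set.Icc (0 : ℝ) 1, HasDerivWithinAt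
        (fun s => p₁ (extendI (γ x) s) - (ε * s) • x.2.1) 0 (Set.Icc 0 1) s := by
      intro s hs
      have h1 := p₁.hasFDerivAt.comp_hasDerivWithinAt s ((hsol x hx).2.2.1 s hs)
      have h2 : HasDerivWithinAt (fun s : ℝ => (ε * s) • x.2.1) (ε • x.2.1) (Set.Icc 0 1) s := by
        have := (((hasDerivAt_id s).const_mul ε).smul_const x.2.1).hasDerivWithinAt
          (s := Set.Icc 0 1)
        simpa using this
      refine (h1.sub h2).congr_deriv ?_
      have := hsnd x hx s hs
      simp [p₁, f, this]
    have h2 := eq_of_hasDerivWithinAt_zero hd hs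
    simp only [hinit x hx, mul_zero, zero_smul, sub_zero] at h2
    rw [sub_eq_iff_eq_add] at h2
    exact h2
  let ev : C(unitInterval, (E × E × EndV E)) →L[ℝ] EndV E := p₃.comp (ContinuousMap.evalCLM ℝ 1)
  have hev : ∀ η : C(unitInterval, (E × E × EndV E)), p₃ (extendI η 1) = ev η := by
    intro η
    have := extendI_coe η 1
    rw [show ((1 : unitInterval) : ℝ) = 1 from rfl] at this
    rw [this]; rfl
  have h1mem : (1 : ℝ) ∈ Set.Icc (0 : ℝ) 1 := ⟨zero_le_one, le_rfl⟩
  refine ⟨r, hr, hbΩ, fun z => ev (γ (ι z)), fun z s => p₃ (extendI (γ (ι z)) s), ?_, ?_, ?_⟩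
  · refine ev.contDiff.comp_contDiffOn (hγ.comp hι.contDiffOn fun z hz => ?_)
    exact hbV _ hz.1 _ hz.2
  · intro y₁ h₁ y₂ h₂
    have hx := hbV y₁ h₁ y₂ h₂
    refine ⟨?_, hev _, fun s hs => ?_⟩
    · change p₃ (extendI (γ (ι (y₁, y₂))) 0) = 1
      rw [hinit _ hx]; rfl
    · have h3 := p₃.hasFDerivAt.comp_hasDerivWithinAt s ((hsol _ hx).2.2.1 s hs)
      refine h3.congr_deriv ?_
      have h4 := hsnd _ hx s hs
      have h5 := hfst _ hx s hs
      simp only [ι, smul_smul] at h4 h5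
      rw [show ε * s * ε⁻¹ = s by field_simp] at h5
      rw [map_smul]
      change ε • -(Γ (extendI (γ (ι (y₁, y₂))) s).1 (extendI (γ (ι (y₁, y₂))) s).2.1 *
        (extendI (γ (ι (y₁, y₂))) s).2.2) = _
      rw [h4, h5, map_smul, smul_mul_assoc, smul_neg, smul_smul, mul_inv_cancel₀ hε.ne', one_smul]
      rfl
  · intro y hy
    have hx := hbV y hy y hy
    have hιy : ι (y, y) = (y, 0, 1) := by simp [ι]
    rw [hιy] at hx
    have hconst : ∀ s ∈ Set.Icc (0 : ℝ) 1, extendI (γ (y, 0, 1)) s = (y, 0, 1) := by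
      intro s hs
      have hd : ∀ s ∈ Set.Icc (0 : ℝ) 1,
          HasDerivWithinAt (extendI (γ (y, 0, 1))) 0 (Set.Icc 0 1) s := by
        intro s hs
        refine ((hsol _ hx).2.2.1 s hs).congr_deriv ?_
        simp [f, hsnd _ hx s hs]
      rw [eq_of_hasDerivWithinAt_zero hd hs, hinit _ hx]
    refine ⟨?_, fun v => ?_⟩
    · change ev (γ (ι (y, y))) = 1
      rw [hιy, ← hev, hconst 1 h1mem]; rfl
    · let w : (E × E × EndV E) := (0, ε⁻¹ • v, 0)
      have hd : HasFDerivAt γ (fderiv ℝ γ (y, 0, 1)) (ι (y, y)) := by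
        rw [hιy]
        exact ((hγ.contDiffAt (hV₀.mem_nhds hx)).differentiableAt (by simp)).hasFDerivAt
      have hι' : HasFDerivAt (fun z => ι (y, z)) ((0 : E →L[ℝ] E).prod
          ((ε⁻¹ • ContinuousLinearMap.id ℝ E).prod (0 : E →L[ℝ] EndV E))) y :=
        (hasFDerivAt_const y y).prodMk ((((hasFDerivAt_id y).sub_const y).const_smul ε⁻¹).prodMk
          (hasFDerivAt_const (1 : EndV E) y))
      have h2 := ev.hasFDerivAt.comp y (hd.comp y hι')
      have h3 : fderiv ℝ (fun z => ev (γ (ι (y, z)))) y v = ev (fderiv ℝ γ (y, 0, 1) w) := by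
        have h4 : HasFDerivAt (fun z => ev (γ (ι (y, z)))) _ y := h2
        rw [h4.fderiv]
        simp [w]
      obtain ⟨hw0, hwd⟩ := (hsol _ hx).2.2.2 w
      let A : ℝ → (E × E × EndV E) →L[ℝ] (E × E × EndV E) := fun s => ε • fderiv ℝ f (extendI (γ (y, 0, 1)) s)
      have hA : ContinuousOn A (Set.Icc 0 1) := by
        refine ContinuousOn.const_smul ?_ ε
        exact (hf.continuousOn_fderiv_of_isOpen hW (by simp)).comp
          (continuous_extendI _).continuousOn fun s _ => (hsol _ hx).1 s
      -- An explicit solution of the linearised equation along the constant curve `(y, 0, 1)`; its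
      -- last component at time `1` is the desired derivative `-Γ(v)`.
      let Z : ℝ → (E × E × EndV E) := fun s => (s • v, ε⁻¹ • v, s • -(Γ y v))
      have hZ : ∀ s ∈ Set.Icc (0 : ℝ) 1, HasDerivWithinAt Z (A s (Z s)) (Set.Icc 0 1) s := by
        intro s hs
        have h5 := ((hasDerivWithinAt_id s (Set.Icc (0 : ℝ) 1)).smul_const v).prodMk
          ((hasDerivWithinAt_const s (Set.Icc (0 : ℝ) 1) (ε⁻¹ • v)).prodMk
            ((hasDerivWithinAt_id s (Set.Icc (0 : ℝ) 1)).smul_const (-(Γ y v))))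
        refine h5.congr_deriv ?_
        simp only [A, Z, smul_apply, hconst s hs, hf' y (hbΩ hy)]
        simp [smul_smul, hε.ne']
      have hYZ := linearODE_unique hA (fun s hs => hwd s hs) hZ (by
        have := extendI_coe (fderiv ℝ γ (y, 0, 1) w) 0
        rw [hw0] at this
        simpa [Z, w] using this) h1mem
      rw [h3, ← hev, hYZ]
      simp [Z, p₃]

end Segments

/-! ### Parallel fields -/

section Parallel

variable {E : Type u} [NormedAddCommGroup E] [NormedSpace ℝ E] [FiniteDimensional ℝ E]
  {M : Type*} [TopologicalSpace M] [ChartedSpace E M] [IsManifold 𝓘(ℝ, E) ∞ M]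
  {g : RiemMetric E M} {J : EndField E M}

/-- The parallelism condition at time `t`, in the chart around `c`. -/
def IsParallelAt (g : RiemMetric E M) (J : EndField E M) (c : M) (γ : ℝ → M) (X : ℝ → E)
    (t : ℝ) : Prop :=
  HasDerivAt (fun s => dC c (γ s) (X s))
    (-(canonicalForm g J c (extChartAt 𝓘(ℝ, E) c (γ t))
        (deriv (fun s => extChartAt 𝓘(ℝ, E) c (γ s)) t) (dC c (γ t) (X t)))) t

theorem differentiableAt_chart_curve {γ : ℝ → M} (hγ : ContMDiff 𝓘(ℝ, ℝ) 𝓘(ℝ, E) ∞ γ) {c : M}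
    {t : ℝ} (hc : γ t ∈ (extChartAt 𝓘(ℝ, E) c).source) :
    DifferentiableAt ℝ (fun s => extChartAt 𝓘(ℝ, E) c (γ s)) t := by
  have h1 : MDifferentiableAt 𝓘(ℝ, E) 𝓘(ℝ, E) (extChartAt 𝓘(ℝ, E) c) (γ t) :=
    mdifferentiableAt_extChartAt (by rwa [extChartAt_source] at hc)
  have h2 : MDifferentiableAt 𝓘(ℝ, ℝ) 𝓘(ℝ, E) γ t := hγ.mdifferentiableAt (by simp)
  exact mdifferentiableAt_iff_differentiableAt.1 (h1.comp t h2)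

theorem eventually_mem_source {γ : ℝ → M} (hγ : ContMDiff 𝓘(ℝ, ℝ) 𝓘(ℝ, E) ∞ γ) {c : M}
    {t : ℝ} (hc : γ t ∈ (extChartAt 𝓘(ℝ, E) c).source) :
    ∀ᶠ s in 𝓝 t, γ s ∈ (extChartAt 𝓘(ℝ, E) c).source :=
  hγ.continuous.continuousAt.preimage_mem_nhds ((isOpen_extChartAt_source c).mem_nhds hc)

/-- Parallel fields are defined with a chart that moves with the curve; this allows one fixed chart
to be used. The second derivative of the transition map produced by the product rule cancels the
inhomogeneous term of the connection form. -/
theorem IsParallelAt.change_chart (hJ : IsAlmostHermitian g J) {γ : ℝ → M}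
    (hγ : ContMDiff 𝓘(ℝ, ℝ) 𝓘(ℝ, E) ∞ γ) {X : ℝ → E} {c c' : M} {t : ℝ}
    (hc : γ t ∈ (extChartAt 𝓘(ℝ, E) c).source) (hc' : γ t ∈ (extChartAt 𝓘(ℝ, E) c').source)
    (h : IsParallelAt g J c γ X t) : IsParallelAt g J c' γ X t := by
  have hy := differentiableAt_chart_curve hγ hc
  set y : ℝ → E := fun s => extChartAt 𝓘(ℝ, E) c (γ s) with hydef
  have hyt : y t ∈ (extChartAt 𝓘(ℝ, E) c).target := (extChartAt 𝓘(ℝ, E) c).map_source hc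
  have hsy : ∀ s, γ s ∈ (extChartAt 𝓘(ℝ, E) c).source →
      (extChartAt 𝓘(ℝ, E) c).symm (y s) = γ s := fun s hs => (extChartAt 𝓘(ℝ, E) c).left_inv hs
  have hyt' : (extChartAt 𝓘(ℝ, E) c).symm (y t) ∈ (extChartAt 𝓘(ℝ, E) c').source := by
    rwa [hsy t hc]
  have hφ := contDiffAt_transition (E := E) hyt hyt'
  have hφd : HasFDerivAt (transition c c') (fderiv ℝ (transition c c') (y t)) (y t) :=
    (hφ.differentiableAt (by simp)).hasFDerivAt
  have hφ' : HasFDerivAt (fderiv ℝ (transition (E := E) c c'))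
      (fderiv ℝ (fderiv ℝ (transition c c')) (y t)) (y t) :=
    ((hφ.fderiv_right (m := ∞) (by simp)).differentiableAt (by simp)).hasFDerivAt
  have hev : ∀ᶠ s in 𝓝 t, γ s ∈ (extChartAt 𝓘(ℝ, E) c).source ∧
      γ s ∈ (extChartAt 𝓘(ℝ, E) c').source :=
    (eventually_mem_source hγ hc).and (eventually_mem_source hγ hc')
  have h1 : (fun s => extChartAt 𝓘(ℝ, E) c' (γ s)) =ᶠ[𝓝 t] fun s => transition c c' (y s) := by
    filter_upwards [hev] with s hs
    rw [transition, hsy s hs.1]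
  have hX : ∀ s, γ s ∈ (extChartAt 𝓘(ℝ, E) c).source → γ s ∈ (extChartAt 𝓘(ℝ, E) c').source →
      dC c' (γ s) (X s) = fderiv ℝ (transition c c') (y s) (dC c (γ s) (X s)) := by
    intro s hs hs'
    rw [fderiv_transition ((extChartAt 𝓘(ℝ, E) c).map_source hs) (by rwa [hsy s hs]), hsy s hs]
    change _ = dC c' (γ s) (dCI c (y s) (dC c (γ s) (X s)))
    rw [hydef, dCI_dC' hs]
  have h2 : (fun s => dC c' (γ s) (X s)) =ᶠ[𝓝 t] fun s =>
      fderiv ℝ (transition c c') (y s) (dC c (γ s) (X s)) := by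
    filter_upwards [hev] with s hs using hX s hs.1 hs.2
  have h3 : deriv (fun s => extChartAt 𝓘(ℝ, E) c' (γ s)) t =
      fderiv ℝ (transition c c') (y t) (deriv y t) := by
    rw [h1.deriv_eq]
    exact (hφd.comp_hasDerivAt t hy.hasDerivAt).deriv
  have h4 := (hφ'.comp_hasDerivAt t hy.hasDerivAt).clm_apply h
  unfold IsParallelAt
  refine (h4.congr_of_eventuallyEq h2).congr_deriv ?_
  have h5 := hJ.canonicalForm_transition hyt hyt' (deriv y t) (dC c (γ t) (X t))
  have h6 : transition c c' (y t) = extChartAt 𝓘(ℝ, E) c' (γ t) := h1.eq_of_nhds.symm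
  change fderiv ℝ (fderiv ℝ (transition c c')) (y t) (deriv y t) (dC c (γ t) (X t)) +
    fderiv ℝ (transition c c') (y t)
      (-(canonicalForm g J c (y t) (deriv y t) (dC c (γ t) (X t)))) = _
  rw [h3, hX t hc hc', map_neg, h5, h6]
  abel

/-- The canonical connection preserves the metric. -/
theorem inner_eq_of_isParallelAt (hJ : IsAlmostHermitian g J) {γ : ℝ → M}
    (hγ : ContMDiff 𝓘(ℝ, ℝ) 𝓘(ℝ, E) ∞ γ) {X Y : ℝ → E}
    (hX : ∀ t, IsParallelAt g J (γ t) γ X t) (hY : ∀ t, IsParallelAt g J (γ t) γ Y t) (t t' : ℝ) :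
    innerE g (γ t) (X t) (Y t) = innerE g (γ t') (X t') (Y t') := by
  have key : ∀ t, HasDerivAt (fun s => innerE g (γ s) (X s) (Y s)) 0 t := by
    intro t
    have hc := mem_extChartAt_source (I := 𝓘(ℝ, E)) (γ t)
    have hy := (differentiableAt_chart_curve hγ hc).hasDerivAt
    have hyt := (extChartAt 𝓘(ℝ, E) (γ t)).map_source hc
    have hH := hJ.isHermitianOn (γ t)
    have ho := isOpen_extChartAt_target (I := 𝓘(ℝ, E)) (γ t)
    set y : ℝ → E := fun s => extChartAt 𝓘(ℝ, E) (γ t) (γ s) with hydef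
    have hGd : HasFDerivAt (chartMetric g (γ t)) (fderiv ℝ (chartMetric g (γ t)) (y t)) (y t) :=
      (hH.toIsMetricOn.differentiableAt ho hyt).hasFDerivAt
    have h1 := ((hGd.comp_hasDerivAt t hy).clm_apply (hX t)).clm_apply (hY t)
    have h2 : (fun s => innerE g (γ s) (X s) (Y s)) =ᶠ[𝓝 t] fun s =>
        chartMetric g (γ t) (y s) (dC (γ t) (γ s) (X s)) (dC (γ t) (γ s) (Y s)) := by
      filter_upwards [eventually_mem_source hγ hc] with s hs
      rw [chartMetric_apply, hydef, dCI_dC' hs, dCI_dC' hs,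
        (extChartAt 𝓘(ℝ, E) (γ t)).left_inv hs]
    refine (h1.congr_of_eventuallyEq h2).congr_deriv ?_
    have h3 := hH.canonicalL_metric ho hyt (deriv y t)
      (dC (γ t) (γ t) (X t)) (dC (γ t) (γ t) (Y t))
    change (fderiv ℝ (chartMetric g (γ t)) (y t) (deriv y t) (dC (γ t) (γ t) (X t)) +
      chartMetric g (γ t) (y t) (-(canonicalL (chartMetric g (γ t)) (chartEnd J (γ t)) (y t)
        (deriv y t) (dC (γ t) (γ t) (X t))))) (dC (γ t) (γ t) (Y t)) +
      chartMetric g (γ t) (y t) (dC (γ t) (γ t) (X t)) (-(canonicalL (chartMetric g (γ t))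
        (chartEnd J (γ t)) (y t) (deriv y t) (dC (γ t) (γ t) (Y t)))) = 0
    simp only [map_neg, add_apply, neg_apply]
    linarith
  exact is_const_of_deriv_eq_zero (fun t => (key t).differentiableAt) (fun t => (key t).deriv) _ _

/-- The canonical connection preserves the almost complex structure. -/
theorem IsParallelAt.complex (hJ : IsAlmostHermitian g J) {γ : ℝ → M}
    (hγ : ContMDiff 𝓘(ℝ, ℝ) 𝓘(ℝ, E) ∞ γ) {X : ℝ → E} {t : ℝ}
    (hX : IsParallelAt g J (γ t) γ X t) :
    IsParallelAt g J (γ t) γ (fun t => endE J (γ t) (X t)) t := by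
  have hc := mem_extChartAt_source (I := 𝓘(ℝ, E)) (γ t)
  have hy := (differentiableAt_chart_curve hγ hc).hasDerivAt
  have hyt := (extChartAt 𝓘(ℝ, E) (γ t)).map_source hc
  have hH := hJ.isHermitianOn (γ t)
  have ho := isOpen_extChartAt_target (I := 𝓘(ℝ, E)) (γ t)
  set y : ℝ → E := fun s => extChartAt 𝓘(ℝ, E) (γ t) (γ s) with hydef
  have hJd : HasFDerivAt (chartEnd J (γ t)) (fderiv ℝ (chartEnd J (γ t)) (y t)) (y t) :=
    (hH.differentiableAtJ ho hyt).hasFDerivAt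
  have hJX : ∀ s, γ s ∈ (extChartAt 𝓘(ℝ, E) (γ t)).source →
      dC (γ t) (γ s) (endE J (γ s) (X s)) =
      chartEnd J (γ t) (y s) (dC (γ t) (γ s) (X s)) := by
    intro s hs
    rw [chartEnd_apply, hydef, dCI_dC' hs, (extChartAt 𝓘(ℝ, E) (γ t)).left_inv hs]
  have h1 := (hJd.comp_hasDerivAt t hy).clm_apply hX
  have h2 : (fun s => dC (γ t) (γ s) (endE J (γ s) (X s))) =ᶠ[𝓝 t] fun s =>
      chartEnd J (γ t) (y s) (dC (γ t) (γ s) (X s)) := by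
    filter_upwards [eventually_mem_source hγ hc] with s hs using hJX s hs
  unfold IsParallelAt
  refine (h1.congr_of_eventuallyEq h2).congr_deriv ?_
  have h3 := congrArg (fun A : EndV E => A (dC (γ t) (γ t) (X t)))
    (hH.canonicalL_complex ho hyt (deriv y t))
  simp only [add_apply, sub_apply, mul_apply_eq_comp, zero_apply] at h3
  rw [hJX t hc]
  change fderiv ℝ (chartEnd J (γ t)) (y t) (deriv y t) (dC (γ t) (γ t) (X t)) +
      chartEnd J (γ t) (y t) (-(canonicalL (chartMetric g (γ t)) (chartEnd J (γ t)) (y t)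
        (deriv y t) (dC (γ t) (γ t) (X t)))) = -(canonicalL (chartMetric g (γ t))
        (chartEnd J (γ t)) (y t) (deriv y t) (chartEnd J (γ t) (y t) (dC (γ t) (γ t) (X t))))
  rw [map_neg]
  linear_combination (norm := module) h3

theorem IsParallelAt.sub {c : M} {γ : ℝ → M} {X Y : ℝ → E} {t : ℝ}
    (hX : IsParallelAt g J c γ X t) (hY : IsParallelAt g J c γ Y t) :
    IsParallelAt g J c γ (fun t => X t - Y t) t := by
  unfold IsParallelAt at *
  have h := hX.sub hY
  simp only [map_sub]
  refine h.congr_deriv ?_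
  abel

/-- Parallel fields are determined by one value. -/
theorem eq_of_isParallelAt (hJ : IsAlmostHermitian g J) {γ : ℝ → M}
    (hγ : ContMDiff 𝓘(ℝ, ℝ) 𝓘(ℝ, E) ∞ γ) {X Y : ℝ → E}
    (hX : ∀ t, IsParallelAt g J (γ t) γ X t) (hY : ∀ t, IsParallelAt g J (γ t) γ Y t) {t : ℝ}
    (h : X t = Y t) (t' : ℝ) : X t' = Y t' := by
  -- The difference of the two fields is parallel, so its length is constant and equal to zero.
  have h1 := inner_eq_of_isParallelAt hJ hγ (fun t => (hX t).sub (hY t))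
    (fun t => (hX t).sub (hY t)) t' t
  simp only [h, sub_self, map_zero, zero_apply] at h1
  by_contra hne
  exact (g.pos (γ t') (X t' - Y t') (sub_ne_zero.2 hne)).ne' h1

/-! ### Parallel transport -/

/-- Transport, with tangent spaces identified with the model space. -/
def IsTransportE (g : RiemMetric E M) (J : EndField E M) (x y : M) (P : EndV E) : Prop :=
  IsTransport g J x y P

theorem isTransportE_segment {γ : ℝ → M} (hγ : ContMDiff 𝓘(ℝ, ℝ) 𝓘(ℝ, E) ∞ γ) {x y : M}
    (hx : γ 0 = x) (hy : γ 1 = y) {P : EndV E}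
    (hP : ∀ v, ∃ X : ℝ → E, (∀ t, IsParallelAt g J (γ t) γ X t) ∧ X 0 = v ∧ X 1 = P v) :
    IsTransportE g J x y P := by
  subst hx hy
  exact IsTransport.segment γ hγ P hP

theorem IsTransportE.comp {x y z : M} {P Q : EndV E} (hQ : IsTransportE g J y z Q)
    (hP : IsTransportE g J x y P) : IsTransportE g J x z (Q * P) :=
  IsTransport.comp hP hQ

/-- A property of transports that holds for smooth segments and is preserved by composition. -/
theorem IsTransportE.induction {C : (x y : M) → EndV E → Prop}
    (hseg : ∀ (γ : ℝ → M), ContMDiff 𝓘(ℝ, ℝ) 𝓘(ℝ, E) ∞ γ → ∀ P : EndV E,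
      (∀ v, ∃ X : ℝ → E, (∀ t, IsParallelAt g J (γ t) γ X t) ∧ X 0 = v ∧ X 1 = P v) →
      C (γ 0) (γ 1) P)
    (hcomp : ∀ x y z P Q, C x y P → C y z Q → C x z (Q * P)) {x y : M} {P : EndV E}
    (h : IsTransportE g J x y P) : C x y P := by
  unfold IsTransportE at h
  induction h with
  | segment γ hγ P hP => exact hseg γ hγ P hP
  | comp _ _ h1 h2 => exact hcomp _ _ _ _ _ h1 h2

theorem IsTransportE.isometry (hJ : IsAlmostHermitian g J) {x y : M} {P : EndV E}
    (h : IsTransportE g J x y P) : ∀ u v, innerE g y (P u) (P v) = innerE g x u v := by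
  refine h.induction (C := fun x y P => ∀ u v, innerE g y (P u) (P v) = innerE g x u v) ?_ ?_
  · intro γ hγ P hP u v
    obtain ⟨X, hX, hX0, hX1⟩ := hP u
    obtain ⟨Y, hY, hY0, hY1⟩ := hP v
    have h1 : innerE g (γ 1) (X 1) (Y 1) = innerE g (γ 0) (X 0) (Y 0) :=
      inner_eq_of_isParallelAt hJ hγ hX hY 1 0
    rwa [hX0, hY0, hX1, hY1] at h1
  · intro x y z P Q hP hQ u v
    rw [mul_apply_eq_comp, mul_apply_eq_comp, hQ, hP]

/-- `J` applied to a parallel field is parallel, so by uniqueness it is the field that starts at `J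
u`. -/
theorem IsTransportE.complex (hJ : IsAlmostHermitian g J) {x y : M} {P : EndV E}
    (h : IsTransportE g J x y P) : ∀ u, P (endE J x u) = endE J y (P u) := by
  refine h.induction (C := fun x y P => ∀ u, P (endE J x u) = endE J y (P u)) ?_ ?_
  · intro γ hγ P hP u
    obtain ⟨X, hX, hX0, hX1⟩ := hP u
    obtain ⟨Y, hY, hY0, hY1⟩ := hP (endE J (γ 0) u)
    rw [← hY1, ← hX1]
    exact eq_of_isParallelAt hJ hγ hY (fun t => (hX t).complex hJ hγ) (t := 0) (by rw [hY0, hX0]) 1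
  · intro x y z P Q hP hQ u
    rw [mul_apply_eq_comp, mul_apply_eq_comp, hP, hQ]

theorem IsParallelAt.reverse {c : M} {γ : ℝ → M} {X : ℝ → E} {t : ℝ}
    (hX : IsParallelAt g J c γ X (1 - t)) :
    IsParallelAt g J c (fun s => γ (1 - s)) (fun s => X (1 - s)) t := by
  unfold IsParallelAt at *
  have h1 := hX.comp_const_sub 1 t
  refine h1.congr_deriv ?_
  have h2 := deriv_comp_const_sub (f := fun s => extChartAt 𝓘(ℝ, E) c (γ s)) (a := 1) (x := t)
  rw [h2, canonicalForm_eq, canonicalForm_eq, map_neg, neg_apply]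

/-- A transport is an isometry between spaces of equal dimension, hence invertible. Its inverse is
the transport along the reversed curve. -/
theorem IsTransportE.exists_inverse (hJ : IsAlmostHermitian g J) {x y : M} {P : EndV E}
    (h : IsTransportE g J x y P) : ∃ Q, IsTransportE g J y x Q ∧ Q * P = 1 ∧ P * Q = 1 := by
  refine h.induction (C := fun x y P => ∃ Q, IsTransportE g J y x Q ∧ Q * P = 1 ∧ P * Q = 1) ?_ ?_
  · intro γ hγ P hP
    have hPt : IsTransportE g J (γ 0) (γ 1) P := isTransportE_segment hγ rfl rfl hP
    have hinj : Function.Injective P.toLinearMap := by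
      rw [← LinearMap.ker_eq_bot, LinearMap.ker_eq_bot']
      intro u hu
      by_contra hne
      have h1 := hPt.isometry hJ u u
      have h2 : P u = 0 := hu
      rw [h2] at h1
      simp only [map_zero] at h1
      exact (g.pos (γ 0) u hne).ne h1
    let e := (LinearEquiv.ofInjectiveEndo P.toLinearMap hinj).toContinuousLinearEquiv
    have he : ∀ u, e u = P u := fun u => rfl
    have hQP : ∀ u, P (e.symm u) = u := fun u => e.apply_symm_apply u
    refine ⟨(e.symm : E →L[ℝ] E), ?_, ?_, ?_⟩
    · refine isTransportE_segment (γ := fun s => γ (1 - s))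
        (hγ.comp (contDiff_const.sub contDiff_id).contMDiff) (by simp) (by simp) fun v => ?_
      obtain ⟨X, hX, hX0, hX1⟩ := hP (e.symm v)
      refine ⟨fun s => X (1 - s), fun t => (hX (1 - t)).reverse, ?_, ?_⟩
      · simp [hX1, hQP]
      · simp [hX0]
    · ext u
      exact e.symm_apply_apply u
    · ext u
      exact hQP u
  · rintro x y z P Q ⟨P', hP', h1, h2⟩ ⟨Q', hQ', h3, h4⟩
    refine ⟨P' * Q', hP'.comp hQ', ?_, ?_⟩
    · rw [mul_assoc, ← mul_assoc Q', h3, one_mul, h1]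
    · rw [mul_assoc, ← mul_assoc P, h2, one_mul, h4]

end Parallel

/-! ### Local gauges of the canonical connection -/

section Gauge

variable {E : Type u} [NormedAddCommGroup E] [NormedSpace ℝ E] [FiniteDimensional ℝ E]
  {M : Type*} [TopologicalSpace M] [ChartedSpace E M] [IsManifold 𝓘(ℝ, E) ∞ M]
  {g : RiemMetric E M} {J : EndField E M}

/-- The connection form of the canonical connection in the chart around `c`. -/
abbrev connL (g : RiemMetric E M) (J : EndField E M) (c : M) (y : E) : E →L[ℝ] EndV E :=
  canonicalL (chartMetric g c) (chartEnd J c) y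

/-- Parallel transports along coordinate segments depend smoothly on the end points. -/
theorem exists_chart_transport (hJ : IsAlmostHermitian g J) (c : M) :
    ∃ r > 0, Metric.ball (extChartAt 𝓘(ℝ, E) c c) r ⊆ (extChartAt 𝓘(ℝ, E) c).target ∧
      ∃ A : E × E → EndV E,
        ContDiffOn ℝ ∞ A (Metric.ball (extChartAt 𝓘(ℝ, E) c c) r ×ˢ
          Metric.ball (extChartAt 𝓘(ℝ, E) c c) r) ∧
        (∀ y₁ ∈ Metric.ball (extChartAt 𝓘(ℝ, E) c c) r,
          ∀ y₂ ∈ Metric.ball (extChartAt 𝓘(ℝ, E) c c) r,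
          IsTransportE g J ((extChartAt 𝓘(ℝ, E) c).symm y₁) ((extChartAt 𝓘(ℝ, E) c).symm y₂)
            (dCI c y₂ * A (y₁, y₂) * dC c ((extChartAt 𝓘(ℝ, E) c).symm y₁))) ∧
        ∀ y ∈ Metric.ball (extChartAt 𝓘(ℝ, E) c c) r, A (y, y) = 1 ∧
          ∀ v, fderiv ℝ (fun z => A (y, z)) y v = -connL g J c y v := by
  obtain ⟨r, hr, hball, A, α, hA, hα, hd⟩ := exists_segment_transport
    (isOpen_extChartAt_target c) ((hJ.isHermitianOn c).contDiffOn_canonicalL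
      (isOpen_extChartAt_target c)) (mem_extChartAt_target (I := 𝓘(ℝ, E)) c)
  refine ⟨r, hr, hball, A, hA, fun y₁ h₁ y₂ h₂ => ?_, hd⟩
  obtain ⟨hα0, hα1, hαd⟩ := hα y₁ h₁ y₂ h₂
  -- A transport needs a curve and parallel fields on the whole real line. `Real.smoothTransition`
  -- runs through the segment with values in `[0, 1]`, so the curve is smooth for all times and
  -- never leaves the ball.
  set y : ℝ → E := fun t => y₁ + Real.smoothTransition t • (y₂ - y₁) with hy
  have hσ : ∀ t, Real.smoothTransition t ∈ Set.Icc (0 : ℝ) 1 := fun t =>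
    ⟨Real.smoothTransition.nonneg t, Real.smoothTransition.le_one t⟩
  have hyb : ∀ t, y t ∈ Metric.ball (extChartAt 𝓘(ℝ, E) c c) r := fun t =>
    (convex_ball _ r).add_smul_sub_mem h₁ h₂ (hσ t)
  have hyt : ∀ t, y t ∈ (extChartAt 𝓘(ℝ, E) c).target := fun t => hball (hyb t)
  have hyc : ContDiff ℝ ∞ y :=
    contDiff_const.add ((Real.smoothTransition.contDiff (n := ⊤)).smul contDiff_const)
  set γ : ℝ → M := fun t => (extChartAt 𝓘(ℝ, E) c).symm (y t) with hγdef
  have hγ : ContMDiff 𝓘(ℝ, ℝ) 𝓘(ℝ, E) ∞ γ :=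
    (contMDiffOn_extChartAt_symm (n := ∞) c).comp_contMDiff hyc.contMDiff hyt
  have hγs : ∀ t, γ t ∈ (extChartAt 𝓘(ℝ, E) c).source := fun t =>
    (extChartAt 𝓘(ℝ, E) c).map_target (hyt t)
  have hy0 : y 0 = y₁ := by simp [hy]
  have hy1 : y 1 = y₂ := by simp [hy]
  refine isTransportE_segment hγ (by simp [hγdef, hy0]) (by simp [hγdef, hy1]) fun v => ?_
  refine ⟨fun t => dCI c (y t) (α (y₁, y₂) (Real.smoothTransition t)
    (dC c ((extChartAt 𝓘(ℝ, E) c).symm y₁) v)), fun t => ?_, ?_, ?_⟩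
  · refine IsParallelAt.change_chart hJ hγ (hγs t) (mem_extChartAt_source _) ?_
    unfold IsParallelAt
    have h1 : ∀ t, dC c (γ t) (dCI c (y t) (α (y₁, y₂) (Real.smoothTransition t)
        (dC c ((extChartAt 𝓘(ℝ, E) c).symm y₁) v))) = α (y₁, y₂) (Real.smoothTransition t)
        (dC c ((extChartAt 𝓘(ℝ, E) c).symm y₁) v) := fun t => dC_dCI (hyt t) _
    have h2 : ∀ t, extChartAt 𝓘(ℝ, E) c (γ t) = y t := fun t =>
      (extChartAt 𝓘(ℝ, E) c).right_inv (hyt t)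
    simp only [h1, h2]
    have hs : HasDerivAt Real.smoothTransition (deriv Real.smoothTransition t) t :=
      (((Real.smoothTransition.contDiff (n := 1)).differentiable (by simp)) t).hasDerivAt
    have h3 := ((hαd _ (hσ t)).scomp_hasDerivAt t hs hσ).clm_apply
      (hasDerivAt_const t (dC c ((extChartAt 𝓘(ℝ, E) c).symm y₁) v))
    have h4 : deriv y t = deriv Real.smoothTransition t • (y₂ - y₁) :=
      ((hs.smul_const (y₂ - y₁)).const_add y₁).deriv
    refine h3.congr_deriv ?_
    rw [h4, canonicalForm_eq]
    simp [hy, mul_apply_eq_comp]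
  · simp only [Real.smoothTransition.zero, hα0, hy0]
    exact dCI_dC (hball h₁) v
  · simp only [Real.smoothTransition.one, hα1, hy1]
    rfl

theorem IsTransportE.injective (hJ : IsAlmostHermitian g J) {x y : M} {P : EndV E}
    (h : IsTransportE g J x y P) : Function.Injective P := by
  obtain ⟨Q, -, hQ, -⟩ := h.exists_inverse hJ
  intro u v huv
  have := congrArg Q huv
  rwa [← mul_apply_eq_comp, ← mul_apply_eq_comp, hQ] at this

/-- Any two points of a connected manifold are joined by a parallel transport. -/
theorem exists_transport [ConnectedSpace M] (hJ : IsAlmostHermitian g J) (q p : M) :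
    ∃ P, IsTransportE g J q p P := by
  have hloc : ∀ x : M, ∃ N ∈ 𝓝 x, ∀ x' ∈ N, ∃ P, IsTransportE g J x x' P := by
    intro x
    obtain ⟨r, hr, hball, A, -, hA, -⟩ := exists_chart_transport hJ x
    refine ⟨(extChartAt 𝓘(ℝ, E) x).source ∩ extChartAt 𝓘(ℝ, E) x ⁻¹' Metric.ball _ r,
      Filter.inter_mem (extChartAt_source_mem_nhds x) ((continuousAt_extChartAt x).preimage_mem_nhds
        (Metric.ball_mem_nhds _ hr)), fun x' hx' => ?_⟩
    have h := hA _ (Metric.mem_ball_self hr) _ hx'.2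
    rw [(extChartAt 𝓘(ℝ, E) x).left_inv hx'.1, extChartAt_to_inv] at h
    exact ⟨_, h⟩
  -- The set of points reached from `q` is closed because local transports can be inverted, and open
  -- because they can be appended.
  have h : {x | ∃ P, IsTransportE g J q x P} = Set.univ := by
    refine IsClopen.eq_univ ⟨⟨?_⟩, ?_⟩ ?_
    · rw [isOpen_iff_mem_nhds]
      intro x hx
      obtain ⟨N, hN, h⟩ := hloc x
      filter_upwards [hN] with x' hx' ⟨P, hP⟩
      obtain ⟨Q, hQ⟩ := h x' hx'
      obtain ⟨Q', hQ', -⟩ := hQ.exists_inverse hJ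
      exact hx ⟨_, hQ'.comp hP⟩
    · rw [isOpen_iff_mem_nhds]
      rintro x ⟨P, hP⟩
      obtain ⟨N, hN, h⟩ := hloc x
      filter_upwards [hN] with x' hx'
      obtain ⟨Q, hQ⟩ := h x' hx'
      exact ⟨_, hQ.comp hP⟩
    · obtain ⟨N, hN, h⟩ := hloc q
      exact ⟨q, h q (mem_of_mem_nhds hN)⟩
  exact (Set.eq_univ_iff_forall.1 h) p

/-- The Lie algebra `s(u(L) ⊕ u(L^⊥))` of a Hermitian vector space `(E, B, I)`. -/
structure IsSplit (B : Bil E) (I : EndV E) (L : Submodule ℝ E) (A : EndV E) : Prop where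
  skew : ∀ v w, B (A v) w = -B v (A w)
  comm : ∀ v, A (I v) = I (A v)
  trace_eq : LinearMap.trace ℝ E (I * A).toLinearMap = 0
  mapsTo : ∀ v ∈ L, A v ∈ L

theorem IsSplit.smul {B : Bil E} {I : EndV E} {L : Submodule ℝ E} {A : EndV E}
    (h : IsSplit B I L A) (t : ℝ) : IsSplit B I L (t • A) where
  skew v w := by simp [h.skew v w]
  comm v := by simp [h.comm v]
  trace_eq := by
    have h1 : (I * (t • A)).toLinearMap = t • (I * A).toLinearMap := by ext; simp
    rw [h1, map_smul, h.trace_eq, smul_zero]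
  mapsTo v hv := L.smul_mem t (h.mapsTo v hv)

/-- Conjugation by `P` turns a family of loop transports at `p` into one at `q`. Its velocity is
thus the conjugate of an element of the holonomy algebra at `q`. This is where the holonomy
hypothesis enters the argument. -/
theorem isSplit_of_transport (hJ : IsAlmostHermitian g J) {q p : M} {P : EndV E}
    (hP : IsTransportE g J q p P) {L : Submodule ℝ E}
    (hhol : holonomyAlgebra g J q ⊆ specialUnitarySplit g J q L) {c : ℝ → EndV E}
    (hc : ContDiff ℝ 1 c) (hct : ∀ t, IsTransportE g J p p (c t)) (hc0 : c 0 = 1) :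
    IsSplit (innerE g p) (endE J p) (L.map P.toLinearMap) (deriv c 0) := by
  obtain ⟨Q, hQ, hQP, hPQ⟩ := hP.exists_inverse hJ
  have hPQ' : ∀ v, P (Q v) = v := fun v => congrArg (fun A : EndV E => A v) hPQ
  have hQP' : ∀ v, Q (P v) = v := fun v => congrArg (fun A : EndV E => A v) hQP
  have hd : HasDerivAt (fun t => Q * c t * P) (Q * deriv c 0 * P) 0 := by
    have h1 := ((hc.differentiable (by simp)) 0).hasDerivAt
    exact (h1.const_mul Q).mul_const P
  have hmem : (Q * deriv c 0 * P : EndV E) ∈ holonomyAlgebra g J q := by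
    refine ⟨fun t => Q * c t * P, (contDiff_const.mul hc).mul contDiff_const, fun t => ?_, ?_,
      hd.deriv⟩
    · exact (hQ.comp (hct t)).comp hP
    · change Q * c 0 * P = 1
      rw [hc0, mul_one, hQP]
  obtain ⟨h1, h2, -, h3, h4⟩ := hhol hmem
  set A := deriv c 0
  have hA : ∀ v, A (P v) = P ((Q * A * P : EndV E) v) := fun v => (hPQ' _).symm
  have h1' : ∀ v w, innerE g q ((Q * A * P : EndV E) v) w =
    -innerE g q v ((Q * A * P : EndV E) w) := h1
  have h2' : ∀ v, (Q * A * P : EndV E) (endE J q v) = endE J q ((Q * A * P : EndV E) v) := h2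
  have h3' : LinearMap.trace ℝ E (endE J q * (Q * A * P)).toLinearMap = 0 := h3
  refine ⟨fun v w => ?_, fun v => ?_, ?_, ?_⟩
  · rw [← hPQ' v, ← hPQ' w, hA, hA, hP.isometry hJ, hP.isometry hJ, h1']
  · rw [← hPQ' v, ← hP.complex hJ, hA, hA, ← hP.complex hJ, h2']
  · have h5 : endE J q * (Q * A * P) = Q * (endE J p * A) * P := by
      ext v
      have := hQ.complex hJ (A (P v))
      simp only [mul_apply_eq_comp]
      rw [this]
    rw [h5] at h3'
    have h6 : (Q * (endE J p * A) * P).toLinearMap = (Q * (endE J p * A)).toLinearMap *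
      P.toLinearMap := rfl
    have h7 : P.toLinearMap * (Q * (endE J p * A)).toLinearMap = (endE J p * A).toLinearMap := by
      ext v
      exact hPQ' _
    rw [h6, LinearMap.trace_mul_comm, h7] at h3'
    exact h3'
  · rintro _ ⟨v, hv, rfl⟩
    exact ⟨_, h4 v hv, (hA v).symm⟩

/-- A gauge of the canonical connection around `p` with values in `s(u(L) ⊕ u(L^⊥))`: the columns of
`a y` are a frame over the chart around `p` with connection form `w`. -/
structure IsAdaptedGauge (g : RiemMetric E M) (J : EndField E M) (p : M) (L : Submodule ℝ E) (r : ℝ)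
    (a b : E → EndV E) (w : E → E →L[ℝ] EndV E) : Prop where
  ball_subset : Metric.ball (extChartAt 𝓘(ℝ, E) p p) r ⊆ (extChartAt 𝓘(ℝ, E) p).target
  smooth_a : ContDiffOn ℝ ∞ a (Metric.ball (extChartAt 𝓘(ℝ, E) p p) r)
  smooth_b : ContDiffOn ℝ ∞ b (Metric.ball (extChartAt 𝓘(ℝ, E) p p) r)
  smooth_w : ContDiffOn ℝ ∞ w (Metric.ball (extChartAt 𝓘(ℝ, E) p p) r)
  a_self : a (extChartAt 𝓘(ℝ, E) p p) = 1
  a_mul_b : ∀ y ∈ Metric.ball (extChartAt 𝓘(ℝ, E) p p) r, a y * b y = 1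
  b_mul_a : ∀ y ∈ Metric.ball (extChartAt 𝓘(ℝ, E) p p) r, b y * a y = 1
  metric : ∀ y ∈ Metric.ball (extChartAt 𝓘(ℝ, E) p p) r, ∀ u v,
    chartMetric g p y (a y u) (a y v) = innerE g p u v
  complex : ∀ y ∈ Metric.ball (extChartAt 𝓘(ℝ, E) p p) r, ∀ u,
    chartEnd J p y (a y u) = a y (endE J p u)
  deriv_a : ∀ y ∈ Metric.ball (extChartAt 𝓘(ℝ, E) p p) r, ∀ v,
    fderiv ℝ a y v + connL g J p y v * a y = a y * w y v
  split : ∀ y ∈ Metric.ball (extChartAt 𝓘(ℝ, E) p p) r, ∀ v,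
    IsSplit (innerE g p) (endE J p) L (w y v)

/-- The gauge `a` is the radial transport from `p` in the chart. Its connection form at `y` is
obtained as the velocity of a family of loops through `y`, so it takes values in the holonomy
algebra without any recourse to curvature. -/
theorem exists_adaptedGauge (hJ : IsAlmostHermitian g J) {q p : M} {P : EndV E}
    (hP : IsTransportE g J q p P) {L : Submodule ℝ E}
    (hhol : holonomyAlgebra g J q ⊆ specialUnitarySplit g J q L) :
    ∃ r > 0, ∃ a b w, IsAdaptedGauge g J p (L.map P.toLinearMap) r a b w := by
  obtain ⟨r, hr, hball, A, hA, hAt, hAd⟩ := exists_chart_transport hJ p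
  set y₀ := extChartAt 𝓘(ℝ, E) p p with hy₀
  have h0 : y₀ ∈ Metric.ball y₀ r := Metric.mem_ball_self hr
  have hopen : IsOpen (Metric.ball y₀ r) := Metric.isOpen_ball
  set a : E → EndV E := fun y => A (y₀, y) with ha
  have hasm : ContDiffOn ℝ ∞ a (Metric.ball y₀ r) :=
    hA.comp (contDiff_const.prodMk contDiff_id).contDiffOn fun y hy => ⟨h0, hy⟩
  have hat : ∀ y ∈ Metric.ball y₀ r, IsTransportE g J p ((extChartAt 𝓘(ℝ, E) p).symm y)
      (dCI p y * a y) := by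
    intro y hy
    have h := hAt y₀ h0 y hy
    rw [hy₀, extChartAt_to_inv] at h
    have h1 : dC p p = (1 : EndV E) := by ext v; exact dC_self p v
    rwa [h1, mul_one] at h
  have hunit : ∀ y ∈ Metric.ball y₀ r, IsUnit (a y) := by
    intro y hy
    obtain ⟨Q, -, hQ1, hQ2⟩ := (hat y hy).exists_inverse hJ
    refine ⟨⟨a y, Q * dCI p y, ?_, ?_⟩, rfl⟩
    · have h1 : (Q * dCI p y) * a y = 1 := by rw [mul_assoc, hQ1]
      have h2 : (Q * dCI p y).toLinearMap * (a y).toLinearMap = 1 :=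
        congrArg ContinuousLinearMap.toLinearMap h1
      have h3 : (a y).toLinearMap * (Q * dCI p y).toLinearMap = 1 := mul_eq_one_comm.1 h2
      ext v
      exact congrArg (fun L : E →ₗ[ℝ] E => L v) h3
    · rw [mul_assoc, hQ1]
  set b : E → EndV E := fun y => Ring.inverse (a y) with hb
  have hba : ∀ y ∈ Metric.ball y₀ r, b y * a y = 1 := fun y hy =>
    Ring.inverse_mul_cancel _ (hunit y hy)
  have hab : ∀ y ∈ Metric.ball y₀ r, a y * b y = 1 := fun y hy =>
    Ring.mul_inverse_cancel _ (hunit y hy)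
  have hbsm : ContDiffOn ℝ ∞ b (Metric.ball y₀ r) := by
    intro y hy
    obtain ⟨x, hx⟩ := hunit y hy
    have := contDiffAt_ringInverse ℝ (n := ∞) x
    rw [hx] at this
    exact this.comp_contDiffWithinAt y (hasm y hy)
  set w : E → E →L[ℝ] EndV E := fun y =>
    (ContinuousLinearMap.mul ℝ (EndV E) (b y)).comp (fderiv ℝ a y +
      ((ContinuousLinearMap.mul ℝ (EndV E)).flip (a y)).comp (connL g J p y)) with hw
  have hwa : ∀ y v, w y v = b y * (fderiv ℝ a y v + connL g J p y v * a y) := fun y v => rfl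
  have hΓ : ContDiffOn ℝ ∞ (connL g J p) (Metric.ball y₀ r) :=
    ((hJ.isHermitianOn p).contDiffOn_canonicalL (isOpen_extChartAt_target p)).mono hball
  have hda : ∀ y ∈ Metric.ball y₀ r, ∀ v,
      fderiv ℝ a y v + connL g J p y v * a y = a y * w y v := by
    intro y hy v
    rw [hwa, ← mul_assoc, hab y hy, one_mul]
  refine ⟨r, hr, a, b, w, hball, hasm, hbsm, ?_, (hAd y₀ h0).1, hab, hba, ?_, ?_, hda, ?_⟩
  · refine ((ContinuousLinearMap.mul ℝ (EndV E)).contDiff.comp_contDiffOn hbsm).clm_comp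
      ((hasm.fderiv_of_isOpen hopen (by simp)).add
        (((ContinuousLinearMap.mul ℝ (EndV E)).flip.contDiff.comp_contDiffOn hasm).clm_comp hΓ))
  · intro y hy u v
    rw [chartMetric_apply]
    exact (hat y hy).isometry hJ u v
  · intro y hy u
    rw [chartEnd_apply]
    have h := (hat y hy).complex hJ u
    simp only [mul_apply_eq_comp] at h
    rw [← h, dC_dCI (hball hy)]
  · intro y hy v
    obtain ⟨ε, hε, hεb⟩ : ∃ ε : ℝ, 0 < ε ∧ ∀ s : ℝ, |s| ≤ 1 → y + s • ε • v ∈ Metric.ball y₀ r := by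
      obtain ⟨δ, hδ, hδb⟩ := Metric.isOpen_iff.1 hopen y hy
      refine ⟨δ / (‖v‖ + 1), by positivity, fun s hs => hδb ?_⟩
      rw [Metric.mem_ball, dist_eq_norm, add_sub_cancel_left, norm_smul, norm_smul, Real.norm_eq_abs,
        Real.norm_eq_abs, abs_of_pos (by positivity : 0 < δ / (‖v‖ + 1))]
      calc |s| * (δ / (‖v‖ + 1) * ‖v‖) ≤ 1 * (δ / (‖v‖ + 1) * ‖v‖) := by gcongr
        _ = δ * (‖v‖ / (‖v‖ + 1)) := by ring
        _ < δ * 1 := by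
          gcongr
          rw [div_lt_one (by positivity)]
          linarith
        _ = δ := mul_one δ
    -- The holonomy algebra is defined by families of loops with a real parameter. The sine keeps
    -- the endpoint in the ball for every `t` and has derivative `1` at `0`.
    set z : ℝ → E := fun t => y + Real.sin t • ε • v with hz
    have hzb : ∀ t, z t ∈ Metric.ball y₀ r := fun t => hεb _ (Real.abs_sin_le_one t)
    have hz0 : z 0 = y := by simp [hz]
    have hzc : ContDiff ℝ ∞ z := contDiff_const.add (Real.contDiff_sin.smul contDiff_const)
    have hzd : HasDerivAt z (ε • v) 0 := by
      have := ((Real.hasDerivAt_sin 0).smul_const (ε • v)).const_add y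
      rw [Real.cos_zero, one_smul] at this
      exact this
    -- The transport around the loop that goes from `p` to `y`, along the segment from `y` to `z t`,
    -- and back to `p`, written in the chart.
    set c : ℝ → EndV E := fun t => b (z t) * A (y, z t) * a y with hc
    have hcs : ContDiff ℝ ∞ c :=
      ((hbsm.comp_contDiff hzc hzb).mul (hA.comp_contDiff (contDiff_const.prodMk hzc)
        fun t => ⟨hy, hzb t⟩)).mul contDiff_const
    have hct : ∀ t, IsTransportE g J p p (c t) := by
      intro t
      obtain ⟨Q, hQt, hQ1, -⟩ := (hat _ (hzb t)).exists_inverse hJ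
      have h1 := (hQt.comp (hAt y hy (z t) (hzb t))).comp (hat y hy)
      have h2 : Q * dCI p (z t) = b (z t) := by
        calc Q * dCI p (z t) = Q * dCI p (z t) * (a (z t) * b (z t)) := by
              rw [hab _ (hzb t), mul_one]
          _ = (Q * (dCI p (z t) * a (z t))) * b (z t) := by simp only [mul_assoc]
          _ = b (z t) := by rw [hQ1, one_mul]
      have h3 : dC p ((extChartAt 𝓘(ℝ, E) p).symm y) * dCI p y = 1 := by
        ext u; exact dC_dCI (hball hy) u
      have h4 : Q * (dCI p (z t) * A (y, z t) * dC p ((extChartAt 𝓘(ℝ, E) p).symm y)) *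
          (dCI p y * a y) = c t := by
        calc _ = (Q * dCI p (z t)) * A (y, z t) *
              (dC p ((extChartAt 𝓘(ℝ, E) p).symm y) * dCI p y) * a y := by simp only [mul_assoc]
          _ = c t := by rw [h2, h3, mul_one]
      rwa [h4] at h1
    have hc0 : c 0 = 1 := by
      simp only [hc, hz0, (hAd y hy).1, mul_one, hba y hy]
    have hcd := ((hcs.differentiable (by simp)) 0).hasDerivAt
    have h1 := isSplit_of_transport hJ hP hhol (hcs.of_le (by simp)) hct hc0
    have had : HasDerivAt (fun t => a (z t)) (fderiv ℝ a y (ε • v)) 0 := by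
      have h5 : HasFDerivAt a (fderiv ℝ a y) (z 0) := by
        rw [hz0]
        exact ((hasm.contDiffAt (hopen.mem_nhds hy)).differentiableAt (by simp)).hasFDerivAt
      exact h5.comp_hasDerivAt 0 hzd
    have hAdd : HasDerivAt (fun t => A (y, z t)) (-connL g J p y (ε • v)) 0 := by
      rw [← (hAd y hy).2]
      have h5 : HasFDerivAt (fun x => A (y, x)) (fderiv ℝ (fun x => A (y, x)) y) (z 0) := by
        rw [hz0]
        have h6 : ContDiffAt ℝ ∞ (fun x => A (y, x)) y :=
          (hA.contDiffAt ((hopen.prod hopen).mem_nhds ⟨hy, hy⟩)).comp y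
            (contDiff_const.prodMk contDiff_id).contDiffAt
        exact (h6.differentiableAt (by simp)).hasFDerivAt
      exact h5.comp_hasDerivAt 0 hzd
    -- Both sides are differentiated at `0`. The derivative of `a` in the direction `ε • v` and the
    -- connection term combine to give `c'(0) = -w y (ε • v)`.
    have h2 : (fun t => a (z t) * c t) = fun t => A (y, z t) * a y := by
      funext t
      simp only [hc]
      rw [← mul_assoc, ← mul_assoc, hab _ (hzb t), one_mul]
    have h3 := had.mul hcd
    have h4 := hAdd.mul_const (a y)
    change HasDerivAt (fun t => a (z t) * c t) _ 0 at h3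
    rw [h2] at h3
    have h5 := h3.unique h4
    rw [hz0, hc0, mul_one] at h5
    have h6 : deriv c 0 = -w y (ε • v) := by
      calc deriv c 0 = b y * (a y * deriv c 0) := by rw [← mul_assoc, hba y hy, one_mul]
        _ = b y * -(fderiv ℝ a y (ε • v) + connL g J p y (ε • v) * a y) := by
          congr 1
          linear_combination (norm := noncomm_ring) h5
        _ = -w y (ε • v) := by rw [hwa, mul_neg]
    have h7 := h1.smul (-ε⁻¹)
    rw [h6] at h7
    have h8 : -ε⁻¹ • -w y (ε • v) = w y v := by
      rw [map_smul, smul_neg, neg_smul, neg_neg, smul_smul, inv_mul_cancel₀ hε.ne', one_smul]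
    rwa [h8] at h7

end Gauge

/-! ### Hermitian linear algebra -/

section Hermitian

variable {E : Type*} [NormedAddCommGroup E] [NormedSpace ℝ E] [FiniteDimensional ℝ E]

/-- An orthonormal family of maximal length is a basis, and the inner products are coordinates. -/
theorem exists_basis_of_orthonormal {n : ℕ} [NeZero n] (B : Bil E) {f : Fin n → E}
    (hf : ∀ i j, B (f i) (f j) = if i = j then 1 else 0) (hn : n = Module.finrank ℝ E) :
    ∃ b : Module.Basis (Fin n) ℝ E, (∀ i, b i = f i) ∧ ∀ u i, b.repr u i = B u (f i) := by
  have hli : LinearIndependent ℝ f := by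
    rw [Fintype.linearIndependent_iff]
    intro c hc i
    have h1 := congrArg (fun u => B u (f i)) hc
    simpa [hf] using h1
  let b := basisOfLinearIndependentOfCardEqFinrank hli (by simpa using hn)
  have hb : ∀ i, b i = f i := fun i => by simp [b]
  refine ⟨b, hb, fun u i => ?_⟩
  conv_rhs => rw [← b.sum_repr u]
  simp [hb, hf]

theorem trace_eq_sum_inner {n : ℕ} [NeZero n] (B : Bil E) {f : Fin n → E}
    (hf : ∀ i j, B (f i) (f j) = if i = j then 1 else 0) (hn : n = Module.finrank ℝ E)
    (A : E →ₗ[ℝ] E) : LinearMap.trace ℝ E A = ∑ i, B (A (f i)) (f i) := by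
  obtain ⟨b, hb, hbr⟩ := exists_basis_of_orthonormal B hf hn
  rw [LinearMap.trace_eq_matrix_trace ℝ b, Matrix.trace]
  refine Finset.sum_congr rfl fun i _ => ?_
  rw [Matrix.diag_apply, LinearMap.toMatrix_apply, hbr, hb]

theorem exists_unit_of_ne_zero {B : Bil E} (hpos : ∀ u, u ≠ 0 → 0 < B u u) {u : E} (hu : u ≠ 0) :
    ∃ t : ℝ, B (t • u) (t • u) = 1 := by
  have h := hpos u hu
  refine ⟨(Real.sqrt (B u u))⁻¹, ?_⟩
  simp only [map_smul, smul_apply, smul_eq_mul]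
  rw [← mul_assoc, ← mul_inv, Real.mul_self_sqrt h.le, inv_mul_cancel₀ h.ne']

theorem exists_unit_orthogonal {B : Bil E} (hpos : ∀ u, u ≠ 0 → 0 < B u u) {n : ℕ} (f : Fin n → E)
    (hn : n < Module.finrank ℝ E) : ∃ e, B e e = 1 ∧ ∀ i, B e (f i) = 0 := by
  let φ : E →ₗ[ℝ] (Fin n → ℝ) := LinearMap.pi fun i => (B.flip (f i)).toLinearMap
  have hφ : φ.ker ≠ ⊥ := LinearMap.ker_ne_bot_of_finrank_lt (by simpa using hn)
  obtain ⟨u, hu, hne⟩ := Submodule.exists_mem_ne_zero_of_ne_bot hφ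
  obtain ⟨t, ht⟩ := exists_unit_of_ne_zero hpos hne
  refine ⟨t • u, ht, fun i => ?_⟩
  have h1 : B u (f i) = 0 := congrFun hu i
  simp [h1]

/-- A unitary coframe `β` of `(E, B, I)`, dual to `e`, adapted to the complex line `L`. -/
structure IsUnitaryCoframe (B : Bil E) (I : EndV E) (L : Submodule ℝ E) (e₁ e₂ e₃ : E)
    (β₁ β₂ β₃ : E →L[ℝ] ℂ) : Prop where
  bijective : Function.Bijective fun u => (β₁ u, β₂ u, β₃ u)
  complex₁ : ∀ u, β₁ (I u) = Complex.I * β₁ u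
  complex₂ : ∀ u, β₂ (I u) = Complex.I * β₂ u
  complex₃ : ∀ u, β₃ (I u) = Complex.I * β₃ u
  apply₁ : β₁ e₁ = 1 ∧ β₂ e₁ = 0 ∧ β₃ e₁ = 0
  apply₂ : β₁ e₂ = 0 ∧ β₂ e₂ = 1 ∧ β₃ e₂ = 0
  apply₃ : β₁ e₃ = 0 ∧ β₂ e₃ = 0 ∧ β₃ e₃ = 1
  def₁ : ∀ u, β₁ u = B u e₁ + B u (I e₁) * Complex.I
  def₂ : ∀ u, β₂ u = B u e₂ + B u (I e₂) * Complex.I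
  def₃ : ∀ u, β₃ u = B u e₃ + B u (I e₃) * Complex.I
  mem_iff : ∀ u, u ∈ L ↔ β₁ u = 0 ∧ β₂ u = 0

/-- The unitary basis is built from `L` outwards: first a unit `e₃` in `L`, then `e₂` and `e₁`
orthogonal to the complex lines already chosen. With this order `L` is the common kernel of `β₁` and
`β₂`, and `β₃` measures the fibre direction. -/
theorem exists_unitaryCoframe (hE : Module.finrank ℝ E = 6) {B : Bil E} {I : EndV E}
    {L : Submodule ℝ E} (hsymm : ∀ u v, B u v = B v u) (hpos : ∀ u, u ≠ 0 → 0 < B u u)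
    (hI : ∀ u, I (I u) = -u) (hBI : ∀ u v, B (I u) (I v) = B u v)
    (hL : Module.finrank ℝ L = 2) (hLI : ∀ u ∈ L, I u ∈ L) :
    ∃ e₁ e₂ e₃ β₁ β₂ β₃, IsUnitaryCoframe B I L e₁ e₂ e₃ β₁ β₂ β₃ := by
  have hsk : ∀ u v, B (I u) v = -B u (I v) := fun u v => by
    have := hBI u (I v)
    rw [hI, map_neg] at this
    linarith
  have hself : ∀ u, B u (I u) = 0 := fun u => by
    have := hsk u u
    rw [hsymm] at this
    linarith
  obtain ⟨e₃, he₃L, he₃⟩ : ∃ e ∈ L, B e e = 1 := by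
    have hne : L ≠ ⊥ := by
      rintro rfl
      simp at hL
    obtain ⟨u, hu, hne⟩ := Submodule.exists_mem_ne_zero_of_ne_bot hne
    obtain ⟨t, ht⟩ := exists_unit_of_ne_zero hpos hne
    exact ⟨t • u, L.smul_mem t hu, ht⟩
  obtain ⟨e₂, he₂, h₂⟩ := exists_unit_orthogonal hpos ![e₃, I e₃] (by omega)
  obtain ⟨e₁, he₁, h₁⟩ := exists_unit_orthogonal hpos ![e₃, I e₃, e₂, I e₂] (by omega)
  have h23 : B e₂ e₃ = 0 := h₂ 0
  have h23' : B e₂ (I e₃) = 0 := h₂ 1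
  have h13 : B e₁ e₃ = 0 := h₁ 0
  have h13' : B e₁ (I e₃) = 0 := h₁ 1
  have h12 : B e₁ e₂ = 0 := h₁ 2
  have h12' : B e₁ (I e₂) = 0 := h₁ 3
  let β : E → E →L[ℝ] ℂ := fun e =>
    Complex.ofRealCLM.comp (B.flip e) + Complex.I • Complex.ofRealCLM.comp (B.flip (I e))
  have hβ : ∀ e u, β e u = B u e + B u (I e) * Complex.I := fun e u => by
    simp [β, mul_comm]
  have hβI : ∀ e u, β e (I u) = Complex.I * β e u := fun e u => by
    rw [hβ, hβ, hBI, hsk]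
    push_cast
    linear_combination (-(B u (I e) : ℂ)) * Complex.I_mul_I
  have ap : ∀ e e', B e' e = 0 → B e' (I e) = 0 → β e e' = 0 := fun e e' h h' => by
    rw [hβ, h, h']; simp
  have ap1 : ∀ e, B e e = 1 → β e e = 1 := fun e h => by
    rw [hβ, h, hself]; simp
  have sy : ∀ e e', B e e' = 0 → B e (I e') = 0 → B e' e = 0 ∧ B e' (I e) = 0 :=
    fun e e' h h' => ⟨by rw [hsymm, h], by rw [hsymm, hsk, h', neg_zero]⟩
  have a31 := ap e₃ e₁ h13 h13'
  have a32 := ap e₃ e₂ h23 h23'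
  have a21 := ap e₂ e₁ h12 h12'
  have a13 := ap e₁ e₃ (sy _ _ h13 h13').1 (sy _ _ h13 h13').2
  have a23 := ap e₂ e₃ (sy _ _ h23 h23').1 (sy _ _ h23 h23').2
  have a12 := ap e₁ e₂ (sy _ _ h12 h12').1 (sy _ _ h12 h12').2
  have a11 := ap1 e₁ he₁
  have a22 := ap1 e₂ he₂
  have a33 := ap1 e₃ he₃
  let φ : E →ₗ[ℝ] ℂ × ℂ × ℂ := ((β e₁).prod ((β e₂).prod (β e₃))).toLinearMap
  have hre : ∀ (e e' : E) (z : ℂ), β e (z.re • e' + z.im • I e') = z * β e e' := fun e e' z => by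
    rw [map_add, map_smul, map_smul, hβI]
    simp only [Complex.real_smul]
    conv_rhs => rw [← Complex.re_add_im z]
    ring
  have hadd : ∀ e x y z, β e (x + y + z) = β e x + β e y + β e z := fun e x y z => by
    rw [map_add, map_add]
  have hsurj : ∀ z₁ z₂ z₃ : ℂ, φ ((z₁.re • e₁ + z₁.im • I e₁) + (z₂.re • e₂ + z₂.im • I e₂) +
      (z₃.re • e₃ + z₃.im • I e₃)) = (z₁, z₂, z₃) := fun z₁ z₂ z₃ => by
    change (β e₁ _, β e₂ _, β e₃ _) = _
    rw [hadd, hadd, hadd]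
    simp only [hre, a11, a12, a13, a21, a22, a23, a31, a32, a33]
    simp
  have hφs : Function.Surjective φ := fun z => ⟨_, hsurj z.1 z.2.1 z.2.2⟩
  have hφi : Function.Injective φ := by
    refine (LinearMap.injective_iff_surjective_of_finrank_eq_finrank ?_).2 hφs
    rw [hE]; simp [Complex.finrank_real_complex]
  refine ⟨e₁, e₂, e₃, β e₁, β e₂, β e₃, ⟨hφi, hφs⟩, hβI _, hβI _, hβI _, ⟨a11, a21, a31⟩,
    ⟨a12, a22, a32⟩, ⟨a13, a23, a33⟩, hβ _, hβ _, hβ _, ?_⟩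
  let ψ : E →ₗ[ℝ] ℂ × ℂ := ((β e₁).prod (β e₂)).toLinearMap
  have hψs : Function.Surjective ψ := fun z => by
    obtain ⟨u, hu⟩ := hφs (z.1, z.2, 0)
    refine ⟨u, ?_⟩
    have hu' : (β e₁ u, β e₂ u, β e₃ u) = (z.1, z.2, 0) := hu
    simp only [Prod.mk.injEq] at hu'
    exact Prod.ext hu'.1 hu'.2.1
  have hker : ψ.ker = L := by
    refine Submodule.eq_of_le_of_finrank_eq ?_ ?_
    · intro u hu
      have hu' : (β e₁ u, β e₂ u) = (0, 0) := hu
      simp only [Prod.mk.injEq] at hu'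
      have h : u = (β e₃ u).re • e₃ + (β e₃ u).im • I e₃ := by
        refine hφi ?_
        have h := hsurj 0 0 (β e₃ u)
        simp only [Complex.zero_re, Complex.zero_im, zero_smul, add_zero, zero_add] at h
        rw [h]
        exact Prod.ext hu'.1 (Prod.ext hu'.2 rfl)
      rw [h]
      exact L.add_mem (L.smul_mem _ he₃L) (L.smul_mem _ (hLI _ he₃L))
    · have h1 := ψ.finrank_range_add_finrank_ker
      rw [LinearMap.range_eq_top.2 hψs, finrank_top, hE] at h1
      simp [Complex.finrank_real_complex] at h1
      omega
  intro u
  rw [← hker, LinearMap.mem_ker]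
  change (β e₁ u, β e₂ u) = (0, 0) ↔ _
  simp

/-! ### Holonomy algebra and torsion in a unitary coframe. -/

namespace IsUnitaryCoframe

variable {B : Bil E} {I : EndV E} {L : Submodule ℝ E} {e₁ e₂ e₃ : E} {β₁ β₂ β₃ : E →L[ℝ] ℂ}

theorem decomp (h : IsUnitaryCoframe B I L e₁ e₂ e₃ β₁ β₂ β₃) (u : E) :
    u = ((β₁ u).re • e₁ + (β₁ u).im • I e₁) + ((β₂ u).re • e₂ + (β₂ u).im • I e₂) +
      ((β₃ u).re • e₃ + (β₃ u).im • I e₃) := by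
  apply h.bijective.1
  obtain ⟨a11, a21, a31⟩ := h.apply₁
  obtain ⟨a12, a22, a32⟩ := h.apply₂
  obtain ⟨a13, a23, a33⟩ := h.apply₃
  simp only [map_add, map_smul, h.complex₁, h.complex₂, h.complex₃, a11, a12, a13, a21, a22, a23,
    a31, a32, a33, mul_one, mul_zero, smul_zero, add_zero, zero_add, Complex.real_smul,
    Complex.re_add_im]

theorem metric_eq (h : IsUnitaryCoframe B I L e₁ e₂ e₃ β₁ β₂ β₃) (u v : E) :
    B u v = ((β₁ u) * starRingEnd ℂ (β₁ v) + (β₂ u) * starRingEnd ℂ (β₂ v) +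
      (β₃ u) * starRingEnd ℂ (β₃ v)).re := by
  conv_lhs => rw [h.decomp v]
  simp only [map_add, map_smul, smul_eq_mul, Complex.add_re, Complex.mul_re, Complex.conj_re,
    Complex.conj_im]
  have r1 : (β₁ u).re = B u e₁ := by rw [h.def₁]; simp
  have r2 : (β₂ u).re = B u e₂ := by rw [h.def₂]; simp
  have r3 : (β₃ u).re = B u e₃ := by rw [h.def₃]; simp
  have i1 : (β₁ u).im = B u (I e₁) := by rw [h.def₁]; simp
  have i2 : (β₂ u).im = B u (I e₂) := by rw [h.def₂]; simp
  have i3 : (β₃ u).im = B u (I e₃) := by rw [h.def₃]; simp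
  rw [r1, r2, r3, i1, i2, i3]
  ring

/-- An antilinear or linear functional is determined by its values on `e`. -/
theorem apply_eq_of_linear (h : IsUnitaryCoframe B I L e₁ e₂ e₃ β₁ β₂ β₃) {φ : E →L[ℝ] ℂ}
    (hφ : ∀ u, φ (I u) = Complex.I * φ u) (u : E) :
    φ u = φ e₁ * β₁ u + φ e₂ * β₂ u + φ e₃ * β₃ u := by
  conv_lhs => rw [h.decomp u]
  simp only [map_add, map_smul, hφ, Complex.real_smul]
  conv_rhs => rw [← Complex.re_add_im (β₁ u), ← Complex.re_add_im (β₂ u),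
    ← Complex.re_add_im (β₃ u)]
  ring

theorem apply_eq_of_antilinear (h : IsUnitaryCoframe B I L e₁ e₂ e₃ β₁ β₂ β₃) {φ : E →L[ℝ] ℂ}
    (hφ : ∀ u, φ (I u) = -(Complex.I * φ u)) (u : E) :
    φ u = φ e₁ * starRingEnd ℂ (β₁ u) + φ e₂ * starRingEnd ℂ (β₂ u) +
      φ e₃ * starRingEnd ℂ (β₃ u) := by
  conv_lhs => rw [h.decomp u]
  simp only [map_add, map_smul, hφ, Complex.real_smul]
  have hconj : ∀ z : ℂ, starRingEnd ℂ z = z.re - z.im * Complex.I := fun z =>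
    Complex.ext (by simp) (by simp)
  rw [hconj, hconj, hconj]
  ring

/-- The matrix of an element of `s(u(L) ⊕ u(L^⊥))`. -/
theorem split_apply (h : IsUnitaryCoframe B I L e₁ e₂ e₃ β₁ β₂ β₃)
    (hE : Module.finrank ℝ E = 6) (hsymm : ∀ u v, B u v = B v u)
    (hI : ∀ u, I (I u) = -u) (hBI : ∀ u v, B (I u) (I v) = B u v) {A : EndV E}
    (hA : IsSplit B I L A) :
    (starRingEnd ℂ (β₁ (A e₁)) = -β₁ (A e₁) ∧ starRingEnd ℂ (β₂ (A e₂)) = -β₂ (A e₂)) ∧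
    ∀ u, β₁ (A u) = β₁ (A e₁) * β₁ u + β₁ (A e₂) * β₂ u ∧
      β₂ (A u) = -starRingEnd ℂ (β₁ (A e₂)) * β₁ u + β₂ (A e₂) * β₂ u ∧
      β₃ (A u) = -(β₁ (A e₁) + β₂ (A e₂)) * β₃ u := by
  have hsk : ∀ u v, B (I u) v = -B u (I v) := fun u v => by
    have := hBI u (I v)
    rw [hI, map_neg] at this
    linarith
  have key : ∀ e e' : E, B (A e') e + B (A e') (I e) * Complex.I =
      -starRingEnd ℂ (B (A e) e' + B (A e) (I e') * Complex.I) := fun e e' => by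
    have h1 : B (A e') e = -B (A e) e' := by rw [hA.skew, hsymm]
    have h2 : B (A e') (I e) = B (A e) (I e') := by
      rw [hA.skew, hA.comm, ← hsymm, hsk]; ring
    rw [h1, h2]
    simp
    ring
  have k11 : β₁ (A e₁) = -starRingEnd ℂ (β₁ (A e₁)) := by rw [h.def₁]; exact key _ _
  have k22 : β₂ (A e₂) = -starRingEnd ℂ (β₂ (A e₂)) := by rw [h.def₂]; exact key _ _
  have k33 : β₃ (A e₃) = -starRingEnd ℂ (β₃ (A e₃)) := by rw [h.def₃]; exact key _ _
  have k21 : β₂ (A e₁) = -starRingEnd ℂ (β₁ (A e₂)) := by rw [h.def₁, h.def₂]; exact key _ _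
  have k31 : β₃ (A e₁) = -starRingEnd ℂ (β₁ (A e₃)) := by rw [h.def₁, h.def₃]; exact key _ _
  have k32 : β₃ (A e₂) = -starRingEnd ℂ (β₂ (A e₃)) := by rw [h.def₂, h.def₃]; exact key _ _
  have he₃ : e₃ ∈ L := (h.mem_iff _).2 ⟨h.apply₃.1, h.apply₃.2.1⟩
  obtain ⟨k13, k23⟩ := (h.mem_iff _).1 (hA.mapsTo _ he₃)
  rw [k13, map_zero, neg_zero] at k31
  rw [k23, map_zero, neg_zero] at k32
  -- In the real orthonormal basis `eᵢ, I eᵢ` the trace of `I A` is `-2` times the sum of the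
  -- imaginary parts of the diagonal entries. Their real parts vanish since the matrix is
  -- skew-Hermitian.
  have htr : (β₁ (A e₁)).im + (β₂ (A e₂)).im + (β₃ (A e₃)).im = 0 := by
    have o11 := h.metric_eq e₁ e₁
    have hON : ∀ i j, B ((![e₁, I e₁, e₂, I e₂, e₃, I e₃] : Fin 6 → E) i)
        ((![e₁, I e₁, e₂, I e₂, e₃, I e₃] : Fin 6 → E) j) = if i = j then 1 else 0 := by
      obtain ⟨a11, a21, a31⟩ := h.apply₁
      obtain ⟨a12, a22, a32⟩ := h.apply₂
      obtain ⟨a13, a23, a33⟩ := h.apply₃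
      intro i j
      rw [h.metric_eq]
      fin_cases i <;> fin_cases j <;>
        simp [h.complex₁, h.complex₂, h.complex₃, a11, a12, a13, a21, a22, a23, a31, a32, a33]
    have h1 := trace_eq_sum_inner B hON hE.symm (I * A).toLinearMap
    rw [hA.trace_eq] at h1
    simp only [Fin.sum_univ_six] at h1
    change 0 = B (I (A e₁)) e₁ + B (I (A (I e₁))) (I e₁) + B (I (A e₂)) e₂ +
      B (I (A (I e₂))) (I e₂) + B (I (A e₃)) e₃ + B (I (A (I e₃))) (I e₃) at h1
    simp only [hBI, hA.comm, hsk] at h1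
    rw [h.def₁, h.def₂, h.def₃]
    simp
    linarith
  have k33' : β₃ (A e₃) = -(β₁ (A e₁) + β₂ (A e₂)) := by
    have r1 := congrArg Complex.re k11
    have r2 := congrArg Complex.re k22
    have r3 := congrArg Complex.re k33
    simp only [Complex.neg_re, Complex.conj_re] at r1 r2 r3
    refine Complex.ext ?_ ?_
    · simp only [Complex.neg_re, Complex.add_re]; linarith
    · simp only [Complex.neg_im, Complex.add_im]; linarith
  refine ⟨⟨(neg_eq_iff_eq_neg.2 k11).symm, (neg_eq_iff_eq_neg.2 k22).symm⟩, fun u => ⟨?_, ?_, ?_⟩⟩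
  · have := h.apply_eq_of_linear (φ := β₁.comp A) (fun u => by simp [hA.comm, h.complex₁]) u
    simpa [k13] using this
  · have := h.apply_eq_of_linear (φ := β₂.comp A) (fun u => by simp [hA.comm, h.complex₂]) u
    simpa [k21, k23] using this
  · have := h.apply_eq_of_linear (φ := β₃.comp A) (fun u => by simp [hA.comm, h.complex₃]) u
    simpa [k31, k32, k33'] using this

/-- A totally skew, antilinear product has, in a unitary coframe, a single component. -/
theorem torsion_apply (h : IsUnitaryCoframe B I L e₁ e₂ e₃ β₁ β₂ β₃)
    (hBI : ∀ u v, B (I u) (I v) = B u v) {T : E →L[ℝ] EndV E}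
    (hI : ∀ u, I (I u) = -u) (hT : ∀ u v, T u v = -T v u) (hTI : ∀ u v, T u (I v) = -I (T u v))
    (hTs : ∀ u v w, B (T u v) w = -B (T u w) v) (u v : E) :
    β₁ (T u v) = β₁ (T e₂ e₃) * (starRingEnd ℂ (β₂ u) * starRingEnd ℂ (β₃ v) -
        starRingEnd ℂ (β₂ v) * starRingEnd ℂ (β₃ u)) ∧
    β₂ (T u v) = β₁ (T e₂ e₃) * (starRingEnd ℂ (β₃ u) * starRingEnd ℂ (β₁ v) -
        starRingEnd ℂ (β₃ v) * starRingEnd ℂ (β₁ u)) ∧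
    β₃ (T u v) = β₁ (T e₂ e₃) * (starRingEnd ℂ (β₁ u) * starRingEnd ℂ (β₂ v) -
        starRingEnd ℂ (β₁ v) * starRingEnd ℂ (β₂ u)) := by
  have hsk : ∀ u v, B (I u) v = -B u (I v) := fun u v => by
    have := hBI u (I v)
    rw [hI, map_neg] at this
    linarith
  have h0 : ∀ u, T u u = 0 := fun u => by
    have := hT u u
    have h2 : (2 : ℝ) • T u u = 0 := by
      rw [two_smul]
      nth_rewrite 1 [this]
      exact neg_add_cancel _
    exact (smul_eq_zero.1 h2).resolve_left two_ne_zero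
  have hTI' : ∀ u v, T (I u) v = -I (T u v) := fun u v => by
    rw [hT, hTI, hT v u, map_neg, neg_neg]
  -- cyclic symmetry of the Hermitian components
  have cyc : ∀ u v e : E, B (T u v) e + B (T u v) (I e) * Complex.I =
      B (T v e) u + B (T v e) (I u) * Complex.I := fun u v e => by
    have h1 : B (T u v) e = B (T v e) u := by
      rw [hT, map_neg, neg_apply, hTs, neg_neg]
    have h2 : B (T u v) (I e) = B (T v e) (I u) := by
      rw [hT, map_neg, neg_apply, hTs, neg_neg, hTI, map_neg, neg_apply, hsk, neg_neg]
    rw [h1, h2]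
  have f23 : β₂ (T e₃ e₁) = β₁ (T e₂ e₃) := by
    rw [h.def₂, h.def₁]; exact (cyc _ _ _).symm
  have f31 : β₃ (T e₁ e₂) = β₁ (T e₂ e₃) := by
    rw [h.def₃, h.def₁]; exact cyc _ _ _
  -- By cyclic symmetry, a component with a repeated vector is a component of `T u u = 0`. So only
  -- the component on the three distinct basis vectors survives.
  have z : ∀ e e' : E, B (T e e') e + B (T e e') (I e) * Complex.I = 0 := fun e e' => by
    have := cyc e e' e
    rw [cyc e e' e, cyc e' e e, h0]
    simp
  have z' : ∀ e e' : E, B (T e e') e' + B (T e e') (I e') * Complex.I = 0 := fun e e' => by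
    rw [cyc, h0]
    simp
  have expand : ∀ β : E →L[ℝ] ℂ, (∀ u, β (I u) = Complex.I * β u) → β (T u v) =
      β (T e₁ e₂) * (starRingEnd ℂ (β₁ u) * starRingEnd ℂ (β₂ v) -
        starRingEnd ℂ (β₁ v) * starRingEnd ℂ (β₂ u)) +
      β (T e₂ e₃) * (starRingEnd ℂ (β₂ u) * starRingEnd ℂ (β₃ v) -
        starRingEnd ℂ (β₂ v) * starRingEnd ℂ (β₃ u)) +
      β (T e₃ e₁) * (starRingEnd ℂ (β₃ u) * starRingEnd ℂ (β₁ v) -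
        starRingEnd ℂ (β₃ v) * starRingEnd ℂ (β₁ u)) := by
    intro β hβ
    have e1 : ∀ u v, β (T u v) = β (T u e₁) * starRingEnd ℂ (β₁ v) +
        β (T u e₂) * starRingEnd ℂ (β₂ v) + β (T u e₃) * starRingEnd ℂ (β₃ v) := fun u v =>
      h.apply_eq_of_antilinear (φ := β.comp (T u)) (fun w => by simp [hTI, hβ]) v
    have e2 : ∀ v, β (T u v) = -β (T v u) := fun v => by rw [hT, map_neg]
    rw [e1 u v, e2 e₁, e2 e₂, e2 e₃, e1 e₁ u, e1 e₂ u, e1 e₃ u, h0, h0, h0, hT e₂ e₁, hT e₃ e₂,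
      hT e₁ e₃]
    simp only [map_neg, map_zero]
    ring
  refine ⟨?_, ?_, ?_⟩
  · rw [expand β₁ h.complex₁, h.def₁ (T e₁ e₂), h.def₁ (T e₃ e₁), z, z']
    ring
  · rw [expand β₂ h.complex₂, f23, h.def₂ (T e₁ e₂), h.def₂ (T e₂ e₃), z, z']
    ring
  · rw [expand β₃ h.complex₃, f31, h.def₃ (T e₂ e₃), h.def₃ (T e₃ e₁), z, z']
    ring

end IsUnitaryCoframe

end Hermitian

/-! ### Moving frames -/

section MovingFrame

variable {E : Type*} [NormedAddCommGroup E] [NormedSpace ℝ E]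

/-- The exterior derivative of a one-form. -/
def extd (α : E → E →L[ℝ] ℂ) (x u v : E) : ℂ := fderiv ℝ α x u v - fderiv ℝ α x v u

/-- A coframe, the entries of a connection form with values in `s(u(2) ⊕ u(1))`, and a torsion
function. -/
structure FrameData (E : Type*) [NormedAddCommGroup E] [NormedSpace ℝ E] where
  (θ₁ θ₂ θ₃ a b c : E → E →L[ℝ] ℂ)
  f : E → ℂ

/-- The structure equations of an adapted unitary frame of a nearly Kähler manifold of dimension six
whose canonical connection reduces to `S(U(2) × U(1))`. -/
structure IsMovingFrame (m : FrameData E) (Ω : Set E) : Prop where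
  smooth_θ₁ : ContDiffOn ℝ ∞ m.θ₁ Ω
  smooth_θ₂ : ContDiffOn ℝ ∞ m.θ₂ Ω
  smooth_θ₃ : ContDiffOn ℝ ∞ m.θ₃ Ω
  smooth_a : ContDiffOn ℝ ∞ m.a Ω
  smooth_b : ContDiffOn ℝ ∞ m.b Ω
  smooth_c : ContDiffOn ℝ ∞ m.c Ω
  smooth_f : ContDiffOn ℝ ∞ m.f Ω
  bijective : ∀ x ∈ Ω, Function.Bijective fun u => (m.θ₁ x u, m.θ₂ x u, m.θ₃ x u)
  conj_a : ∀ x ∈ Ω, ∀ u, cj (m.a x u) = -m.a x u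
  conj_c : ∀ x ∈ Ω, ∀ u, cj (m.c x u) = -m.c x u
  d₁ : ∀ x ∈ Ω, ∀ u v, extd m.θ₁ x u v =
    -(m.a x u * m.θ₁ x v - m.a x v * m.θ₁ x u + (m.b x u * m.θ₂ x v - m.b x v * m.θ₂ x u)) +
      m.f x * (cj (m.θ₂ x u) * cj (m.θ₃ x v) - cj (m.θ₂ x v) * cj (m.θ₃ x u))
  d₂ : ∀ x ∈ Ω, ∀ u v, extd m.θ₂ x u v =
    -(-cj (m.b x u) * m.θ₁ x v + cj (m.b x v) * m.θ₁ x u +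
      (m.c x u * m.θ₂ x v - m.c x v * m.θ₂ x u)) +
      m.f x * (cj (m.θ₃ x u) * cj (m.θ₁ x v) - cj (m.θ₃ x v) * cj (m.θ₁ x u))
  d₃ : ∀ x ∈ Ω, ∀ u v, extd m.θ₃ x u v =
    (m.a x u + m.c x u) * m.θ₃ x v - (m.a x v + m.c x v) * m.θ₃ x u +
      m.f x * (cj (m.θ₁ x u) * cj (m.θ₂ x v) - cj (m.θ₁ x v) * cj (m.θ₂ x u))

/-- Derivatives of forms are computed along lines, where the product rule of one variable suffices
and the derivatives are determined uniquely. -/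
theorem hasDerivAt_line {F : Type*} [NormedAddCommGroup F] [NormedSpace ℝ F] {φ : E → F} {x : E}
    (h : DifferentiableAt ℝ φ x) (u : E) :
    HasDerivAt (fun t : ℝ => φ (x + t • u)) (fderiv ℝ φ x u) 0 := by
  have h1 : HasDerivAt (fun t : ℝ => x + t • u) u 0 := by
    have := ((hasDerivAt_id (0 : ℝ)).smul_const u).const_add x
    rw [one_smul] at this
    exact this
  have h2 : HasFDerivAt φ (fderiv ℝ φ x) (x + (0 : ℝ) • u) := by
    rw [zero_smul, add_zero]; exact h.hasFDerivAt
  exact h2.comp_hasDerivAt 0 h1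

theorem hasDerivAt_line_apply {F G : Type*} [NormedAddCommGroup F] [NormedSpace ℝ F]
    [NormedAddCommGroup G] [NormedSpace ℝ G] {φ : E → F →L[ℝ] G} {x : E}
    (h : DifferentiableAt ℝ φ x) (u : E) (v : F) :
    HasDerivAt (fun t : ℝ => φ (x + t • u) v) (fderiv ℝ φ x u v) 0 := by
  have := (hasDerivAt_line h u).clm_apply (hasDerivAt_const 0 v)
  simpa using this

theorem hasDerivAt_conj {φ : ℝ → ℂ} {φ' : ℂ} {t : ℝ} (h : HasDerivAt φ φ' t) :
    HasDerivAt (fun t => cj (φ t)) (cj φ') t :=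
  (Complex.conjCLE.toContinuousLinearMap.hasFDerivAt).comp_hasDerivAt t h

/-- The wedge product of two one-forms. -/
def wedge {V : Type*} (α β : V → ℂ) (u v : V) : ℂ := α u * β v - α v * β u

/-- The wedge product of a two-form and a one-form. -/
def cyc {V : Type*} (P : V → V → ℂ) (α : V → ℂ) (u v w : V) : ℂ :=
  P u v * α w + P v w * α u + P w u * α v

/-- The complex-linear extension of a one-form to complex tangent vectors. -/
def complexify {V : Type*} (α : V → ℂ) (U : V × V) : ℂ := α U.1 + Complex.I * α U.2

/-- The complex-linear extension of a two-form to complex tangent vectors. -/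
def complexify₂ {V : Type*} (P : V → V → ℂ) (U W : V × V) : ℂ :=
  P U.1 W.1 + Complex.I * P U.1 W.2 + Complex.I * P U.2 W.1 - P U.2 W.2

theorem cyc_complexify {V : Type*} (P : V → V → ℂ) (α : V → ℂ) (U W Z : V × V) :
    cyc (complexify₂ P) (complexify α) U W Z =
      cyc P α U.1 W.1 Z.1 + Complex.I * cyc P α U.2 W.1 Z.1 + Complex.I * cyc P α U.1 W.2 Z.1 +
      Complex.I * cyc P α U.1 W.1 Z.2 - cyc P α U.2 W.2 Z.1 - cyc P α U.2 W.1 Z.2 -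
      cyc P α U.1 W.2 Z.2 - Complex.I * cyc P α U.2 W.2 Z.2 := by
  simp only [cyc, complexify, complexify₂]
  linear_combination (P U.1 W.2 * α Z.2 + P U.2 W.1 * α Z.2 + P W.1 Z.2 * α U.2 +
    P W.2 Z.1 * α U.2 + P Z.1 U.2 * α W.2 + P Z.2 U.1 * α W.2) * Complex.I_mul_I

/-- Identities between real multilinear expressions pass to complex tangent vectors, on which the
forms `θᵢ` and `θ̄ᵢ` can be separated by type. Each of the Bianchi identities fits into five such
terms. -/
theorem cyc_complexify₅ {V : Type*} {P₁ P₂ P₃ P₄ P₅ : V → V → ℂ} {α₁ α₂ α₃ α₄ α₅ : V → ℂ}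
    (h : ∀ u v w, cyc P₁ α₁ u v w + cyc P₂ α₂ u v w + cyc P₃ α₃ u v w + cyc P₄ α₄ u v w +
      cyc P₅ α₅ u v w = 0) (U W Z : V × V) :
    cyc (complexify₂ P₁) (complexify α₁) U W Z + cyc (complexify₂ P₂) (complexify α₂) U W Z +
    cyc (complexify₂ P₃) (complexify α₃) U W Z + cyc (complexify₂ P₄) (complexify α₄) U W Z +
    cyc (complexify₂ P₅) (complexify α₅) U W Z = 0 := by
  simp only [cyc_complexify]
  linear_combination h U.1 W.1 Z.1 + Complex.I * h U.2 W.1 Z.1 + Complex.I * h U.1 W.2 Z.1 +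
    Complex.I * h U.1 W.1 Z.2 - h U.2 W.2 Z.1 - h U.2 W.1 Z.2 - h U.1 W.2 Z.2 -
    Complex.I * h U.2 W.2 Z.2

/-- `d² = 0`. -/
theorem cyclic_sum_of_extd {Ω : Set E} (hΩ : IsOpen Ω) {θ : E → E →L[ℝ] ℂ}
    (hθ : ContDiffOn ℝ ∞ θ Ω) {R : E → E → E → ℂ} (hR : ∀ x ∈ Ω, ∀ u v, extd θ x u v = R x u v)
    {x : E} (hx : x ∈ Ω) {R' : E → E → E → ℂ}
    (hR' : ∀ u v w, HasDerivAt (fun t : ℝ => R (x + t • u) v w) (R' u v w) 0) (u v w : E) :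
    R' u v w + R' v w u + R' w u v = 0 := by
  have hθx := hθ.contDiffAt (hΩ.mem_nhds hx)
  have h1 : DifferentiableAt ℝ (fderiv ℝ θ) x :=
    (hθx.fderiv_right (m := ∞) (by simp)).differentiableAt (by simp)
  have hsymm : IsSymmSndFDerivAt ℝ θ x := by
    exact hθx.isSymmSndFDerivAt (by rw [minSmoothness_of_isRCLikeNormedField]; exact two_le_infty)
  have h2 : ∀ u v w, R' u v w = fderiv ℝ (fderiv ℝ θ) x u v w - fderiv ℝ (fderiv ℝ θ) x u w v := by
    intro u v w
    have hl := hasDerivAt_line h1 u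
    have h3 := ((hl.clm_apply (hasDerivAt_const 0 v)).clm_apply (hasDerivAt_const 0 w)).sub
      ((hl.clm_apply (hasDerivAt_const 0 w)).clm_apply (hasDerivAt_const 0 v))
    refine (hR' u v w).unique ?_
    refine (h3.congr_of_eventuallyEq ?_).congr_deriv (by simp)
    have h4 : ∀ᶠ t : ℝ in 𝓝 0, x + t • u ∈ Ω := by
      have hc : ContinuousAt (fun t : ℝ => x + t • u) 0 := by fun_prop
      refine hc.preimage_mem_nhds (hΩ.mem_nhds ?_)
      simpa using hx
    filter_upwards [h4] with t ht
    rw [← hR _ ht]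
    rfl
  rw [h2, h2, h2, hsymm.eq u v, hsymm.eq v w, hsymm.eq w u]
  ring

/-! ### Bianchi identities and constancy of the torsion. -/

namespace IsMovingFrame

variable {m : FrameData E} {Ω : Set E}

theorem differentiableAt_of {F : Type*} [NormedAddCommGroup F] [NormedSpace ℝ F] {φ : E → F}
    (hΩ : IsOpen Ω) (h : ContDiffOn ℝ ∞ φ Ω) {x : E} (hx : x ∈ Ω) : DifferentiableAt ℝ φ x :=
  (h.contDiffAt (hΩ.mem_nhds hx)).differentiableAt (by simp)

/-- This is `d(dθ₁) = 0` after the structure equations have been substituted again for each `dθᵢ`.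
The mixed curvature `R₁₂` need only exist: the vectors on which the identity is later evaluated are
all annihilated by `θ₂`. -/
theorem bianchi₁ (h : IsMovingFrame m Ω) (hΩ : IsOpen Ω) {x : E} (hx : x ∈ Ω) :
    ∃ R₁₂ : E → E → ℂ, ∀ u v w,
      -cyc (fun u v => extd m.a x u v - wedge (m.b x) (fun u => cj (m.b x u)) u v) (m.θ₁ x) u v w
      - cyc R₁₂ (m.θ₂ x) u v w
      + cyc (wedge (fun u => cj (m.θ₂ x u)) fun u => cj (m.θ₃ x u)) (fderiv ℝ m.f x) u v w
      + m.f x * cj (m.f x) * (cyc (wedge (m.θ₃ x) (m.θ₁ x)) (fun u => cj (m.θ₃ x u)) u v w -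
        cyc (wedge (m.θ₁ x) (m.θ₂ x)) (fun u => cj (m.θ₂ x u)) u v w) = 0 := by
  refine ⟨fun u v => extd m.b x u v + (m.a x u * m.b x v - m.a x v * m.b x u) +
    (m.b x u * m.c x v - m.b x v * m.c x u), fun u v w => ?_⟩
  have lθ₁ := hasDerivAt_line_apply (differentiableAt_of hΩ h.smooth_θ₁ hx)
  have lθ₂ := hasDerivAt_line_apply (differentiableAt_of hΩ h.smooth_θ₂ hx)
  have lθ₃ := hasDerivAt_line_apply (differentiableAt_of hΩ h.smooth_θ₃ hx)
  have la := hasDerivAt_line_apply (differentiableAt_of hΩ h.smooth_a hx)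
  have lb := hasDerivAt_line_apply (differentiableAt_of hΩ h.smooth_b hx)
  have lf := hasDerivAt_line (differentiableAt_of hΩ h.smooth_f hx)
  have H := cyclic_sum_of_extd hΩ h.smooth_θ₁ h.d₁ hx (fun u v w =>
    (((((la u v).mul (lθ₁ u w)).sub ((la u w).mul (lθ₁ u v))).add
      (((lb u v).mul (lθ₂ u w)).sub ((lb u w).mul (lθ₂ u v)))).neg).add
    ((lf u).mul (((hasDerivAt_conj (lθ₂ u v)).mul (hasDerivAt_conj (lθ₃ u w))).sub
      ((hasDerivAt_conj (lθ₂ u w)).mul (hasDerivAt_conj (lθ₃ u v)))))) u v w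
  simp only [zero_smul, add_zero] at H
  have c2 : ∀ u v, _ := fun u v => congrArg cj (h.d₂ x hx u v)
  have c3 : ∀ u v, _ := fun u v => congrArg cj (h.d₃ x hx u v)
  simp only [extd, map_add, map_sub, map_mul, map_neg, Complex.conj_conj, h.conj_a x hx,
    h.conj_c x hx] at c2 c3
  have d1 := h.d₁ x hx
  have d2 := h.d₂ x hx
  simp only [extd] at d1 d2
  simp only [cyc, wedge, extd]
  linear_combination H
    - m.a x u * d1 v w - m.a x v * d1 w u - m.a x w * d1 u v
    - m.b x u * d2 v w - m.b x v * d2 w u - m.b x w * d2 u v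
    - m.f x * (cj (m.θ₃ x u) * c2 v w + cj (m.θ₃ x v) * c2 w u + cj (m.θ₃ x w) * c2 u v)
    + m.f x * (cj (m.θ₂ x u) * c3 v w + cj (m.θ₂ x v) * c3 w u + cj (m.θ₂ x w) * c3 u v)

theorem bianchi₂ (h : IsMovingFrame m Ω) (hΩ : IsOpen Ω) {x : E} (hx : x ∈ Ω) :
    ∃ R₂₁ : E → E → ℂ, ∀ u v w,
      -cyc (fun u v => extd m.c x u v - wedge (fun u => cj (m.b x u)) (m.b x) u v) (m.θ₂ x) u v w
      - cyc R₂₁ (m.θ₁ x) u v w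
      + cyc (wedge (fun u => cj (m.θ₃ x u)) fun u => cj (m.θ₁ x u)) (fderiv ℝ m.f x) u v w
      + m.f x * cj (m.f x) * (cyc (wedge (m.θ₁ x) (m.θ₂ x)) (fun u => cj (m.θ₁ x u)) u v w -
        cyc (wedge (m.θ₂ x) (m.θ₃ x)) (fun u => cj (m.θ₃ x u)) u v w) = 0 := by
  refine ⟨fun u v => -cj (extd m.b x u v) - (cj (m.b x u) * m.a x v - cj (m.b x v) * m.a x u) -
    (m.c x u * cj (m.b x v) - m.c x v * cj (m.b x u)), fun u v w => ?_⟩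
  have lθ₁ := hasDerivAt_line_apply (differentiableAt_of hΩ h.smooth_θ₁ hx)
  have lθ₂ := hasDerivAt_line_apply (differentiableAt_of hΩ h.smooth_θ₂ hx)
  have lθ₃ := hasDerivAt_line_apply (differentiableAt_of hΩ h.smooth_θ₃ hx)
  have lc := hasDerivAt_line_apply (differentiableAt_of hΩ h.smooth_c hx)
  have lb := hasDerivAt_line_apply (differentiableAt_of hΩ h.smooth_b hx)
  have lf := hasDerivAt_line (differentiableAt_of hΩ h.smooth_f hx)
  have H := cyclic_sum_of_extd hΩ h.smooth_θ₂ h.d₂ hx (fun u v w =>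
    ((((((hasDerivAt_conj (lb u v)).neg).mul (lθ₁ u w)).add ((hasDerivAt_conj (lb u w)).mul
      (lθ₁ u v))).add
      (((lc u v).mul (lθ₂ u w)).sub ((lc u w).mul (lθ₂ u v)))).neg).add
    ((lf u).mul (((hasDerivAt_conj (lθ₃ u v)).mul (hasDerivAt_conj (lθ₁ u w))).sub
      ((hasDerivAt_conj (lθ₃ u w)).mul (hasDerivAt_conj (lθ₁ u v)))))) u v w
  simp only [zero_smul, add_zero, Pi.neg_apply] at H
  have c1 : ∀ u v, _ := fun u v => congrArg cj (h.d₁ x hx u v)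
  have c3 : ∀ u v, _ := fun u v => congrArg cj (h.d₃ x hx u v)
  simp only [extd, map_add, map_sub, map_mul, map_neg, Complex.conj_conj, h.conj_a x hx,
    h.conj_c x hx] at c1 c3
  have d1 := h.d₁ x hx
  have d2 := h.d₂ x hx
  simp only [extd] at d1 d2
  simp only [cyc, wedge, extd, map_sub]
  linear_combination H
    + cj (m.b x u) * d1 v w + cj (m.b x v) * d1 w u + cj (m.b x w) * d1 u v
    - m.c x u * d2 v w - m.c x v * d2 w u - m.c x w * d2 u v
    - m.f x * (cj (m.θ₁ x u) * c3 v w + cj (m.θ₁ x v) * c3 w u + cj (m.θ₁ x w) * c3 u v)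
    + m.f x * (cj (m.θ₃ x u) * c1 v w + cj (m.θ₃ x v) * c1 w u + cj (m.θ₃ x w) * c1 u v)

/-- Here only `da + dc` occurs as curvature: the block form removes the mixed entries and the
vanishing trace expresses the entry of `θ₃` by `a` and `c`. -/
theorem bianchi₃ (h : IsMovingFrame m Ω) (hΩ : IsOpen Ω) {x : E} (hx : x ∈ Ω) (u v w : E) :
    cyc (fun u v => extd m.a x u v + extd m.c x u v) (m.θ₃ x) u v w
      + cyc (wedge (fun u => cj (m.θ₁ x u)) fun u => cj (m.θ₂ x u)) (fderiv ℝ m.f x) u v w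
      - m.f x * cj (m.f x) * (cyc (wedge (m.θ₁ x) (fun u => cj (m.θ₁ x u))) (m.θ₃ x) u v w +
        cyc (wedge (m.θ₂ x) (fun u => cj (m.θ₂ x u))) (m.θ₃ x) u v w) = 0 := by
  have lθ₁ := hasDerivAt_line_apply (differentiableAt_of hΩ h.smooth_θ₁ hx)
  have lθ₂ := hasDerivAt_line_apply (differentiableAt_of hΩ h.smooth_θ₂ hx)
  have lθ₃ := hasDerivAt_line_apply (differentiableAt_of hΩ h.smooth_θ₃ hx)
  have lc := hasDerivAt_line_apply (differentiableAt_of hΩ h.smooth_c hx)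
  have la := hasDerivAt_line_apply (differentiableAt_of hΩ h.smooth_a hx)
  have lf := hasDerivAt_line (differentiableAt_of hΩ h.smooth_f hx)
  have H := cyclic_sum_of_extd hΩ h.smooth_θ₃ h.d₃ hx (fun u v w =>
    ((((la u v).add (lc u v)).mul (lθ₃ u w)).sub (((la u w).add (lc u w)).mul (lθ₃ u v))).add
    ((lf u).mul (((hasDerivAt_conj (lθ₁ u v)).mul (hasDerivAt_conj (lθ₂ u w))).sub
      ((hasDerivAt_conj (lθ₁ u w)).mul (hasDerivAt_conj (lθ₂ u v)))))) u v w
  simp only [zero_smul, add_zero, Pi.add_apply] at H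
  have c1 : ∀ u v, _ := fun u v => congrArg cj (h.d₁ x hx u v)
  have c2 : ∀ u v, _ := fun u v => congrArg cj (h.d₂ x hx u v)
  simp only [extd, map_add, map_sub, map_mul, map_neg, Complex.conj_conj, h.conj_a x hx,
    h.conj_c x hx] at c1 c2
  have d3 := h.d₃ x hx
  simp only [extd] at d3
  simp only [cyc, wedge, extd]
  linear_combination H
    + (m.a x u + m.c x u) * d3 v w + (m.a x v + m.c x v) * d3 w u + (m.a x w + m.c x w) * d3 u v
    - m.f x * (cj (m.θ₂ x u) * c1 v w + cj (m.θ₂ x v) * c1 w u + cj (m.θ₂ x w) * c1 u v)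
    + m.f x * (cj (m.θ₁ x u) * c2 v w + cj (m.θ₁ x v) * c2 w u + cj (m.θ₁ x w) * c2 u v)

/-- The differential of the torsion function vanishes. -/
theorem fderiv_f (h : IsMovingFrame m Ω) (hΩ : IsOpen Ω) {x : E} (hx : x ∈ Ω) :
    fderiv ℝ m.f x = 0 := by
  obtain ⟨R₁₂, B₁⟩ := h.bianchi₁ hΩ hx
  obtain ⟨R₂₁, B₂⟩ := h.bianchi₂ hΩ hx
  have B₃ := h.bianchi₃ hΩ hx
  have C₁ : ∀ U V W, _ := fun U V W => cyc_complexify₅ (P₁ := fun u v => -(extd m.a x u v -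
      wedge (m.b x) (fun u => cj (m.b x u)) u v)) (α₁ := m.θ₁ x) (P₂ := fun u v => -R₁₂ u v)
    (α₂ := m.θ₂ x) (P₃ := wedge (fun u => cj (m.θ₂ x u)) fun u => cj (m.θ₃ x u))
    (α₃ := fderiv ℝ m.f x) (P₄ := wedge (m.θ₃ x) (m.θ₁ x))
    (α₄ := fun u => m.f x * cj (m.f x) * cj (m.θ₃ x u))
    (P₅ := wedge (m.θ₁ x) (m.θ₂ x)) (α₅ := fun u => -(m.f x * cj (m.f x)) * cj (m.θ₂ x u))
    (fun u v w => by
      have := B₁ u v w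
      simp only [cyc] at this ⊢
      linear_combination this) U V W
  have C₂ : ∀ U V W, _ := fun U V W => cyc_complexify₅ (P₁ := fun u v => -(extd m.c x u v -
      wedge (fun u => cj (m.b x u)) (m.b x) u v)) (α₁ := m.θ₂ x) (P₂ := fun u v => -R₂₁ u v)
    (α₂ := m.θ₁ x) (P₃ := wedge (fun u => cj (m.θ₃ x u)) fun u => cj (m.θ₁ x u))
    (α₃ := fderiv ℝ m.f x) (P₄ := wedge (m.θ₁ x) (m.θ₂ x))
    (α₄ := fun u => m.f x * cj (m.f x) * cj (m.θ₁ x u))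
    (P₅ := wedge (m.θ₂ x) (m.θ₃ x)) (α₅ := fun u => -(m.f x * cj (m.f x)) * cj (m.θ₃ x u))
    (fun u v w => by
      have := B₂ u v w
      simp only [cyc] at this ⊢
      linear_combination this) U V W
  have C₃ : ∀ U V W, _ := fun U V W => cyc_complexify₅ (P₁ := fun u v => extd m.a x u v +
      extd m.c x u v) (α₁ := m.θ₃ x) (P₂ := fun u v => 0)
    (α₂ := m.θ₁ x) (P₃ := wedge (fun u => cj (m.θ₁ x u)) fun u => cj (m.θ₂ x u))
    (α₃ := fderiv ℝ m.f x) (P₄ := wedge (m.θ₁ x) (fun u => cj (m.θ₁ x u)))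
    (α₄ := fun u => -(m.f x * cj (m.f x)) * m.θ₃ x u)
    (P₅ := wedge (m.θ₂ x) (fun u => cj (m.θ₂ x u)))
    (α₅ := fun u => -(m.f x * cj (m.f x)) * m.θ₃ x u)
    (fun u v w => by
      have := B₃ u v w
      simp only [cyc] at this ⊢
      linear_combination this) U V W
  clear B₁ B₂ B₃
  obtain ⟨e₁, he₁⟩ := (h.bijective x hx).2 (1, 0, 0)
  obtain ⟨e₂, he₂⟩ := (h.bijective x hx).2 (0, 1, 0)
  obtain ⟨e₃, he₃⟩ := (h.bijective x hx).2 (0, 0, 1)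
  obtain ⟨e₁', he₁'⟩ := (h.bijective x hx).2 (Complex.I, 0, 0)
  obtain ⟨e₂', he₂'⟩ := (h.bijective x hx).2 (0, Complex.I, 0)
  obtain ⟨e₃', he₃'⟩ := (h.bijective x hx).2 (0, 0, Complex.I)
  simp only [Prod.mk.injEq] at he₁ he₂ he₃ he₁' he₂' he₃'
  obtain ⟨a1, a2, a3⟩ := he₁
  obtain ⟨b1, b2, b3⟩ := he₂
  obtain ⟨c1, c2, c3⟩ := he₃
  obtain ⟨a1', a2', a3'⟩ := he₁'
  obtain ⟨b1', b2', b3'⟩ := he₂'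
  obtain ⟨c1', c2', c3'⟩ := he₃'
  have hw : ∀ (α β : E → ℂ) (U V : E × E), complexify₂ (wedge α β) U V =
      complexify α U * complexify β V - complexify α V * complexify β U := fun α β U V => by
    simp only [complexify₂, complexify, wedge]
    linear_combination (-(α U.2 * β V.2) + α V.2 * β U.2) * Complex.I_mul_I
  have hms : ∀ (s : ℂ) (α : E → ℂ) (U : E × E), complexify (fun u => s * α u) U =
      s * complexify α U := fun s α U => by simp only [complexify]; ring
  have I2 := Complex.I_mul_I
  -- values of the coframe on vectors of type `(1,0)` and `(0,1)`
  have v : ∀ (e e' : E) (z : ℂ) (α : E →L[ℝ] ℂ), α e = z → α e' = Complex.I * z →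
      complexify α (e, e') = 0 ∧ complexify α (e, -e') = 2 * z ∧
      complexify (fun u => cj (α u)) (e, e') = 2 * cj z ∧
      complexify (fun u => cj (α u)) (e, -e') = 0 := by
    intro e e' z α h1 h2
    simp only [complexify, map_neg, h1, h2, map_mul, Complex.conj_I]
    refine ⟨?_, ?_, ?_, ?_⟩
    · linear_combination z * I2
    · linear_combination -z * I2
    · linear_combination -cj z * I2
    · linear_combination cj z * I2
  have v11 := v e₁ e₁' 1 (m.θ₁ x) a1 (by rw [a1', mul_one])
  have v21 := v e₁ e₁' 0 (m.θ₂ x) a2 (by rw [a2', mul_zero])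
  have v31 := v e₁ e₁' 0 (m.θ₃ x) a3 (by rw [a3', mul_zero])
  have v12 := v e₂ e₂' 0 (m.θ₁ x) b1 (by rw [b1', mul_zero])
  have v22 := v e₂ e₂' 1 (m.θ₂ x) b2 (by rw [b2', mul_one])
  have v32 := v e₂ e₂' 0 (m.θ₃ x) b3 (by rw [b3', mul_zero])
  have v13 := v e₃ e₃' 0 (m.θ₁ x) c1 (by rw [c1', mul_zero])
  have v23 := v e₃ e₃' 0 (m.θ₂ x) c2 (by rw [c2', mul_zero])
  have v33 := v e₃ e₃' 1 (m.θ₃ x) c3 (by rw [c3', mul_one])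
  simp only [map_one, map_zero, mul_one, mul_zero] at v11 v12 v13 v21 v22 v23 v31 v32 v33
  simp only [cyc, hw, hms] at C₁ C₂ C₃
  set f' : E →L[ℝ] ℂ := fderiv ℝ m.f x with hf'
  -- On three vectors of type `(0,1)` all `θᵢ` vanish and only the `df` term remains. Hence `df`
  -- vanishes on vectors of type `(0,1)`.
  have z3 := C₃ (e₁, e₁') (e₂, e₂') (e₃, e₃')
  have z1 := C₁ (e₁, e₁') (e₂, e₂') (e₃, e₃')
  have z2 := C₂ (e₁, e₁') (e₂, e₂') (e₃, e₃')
  -- For a pair of type `(0,1)`, the third vector runs over the `(1,0)` vectors. Adding the three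
  -- identities for the same pair eliminates the curvature, because its trace is zero, and leaves
  -- `df` on one vector of type `(1,0)`.
  have r11_12 := C₁ (e₁, e₁') (e₂, e₂') (e₁, -e₁')
  have r22_12 := C₂ (e₁, e₁') (e₂, e₂') (e₂, -e₂')
  have r33_12 := C₃ (e₁, e₁') (e₂, e₂') (e₃, -e₃')
  have r33_23 := C₃ (e₂, e₂') (e₃, e₃') (e₃, -e₃')
  have r22_23 := C₂ (e₂, e₂') (e₃, e₃') (e₂, -e₂')
  have r11_23 := C₁ (e₂, e₂') (e₃, e₃') (e₁, -e₁')
  have r33_31 := C₃ (e₃, e₃') (e₁, e₁') (e₃, -e₃')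
  have r11_31 := C₁ (e₃, e₃') (e₁, e₁') (e₁, -e₁')
  have r22_31 := C₂ (e₃, e₃') (e₁, e₁') (e₂, -e₂')
  clear C₁ C₂ C₃
  simp only [v11, v12, v13, v21, v22, v23, v31, v32, v33, mul_zero, zero_mul, add_zero, zero_add,
    sub_zero, sub_self] at *
  simp only [complexify, complexify₂, wedge, map_neg] at z1 z2 z3 r11_12 r22_12 r33_12
  simp only [complexify, complexify₂, wedge, map_neg] at r33_23 r22_23 r11_23 r33_31 r11_31 r22_31
  have p3 : f' e₃ - Complex.I * f' e₃' = 0 := by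
    linear_combination (r33_12 + r11_12 + r22_12) / 4
  have p1 : f' e₁ - Complex.I * f' e₁' = 0 := by
    linear_combination (r11_23 + r22_23 + r33_23) / 4
  have p2 : f' e₂ - Complex.I * f' e₂' = 0 := by
    linear_combination (r22_31 + r11_31 + r33_31) / 4
  have q : ∀ e e' : E, 2 * 2 * (f' e + Complex.I * f' e') = 0 → f' e - Complex.I * f' e' = 0 →
      f' e = 0 ∧ f' e' = 0 := fun e e' h1 h2 =>
    ⟨by linear_combination h1 / 8 + h2 / 2,
      by linear_combination -Complex.I * (h1 / 8 - h2 / 2) + f' e' * I2⟩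
  obtain ⟨q1, q1'⟩ := q _ _ z1 p1
  obtain ⟨q2, q2'⟩ := q _ _ z2 p2
  obtain ⟨q3, q3'⟩ := q _ _ z3 p3
  ext u
  have hu : u = ((m.θ₁ x u).re • e₁ + (m.θ₁ x u).im • e₁') +
      ((m.θ₂ x u).re • e₂ + (m.θ₂ x u).im • e₂') +
      ((m.θ₃ x u).re • e₃ + (m.θ₃ x u).im • e₃') := by
    apply (h.bijective x hx).1
    simp only [map_add, map_smul, a1, a2, a3, b1, b2, b3, c1, c2, c3, a1', a2', a3', b1', b2', b3',
      c1', c2', c3', smul_zero, add_zero, zero_add, Complex.real_smul, mul_one, Complex.re_add_im]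
  rw [hu]
  simp only [map_add, map_smul, q1, q2, q3, q1', q2', q3', smul_zero, add_zero, zero_apply]

/-- The curvature of the determinant line on vectors orthogonal to the fibres. -/
theorem extd_trace (h : IsMovingFrame m Ω) (hΩ : IsOpen Ω) {x : E} (hx : x ∈ Ω) {u v : E}
    (hu : m.θ₃ x u = 0) (hv : m.θ₃ x v = 0) :
    extd m.a x u v + extd m.c x u v = m.f x * cj (m.f x) *
      (m.θ₁ x u * cj (m.θ₁ x v) - m.θ₁ x v * cj (m.θ₁ x u) +
        (m.θ₂ x u * cj (m.θ₂ x v) - m.θ₂ x v * cj (m.θ₂ x u))) := by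
  -- Inserting a vertical vector `w` with `θ₃(w) = 1` into the third identity isolates `da + dc` on
  -- `u` and `v`.
  obtain ⟨w, hw⟩ := (h.bijective x hx).2 (0, 0, 1)
  simp only [Prod.mk.injEq] at hw
  have B := h.bianchi₃ hΩ hx u v w
  rw [h.fderiv_f hΩ hx] at B
  simp only [cyc, wedge, hu, hv, hw, zero_apply] at B
  linear_combination B

end IsMovingFrame

end MovingFrame

/-! ### Adapted frames of nearly Kähler manifolds -/

section AdaptedFrame

variable {E : Type u} [NormedAddCommGroup E] [NormedSpace ℝ E] [FiniteDimensional ℝ E]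
  {M : Type*} [TopologicalSpace M] [ChartedSpace E M] [IsManifold 𝓘(ℝ, E) ∞ M]
  {g : RiemMetric E M} {J : EndField E M}

/-- A unitary moving frame over a coordinate ball around `p`, adapted to the complex line `L` at `p`. -/
structure IsAdaptedFrame (g : RiemMetric E M) (J : EndField E M) (p : M) (L : Submodule ℝ E) (r : ℝ)
    (m : FrameData E) : Prop where
  ball_subset : Metric.ball (extChartAt 𝓘(ℝ, E) p p) r ⊆ (extChartAt 𝓘(ℝ, E) p).target
  moving : IsMovingFrame m (Metric.ball (extChartAt 𝓘(ℝ, E) p p) r)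
  metric : ∀ y ∈ Metric.ball (extChartAt 𝓘(ℝ, E) p p) r, ∀ u v, chartMetric g p y u v =
    (m.θ₁ y u * cj (m.θ₁ y v) + m.θ₂ y u * cj (m.θ₂ y v) + m.θ₃ y u * cj (m.θ₃ y v)).re
  complex₁ : ∀ y ∈ Metric.ball (extChartAt 𝓘(ℝ, E) p p) r, ∀ u,
    m.θ₁ y (chartEnd J p y u) = Complex.I * m.θ₁ y u
  complex₂ : ∀ y ∈ Metric.ball (extChartAt 𝓘(ℝ, E) p p) r, ∀ u,
    m.θ₂ y (chartEnd J p y u) = Complex.I * m.θ₂ y u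
  complex₃ : ∀ y ∈ Metric.ball (extChartAt 𝓘(ℝ, E) p p) r, ∀ u,
    m.θ₃ y (chartEnd J p y u) = Complex.I * m.θ₃ y u
  nabla₁ : ∀ y ∈ Metric.ball (extChartAt 𝓘(ℝ, E) p p) r, ∀ u v, fderiv ℝ m.θ₁ y u v =
    -(m.a y u * m.θ₁ y v + m.b y u * m.θ₂ y v) + m.θ₁ y (connL g J p y u v)
  nabla₂ : ∀ y ∈ Metric.ball (extChartAt 𝓘(ℝ, E) p p) r, ∀ u v, fderiv ℝ m.θ₂ y u v =
    -(-cj (m.b y u) * m.θ₁ y v + m.c y u * m.θ₂ y v) + m.θ₂ y (connL g J p y u v)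
  mem_iff : ∀ u, u ∈ L ↔ m.θ₁ (extChartAt 𝓘(ℝ, E) p p) u = 0 ∧ m.θ₂ (extChartAt 𝓘(ℝ, E) p p) u = 0
  f_eq_zero_iff : ∀ y ∈ Metric.ball (extChartAt 𝓘(ℝ, E) p p) r, m.f y = 0 ↔
    ∀ u, nablaJ g J p y u = 0

/-- The coframe is a fixed unitary coframe at `p` composed with the inverse gauge `b`. In this gauge
the torsion `-J ∇J` is skew in all arguments by the nearly Kähler condition and antilinear, so it
reduces to one function `f`; the connection form is already in the split algebra. -/
theorem IsAdaptedGauge.exists_adaptedFrame (hNK : IsNearlyKahler g J)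
    (hE : Module.finrank ℝ E = 6) {p : M} {L : Submodule ℝ E} {r : ℝ} (hr : 0 < r)
    {a b : E → EndV E} {w : E → E →L[ℝ] EndV E} (hg : IsAdaptedGauge g J p L r a b w)
    (hL : Module.finrank ℝ L = 2) (hLJ : ∀ u ∈ L, endE J p u ∈ L) :
    ∃ m, IsAdaptedFrame g J p L r m := by
  have hJ := hNK.toIsAlmostHermitian
  have hsymm : ∀ u v, innerE g p u v = innerE g p v u := fun u v => g.symm p u v
  have hI : ∀ u, endE J p (endE J p u) = -u := fun u => hJ.sq p u
  have hBI : ∀ u v, innerE g p (endE J p u) (endE J p v) = innerE g p u v := fun u v =>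
    hJ.compat p u v
  obtain ⟨e₁, e₂, e₃, β₁, β₂, β₃, hβ⟩ := exists_unitaryCoframe hE hsymm (fun u hu => g.pos p u hu)
    hI hBI hL hLJ
  set Ω := Metric.ball (extChartAt 𝓘(ℝ, E) p p) r with hΩdef
  have hΩ : IsOpen Ω := Metric.isOpen_ball
  have hH := hJ.isHermitianOn p
  have ht := isOpen_extChartAt_target (I := 𝓘(ℝ, E)) p
  set N := nablaL (chartMetric g p) (chartEnd J p) with hN
  set I := chartEnd J p with hIdef
  set G := chartMetric g p with hGdef
  have hsub := hg.ball_subset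
  have hba : ∀ y ∈ Ω, ∀ v, b y (a y v) = v := fun y hy v =>
    congrArg (fun A : EndV E => A v) (hg.b_mul_a y hy)
  have hab : ∀ y ∈ Ω, ∀ v, a y (b y v) = v := fun y hy v =>
    congrArg (fun A : EndV E => A v) (hg.a_mul_b y hy)
  have hIb : ∀ y ∈ Ω, ∀ v, b y (I y v) = endE J p (b y v) := fun y hy v => by
    conv_lhs => rw [← hab y hy v, hg.complex y hy, hba y hy]
  have hGb : ∀ y ∈ Ω, ∀ u v, innerE g p (b y u) (b y v) = G y u v := fun y hy u v => by
    rw [← hg.metric y hy, hab y hy, hab y hy]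
  have hNsk : ∀ y ∈ Ω, ∀ u v, N y u v = -N y v u := fun y hy u v => by
    have h1 := hNK.nearly p y (hsub hy)
    have h2 : ∀ u, N y u u = 0 := fun u => h1 u
    have h3 := h2 (u + v)
    simp only [map_add, add_apply, h2, zero_add, add_zero] at h3
    exact eq_neg_of_add_eq_zero_right h3
  have hNI : ∀ y ∈ Ω, ∀ u v, N y u (I y v) = -I y (N y u v) := fun y hy u v =>
    congrArg (fun A : EndV E => A v) (hH.nablaL_anticomm ht (hsub hy) u)
  have hII : ∀ y ∈ Ω, ∀ v, I y (I y v) = -v := fun y hy v => hH.J_J (hsub hy) v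
  have hNs : ∀ y ∈ Ω, ∀ u v z, G y (N y u v) z = -G y v (N y u z) := fun y hy u v z =>
    hH.nablaL_skew ht (hsub hy) u v z
  -- torsion in the gauge
  let T : E → E →L[ℝ] EndV E := fun y =>
    ((ContinuousLinearMap.mul ℝ (EndV E) (-(b y * I y))).comp
      (((ContinuousLinearMap.mul ℝ (EndV E)).flip (a y)).comp ((N y).comp (a y))))
  have hT : ∀ y u v, T y u v = -b y (I y (N y (a y u) (a y v))) := fun y u v => rfl
  have hTt : ∀ y ∈ Ω, ∀ u v, b y (connL g J p y u v - connL g J p y v u) =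
      T y (b y u) (b y v) := fun y hy u v => by
    have h1 := hH.toIsMetricOn.christoffel_symm ht (hsub hy) u v
    rw [hT, hab y hy, hab y hy, canonicalL_apply, canonicalL_apply]
    simp only [sub_apply, smul_apply, mul_apply_eq_comp]
    rw [h1, show nablaL G I y v u = -N y u v from hNsk y hy v u]
    rw [← map_neg (b y), map_neg (chartEnd J p y)]
    refine congrArg (b y) ?_
    change _ - (1 / 2 : ℝ) • I y (N y u v) - _ = _
    module
  have htor : ∀ y ∈ Ω, ∀ u v, _ := fun y hy u v => hβ.torsion_apply hBI (T := T y) hI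
    (fun u v => by rw [hT, hT, hNsk y hy, map_neg, map_neg])
    (fun u v => by
      rw [hT, hT, ← hg.complex y hy, hNI y hy, map_neg, map_neg, map_neg, hIb y hy])
    (fun u v z => by
      rw [hT, hT]
      have h1 : ∀ x z, innerE g p (-b y x) z = -G y x (a y z) := fun x z => by
        rw [map_neg, neg_apply, ← hGb y hy, hba y hy]
      rw [h1, h1, neg_neg]
      rw [hH.J_skew (hsub hy), hNs y hy, neg_neg]
      have h2 := hNI y hy (a y u) (a y z)
      rw [h2, map_neg, neg_neg]
      rw [hH.toIsMetricOn.symm y (hsub hy)]) u v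
  have hdb : ∀ y ∈ Ω, ∀ u v, fderiv ℝ b y u v = -w y u (b y v) + b y (connL g J p y u v) := by
    intro y hy u v
    have hda : HasFDerivAt a (fderiv ℝ a y) y :=
      ((hg.smooth_a.contDiffAt (hΩ.mem_nhds hy)).differentiableAt (by simp)).hasFDerivAt
    have hdb : HasFDerivAt b (fderiv ℝ b y) y :=
      ((hg.smooth_b.contDiffAt (hΩ.mem_nhds hy)).differentiableAt (by simp)).hasFDerivAt
    have h1 := hda.mul' hdb
    have h2 : (a * b) =ᶠ[𝓝 y] fun _ => 1 := by
      filter_upwards [hΩ.mem_nhds hy] with z hz using hg.a_mul_b z hz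
    have h3 := (h1.congr_of_eventuallyEq h2.symm).unique (hasFDerivAt_const (1 : EndV E) y)
    have h4 : a y * fderiv ℝ b y u + fderiv ℝ a y u * b y = 0 :=
      congrArg (fun A : E →L[ℝ] EndV E => A u) h3
    have h5 : a y (fderiv ℝ b y u v) + fderiv ℝ a y u (b y v) = 0 :=
      congrArg (fun A : EndV E => A v) h4
    have h6 : fderiv ℝ a y u (b y v) + connL g J p y u (a y (b y v)) = a y (w y u (b y v)) :=
      congrArg (fun A : EndV E => A (b y v)) (hg.deriv_a y hy u)
    rw [hab y hy] at h6
    rw [← hba y hy (fderiv ℝ b y u v)]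
    have h7 : a y (fderiv ℝ b y u v) = connL g J p y u v - a y (w y u (b y v)) := by
      linear_combination (norm := module) h5 - h6
    rw [h7, map_sub, hba y hy]
    module
  have hdθ : ∀ β : E →L[ℝ] ℂ, ∀ y ∈ Ω, ∀ u v, fderiv ℝ (fun y => β.comp (b y)) y u v =
      -β (w y u (b y v)) + β (b y (connL g J p y u v)) := by
    intro β y hy u v
    have hdb' : HasFDerivAt b (fderiv ℝ b y) y :=
      ((hg.smooth_b.contDiffAt (hΩ.mem_nhds hy)).differentiableAt (by simp)).hasFDerivAt
    have h1 : HasFDerivAt (fun y => β.comp (b y)) _ y :=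
      (ContinuousLinearMap.compL ℝ E E ℂ β).hasFDerivAt.comp y hdb'
    rw [h1.fderiv]
    change β (fderiv ℝ b y u v) = _
    rw [hdb y hy, map_add, map_neg]
  have hspl : ∀ y ∈ Ω, ∀ u, _ := fun y hy u =>
    hβ.split_apply hE hsymm hI hBI (hg.split y hy u)
  let ev : (E →L[ℝ] ℂ) → E → EndV E →L[ℝ] ℂ := fun β e =>
    β.comp (ContinuousLinearMap.apply ℝ E e)
  let m : FrameData E :=
    { θ₁ := fun y => β₁.comp (b y)
      θ₂ := fun y => β₂.comp (b y)
      θ₃ := fun y => β₃.comp (b y)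
      a := fun y => (ev β₁ e₁).comp (w y)
      b := fun y => (ev β₁ e₂).comp (w y)
      c := fun y => (ev β₂ e₂).comp (w y)
      f := fun y => β₁ (T y e₂ e₃) }
  have smθ : ∀ β : E →L[ℝ] ℂ, ContDiffOn ℝ ∞ (fun y => β.comp (b y)) Ω := fun β =>
    contDiffOn_const.clm_comp hg.smooth_b
  have smw : ∀ φ : EndV E →L[ℝ] ℂ, ContDiffOn ℝ ∞ (fun y => φ.comp (w y)) Ω := fun φ =>
    contDiffOn_const.clm_comp hg.smooth_w
  have smN : ContDiffOn ℝ ∞ N Ω := (hH.contDiffOn_nablaL ht).mono hsub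
  have smI : ContDiffOn ℝ ∞ I Ω := hH.smoothJ.mono hsub
  have hn₁ : ∀ y ∈ Ω, ∀ u v, fderiv ℝ m.θ₁ y u v =
      -(m.a y u * m.θ₁ y v + m.b y u * m.θ₂ y v) + m.θ₁ y (connL g J p y u v) := fun y hy u v => by
    rw [hdθ β₁ y hy u v, ((hspl y hy u).2 _).1]; rfl
  have hn₂ : ∀ y ∈ Ω, ∀ u v, fderiv ℝ m.θ₂ y u v =
      -(-cj (m.b y u) * m.θ₁ y v + m.c y u * m.θ₂ y v) + m.θ₂ y (connL g J p y u v) :=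
    fun y hy u v => by
    rw [hdθ β₂ y hy u v, ((hspl y hy u).2 _).2.1]; rfl
  have hn₃ : ∀ y ∈ Ω, ∀ u v, fderiv ℝ m.θ₃ y u v =
      (m.a y u + m.c y u) * m.θ₃ y v + m.θ₃ y (connL g J p y u v) := fun y hy u v => by
    rw [hdθ β₃ y hy u v, ((hspl y hy u).2 _).2.2, neg_mul, neg_neg]; rfl
  have hτ : ∀ β : E →L[ℝ] ℂ, ∀ y ∈ Ω, ∀ u v, β (b y (connL g J p y u v)) =
      β (b y (connL g J p y v u)) + β (T y (b y u) (b y v)) := fun β y hy u v => by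
    rw [← hTt y hy, map_sub, map_sub]; ring
  refine ⟨m, hsub, ?_, ?_, ?_, ?_, ?_, hn₁, hn₂, ?_, ?_⟩
  · refine ⟨smθ _, smθ _, smθ _, smw _, smw _, smw _, ?_, ?_, ?_, ?_, ?_, ?_, ?_⟩
    · refine β₁.contDiff.comp_contDiffOn ?_
      have h1 := hg.smooth_a.clm_apply (contDiffOn_const (c := e₂))
      have h2 := hg.smooth_a.clm_apply (contDiffOn_const (c := e₃))
      exact (hg.smooth_b.clm_apply (smI.clm_apply ((smN.clm_apply h1).clm_apply h2))).neg
    · intro y hy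
      have h1 : Function.Bijective (b y) :=
        ⟨fun u v huv => by rw [← hab y hy u, ← hab y hy v, huv], fun v => ⟨a y v, hba y hy v⟩⟩
      exact hβ.bijective.comp h1
    · exact fun y hy u => (hspl y hy u).1.1
    · exact fun y hy u => (hspl y hy u).1.2
    · intro y hy u v
      have h1 : m.θ₁ y (connL g J p y u v) = m.θ₁ y (connL g J p y v u) + _ := hτ β₁ y hy u v
      rw [(htor y hy _ _).1] at h1
      rw [extd, hn₁ y hy, hn₁ y hy, h1]
      change _ = _ + β₁ (T y e₂ e₃) * (cj (β₂ (b y u)) * cj (β₃ (b y v)) -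
        cj (β₂ (b y v)) * cj (β₃ (b y u)))
      ring
    · intro y hy u v
      have h1 : m.θ₂ y (connL g J p y u v) = m.θ₂ y (connL g J p y v u) + _ := hτ β₂ y hy u v
      rw [(htor y hy _ _).2.1] at h1
      rw [extd, hn₂ y hy, hn₂ y hy, h1]
      change _ = _ + β₁ (T y e₂ e₃) * (cj (β₃ (b y u)) * cj (β₁ (b y v)) -
        cj (β₃ (b y v)) * cj (β₁ (b y u)))
      ring
    · intro y hy u v
      have h1 : m.θ₃ y (connL g J p y u v) = m.θ₃ y (connL g J p y v u) + _ := hτ β₃ y hy u v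
      rw [(htor y hy _ _).2.2] at h1
      rw [extd, hn₃ y hy, hn₃ y hy, h1]
      change _ = _ + β₁ (T y e₂ e₃) * (cj (β₁ (b y u)) * cj (β₂ (b y v)) -
        cj (β₁ (b y v)) * cj (β₂ (b y u)))
      ring
  · intro y hy u v
    rw [← hGb y hy, hβ.metric_eq]
    rfl
  · intro y hy u
    change β₁ (b y (I y u)) = _
    rw [hIb y hy, hβ.complex₁]; rfl
  · intro y hy u
    change β₂ (b y (I y u)) = _
    rw [hIb y hy, hβ.complex₂]; rfl
  · intro y hy u
    change β₃ (b y (I y u)) = _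
    rw [hIb y hy, hβ.complex₃]; rfl
  · intro u
    have h0 : extChartAt 𝓘(ℝ, E) p p ∈ Ω := Metric.mem_ball_self hr
    have hb0 : b (extChartAt 𝓘(ℝ, E) p p) u = u := by
      have := hba _ h0 u
      rwa [hg.a_self] at this
    change _ ↔ β₁ (b (extChartAt 𝓘(ℝ, E) p p) u) = 0 ∧ β₂ (b (extChartAt 𝓘(ℝ, E) p p) u) = 0
    rw [hb0]
    exact hβ.mem_iff u
  -- The function `f` determines the whole torsion `-J ∇J`, and `J` is invertible.
  · refine fun y hy => ⟨fun hf u => ?_, fun hN0 => ?_⟩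
    swap
    · have h1 : N y (a y e₂) = 0 := hN0 (a y e₂)
      change β₁ (T y e₂ e₃) = 0
      rw [hT, h1]
      simp
    ext v
    have hf' : β₁ (T y e₂ e₃) = 0 := hf
    have h1 := htor y hy (b y u) (b y v)
    simp only [hf', zero_mul] at h1
    have h2 : T y (b y u) (b y v) = 0 := by
      apply hβ.bijective.1
      simp [h1.1, h1.2.1, h1.2.2]
    rw [hT, hab y hy, hab y hy, neg_eq_zero] at h2
    have h3 := congrArg (a y) h2
    rw [hab y hy, map_zero] at h3
    have h4 := hII y hy (N y u v)
    rw [h3, map_zero] at h4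
    exact neg_eq_zero.1 h4.symm

/-- The distribution spanned by the frame vectors in the direction of `L`. -/
def frameDistribution (m : FrameData E) (p x : M) : Submodule ℝ E :=
  LinearMap.ker (((m.θ₁ (extChartAt 𝓘(ℝ, E) p x)).comp (dC p x)).prod
    ((m.θ₂ (extChartAt 𝓘(ℝ, E) p x)).comp (dC p x))).toLinearMap

theorem mem_frameDistribution {m : FrameData E} {p x : M} {v : E} :
    v ∈ frameDistribution m p x ↔ m.θ₁ (extChartAt 𝓘(ℝ, E) p x) (dC p x v) = 0 ∧
      m.θ₂ (extChartAt 𝓘(ℝ, E) p x) (dC p x v) = 0 := by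
  rw [frameDistribution, LinearMap.mem_ker]
  change (_, _) = ((0, 0) : ℂ × ℂ) ↔ _
  rw [Prod.mk.injEq]
  rfl

theorem IsAdaptedFrame.frameDistribution_self {p : M} {L : Submodule ℝ E} {r : ℝ}
    {m : FrameData E} (h : IsAdaptedFrame g J p L r m) : frameDistribution m p p = L := by
  ext v
  rw [mem_frameDistribution, h.mem_iff, dC_self]

/-- Along a parallel field the pair `(θ₁, θ₂)` solves a linear system with skew-Hermitian matrix. So
`|θ₁|² + |θ₂|²` is constant, and it vanishes throughout if it vanishes at time `0`. -/
theorem IsAdaptedFrame.isParallelDistributionOn (hJ : IsAlmostHermitian g J) {p : M}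
    {L : Submodule ℝ E} {r : ℝ} {m : FrameData E} (h : IsAdaptedFrame g J p L r m) {U : Set M}
    (hU : ∀ x ∈ U, x ∈ (extChartAt 𝓘(ℝ, E) p).source ∧
      extChartAt 𝓘(ℝ, E) p x ∈ Metric.ball (extChartAt 𝓘(ℝ, E) p p) r) :
    IsParallelDistributionOn g J U (frameDistribution m p) := by
  intro γ hγ hγU X hX hX0 t
  set y : ℝ → E := fun t => extChartAt 𝓘(ℝ, E) p (γ t) with hydef
  set Y : ℝ → E := X
  set ξ : ℝ → E := fun t => dC p (γ t) (Y t) with hξdef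
  have hΩ : IsOpen (Metric.ball (extChartAt 𝓘(ℝ, E) p p) r) := Metric.isOpen_ball
  have hyb : ∀ t, y t ∈ Metric.ball (extChartAt 𝓘(ℝ, E) p p) r := fun t => (hU _ (hγU t)).2
  have hyd : ∀ t, HasDerivAt y (deriv y t) t := fun t =>
    (differentiableAt_chart_curve hγ (hU _ (hγU t)).1).hasDerivAt
  have hξd : ∀ t, HasDerivAt ξ (-connL g J p (y t) (deriv y t) (ξ t)) t := fun t =>
    IsParallelAt.change_chart hJ hγ (mem_extChartAt_source _) (hU _ (hγU t)).1 (hX t)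
  have hz : ∀ θ : E → E →L[ℝ] ℂ, ContDiffOn ℝ ∞ θ (Metric.ball (extChartAt 𝓘(ℝ, E) p p) r) →
      ∀ t, HasDerivAt (fun t => θ (y t) (ξ t)) (fderiv ℝ θ (y t) (deriv y t) (ξ t) +
        θ (y t) (-connL g J p (y t) (deriv y t) (ξ t))) t := fun θ hθ t =>
    ((IsMovingFrame.differentiableAt_of hΩ hθ (hyb t)).hasFDerivAt.comp_hasDerivAt t
      (hyd t)).clm_apply (hξd t)
  set z₁ : ℝ → ℂ := fun t => m.θ₁ (y t) (ξ t)
  set z₂ : ℝ → ℂ := fun t => m.θ₂ (y t) (ξ t)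
  have hz₁ : ∀ t, HasDerivAt z₁ (-(m.a (y t) (deriv y t) * z₁ t + m.b (y t) (deriv y t) * z₂ t)) t :=
    fun t => (hz _ h.moving.smooth_θ₁ t).congr_deriv (by
      rw [h.nabla₁ _ (hyb t), map_neg]; ring)
  have hz₂ : ∀ t, HasDerivAt z₂ (-(-cj (m.b (y t) (deriv y t)) * z₁ t +
      m.c (y t) (deriv y t) * z₂ t)) t :=
    fun t => (hz _ h.moving.smooth_θ₂ t).congr_deriv (by
      rw [h.nabla₂ _ (hyb t), map_neg]; ring)
  have hn : ∀ t, HasDerivAt (fun t => z₁ t * cj (z₁ t) + z₂ t * cj (z₂ t)) 0 t := fun t => by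
    refine (((hz₁ t).mul (hasDerivAt_conj (hz₁ t))).add
      ((hz₂ t).mul (hasDerivAt_conj (hz₂ t)))).congr_deriv ?_
    simp only [map_neg, map_add, map_mul, h.moving.conj_a _ (hyb t), h.moving.conj_c _ (hyb t),
      Complex.conj_conj]
    ring
  have hc := is_const_of_deriv_eq_zero (fun t => (hn t).differentiableAt) (fun t => (hn t).deriv) t 0
  refine (mem_frameDistribution (E := E) (v := Y t)).2 ?_
  have hX0' := (mem_frameDistribution (E := E) (v := Y 0)).1 hX0
  have h1 : z₁ 0 = 0 := hX0'.1
  have h2 : z₂ 0 = 0 := hX0'.2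
  simp only [h1, h2, zero_mul, add_zero, Complex.mul_conj] at hc
  have hc' : Complex.normSq (z₁ t) + Complex.normSq (z₂ t) = 0 := by exact_mod_cast hc
  have p1 := Complex.normSq_nonneg (z₁ t)
  have p2 := Complex.normSq_nonneg (z₂ t)
  exact ⟨Complex.normSq_eq_zero.1 (by linarith), Complex.normSq_eq_zero.1 (by linarith)⟩

/-! ### Existence of adapted frames and non-vanishing of `∇J`. -/

theorem IsTransportE.map_complexLine (hJ : IsAlmostHermitian g J) {q p : M} {P : EndV E}
    (hP : IsTransportE g J q p P) {L : Submodule ℝ E} (hL : IsComplexLine J q L) :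
    Module.finrank ℝ (L.map P.toLinearMap) = 2 ∧
      ∀ u ∈ L.map P.toLinearMap, endE J p u ∈ L.map P.toLinearMap := by
  refine ⟨?_, ?_⟩
  · exact ((Submodule.equivMapOfInjective P.toLinearMap
      (hP.injective hJ) L).finrank_eq).symm.trans hL.1
  · rintro _ ⟨v, hv, rfl⟩
    exact ⟨endE J q v, hL.2 v hv, hP.complex hJ v⟩

/-- Adapted frames exist around every point. -/
theorem exists_adaptedFrame (hNK : IsNearlyKahler g J) (hE : Module.finrank ℝ E = 6) {q p : M}
    {P : EndV E} (hP : IsTransportE g J q p P) {L : Submodule ℝ E} (hL : IsComplexLine J q L)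
    (hhol : holonomyAlgebra g J q ⊆ specialUnitarySplit g J q L) :
    ∃ r > 0, ∃ m, IsAdaptedFrame g J p (L.map P.toLinearMap) r m := by
  have hJ := hNK.toIsAlmostHermitian
  obtain ⟨r, hr, a, b, w, hg⟩ := exists_adaptedGauge hJ hP hhol
  obtain ⟨h1, h2⟩ := hP.map_complexLine hJ hL
  exact ⟨r, hr, hg.exists_adaptedFrame hNK hE hr h1 h2⟩

/-- The covariant derivative of `J` in different charts. -/
theorem nablaJ_eq_zero_transition (hJ : IsAlmostHermitian g J) {c c' x : M}
    (hx : x ∈ (extChartAt 𝓘(ℝ, E) c).source) (hx' : x ∈ (extChartAt 𝓘(ℝ, E) c').source)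
    (h : ∀ u, nablaJ g J c' (extChartAt 𝓘(ℝ, E) c' x) u = 0) (u : E) :
    nablaJ g J c (extChartAt 𝓘(ℝ, E) c x) u = 0 := by
  have hy := (extChartAt 𝓘(ℝ, E) c).map_source hx
  have hs := (extChartAt 𝓘(ℝ, E) c).left_inv hx
  have hy' : (extChartAt 𝓘(ℝ, E) c).symm (extChartAt 𝓘(ℝ, E) c x) ∈
    (extChartAt 𝓘(ℝ, E) c').source := by rwa [hs]
  ext v
  apply (bijective_fderiv_transition hy hy').1
  rw [hJ.nablaJ_transition hy hy' u v]
  have h1 : transition c c' (extChartAt 𝓘(ℝ, E) c x) = extChartAt 𝓘(ℝ, E) c' x := by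
    rw [transition, hs]
  rw [h1, h]
  simp

/-- On a connected strict nearly Kähler manifold, `∇J` vanishes nowhere. -/
theorem IsStrictNearlyKahler.exists_nablaJ_ne_zero [ConnectedSpace M]
    (hNK : IsStrictNearlyKahler g J) (hE : Module.finrank ℝ E = 6) {q : M}
    {L : Submodule ℝ E} (hL : IsComplexLine J q L)
    (hhol : holonomyAlgebra g J q ⊆ specialUnitarySplit g J q L) (p : M) :
    ¬ ∀ u, nablaJ g J p (extChartAt 𝓘(ℝ, E) p p) u = 0 := by
  have hJ := hNK.toIsAlmostHermitian
  intro hp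
  -- If `∇J` vanished at `p`, its zero set would be nonempty, closed by continuity and open because
  -- `f` is locally constant, hence all of `M`, against strictness.
  have huniv : {x : M | ∀ u, nablaJ g J x (extChartAt 𝓘(ℝ, E) x x) u = 0} = Set.univ := by
    refine IsClopen.eq_univ ⟨⟨?_⟩, ?_⟩ ⟨p, hp⟩
    · rw [isOpen_iff_mem_nhds]
      intro x hx
      have h1 : nablaL (chartMetric g x) (chartEnd J x) (extChartAt 𝓘(ℝ, E) x x) ≠ 0 := by
        intro h0
        refine hx fun u => ?_
        rw [nablaJ_eq, h0, zero_apply]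
      have h2 : ContinuousAt (fun x' : M => nablaL (chartMetric g x) (chartEnd J x)
          (extChartAt 𝓘(ℝ, E) x x')) x :=
        (((hJ.isHermitianOn x).contDiffOn_nablaL (isOpen_extChartAt_target x)).continuousOn.continuousAt
          (extChartAt_target_mem_nhds x)).comp (continuousAt_extChartAt x)
      filter_upwards [h2.eventually_ne h1, extChartAt_source_mem_nhds (I := 𝓘(ℝ, E)) x]
        with x' hx' hs hz
      refine hx' ?_
      ext1 u
      exact nablaJ_eq_zero_transition hJ hs (mem_extChartAt_source x') hz u
    · rw [isOpen_iff_mem_nhds]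
      intro x hx
      obtain ⟨P, hP⟩ := exists_transport hJ q x
      obtain ⟨r, hr, m, hm⟩ := exists_adaptedFrame hNK.toIsNearlyKahler hE hP hL hhol
      have h0 := (hm.f_eq_zero_iff _ (Metric.mem_ball_self hr)).2 hx
      -- By `df = 0` a zero of `f` at the centre spreads to the whole coordinate ball.
      have hconst : ∀ y ∈ Metric.ball (extChartAt 𝓘(ℝ, E) x x) r, m.f y = 0 := by
        intro y hy
        rw [← h0]
        refine (convex_ball _ r).is_const_of_fderivWithin_eq_zero (𝕜 := ℝ)
          (hm.moving.smooth_f.differentiableOn (by simp)) (fun z hz => ?_) hy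
          (Metric.mem_ball_self hr)
        rw [fderivWithin_of_isOpen Metric.isOpen_ball hz,
          hm.moving.fderiv_f Metric.isOpen_ball hz]
      filter_upwards [extChartAt_source_mem_nhds (I := 𝓘(ℝ, E)) x,
        (continuousAt_extChartAt (I := 𝓘(ℝ, E)) x).preimage_mem_nhds
          (Metric.ball_mem_nhds _ hr)] with x' hs hb u
      exact nablaJ_eq_zero_transition hJ (mem_extChartAt_source x') hs
        ((hm.f_eq_zero_iff _ hb).1 (hconst _ hb)) u
  obtain ⟨c, y, hy, u, hu⟩ := hNK.strict
  refine hu ?_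
  have h1 : ∀ u, nablaJ g J _ _ u = 0 := (Set.eq_univ_iff_forall.1 huniv)
    ((extChartAt 𝓘(ℝ, E) c).symm y)
  have h2 := nablaJ_eq_zero_transition hJ ((extChartAt 𝓘(ℝ, E) c).map_target hy)
    (mem_extChartAt_source _) h1 u
  rwa [(extChartAt 𝓘(ℝ, E) c).right_inv hy] at h2

end AdaptedFrame

/-! ### Coordinates adapted to the leaves -/

section Pullback

variable {E E' : Type*} [NormedAddCommGroup E'] [NormedSpace ℝ E'] [NormedAddCommGroup E]
  [NormedSpace ℝ E]

/-- The pull-back of a one-form. -/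
def pullbackForm (Λ : E' → E) (θ : E → E →L[ℝ] ℂ) (z : E') : E' →L[ℝ] ℂ :=
  (θ (Λ z)).comp (fderiv ℝ Λ z)

/-- The pull-back of frame data. -/
def FrameData.pullback (m : FrameData E) (Λ : E' → E) : FrameData E' where
  θ₁ := pullbackForm Λ m.θ₁
  θ₂ := pullbackForm Λ m.θ₂
  θ₃ := pullbackForm Λ m.θ₃
  a := pullbackForm Λ m.a
  b := pullbackForm Λ m.b
  c := pullbackForm Λ m.c
  f := fun z => m.f (Λ z)

variable {Λ : E' → E} {O : Set E'} {Ω : Set E}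

theorem contDiffOn_pullbackForm (hO : IsOpen O) (hΛ : ContDiffOn ℝ ∞ Λ O) (hm : Set.MapsTo Λ O Ω)
    {θ : E → E →L[ℝ] ℂ} (hθ : ContDiffOn ℝ ∞ θ Ω) : ContDiffOn ℝ ∞ (pullbackForm Λ θ) O :=
  (hθ.comp hΛ hm).clm_comp (hΛ.fderiv_of_isOpen hO (by simp))

/-- The exterior derivative commutes with pull-backs. -/
theorem extd_pullbackForm (hO : IsOpen O) (hΩ : IsOpen Ω) (hΛ : ContDiffOn ℝ ∞ Λ O)
    (hm : Set.MapsTo Λ O Ω) {θ : E → E →L[ℝ] ℂ} (hθ : ContDiffOn ℝ ∞ θ Ω) {z : E'} (hz : z ∈ O)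
    (u v : E') :
    extd (pullbackForm Λ θ) z u v = extd θ (Λ z) (fderiv ℝ Λ z u) (fderiv ℝ Λ z v) := by
  have hΛz := hΛ.contDiffAt (hO.mem_nhds hz)
  have h1 : HasFDerivAt Λ (fderiv ℝ Λ z) z := (hΛz.differentiableAt (by simp)).hasFDerivAt
  have h2 : HasFDerivAt (fderiv ℝ Λ) (fderiv ℝ (fderiv ℝ Λ) z) z :=
    ((hΛz.fderiv_right (m := ∞) (by simp)).differentiableAt (by simp)).hasFDerivAt
  have h3 : HasFDerivAt θ (fderiv ℝ θ (Λ z)) (Λ z) :=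
    (IsMovingFrame.differentiableAt_of hΩ hθ (hm hz)).hasFDerivAt
  have hsymm : IsSymmSndFDerivAt ℝ Λ z :=
    hΛz.isSymmSndFDerivAt (by rw [minSmoothness_of_isRCLikeNormedField]; exact two_le_infty)
  have h4 : ∀ u v, fderiv ℝ (pullbackForm Λ θ) z u v =
      fderiv ℝ θ (Λ z) (fderiv ℝ Λ z u) (fderiv ℝ Λ z v) +
        θ (Λ z) (fderiv ℝ (fderiv ℝ Λ) z u v) := by
    intro u v
    have h5 : HasFDerivAt (pullbackForm Λ θ) _ z := (h3.comp z h1).clm_comp h2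
    rw [h5.fderiv]
    simp [add_comm]
  rw [extd, extd, h4, h4, hsymm.eq u v]
  ring

theorem IsMovingFrame.pullback {m : FrameData E} (h : IsMovingFrame m Ω) (hO : IsOpen O)
    (hΩ : IsOpen Ω) (hΛ : ContDiffOn ℝ ∞ Λ O) (hm : Set.MapsTo Λ O Ω)
    (hb : ∀ z ∈ O, Function.Bijective (fderiv ℝ Λ z)) : IsMovingFrame (m.pullback Λ) O where
  smooth_θ₁ := contDiffOn_pullbackForm hO hΛ hm h.smooth_θ₁
  smooth_θ₂ := contDiffOn_pullbackForm hO hΛ hm h.smooth_θ₂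
  smooth_θ₃ := contDiffOn_pullbackForm hO hΛ hm h.smooth_θ₃
  smooth_a := contDiffOn_pullbackForm hO hΛ hm h.smooth_a
  smooth_b := contDiffOn_pullbackForm hO hΛ hm h.smooth_b
  smooth_c := contDiffOn_pullbackForm hO hΛ hm h.smooth_c
  smooth_f := h.smooth_f.comp hΛ hm
  bijective z hz := (h.bijective _ (hm hz)).comp (hb z hz)
  conj_a z hz u := h.conj_a _ (hm hz) _
  conj_c z hz u := h.conj_c _ (hm hz) _
  d₁ z hz u v := (extd_pullbackForm hO hΩ hΛ hm h.smooth_θ₁ hz u v).trans (h.d₁ _ (hm hz) _ _)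
  d₂ z hz u v := (extd_pullbackForm hO hΩ hΛ hm h.smooth_θ₂ hz u v).trans (h.d₂ _ (hm hz) _ _)
  d₃ z hz u v := (extd_pullbackForm hO hΩ hΛ hm h.smooth_θ₃ hz u v).trans (h.d₃ _ (hm hz) _ _)

/-- The differential of a diffeomorphism is bijective. -/
theorem bijective_fderiv_of_openPartialHomeomorph (Λ : OpenPartialHomeomorph E' E)
    (hΛ : ContDiffOn ℝ ∞ Λ Λ.source) (hΛ' : ContDiffOn ℝ ∞ Λ.symm Λ.target) {z : E'}
    (hz : z ∈ Λ.source) : Function.Bijective (fderiv ℝ Λ z) ∧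
      ∀ u, fderiv ℝ Λ.symm (Λ z) (fderiv ℝ Λ z u) = u := by
  have h1 : HasFDerivAt Λ (fderiv ℝ Λ z) z :=
    (IsMovingFrame.differentiableAt_of Λ.open_source hΛ hz).hasFDerivAt
  have h2 : HasFDerivAt Λ.symm (fderiv ℝ Λ.symm (Λ z)) (Λ z) :=
    (IsMovingFrame.differentiableAt_of Λ.open_target hΛ' (Λ.map_source hz)).hasFDerivAt
  have h3 := (h2.comp z h1).congr_of_eventuallyEq (Λ.eventually_left_inverse hz
    |>.mono fun x hx => (hx.symm : x = Λ.symm (Λ x)))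
  have h4 := h3.unique (hasFDerivAt_id z)
  have h1' : HasFDerivAt Λ (fderiv ℝ Λ z) (Λ.symm (Λ z)) := by rwa [Λ.left_inv hz]
  have h5 := (h1'.comp (Λ z) h2).congr_of_eventuallyEq (Λ.eventually_right_inverse
    (Λ.map_source hz) |>.mono fun x hx => (hx.symm : x = Λ (Λ.symm x)))
  have h6 := h5.unique (hasFDerivAt_id (Λ z))
  have h4' : ∀ u, fderiv ℝ Λ.symm (Λ z) (fderiv ℝ Λ z u) = u := fun u =>
    congrArg (fun A : E' →L[ℝ] E' => A u) h4
  have h6' : ∀ u, fderiv ℝ Λ z (fderiv ℝ Λ.symm (Λ z) u) = u := fun u =>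
    congrArg (fun A : E →L[ℝ] E => A u) h6
  exact ⟨⟨fun u v huv => by rw [← h4' u, ← h4' v, huv], fun v => ⟨_, h6' v⟩⟩, h4'⟩

end Pullback

/-- The identification of `ℝ⁴` with `ℂ²`. -/
def kappa : R4 ≃L[ℝ] ℂ × ℂ :=
  LinearEquiv.toContinuousLinearEquiv
    { toFun := fun x => (⟨x 0, x 1⟩, ⟨x 2, x 3⟩)
      invFun := fun z => !₂[z.1.re, z.1.im, z.2.re, z.2.im]
      map_add' := fun x y => rfl
      map_smul' := fun t x => by
        refine Prod.ext (Complex.ext ?_ ?_) (Complex.ext ?_ ?_) <;> simp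
      left_inv := fun x => by
        ext i
        fin_cases i <;> rfl
      right_inv := fun z => rfl }

section Leaves

variable {E : Type*} [NormedAddCommGroup E] [NormedSpace ℝ E] [FiniteDimensional ℝ E]

/-- Near the origin `(θ₁, θ₂)` is invertible on `ℝ⁴ × 0`, so its kernel is the graph of a map `S`.
The integrability condition on `S` says that `dθ₁` and `dθ₂` vanish on pairs of kernel vectors;
every term of the structure equations, including the torsion, contains a factor `θ₁`, `θ₂` or a
conjugate of one of them. -/
theorem exists_leaf_parametrization {m : FrameData (R4 × ℂ)} {Ω : Set (R4 × ℂ)} (hΩ : IsOpen Ω)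
    (hm : IsMovingFrame m Ω) (h0 : (0 : R4 × ℂ) ∈ Ω)
    (h1 : ∀ k d, m.θ₁ 0 (k, d) = (kappa k).1) (h2 : ∀ k d, m.θ₂ 0 (k, d) = (kappa k).2) :
    ∃ V : Set (R4 × ℂ), IsOpen V ∧ (0 : R4 × ℂ) ∈ V ∧ ∃ Ψ : R4 × ℂ → R4 × ℂ,
      ContDiffOn ℝ ∞ Ψ V ∧ Set.MapsTo Ψ V Ω ∧ Ψ 0 = 0 ∧
      fderiv ℝ Ψ 0 = ContinuousLinearMap.id ℝ (R4 × ℂ) ∧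
      ∀ z ∈ V, ∀ w, m.θ₁ (Ψ z) (fderiv ℝ Ψ z (0, w)) = 0 ∧
        m.θ₂ (Ψ z) (fderiv ℝ Ψ z (0, w)) = 0 := by
  let η : R4 × ℂ → R4 × ℂ →L[ℝ] ℂ × ℂ := fun z => (m.θ₁ z).prod (m.θ₂ z)
  have hη : ContDiffOn ℝ ∞ η Ω := by
    refine (((contDiffOn_const (c := ContinuousLinearMap.inl ℝ ℂ ℂ)).clm_comp hm.smooth_θ₁).add
      ((contDiffOn_const (c := ContinuousLinearMap.inr ℝ ℂ ℂ)).clm_comp hm.smooth_θ₂)).congr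
      fun z _ => ContinuousLinearMap.ext fun v => ?_
    simp [η]
  let ηK : R4 × ℂ → R4 →L[ℝ] ℂ × ℂ := fun z => (η z).comp (ContinuousLinearMap.inl ℝ R4 ℂ)
  let ηD : R4 × ℂ → ℂ →L[ℝ] ℂ × ℂ := fun z => (η z).comp (ContinuousLinearMap.inr ℝ R4 ℂ)
  have hηK : ContDiffOn ℝ ∞ ηK Ω := hη.clm_comp contDiffOn_const
  have hηD : ContDiffOn ℝ ∞ ηD Ω := hη.clm_comp contDiffOn_const
  let W : Set (R4 × ℂ) := Ω ∩ ηK ⁻¹' Set.range ((↑) : (R4 ≃L[ℝ] ℂ × ℂ) → R4 →L[ℝ] ℂ × ℂ)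
  have hW : IsOpen W := hηK.continuousOn.isOpen_inter_preimage hΩ ContinuousLinearEquiv.isOpen
  have hK0 : ηK 0 = kappa := by
    ext k
    · exact h1 k 0
    · exact h2 k 0
  have h0W : ((0 : R4), (0 : ℂ)) ∈ W := ⟨h0, kappa, hK0.symm⟩
  let S : R4 × ℂ → ℂ →L[ℝ] R4 := fun z => -((ηK z).inverse.comp (ηD z))
  have hS : ContDiffOn ℝ ∞ S W := by
    refine ContDiffOn.neg (ContDiffOn.clm_comp ?_ (hηD.mono Set.inter_subset_left))
    rintro z ⟨hz, e, he⟩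
    have := contDiffAt_map_inverse (𝕜 := ℝ) (n := ∞) e
    rw [he] at this
    exact this.comp_contDiffWithinAt z ((hηK z hz).mono Set.inter_subset_left)
  have hinj : ∀ z ∈ W, Function.Injective (ηK z) := by
    rintro z ⟨hz, e, he⟩
    rw [← he]
    exact e.injective
  have hηS : ∀ z ∈ W, ∀ d, η z (S z d, d) = 0 := by
    rintro z ⟨hz, e, he⟩ d
    have h3 : η z (S z d, d) = ηK z (S z d) + ηD z d := by
      change _ = η z (S z d, 0) + η z (0, d)
      rw [← map_add]
      simp
    have h4 : S z d = -(ηK z).inverse (ηD z d) := rfl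
    rw [h3, h4, ← he, ContinuousLinearMap.inverse_equiv, map_neg]
    simp
  have hθS : ∀ z ∈ W, ∀ d, m.θ₁ z (S z d, d) = 0 ∧ m.θ₂ z (S z d, d) = 0 := fun z hz d =>
    ⟨congrArg Prod.fst (hηS z hz d), congrArg Prod.snd (hηS z hz d)⟩
  have hdiff : ∀ θ : R4 × ℂ → R4 × ℂ →L[ℝ] ℂ, ContDiffOn ℝ ∞ θ Ω →
      (∀ z ∈ W, ∀ d, θ z (S z d, d) = 0) → ∀ z ∈ W, ∀ d X,
      fderiv ℝ θ z X (S z d, d) + θ z (fderiv ℝ S z X d, 0) = 0 := by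
    intro θ hθ hz0 z hz d X
    have hθd := IsMovingFrame.differentiableAt_of hΩ hθ hz.1
    have hSd := IsMovingFrame.differentiableAt_of hW hS hz
    have h3 := (hasDerivAt_line hθd X).clm_apply
      ((hasDerivAt_line_apply hSd X d).prodMk (hasDerivAt_const 0 d))
    simp only [zero_smul, add_zero] at h3
    have h4 : (fun t : ℝ => θ (z + t • X) (S (z + t • X) d, d)) =ᶠ[𝓝 0] fun _ => 0 := by
      have hc : ContinuousAt (fun t : ℝ => z + t • X) 0 := by fun_prop
      have : ∀ᶠ t : ℝ in 𝓝 0, z + t • X ∈ W :=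
        hc.preimage_mem_nhds (hW.mem_nhds (by simpa using hz))
      filter_upwards [this] with t ht using hz0 _ ht d
    exact h3.unique ((hasDerivAt_const 0 0).congr_of_eventuallyEq h4)
  have hint : ∀ z ∈ W, ∀ d e, fderiv ℝ S z (S z d, d) e = fderiv ℝ S z (S z e, e) d := by
    intro z hz d e
    have key : ∀ θ : R4 × ℂ → R4 × ℂ →L[ℝ] ℂ, ContDiffOn ℝ ∞ θ Ω →
        (∀ z ∈ W, ∀ d, θ z (S z d, d) = 0) → extd θ z (S z d, d) (S z e, e) = 0 →
        θ z (fderiv ℝ S z (S z d, d) e, 0) = θ z (fderiv ℝ S z (S z e, e) d, 0) := by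
      intro θ hθ hz0 hd
      have h3 := hdiff θ hθ hz0 z hz e (S z d, d)
      have h4 := hdiff θ hθ hz0 z hz d (S z e, e)
      rw [extd] at hd
      linear_combination h3 - h4 - hd
    refine hinj z hz (Prod.ext ?_ ?_)
    · refine key m.θ₁ hm.smooth_θ₁ (fun z hz d => (hθS z hz d).1) ?_
      rw [hm.d₁ z hz.1]
      simp [hθS z hz]
    · refine key m.θ₂ hm.smooth_θ₂ (fun z hz d => (hθS z hz d).2) ?_
      rw [hm.d₂ z hz.1]
      simp [hθS z hz]
  obtain ⟨V, hV, h0V, Φ, hΦ, hΦS, hΦ0⟩ := exists_integral_leaves hW hS h0W hint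
  let Ψ : R4 × ℂ → R4 × ℂ := fun z => (Φ z, z.2)
  have hΨ : ContDiffOn ℝ ∞ Ψ V := hΦ.prodMk contDiff_snd.contDiffOn
  have hΦd : ∀ z ∈ V, HasFDerivAt Φ (fderiv ℝ Φ z) z := fun z hz =>
    (IsMovingFrame.differentiableAt_of hV hΦ hz).hasFDerivAt
  have hΨd : ∀ z ∈ V, ∀ w, fderiv ℝ Ψ z w = (fderiv ℝ Φ z w, w.2) := fun z hz w => by
    have h3 : HasFDerivAt Ψ _ z := (hΦd z hz).prodMk hasFDerivAt_snd
    rw [h3.fderiv]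
    rfl
  refine ⟨V, hV, h0V, Ψ, hΨ, fun z hz => (hΦS z hz).1.1, ?_, ?_, fun z hz w => ?_⟩
  · exact Prod.ext (hΦ0 0 h0V) rfl
  -- At the origin the kernel is `0 × ℂ`, so `S` vanishes there. As `Φ(k, 0) = k`, the
  -- parametrization agrees with the identity to first order.
  · have hS0 : S 0 = 0 := by
      have : ηD 0 = 0 := by
        ext d
        · exact (h1 0 d).trans (by simp)
        · exact (h2 0 d).trans (by simp)
      change -((ηK 0).inverse.comp (ηD 0)) = 0
      rw [this]
      simp
    have h3 : ∀ k, fderiv ℝ Φ 0 (k, 0) = k := by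
      intro k
      have h4 := hasDerivAt_line (hΦd 0 h0V).differentiableAt (k, (0 : ℂ))
      have h5 : (fun t : ℝ => Φ ((0 : R4 × ℂ) + t • (k, (0 : ℂ)))) =ᶠ[𝓝 0] fun t => t • k := by
        have hc : ContinuousAt (fun t : ℝ => (0 : R4 × ℂ) + t • (k, (0 : ℂ))) 0 := by fun_prop
        have : ∀ᶠ t : ℝ in 𝓝 0, (0 : R4 × ℂ) + t • (k, (0 : ℂ)) ∈ V :=
          hc.preimage_mem_nhds (hV.mem_nhds (by rw [zero_smul, add_zero]; exact h0V))
        filter_upwards [this] with t ht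
        have h6 : (0 : R4 × ℂ) + t • (k, (0 : ℂ)) = (t • k, 0) := by simp
        rw [h6] at ht ⊢
        exact hΦ0 _ ht
      have h7 := (h4.congr_of_eventuallyEq h5.symm).unique
        ((hasDerivAt_id (0 : ℝ)).smul_const k)
      rwa [one_smul] at h7
    refine ContinuousLinearMap.ext fun w => ?_
    rw [hΨd 0 h0V w]
    have h8 : fderiv ℝ Φ 0 w = w.1 := by
      have h9 : w = (w.1, 0) + (0, w.2) := by simp
      have h10 : fderiv ℝ Φ 0 (0, w.2) = 0 := by
        rw [(hΦS 0 h0V).2 w.2]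
        have : (Φ 0, (0 : R4 × ℂ).2) = 0 := Prod.ext (hΦ0 0 h0V) rfl
        rw [this, hS0]
        rfl
      conv_lhs => rw [h9]
      rw [map_add, h3, h10, add_zero]
    rw [h8]
    rfl
  · rw [hΨd z hz, (hΦS z hz).2]
    exact hθS _ (hΦS z hz).1 w

/-- Around every point of a moving frame there are coordinates `(k, d)` such that the leaves are the
sets on which `k` is constant. -/
theorem IsMovingFrame.exists_leaf_coordinates {m : FrameData E} {Ω : Set E} (hΩ : IsOpen Ω)
    (hm : IsMovingFrame m Ω) {y₀ : E} (hy₀ : y₀ ∈ Ω) :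
    ∃ Λ : OpenPartialHomeomorph (R4 × ℂ) E, (0 : R4 × ℂ) ∈ Λ.source ∧ Λ 0 = y₀ ∧ Λ.target ⊆ Ω ∧
      ContDiffOn ℝ ∞ Λ Λ.source ∧ ContDiffOn ℝ ∞ Λ.symm Λ.target ∧
      IsMovingFrame (m.pullback Λ) Λ.source ∧
      (∀ z ∈ Λ.source, ∀ w, (m.pullback Λ).θ₁ z (0, w) = 0 ∧ (m.pullback Λ).θ₂ z (0, w) = 0) ∧
      ∀ k, ((m.pullback Λ).θ₁ 0 (k, 0), (m.pullback Λ).θ₂ 0 (k, 0)) = kappa k := by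
  -- Linear coordinates in which the coframe at `y₀` is the standard one; they bring the frame into
  -- the normal form that the leaf parametrization requires at the origin.
  let e₀ : E ≃ₗ[ℝ] ℂ × ℂ × ℂ := LinearEquiv.ofBijective
    ((m.θ₁ y₀).prod ((m.θ₂ y₀).prod (m.θ₃ y₀))).toLinearMap (hm.bijective y₀ hy₀)
  let ℓ : (R4 × ℂ) ≃L[ℝ] E := ((kappa.toLinearEquiv.prodCongr (LinearEquiv.refl ℝ ℂ)).trans
    ((LinearEquiv.prodAssoc ℝ ℂ ℂ ℂ).trans e₀.symm)).toContinuousLinearEquiv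
  have hℓ : ∀ k d, e₀ (ℓ (k, d)) = ((kappa k).1, (kappa k).2, d) := fun k d =>
    e₀.apply_symm_apply _
  have hℓ₁ : ∀ k d, m.θ₁ y₀ (ℓ (k, d)) = (kappa k).1 := fun k d => congrArg Prod.fst (hℓ k d)
  have hℓ₂ : ∀ k d, m.θ₂ y₀ (ℓ (k, d)) = (kappa k).2 := fun k d =>
    congrArg (fun p : ℂ × ℂ × ℂ => p.2.1) (hℓ k d)
  let ι : R4 × ℂ → E := fun z => y₀ + ℓ z
  have hι : ContDiff ℝ ∞ ι := contDiff_const.add ℓ.contDiff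
  have hιd : ∀ z, HasFDerivAt ι (ℓ : R4 × ℂ →L[ℝ] E) z := fun z => ℓ.hasFDerivAt.const_add y₀
  have hι0 : ι 0 = y₀ := by simp [ι]
  have hO : IsOpen (ι ⁻¹' Ω) := hΩ.preimage hι.continuous
  have hpb : ∀ θ : E → E →L[ℝ] ℂ, ∀ z v, pullbackForm ι θ z v = θ (ι z) (ℓ v) := fun θ z v => by
    rw [pullbackForm, (hιd z).fderiv]; rfl
  have hm' := hm.pullback hO hΩ hι.contDiffOn (fun z hz => hz) (fun z _ => by
    rw [(hιd z).fderiv]; exact ℓ.bijective)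
  obtain ⟨V, hV, h0V, Ψ, hΨ, hΨΩ, hΨ0, hΨd, hΨθ⟩ := exists_leaf_parametrization hO hm'
    (by change ι 0 ∈ Ω; rwa [hι0])
    (fun k d => by
      change pullbackForm ι m.θ₁ 0 (k, d) = _
      rw [hpb, hι0, hℓ₁])
    (fun k d => by
      change pullbackForm ι m.θ₂ 0 (k, d) = _
      rw [hpb, hι0, hℓ₂])
  have hcomp : ∀ z ∈ V, HasFDerivAt (fun z => ι (Ψ z)) ((ℓ : R4 × ℂ →L[ℝ] E).comp (fderiv ℝ Ψ z)) z :=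
    fun z hz => (hιd _).comp z (IsMovingFrame.differentiableAt_of hV hΨ hz).hasFDerivAt
  have hsm : ContDiffOn ℝ ∞ (fun z => ι (Ψ z)) V := hι.comp_contDiffOn hΨ
  obtain ⟨Λ, h0Λ, hΛV, hΛ, hΛs⟩ := exists_smooth_inverse hV hsm h0V ℓ (by
    have := hcomp 0 h0V
    rwa [hΨd, ContinuousLinearMap.comp_id] at this)
  have hΛ' : (Λ : R4 × ℂ → E) = fun z => ι (Ψ z) := funext hΛ
  have hΛsm : ContDiffOn ℝ ∞ Λ Λ.source := by
    rw [hΛ']; exact hsm.mono hΛV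
  have hΛΩ : Set.MapsTo Λ Λ.source Ω := fun z hz => by
    rw [hΛ]; exact hΨΩ (hΛV hz)
  have hΛd : ∀ z ∈ Λ.source, ∀ v, fderiv ℝ Λ z v = ℓ (fderiv ℝ Ψ z v) := fun z hz v => by
    rw [hΛ', (hcomp z (hΛV hz)).fderiv]; rfl
  have hpΛ : ∀ θ : E → E →L[ℝ] ℂ, ∀ z ∈ Λ.source, ∀ v, pullbackForm Λ θ z v =
      pullbackForm ι θ (Ψ z) (fderiv ℝ Ψ z v) := fun θ z hz v => by
    rw [hpb]
    change θ (Λ z) (fderiv ℝ Λ z v) = _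
    rw [hΛd z hz, hΛ]
  refine ⟨Λ, h0Λ, ?_, ?_, hΛsm, hΛs, ?_, ?_, ?_⟩
  · rw [hΛ, hΨ0, hι0]
  · intro y hy
    rw [← Λ.right_inv hy]
    exact hΛΩ (Λ.map_target hy)
  · exact hm.pullback Λ.open_source hΩ hΛsm hΛΩ fun z hz =>
      (bijective_fderiv_of_openPartialHomeomorph Λ hΛsm hΛs hz).1
  · intro z hz w
    have h3 := hΨθ z (hΛV hz) w
    exact ⟨(hpΛ m.θ₁ z hz _).trans h3.1, (hpΛ m.θ₂ z hz _).trans h3.2⟩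
  · intro k
    have h3 := hpΛ m.θ₁ 0 h0Λ (k, 0)
    have h4 := hpΛ m.θ₂ 0 h0Λ (k, 0)
    rw [hΨd, hpb, hΨ0, hι0] at h3 h4
    refine Prod.ext (h3.trans (hℓ₁ k 0)) (h4.trans (hℓ₂ k 0))

end Leaves

/-! ### Complex structures on `ℂ²` -/

/-- The Euclidean inner product of `ℂ²`. -/
def ipC : Bil (ℂ × ℂ) :=
  let p₁ : ℂ × ℂ →L[ℝ] ℝ := Complex.reCLM.comp (ContinuousLinearMap.fst ℝ ℂ ℂ)
  let p₂ : ℂ × ℂ →L[ℝ] ℝ := Complex.imCLM.comp (ContinuousLinearMap.fst ℝ ℂ ℂ)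
  let p₃ : ℂ × ℂ →L[ℝ] ℝ := Complex.reCLM.comp (ContinuousLinearMap.snd ℝ ℂ ℂ)
  let p₄ : ℂ × ℂ →L[ℝ] ℝ := Complex.imCLM.comp (ContinuousLinearMap.snd ℝ ℂ ℂ)
  p₁.smulRight p₁ + p₂.smulRight p₂ + p₃.smulRight p₃ + p₄.smulRight p₄

theorem ipC_apply (z w : ℂ × ℂ) : ipC z w =
    z.1.re * w.1.re + z.1.im * w.1.im + z.2.re * w.2.re + z.2.im * w.2.im := rfl

theorem ipC_eq_re (z w : ℂ × ℂ) : ipC z w = (z.1 * cj w.1 + z.2 * cj w.2).re := by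
  rw [ipC_apply]
  simp
  ring

theorem ipC_symm (z w : ℂ × ℂ) : ipC z w = ipC w z := by
  rw [ipC_apply, ipC_apply]; ring

theorem ipC_pos {z : ℂ × ℂ} (hz : z ≠ 0) : 0 < ipC z z := by
  have h : ipC z z = Complex.normSq z.1 + Complex.normSq z.2 := by
    rw [ipC_apply, Complex.normSq_apply, Complex.normSq_apply]; ring
  rw [h]
  by_contra hn
  have h1 := Complex.normSq_nonneg z.1
  have h2 := Complex.normSq_nonneg z.2
  exact hz (Prod.ext (Complex.normSq_eq_zero.1 (by linarith)) (Complex.normSq_eq_zero.1 (by linarith)))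

/-- The real-linear endomorphisms `z ↦ (a z₁ + b z₂ + s z̄₂, -b̄ z₁ + c z₂ - s z̄₁)` of `ℂ²`. -/
def omL : (ℂ × ℂ × ℂ × ℂ) →L[ℝ] EndV (ℂ × ℂ) :=
  LinearMap.toContinuousLinearMap
    { toFun := fun p => LinearMap.toContinuousLinearMap
        { toFun := fun z => (p.1 * z.1 + p.2.1 * z.2 + p.2.2.2 * cj z.2,
            -cj p.2.1 * z.1 + p.2.2.1 * z.2 - p.2.2.2 * cj z.1)
          map_add' := fun z w => by
            refine Prod.ext ?_ ?_ <;> simp <;> ring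
          map_smul' := fun t z => by
            refine Prod.ext ?_ ?_ <;> simp <;> ring }
      map_add' := fun p q => by
        refine ContinuousLinearMap.ext fun z => Prod.ext ?_ ?_ <;> simp <;> ring
      map_smul' := fun t p => by
        refine ContinuousLinearMap.ext fun z => Prod.ext ?_ ?_ <;> simp <;> ring }

theorem omL_apply (a b c s : ℂ) (z : ℂ × ℂ) : omL (a, b, c, s) z =
    (a * z.1 + b * z.2 + s * cj z.2, -cj b * z.1 + c * z.2 - s * cj z.1) := rfl

theorem omL_skew {a b c s : ℂ} (ha : cj a = -a) (hc : cj c = -c) (z w : ℂ × ℂ) :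
    ipC (omL (a, b, c, s) z) w = -ipC z (omL (a, b, c, s) w) := by
  have h1 : a.re = 0 := by have := congrArg Complex.re ha; simp at this; linarith
  have h2 : c.re = 0 := by have := congrArg Complex.re hc; simp at this; linarith
  simp only [ipC_apply, omL_apply, Complex.add_re, Complex.add_im, Complex.sub_re, Complex.sub_im,
    Complex.mul_re, Complex.mul_im, Complex.conj_re, Complex.conj_im, Complex.neg_re, Complex.neg_im,
    h1, h2]
  ring

/-- Self-dual skew endomorphisms of `ℂ²`. -/
def selfDual (t : ℝ) (s : ℂ) : EndV (ℂ × ℂ) := omL (t * Complex.I, 0, t * Complex.I, s)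

theorem selfDual_apply (t : ℝ) (s : ℂ) (z : ℂ × ℂ) : selfDual t s z =
    (t * Complex.I * z.1 + s * cj z.2, t * Complex.I * z.2 - s * cj z.1) := by
  rw [selfDual, omL_apply]; simp

theorem selfDual_skew (t : ℝ) (s : ℂ) (z w : ℂ × ℂ) :
    ipC (selfDual t s z) w = -ipC z (selfDual t s w) :=
  omL_skew (by simp) (by simp) z w

theorem selfDual_sq (t : ℝ) (s : ℂ) (z : ℂ × ℂ) :
    selfDual t s (selfDual t s z) = -(t ^ 2 + Complex.normSq s) • z := by
  have h := Complex.mul_conj s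
  refine Prod.ext ?_ ?_ <;>
    simp only [selfDual_apply, Prod.smul_fst, Prod.smul_snd, Complex.real_smul, map_add, map_sub,
      map_mul, Complex.conj_conj, Complex.conj_ofReal, Complex.conj_I, Complex.ofReal_neg,
      Complex.ofReal_add, Complex.ofReal_pow]
  · linear_combination (t : ℂ) ^ 2 * z.1 * Complex.I_mul_I - z.1 * h
  · linear_combination (t : ℂ) ^ 2 * z.2 * Complex.I_mul_I - z.2 * h

/-- The commutator of a connection matrix with the complex structure. -/
theorem omL_commutator (a b c s : ℂ) (z : ℂ × ℂ) :
    omL (a, b, c, s) (selfDual 1 0 z) - selfDual 1 0 (omL (a, b, c, s) z) =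
      selfDual 0 (-2 * Complex.I * s) z := by
  refine Prod.ext ?_ ?_ <;>
    simp only [selfDual_apply, omL_apply, Prod.fst_sub, Prod.snd_sub, map_add, map_mul, map_sub,
      Complex.conj_I, Complex.ofReal_one, Complex.ofReal_zero, map_zero, map_one] <;> ring

/-- The standard orthonormal basis of `ℂ²`. -/
def frameC : Fin 4 → ℂ × ℂ := ![(1, 0), (Complex.I, 0), (0, 1), (0, Complex.I)]

theorem frameC_orthonormal (i j : Fin 4) : ipC (frameC i) (frameC j) = if i = j then 1 else 0 := by
  fin_cases i <;> fin_cases j <;> simp [frameC, ipC_apply]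

theorem finrank_C2 : Module.finrank ℝ (ℂ × ℂ) = 4 := by
  simp [Complex.finrank_real_complex]

theorem trace_C2 (A : EndV (ℂ × ℂ)) : LinearMap.trace ℝ (ℂ × ℂ) A.toLinearMap =
    (A (1, 0)).1.re + (A (Complex.I, 0)).1.im + (A (0, 1)).2.re + (A (0, Complex.I)).2.im := by
  rw [trace_eq_sum_inner ipC frameC_orthonormal finrank_C2.symm, Fin.sum_univ_four]
  simp [frameC, ipC_apply]

theorem det_fin_four (A : Matrix (Fin 4) (Fin 4) ℝ) : A.det =
    A 0 0 * (A 1 1 * (A 2 2 * A 3 3 - A 2 3 * A 3 2) - A 1 2 * (A 2 1 * A 3 3 - A 2 3 * A 3 1) +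
      A 1 3 * (A 2 1 * A 3 2 - A 2 2 * A 3 1)) -
    A 0 1 * (A 1 0 * (A 2 2 * A 3 3 - A 2 3 * A 3 2) - A 1 2 * (A 2 0 * A 3 3 - A 2 3 * A 3 0) +
      A 1 3 * (A 2 0 * A 3 2 - A 2 2 * A 3 0)) +
    A 0 2 * (A 1 0 * (A 2 1 * A 3 3 - A 2 3 * A 3 1) - A 1 1 * (A 2 0 * A 3 3 - A 2 3 * A 3 0) +
      A 1 3 * (A 2 0 * A 3 1 - A 2 1 * A 3 0)) -
    A 0 3 * (A 1 0 * (A 2 1 * A 3 2 - A 2 2 * A 3 1) - A 1 1 * (A 2 0 * A 3 2 - A 2 2 * A 3 0) +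
      A 1 2 * (A 2 0 * A 3 1 - A 2 1 * A 3 0)) := by
  rw [Matrix.det_succ_row_zero]
  simp [Fin.sum_univ_succ, Matrix.det_fin_three, Fin.succAbove]
  ring

/-- The numbers are the entries of a skew orthogonal `4 × 4` matrix. Its Pfaffian `af - be + cd` has
square `1`, and the sign hypothesis makes it `1`. Then `(a - f)² + (b + e)² + (c - d)²` is zero,
which is self-duality. -/
theorem selfDual_coefficients {a b c d e f : ℝ} (h1 : a * a + b * b + c * c = 1)
    (h2 : b * d + c * e = 0) (h3 : a * d = c * f) (h4 : a * e + b * f = 0)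
    (h5 : a * a + d * d + e * e = 1) (h6 : b * b + d * d + f * f = 1)
    (h7 : c * c + e * e + f * f = 1) (hp : 0 ≤ a * f - b * e + c * d) :
    f = a ∧ e = -b ∧ d = c := by
  have k1 : f * f = a * a := by linarith
  have k2 : e * e = b * b := by linarith
  have k3 : d * d = c * c := by linarith
  have hP : (a * f - b * e + c * d) ^ 2 = 1 := by
    linear_combination (a * a + b * b + c * c + 1) * h1 + a * a * k1 + b * b * k2 + c * c * k3 -
      2 * (b * f) * h4 + 2 * (c * f) * h3 - 2 * (c * e) * h2 + (2 * b * b + 2 * c * c) * k1 +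
      2 * c * c * k2
  have hP1 : a * f - b * e + c * d = 1 := by nlinarith
  have hs : (a - f) ^ 2 + (b + e) ^ 2 + (c - d) ^ 2 = 0 := by
    linear_combination 2 * h1 + k1 + k2 + k3 - 2 * hP1
  have z1 := sq_nonneg (a - f)
  have z2 := sq_nonneg (b + e)
  have z3 := sq_nonneg (c - d)
  have y1 : a - f = 0 := pow_eq_zero_iff two_ne_zero |>.1 (by linarith)
  have y2 : b + e = 0 := pow_eq_zero_iff two_ne_zero |>.1 (by linarith)
  have y3 : c - d = 0 := pow_eq_zero_iff two_ne_zero |>.1 (by linarith)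
  exact ⟨by linarith, by linarith, by linarith⟩

/-- Orthogonal complex structures on `ℂ²` that induce its orientation are self-dual. -/
theorem exists_selfDual_of_positive {q : EndV (ℂ × ℂ)} (hq : ∀ z w, ipC (q z) (q w) = ipC z w)
    (hq2 : ∀ z, q (q z) = -z)
    (hpos : ∀ z w, 0 ≤ stdBasis.det ![kappa.symm z, kappa.symm (q z), kappa.symm w,
      kappa.symm (q w)]) :
    ∃ t s, t ^ 2 + Complex.normSq s = 1 ∧ q = selfDual t s := by
  have hsk : ∀ z w, ipC (q z) w = -ipC z (q w) := fun z w => by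
    have := hq z (q w)
    rw [hq2, map_neg] at this
    linarith
  set q0 := q (1, 0) with h0
  set q1 := q (Complex.I, 0) with h1
  set q2 := q (0, 1) with h2
  set q3 := q (0, Complex.I) with h3
  have hexp : ∀ z, q z = z.1.re • q0 + z.1.im • q1 + z.2.re • q2 + z.2.im • q3 := by
    intro z
    have : z = z.1.re • ((1, 0) : ℂ × ℂ) + z.1.im • ((Complex.I, 0) : ℂ × ℂ) +
        z.2.re • ((0, 1) : ℂ × ℂ) + z.2.im • ((0, Complex.I) : ℂ × ℂ) := by
      refine Prod.ext (Complex.ext ?_ ?_) (Complex.ext ?_ ?_) <;> simp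
    conv_lhs => rw [this]
    simp only [map_add, map_smul, h0, h1, h2, h3]
  have s00 := hsk (1, 0) (1, 0)
  have s01 := hsk (1, 0) (Complex.I, 0)
  have s02 := hsk (1, 0) (0, 1)
  have s03 := hsk (1, 0) (0, Complex.I)
  have s11 := hsk (Complex.I, 0) (Complex.I, 0)
  have s12 := hsk (Complex.I, 0) (0, 1)
  have s13 := hsk (Complex.I, 0) (0, Complex.I)
  have s22 := hsk (0, 1) (0, 1)
  have s23 := hsk (0, 1) (0, Complex.I)
  have s33 := hsk (0, Complex.I) (0, Complex.I)
  have n0 := hq2 (1, 0)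
  have n1 := hq2 (Complex.I, 0)
  have n2 := hq2 (0, 1)
  have n3 := hq2 (0, Complex.I)
  rw [← h0, hexp q0] at n0
  rw [← h1, hexp q1] at n1
  rw [← h2, hexp q2] at n2
  rw [← h3, hexp q3] at n3
  -- Each of the three orientation conditions is the nonnegativity of a sum of two of the three
  -- terms of the Pfaffian. Their sum is twice the Pfaffian.
  have d1 := hpos (1, 0) (Complex.I, 0)
  have d2 := hpos (1, 0) (0, 1)
  have d3 := hpos (1, 0) (0, Complex.I)
  simp only [← h0, ← h1, ← h2, ← h3] at s00 s01 s02 s03 s11 s12 s13 s22 s23 s33 d1 d2 d3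
  have hk : ∀ z, kappa.symm z = !₂[z.1.re, z.1.im, z.2.re, z.2.im] := fun z => rfl
  simp only [Module.Basis.det_apply, det_fin_four, Module.Basis.toMatrix_apply,
    OrthonormalBasis.coe_toBasis_repr_apply, EuclideanSpace.basisFun_repr] at d1 d2 d3
  simp [hk] at d1 d2 d3
  simp [ipC_apply] at s00 s01 s02 s03 s11 s12 s13 s22 s23 s33
  simp only [Prod.ext_iff, Complex.ext_iff] at n0 n1 n2 n3
  simp at n0 n1 n2 n3
  obtain ⟨⟨e1, e2⟩, e3, e4⟩ := n0
  obtain ⟨⟨-, e5⟩, -, -⟩ := n1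
  obtain ⟨-, e6, -⟩ := n2
  obtain ⟨-, -, e7⟩ := n3
  have r00 : q0.1.re = 0 := by linarith
  have r11 : q1.1.im = 0 := by linarith
  have r22 : q2.2.re = 0 := by linarith
  have r33 : q3.2.im = 0 := by linarith
  have r10 : q1.1.re = -q0.1.im := by linarith
  have r20 : q2.1.re = -q0.2.re := by linarith
  have r30 : q3.1.re = -q0.2.im := by linarith
  have r21 : q2.1.im = -q1.2.re := by linarith
  have r31 : q3.1.im = -q1.2.im := by linarith
  have r32 : q3.2.re = -q2.2.im := by linarith
  simp only [r00, r11, r22, r33, r10, r20, r30, r21, r31, r32] at e1 e2 e3 e4 e5 e6 e7 d1 d2 d3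
  obtain ⟨hf, he, hd⟩ := selfDual_coefficients (a := q0.1.im) (b := q0.2.re) (c := q0.2.im)
    (d := q1.2.re) (e := q1.2.im) (f := q2.2.im) (by linarith) (by linarith) (by linarith)
    (by linarith) (by linarith) (by linarith) (by linarith) (by linarith)
  refine ⟨q0.1.im, -q0.2, ?_, ?_⟩
  · rw [Complex.normSq_neg, Complex.normSq_apply]
    linarith
  · refine ContinuousLinearMap.ext fun z => ?_
    rw [hexp z, selfDual_apply]
    refine Prod.ext (Complex.ext ?_ ?_) (Complex.ext ?_ ?_) <;>
      simp [r00, r11, r22, r33, r10, r20, r30, r21, r31, r32, hf, he, hd] <;> ring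

/-! ### Curvature of four-dimensional metrics -/

section Curvature

variable {E : Type*} [NormedAddCommGroup E] [NormedSpace ℝ E] [FiniteDimensional ℝ E]
  {G : E → Bil E} {Ω : Set E}

theorem curvature_antisymm (G : E → Bil E) (x u v : E) : curvature G x u v = -curvature G x v u := by
  simp only [curvature]
  abel

/-- The first Bianchi identity. -/
theorem IsMetricOn.curvature_bianchi (hG : IsMetricOn G Ω) (hΩ : IsOpen Ω) {x : E} (hx : x ∈ Ω)
    (u v w : E) : curvature G x u v w + curvature G x v w u + curvature G x w u v = 0 := by
  have hs := fun u v => hG.christoffel_symm hΩ hx u v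
  have hd : DifferentiableAt ℝ (christoffel G) x :=
    IsMovingFrame.differentiableAt_of hΩ (hG.contDiffOn_christoffel hΩ) hx
  have hs' : ∀ y v w, fderiv ℝ (christoffel G) x y v w = fderiv ℝ (christoffel G) x y w v := by
    intro y v w
    have h1 := (hasDerivAt_line_apply hd y v).clm_apply (hasDerivAt_const 0 w)
    have h2 := (hasDerivAt_line_apply hd y w).clm_apply (hasDerivAt_const 0 v)
    simp only [map_zero, add_zero] at h1 h2
    refine h1.unique (h2.congr_of_eventuallyEq ?_)
    have hc : ContinuousAt (fun t : ℝ => x + t • y) 0 := by fun_prop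
    have : ∀ᶠ t : ℝ in 𝓝 0, x + t • y ∈ Ω :=
      hc.preimage_mem_nhds (hΩ.mem_nhds (by simpa using hx))
    filter_upwards [this] with t ht using hG.christoffel_symm hΩ ht v w
  simp only [curvature, add_apply, sub_apply, mul_apply_eq_comp]
  rw [hs' u w v, hs' v w u, hs' w v u, hs w u, hs u v, hs v w]
  abel

/-- Pair symmetry of algebraic curvature tensors. -/
theorem curvature_pair_symm {V : Type*} {R : V → V → V → V → ℝ}
    (h12 : ∀ u v w z, R u v w z = -R v u w z) (h34 : ∀ u v w z, R u v w z = -R u v z w)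
    (hb : ∀ u v w z, R u v w z + R v w u z + R w u v z = 0) (u v w z : V) :
    R u v w z = R w z u v := by
  -- The octahedron argument: the Bianchi identity with each of the four vectors in turn in the last
  -- place.
  have b1 := hb u v w z
  have b2 := hb v w z u
  have b3 := hb w z u v
  have b4 := hb z u v w
  rw [h34 v w z u, h34 w z v u, h12 z v w u, h34 v z w u] at b2
  rw [h12 z u w v, h34 u z w v, h12 u w z v, h34 w u z v] at b3
  rw [h12 z u v w, h34 u v z w] at b4
  linarith [h34 u z v w, h34 v z u w]

/-- The Ricci tensor as a sum over an orthonormal frame. -/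
theorem ricci_eq_sum (hE : Module.finrank ℝ E = 4) {x : E} {f : Fin 4 → E}
    (hf : ∀ i j, G x (f i) (f j) = if i = j then 1 else 0) (u v : E) :
    ricci G x u v = ∑ i, curvature4 G x (f i) u v (f i) := by
  rw [ricci, trace_eq_sum_inner (G x) hf hE.symm]
  rfl

/-- A hyper-Hermitian structure: three orthogonal complex structures with the relations of the
quaternions. -/
structure IsQuaternionic (B : Bil E) (q₁ q₂ q₃ : EndV E) : Prop where
  skew₁ : ∀ u v, B (q₁ u) v = -B u (q₁ v)
  skew₂ : ∀ u v, B (q₂ u) v = -B u (q₂ v)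
  skew₃ : ∀ u v, B (q₃ u) v = -B u (q₃ v)
  sq₁ : ∀ u, q₁ (q₁ u) = -u
  sq₂ : ∀ u, q₂ (q₂ u) = -u
  sq₃ : ∀ u, q₃ (q₃ u) = -u
  mul₁₂ : ∀ u, q₁ (q₂ u) = q₃ u
  mul₂₃ : ∀ u, q₂ (q₃ u) = q₁ u
  mul₃₁ : ∀ u, q₃ (q₁ u) = q₂ u

theorem IsQuaternionic.orthonormal {B : Bil E} {q₁ q₂ q₃ : EndV E} (h : IsQuaternionic B q₁ q₂ q₃)
    (hs : ∀ u v, B u v = B v u) {u : E} (hu : B u u = 1) (i j : Fin 4) :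
    B ((![u, q₁ u, q₂ u, q₃ u] : Fin 4 → E) i) ((![u, q₁ u, q₂ u, q₃ u] : Fin 4 → E) j) =
      if i = j then 1 else 0 := by
  have a1 : B u (q₁ u) = 0 := by have := h.skew₁ u u; rw [hs] at this; linarith
  have a2 : B u (q₂ u) = 0 := by have := h.skew₂ u u; rw [hs] at this; linarith
  have a3 : B u (q₃ u) = 0 := by have := h.skew₃ u u; rw [hs] at this; linarith
  have n1 : B (q₁ u) (q₁ u) = 1 := by rw [h.skew₁, h.sq₁, map_neg, hu, neg_neg]
  have n2 : B (q₂ u) (q₂ u) = 1 := by rw [h.skew₂, h.sq₂, map_neg, hu, neg_neg]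
  have n3 : B (q₃ u) (q₃ u) = 1 := by rw [h.skew₃, h.sq₃, map_neg, hu, neg_neg]
  have c12 : B (q₁ u) (q₂ u) = 0 := by rw [h.skew₁, h.mul₁₂, a3, neg_zero]
  have c23 : B (q₂ u) (q₃ u) = 0 := by rw [h.skew₂, h.mul₂₃, a1, neg_zero]
  have c31 : B (q₃ u) (q₁ u) = 0 := by rw [h.skew₃, h.mul₃₁, a2, neg_zero]
  fin_cases i <;> fin_cases j <;>
    simp [a1, a2, a3, n1, n2, n3, c12, c23, c31, hu, hs (q₁ u) u, hs (q₂ u) u, hs (q₃ u) u,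
      hs (q₂ u) (q₁ u), hs (q₃ u) (q₂ u), hs (q₁ u) (q₃ u)]

/-- A metric of dimension four such that `tr (R(u,v) q) = C g(q u, v)` for all `q` of a hyper-Hermitian
structure satisfies the Einstein equation. -/
theorem ricci_eq_of_quaternionic (hE : Module.finrank ℝ E = 4) (hG : IsMetricOn G Ω)
    (hΩ : IsOpen Ω) {x : E} (hx : x ∈ Ω)
    (h34 : ∀ u v w z, curvature4 G x u v w z = -curvature4 G x u v z w) {q₁ q₂ q₃ : EndV E}
    (hq : IsQuaternionic (G x) q₁ q₂ q₃) {C : ℝ}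
    (hC₁ : ∀ u v, LinearMap.trace ℝ E (curvature G x u v * q₁).toLinearMap = C * G x (q₁ u) v)
    (hC₂ : ∀ u v, LinearMap.trace ℝ E (curvature G x u v * q₂).toLinearMap = C * G x (q₂ u) v)
    (hC₃ : ∀ u v, LinearMap.trace ℝ E (curvature G x u v * q₃).toLinearMap = C * G x (q₃ u) v)
    (u v : E) : ricci G x u v = 3 * C / 2 * G x u v := by
  have hs := hG.symm x hx
  have h12 : ∀ u v w z, curvature4 G x u v w z = -curvature4 G x v u w z := fun u v w z => by
    simp only [curvature4]
    rw [curvature_antisymm]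
    simp
  have hb : ∀ u v w z, curvature4 G x u v w z + curvature4 G x v w u z + curvature4 G x w u v z = 0 :=
    fun u v w z => by
    have := congrArg (fun y => G x y z) (hG.curvature_bianchi hΩ hx u v w)
    simpa [curvature4] using this
  have hpair := curvature_pair_symm h12 h34 hb
  -- In the frame `u, q₁u, q₂u, q₃u` the trace identity for the pair `(u, qᵢu)` equates `C` with
  -- twice the sectional term of that pair plus twice a term with four distinct vectors. The latter
  -- terms add up to zero by the Bianchi identity, so `2 Ric(u, u) = 3C`. Homogeneity and
  -- polarisation give the general case.
  have hunit : ∀ u, G x u u = 1 → ricci G x u u = 3 * C / 2 := by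
    intro u hu
    have hON := hq.orthonormal hs hu
    rw [ricci_eq_sum hE hON, Fin.sum_univ_four]
    have t1 := trace_eq_sum_inner (G x) hON hE.symm (curvature G x u (q₁ u) * q₁).toLinearMap
    have t2 := trace_eq_sum_inner (G x) hON hE.symm (curvature G x u (q₂ u) * q₂).toLinearMap
    have t3 := trace_eq_sum_inner (G x) hON hE.symm (curvature G x u (q₃ u) * q₃).toLinearMap
    rw [hC₁, Fin.sum_univ_four] at t1
    rw [hC₂, Fin.sum_univ_four] at t2
    rw [hC₃, Fin.sum_univ_four] at t3
    have n1 := hON 1 1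
    have n2 := hON 2 2
    have n3 := hON 3 3
    change G x (q₁ u) (q₁ u) = 1 at n1
    change G x (q₂ u) (q₂ u) = 1 at n2
    change G x (q₃ u) (q₃ u) = 1 at n3
    have m21 : q₂ (q₁ u) = -q₃ u := by rw [← hq.mul₂₃, hq.sq₂]
    have m32 : q₃ (q₂ u) = -q₁ u := by rw [← hq.mul₃₁, hq.sq₃]
    have m13 : q₁ (q₃ u) = -q₂ u := by rw [← hq.mul₁₂, hq.sq₁]
    rw [n1] at t1
    rw [n2] at t2
    rw [n3] at t3
    change C * 1 = G x (curvature G x u (q₁ u) (q₁ u)) u +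
      G x (curvature G x u (q₁ u) (q₁ (q₁ u))) (q₁ u) +
      G x (curvature G x u (q₁ u) (q₁ (q₂ u))) (q₂ u) +
      G x (curvature G x u (q₁ u) (q₁ (q₃ u))) (q₃ u) at t1
    change C * 1 = G x (curvature G x u (q₂ u) (q₂ u)) u +
      G x (curvature G x u (q₂ u) (q₂ (q₁ u))) (q₁ u) +
      G x (curvature G x u (q₂ u) (q₂ (q₂ u))) (q₂ u) +
      G x (curvature G x u (q₂ u) (q₂ (q₃ u))) (q₃ u) at t2
    change C * 1 = G x (curvature G x u (q₃ u) (q₃ u)) u +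
      G x (curvature G x u (q₃ u) (q₃ (q₁ u))) (q₁ u) +
      G x (curvature G x u (q₃ u) (q₃ (q₂ u))) (q₂ u) +
      G x (curvature G x u (q₃ u) (q₃ (q₃ u))) (q₃ u) at t3
    rw [hq.sq₁, hq.mul₁₂, m13] at t1
    rw [hq.sq₂, hq.mul₂₃, m21] at t2
    rw [hq.sq₃, hq.mul₃₁, m32] at t3
    simp only [map_neg, neg_apply] at t1 t2 t3
    change _ = curvature4 G x u (q₁ u) (q₁ u) u + -curvature4 G x u (q₁ u) u (q₁ u) +
      curvature4 G x u (q₁ u) (q₃ u) (q₂ u) + -curvature4 G x u (q₁ u) (q₂ u) (q₃ u) at t1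
    change _ = curvature4 G x u (q₂ u) (q₂ u) u + -curvature4 G x u (q₂ u) (q₃ u) (q₁ u) +
      -curvature4 G x u (q₂ u) u (q₂ u) + curvature4 G x u (q₂ u) (q₁ u) (q₃ u) at t2
    change _ = curvature4 G x u (q₃ u) (q₃ u) u + curvature4 G x u (q₃ u) (q₂ u) (q₁ u) +
      -curvature4 G x u (q₃ u) (q₁ u) (q₂ u) + -curvature4 G x u (q₃ u) u (q₃ u) at t3
    change curvature4 G x u u u u + curvature4 G x (q₁ u) u u (q₁ u) +
      curvature4 G x (q₂ u) u u (q₂ u) + curvature4 G x (q₃ u) u u (q₃ u) = _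
    have b := hb (q₁ u) (q₂ u) (q₃ u) u
    rw [hpair (q₁ u) (q₂ u) (q₃ u) u, hpair (q₂ u) (q₃ u) (q₁ u) u,
      hpair (q₃ u) (q₁ u) (q₂ u) u, h12 (q₃ u) u, h12 (q₁ u) u, h12 (q₂ u) u] at b
    have z := h12 u u u u
    linarith [h34 u (q₁ u) (q₁ u) u, h34 u (q₂ u) (q₂ u) u, h34 u (q₃ u) (q₃ u) u,
      h34 u (q₁ u) (q₃ u) (q₂ u), h34 u (q₂ u) (q₁ u) (q₃ u), h34 u (q₃ u) (q₂ u) (q₁ u),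
      h12 (q₁ u) u u (q₁ u), h12 (q₂ u) u u (q₂ u), h12 (q₃ u) u u (q₃ u)]
  -- With an empty family this provides some unit vector, whose frame is used only to see that
  -- `ricci` is bilinear and symmetric.
  obtain ⟨e, he, -⟩ := exists_unit_orthogonal (B := G x) (hG.pos x hx) (n := 0) Fin.elim0 (by omega)
  have hON := hq.orthonormal hs he
  have radd : ∀ u v w, ricci G x (u + v) w = ricci G x u w + ricci G x v w := fun u v w => by
    simp only [ricci_eq_sum hE hON, Fin.sum_univ_four, curvature4, curvature, map_add, map_sub, add_apply,
      sub_apply, mul_apply_eq_comp]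
    ring
  have rsymm : ∀ u v, ricci G x u v = ricci G x v u := fun u v => by
    rw [ricci_eq_sum hE hON, ricci_eq_sum hE hON]
    refine Finset.sum_congr rfl fun i _ => ?_
    rw [hpair, h12, h34, neg_neg]
  have rsmul : ∀ (t : ℝ) u v, ricci G x (t • u) v = t * ricci G x u v := fun t u v => by
    simp only [ricci_eq_sum hE hON, Fin.sum_univ_four, curvature4, curvature, map_smul, smul_apply,
      add_apply, sub_apply, mul_apply_eq_comp, map_add, map_sub, smul_eq_mul]
    ring
  have rzero : ∀ v, ricci G x 0 v = 0 := fun v => by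
    have := rsmul 0 0 v
    rwa [zero_smul, zero_mul] at this
  have hdiag : ∀ u, ricci G x u u = 3 * C / 2 * G x u u := by
    intro u
    by_cases hu : u = 0
    · rw [hu, rzero]; simp
    · obtain ⟨t, ht⟩ := exists_unit_of_ne_zero (hG.pos x hx) hu
      have h1 := hunit _ ht
      rw [rsmul, rsymm, rsmul] at h1
      simp only [map_smul, smul_apply, smul_eq_mul] at ht
      have ht0 : t ≠ 0 := by rintro rfl; simp at ht
      have : t * t * (ricci G x u u - 3 * C / 2 * G x u u) = 0 := by
        linear_combination h1 - 3 * C / 2 * ht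
      have h2 := (mul_eq_zero.1 this).resolve_left (mul_ne_zero ht0 ht0)
      linarith
  have h1 := hdiag (u + v)
  rw [radd, rsymm u, rsymm v, radd, radd, hdiag u, hdiag v, rsymm v u] at h1
  simp only [map_add, add_apply] at h1
  rw [hs v u] at h1
  linarith

/-- The scalar curvature of an Einstein metric of dimension four. -/
theorem scal_eq_of_ricci (hE : Module.finrank ℝ E = 4) (hG : IsMetricOn G Ω) {x : E} (hx : x ∈ Ω)
    {k : ℝ} (hk : ∀ u v, ricci G x u v = k * G x u v) : scal G x = 4 * k := by
  have hs := hG.symm x hx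
  simp only [scal, hk]
  have h1 : ∀ i, G x (Module.finBasis ℝ E i) (ContinuousLinearMap.inverse (G x)
      (LinearMap.toContinuousLinearMap ((Module.finBasis ℝ E).coord i))) = 1 := fun i => by
    rw [hs, apply_inverse_of_pos (hG.pos x hx)]
    simp
  simp only [h1, Finset.sum_const, Finset.card_univ, Fintype.card_fin, hE]
  simp

/-- The complex structure that rotates the planes `f₀ ∧ f₁` and `f₂ ∧ f₃`. -/
def frameRotation (B : Bil E) (f : Fin 4 → E) : EndV E :=
  (B.flip (f 0)).smulRight (f 1) - (B.flip (f 1)).smulRight (f 0) +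
    ((B.flip (f 2)).smulRight (f 3) - (B.flip (f 3)).smulRight (f 2))

theorem frameRotation_apply (B : Bil E) (f : Fin 4 → E) (u : E) : frameRotation B f u =
    B u (f 0) • f 1 - B u (f 1) • f 0 + (B u (f 2) • f 3 - B u (f 3) • f 2) := rfl

/-- The self-dual part of the Weyl tensor of a metric satisfying the equations of
`ricci_eq_of_quaternionic` vanishes. -/
theorem weyl_add_eq_zero (hE : Module.finrank ℝ E = 4) (hG : IsMetricOn G Ω)
    (hΩ : IsOpen Ω) {x : E} (hx : x ∈ Ω)
    (h34 : ∀ u v w z, curvature4 G x u v w z = -curvature4 G x u v z w) {C : ℝ}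
    (hk : ∀ u v, ricci G x u v = 3 * C / 2 * G x u v) {f : Fin 4 → E}
    (hf : ∀ i j, G x (f i) (f j) = if i = j then 1 else 0)
    (hC : ∀ u v, LinearMap.trace ℝ E (curvature G x u v * frameRotation (G x) f).toLinearMap =
      C * G x (frameRotation (G x) f u) v) (u v : E) :
    weyl G x (f 0) (f 1) u v + weyl G x (f 2) (f 3) u v = 0 := by
  have hs := hG.symm x hx
  have h12 : ∀ u v w z, curvature4 G x u v w z = -curvature4 G x v u w z := fun u v w z => by
    simp only [curvature4]
    rw [curvature_antisymm]
    simp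
  have hb : ∀ u v w z, curvature4 G x u v w z + curvature4 G x v w u z + curvature4 G x w u v z = 0 :=
    fun u v w z => by
    have := congrArg (fun y => G x y z) (hG.curvature_bianchi hΩ hx u v w)
    simpa [curvature4] using this
  have hpair := curvature_pair_symm h12 h34 hb
  have hscal := scal_eq_of_ricci hE hG hx hk
  have hq : ∀ i, frameRotation (G x) f (f i) = (![f 1, -f 0, f 3, -f 2] : Fin 4 → E) i := by
    intro i
    rw [frameRotation_apply]
    fin_cases i <;> simp [hf]
  have t := hC u v
  rw [trace_eq_sum_inner (G x) hf hE.symm, Fin.sum_univ_four] at t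
  change G x (curvature G x u v (frameRotation (G x) f (f 0))) (f 0) +
    G x (curvature G x u v (frameRotation (G x) f (f 1))) (f 1) +
    G x (curvature G x u v (frameRotation (G x) f (f 2))) (f 2) +
    G x (curvature G x u v (frameRotation (G x) f (f 3))) (f 3) = _ at t
  rw [hq, hq, hq, hq] at t
  change G x (curvature G x u v (f 1)) (f 0) + G x (curvature G x u v (-f 0)) (f 1) +
    G x (curvature G x u v (f 3)) (f 2) + G x (curvature G x u v (-f 2)) (f 3) = _ at t
  simp only [map_neg, neg_apply] at t
  change curvature4 G x u v (f 1) (f 0) + -curvature4 G x u v (f 0) (f 1) +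
    curvature4 G x u v (f 3) (f 2) + -curvature4 G x u v (f 2) (f 3) = _ at t
  rw [frameRotation_apply] at t
  simp only [map_add, map_sub, map_smul, add_apply, sub_apply, smul_apply, smul_eq_mul] at t
  -- By pair symmetry the trace identity says that the curvature sends `f₀ ∧ f₁ + f₂ ∧ f₃` to a
  -- multiple of itself; for an Einstein metric the Ricci and scalar terms of the Weyl tensor
  -- subtract exactly this multiple.
  simp only [weyl, kulkarniNomizu, hk, hscal]
  rw [hpair (f 0) (f 1), hpair (f 2) (f 3)]
  have s1 := h34 u v (f 1) (f 0)
  have s2 := h34 u v (f 3) (f 2)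
  rw [hs u (f 0), hs u (f 1), hs u (f 2), hs u (f 3)] at t
  linear_combination (-1 / 2) * t + (1 / 2) * s1 + (1 / 2) * s2

/-- The complex structures of positive orthonormal frames induce the orientation. -/
theorem det_frameRotation_nonneg (hE : Module.finrank ℝ E = 4) (b : Module.Basis (Fin 4) ℝ E)
    {B : Bil E} {f : Fin 4 → E} (hf : IsOrientedOrthonormal b B f) (u v : E) :
    0 ≤ b.det ![u, frameRotation B f u, v, frameRotation B f v] := by
  obtain ⟨b', hb', hbr⟩ := exists_basis_of_orthonormal B hf.1 hE.symm
  have h1 := AlternatingMap.eq_smul_basis_det b' b.det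
  have h2 : b.det b' = b.det f := by congr 1; exact funext hb'
  rw [h1, AlternatingMap.smul_apply, h2, smul_eq_mul]
  refine mul_nonneg hf.2.le ?_
  have hr : ∀ u i, b'.repr (frameRotation B f u) i =
      (![-B u (f 1), B u (f 0), -B u (f 3), B u (f 2)] : Fin 4 → ℝ) i := by
    intro u i
    rw [hbr, frameRotation_apply]
    simp only [map_add, map_sub, map_smul, add_apply, sub_apply, smul_apply, smul_eq_mul, hf.1]
    fin_cases i <;> simp
  rw [Module.Basis.det_apply, det_fin_four]
  simp only [Module.Basis.toMatrix_apply]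
  simp [hr, hbr]
  -- In frame coordinates the determinant is the squared modulus of a complex `2 × 2` determinant,
  -- that is, this sum of two squares.
  have e : ∀ a0 a1 a2 a3 c0 c1 c2 c3 : ℝ, 0 ≤ (a0 * c2 - a1 * c3 - a2 * c0 + a3 * c1) ^ 2 +
    (a0 * c3 + a1 * c2 - a2 * c1 - a3 * c0) ^ 2 := fun a0 a1 a2 a3 c0 c1 c2 c3 => by positivity
  refine (e (B u (f 0)) (B u (f 1)) (B u (f 2)) (B u (f 3)) (B v (f 0)) (B v (f 1)) (B v (f 2))
    (B v (f 3))).trans (le_of_eq ?_)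
  ring

end Curvature

/-! ### The leaf space -/

/-- The horizontal part of the coframe. -/
def FrameData.hor (m : FrameData (R4 × ℂ)) (z : R4 × ℂ) : R4 →L[ℝ] ℂ × ℂ :=
  (ContinuousLinearMap.inl ℝ ℂ ℂ).comp ((m.θ₁ z).comp (ContinuousLinearMap.inl ℝ R4 ℂ)) +
    (ContinuousLinearMap.inr ℝ ℂ ℂ).comp ((m.θ₂ z).comp (ContinuousLinearMap.inl ℝ R4 ℂ))

theorem FrameData.hor_apply (m : FrameData (R4 × ℂ)) (z : R4 × ℂ) (k : R4) :
    m.hor z k = (m.θ₁ z (k, 0), m.θ₂ z (k, 0)) := by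
  refine Prod.ext ?_ ?_ <;> simp [FrameData.hor]

/-- The connection form of the leaf space in the coframe `hor`. -/
def FrameData.conn (m : FrameData (R4 × ℂ)) (f₀ : ℂ) (z : R4 × ℂ) :
    (R4 × ℂ) →L[ℝ] EndV (ℂ × ℂ) :=
  let e : ℂ →L[ℝ] ℂ × ℂ × ℂ × ℂ := ContinuousLinearMap.inl ℝ ℂ (ℂ × ℂ × ℂ)
  let r : ℂ × ℂ × ℂ →L[ℝ] ℂ × ℂ × ℂ × ℂ := ContinuousLinearMap.inr ℝ ℂ (ℂ × ℂ × ℂ)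
  let r' : ℂ × ℂ →L[ℝ] ℂ × ℂ × ℂ := ContinuousLinearMap.inr ℝ ℂ (ℂ × ℂ)
  (omL.comp e).comp (m.a z) +
    (omL.comp (r.comp (ContinuousLinearMap.inl ℝ ℂ (ℂ × ℂ)))).comp (m.b z) +
    (omL.comp (r.comp (r'.comp (ContinuousLinearMap.inl ℝ ℂ ℂ)))).comp (m.c z) +
    (omL.comp (r.comp (r'.comp ((ContinuousLinearMap.inr ℝ ℂ ℂ).comp
      ((ContinuousLinearMap.mul ℝ ℂ f₀).comp Complex.conjCLE.toContinuousLinearMap))))).comp (m.θ₃ z)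

theorem FrameData.conn_apply (m : FrameData (R4 × ℂ)) (f₀ : ℂ) (z X : R4 × ℂ) :
    m.conn f₀ z X = omL (m.a z X, m.b z X, m.c z X, f₀ * cj (m.θ₃ z X)) := by
  have : (m.a z X, m.b z X, m.c z X, f₀ * cj (m.θ₃ z X)) =
      (m.a z X, 0, 0, 0) + (0, m.b z X, 0, 0) + (0, 0, m.c z X, 0) +
        (0, 0, 0, f₀ * cj (m.θ₃ z X)) := by simp
  rw [this, map_add, map_add, map_add]
  rfl

/-- A moving frame in coordinates `(k, d)` for which the leaves of the distribution `θ₁ = θ₂ = 0` are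
the sets `{k} × B₂`. -/
structure IsLeafFrame (m : FrameData (R4 × ℂ)) (f₀ : ℂ) (B₁ : Set R4) (B₂ : Set ℂ) : Prop where
  open₁ : IsOpen B₁
  open₂ : IsOpen B₂
  convex₂ : Convex ℝ B₂
  zero_mem : (0 : ℂ) ∈ B₂
  moving : IsMovingFrame m (B₁ ×ˢ B₂)
  vertical₁ : ∀ z ∈ B₁ ×ˢ B₂, ∀ w, m.θ₁ z (0, w) = 0
  vertical₂ : ∀ z ∈ B₁ ×ˢ B₂, ∀ w, m.θ₂ z (0, w) = 0
  f_eq : ∀ z ∈ B₁ ×ˢ B₂, m.f z = f₀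
  f_ne : f₀ ≠ 0
  det_pos : ∀ z ∈ B₁ ×ˢ B₂,
    0 < LinearMap.det (kappa.symm.toContinuousLinearMap.comp (m.hor z)).toLinearMap

/-! ### The horizontal coframe and its first structure equation. -/

namespace IsLeafFrame

variable {m : FrameData (R4 × ℂ)} {f₀ : ℂ} {B₁ : Set R4} {B₂ : Set ℂ}

theorem isOpen (h : IsLeafFrame m f₀ B₁ B₂) : IsOpen (B₁ ×ˢ B₂) := h.open₁.prod h.open₂

theorem hor_eq (h : IsLeafFrame m f₀ B₁ B₂) {z : R4 × ℂ} (hz : z ∈ B₁ ×ˢ B₂) (X : R4 × ℂ) :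
    m.hor z X.1 = (m.θ₁ z X, m.θ₂ z X) := by
  have hX : X = (X.1, 0) + (0, X.2) := by simp
  conv_rhs => rw [hX]
  rw [FrameData.hor_apply, map_add, map_add, h.vertical₁ z hz, h.vertical₂ z hz, add_zero, add_zero]

theorem theta₃_bijective (h : IsLeafFrame m f₀ B₁ B₂) {z : R4 × ℂ} (hz : z ∈ B₁ ×ˢ B₂) :
    Function.Bijective fun w => m.θ₃ z (0, w) := by
  have hb := h.moving.bijective z hz
  have hinj : Function.Injective ((m.θ₃ z).comp (ContinuousLinearMap.inr ℝ R4 ℂ)).toLinearMap := by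
    refine (injective_iff_map_eq_zero _).2 fun w hw => ?_
    have : ((0, w) : R4 × ℂ) = 0 := hb.1 (by
      change (m.θ₁ z (0, w), m.θ₂ z (0, w), m.θ₃ z (0, w)) = (m.θ₁ z 0, m.θ₂ z 0, m.θ₃ z 0)
      rw [h.vertical₁ z hz, h.vertical₂ z hz, show m.θ₃ z (0, w) = 0 from hw]
      simp)
    exact congrArg Prod.snd this
  exact ⟨hinj, LinearMap.injective_iff_surjective.1 hinj⟩

/-- Horizontal lifts. -/
theorem exists_lift (h : IsLeafFrame m f₀ B₁ B₂) {z : R4 × ℂ} (hz : z ∈ B₁ ×ˢ B₂) (k : R4) :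
    ∃ w, m.θ₃ z (k, w) = 0 := by
  obtain ⟨w, hw⟩ := (h.theta₃_bijective hz).2 (-m.θ₃ z (k, 0))
  refine ⟨w, ?_⟩
  have : ((k, w) : R4 × ℂ) = (k, 0) + (0, w) := by simp
  rw [this, map_add]
  change _ + (fun w => m.θ₃ z (0, w)) w = 0
  rw [hw, add_neg_cancel]

theorem hor_injective (h : IsLeafFrame m f₀ B₁ B₂) {z : R4 × ℂ} (hz : z ∈ B₁ ×ˢ B₂) :
    Function.Injective (m.hor z) := by
  refine (injective_iff_map_eq_zero _).2 fun k hk => ?_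
  obtain ⟨w, hw⟩ := h.exists_lift hz k
  have h1 := h.hor_eq hz (k, w)
  rw [hk] at h1
  have : ((k, w) : R4 × ℂ) = 0 := (h.moving.bijective z hz).1 (by
    change (m.θ₁ z (k, w), m.θ₂ z (k, w), m.θ₃ z (k, w)) = (m.θ₁ z 0, m.θ₂ z 0, m.θ₃ z 0)
    rw [hw, show m.θ₁ z (k, w) = 0 from (congrArg Prod.fst h1).symm,
      show m.θ₂ z (k, w) = 0 from (congrArg Prod.snd h1).symm]
    simp)
  exact congrArg Prod.fst this

theorem exists_equiv (h : IsLeafFrame m f₀ B₁ B₂) {z : R4 × ℂ} (hz : z ∈ B₁ ×ˢ B₂) :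
    ∃ e : R4 ≃L[ℝ] ℂ × ℂ, (e : R4 →L[ℝ] ℂ × ℂ) = m.hor z := by
  have hr : Module.finrank ℝ R4 = Module.finrank ℝ (ℂ × ℂ) := by
    rw [finrank_C2, finrank_euclideanSpace_fin]
  exact ⟨(LinearEquiv.ofInjectiveOfFinrankEq (m.hor z).toLinearMap (h.hor_injective hz)
    hr).toContinuousLinearEquiv, rfl⟩

theorem inverse_hor (h : IsLeafFrame m f₀ B₁ B₂) {z : R4 × ℂ} (hz : z ∈ B₁ ×ˢ B₂) (k : R4) :
    (m.hor z).inverse (m.hor z k) = k := by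
  obtain ⟨e, he⟩ := h.exists_equiv hz
  rw [← he, ContinuousLinearMap.inverse_equiv]
  exact e.symm_apply_apply k

theorem hor_inverse (h : IsLeafFrame m f₀ B₁ B₂) {z : R4 × ℂ} (hz : z ∈ B₁ ×ˢ B₂) (w : ℂ × ℂ) :
    m.hor z ((m.hor z).inverse w) = w := by
  obtain ⟨e, he⟩ := h.exists_equiv hz
  rw [← he, ContinuousLinearMap.inverse_equiv]
  exact e.apply_symm_apply w

theorem contDiffOn_hor (h : IsLeafFrame m f₀ B₁ B₂) : ContDiffOn ℝ ∞ m.hor (B₁ ×ˢ B₂) :=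
  (contDiffOn_const.clm_comp (h.moving.smooth_θ₁.clm_comp contDiffOn_const)).add
    (contDiffOn_const.clm_comp (h.moving.smooth_θ₂.clm_comp contDiffOn_const))

theorem contDiffOn_conn (h : IsLeafFrame m f₀ B₁ B₂) : ContDiffOn ℝ ∞ (m.conn f₀) (B₁ ×ˢ B₂) :=
  (((contDiffOn_const.clm_comp h.moving.smooth_a).add
    (contDiffOn_const.clm_comp h.moving.smooth_b)).add
    (contDiffOn_const.clm_comp h.moving.smooth_c)).add (contDiffOn_const.clm_comp h.moving.smooth_θ₃)

theorem differentiableAt_hor (h : IsLeafFrame m f₀ B₁ B₂) {z : R4 × ℂ} (hz : z ∈ B₁ ×ˢ B₂) :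
    DifferentiableAt ℝ m.hor z :=
  IsMovingFrame.differentiableAt_of h.isOpen h.contDiffOn_hor hz

theorem conn_skew (h : IsLeafFrame m f₀ B₁ B₂) {z : R4 × ℂ} (hz : z ∈ B₁ ×ˢ B₂) (X : R4 × ℂ)
    (v w : ℂ × ℂ) : ipC (m.conn f₀ z X v) w = -ipC v (m.conn f₀ z X w) := by
  rw [FrameData.conn_apply]
  exact omL_skew (h.moving.conj_a z hz X) (h.moving.conj_c z hz X) v w

/-- The first structure equation. -/
theorem torsion (h : IsLeafFrame m f₀ B₁ B₂) {z : R4 × ℂ} (hz : z ∈ B₁ ×ˢ B₂) (X Y : R4 × ℂ) :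
    fderiv ℝ m.hor z X Y.1 - fderiv ℝ m.hor z Y X.1 =
      -(m.conn f₀ z X (m.hor z Y.1) - m.conn f₀ z Y (m.hor z X.1)) := by
  have d1 := IsMovingFrame.differentiableAt_of h.isOpen h.moving.smooth_θ₁ hz
  have d2 := IsMovingFrame.differentiableAt_of h.isOpen h.moving.smooth_θ₂ hz
  have key : ∀ X Y : R4 × ℂ, fderiv ℝ m.hor z X Y.1 =
      (fderiv ℝ m.θ₁ z X Y, fderiv ℝ m.θ₂ z X Y) := by
    intro X Y
    have e1 := hasDerivAt_line_apply (h.differentiableAt_hor hz) X Y.1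
    have e2 := (hasDerivAt_line_apply d1 X Y).prodMk (hasDerivAt_line_apply d2 X Y)
    refine e1.unique (e2.congr_of_eventuallyEq ?_)
    have hc : ContinuousAt (fun t : ℝ => z + t • X) 0 := by fun_prop
    filter_upwards [hc.preimage_mem_nhds (h.isOpen.mem_nhds (by simpa using hz))] with t ht
    exact h.hor_eq ht Y
  -- The torsion terms `f θ̄₂∧θ̄₃` and `f θ̄₃∧θ̄₁` are produced by the antilinear entry `f₀ θ̄₃` of
  -- `conn` acting on `(θ₁, θ₂)`, so no torsion is left over.
  have e1 := h.moving.d₁ z hz X Y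
  have e2 := h.moving.d₂ z hz X Y
  rw [key, key, h.hor_eq hz, h.hor_eq hz, FrameData.conn_apply, FrameData.conn_apply, omL_apply,
    omL_apply]
  rw [extd, h.f_eq z hz] at e1 e2
  refine Prod.ext ?_ ?_
  · simp only [Prod.fst_sub, Prod.fst_neg]
    linear_combination e1
  · simp only [Prod.snd_sub, Prod.snd_neg]
    linear_combination e2

/-- Along a fibre the coframe changes only by the skew endomorphism `conn`. This is what makes the
metric descend. -/
theorem fderiv_hor_vertical (h : IsLeafFrame m f₀ B₁ B₂) {z : R4 × ℂ} (hz : z ∈ B₁ ×ˢ B₂) (w : ℂ)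
    (k : R4) : fderiv ℝ m.hor z (0, w) k = -m.conn f₀ z (0, w) (m.hor z k) := by
  have := h.torsion hz (0, w) (k, 0)
  simpa using this

end IsLeafFrame

/-- The metric of the leaf space. -/
def FrameData.baseMetric (m : FrameData (R4 × ℂ)) (x : R4) : Bil R4 :=
  ipC.bilinearComp (m.hor (x, 0)) (m.hor (x, 0))

/-! ### Descent of the metric and identification of the Levi-Civita connection. -/

namespace IsLeafFrame

variable {m : FrameData (R4 × ℂ)} {f₀ : ℂ} {B₁ : Set R4} {B₂ : Set ℂ}

/-- By convexity the segment from `(x, 0)` to `z` stays in the fibre, and along it the derivative of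
the induced metric is zero because `conn` is skew. So the metric taken on the zero section is the
one seen at every point of the fibre. -/
theorem baseMetric_eq (h : IsLeafFrame m f₀ B₁ B₂) {z : R4 × ℂ} (hz : z ∈ B₁ ×ˢ B₂) (u v : R4) :
    m.baseMetric z.1 u v = ipC (m.hor z u) (m.hor z v) := by
  let φ : ℝ → ℝ := fun t => ipC (m.hor (z.1, t • z.2) u) (m.hor (z.1, t • z.2) v)
  have hmem : ∀ t ∈ Set.Icc (0 : ℝ) 1, (z.1, t • z.2) ∈ B₁ ×ˢ B₂ := fun t ht =>
    ⟨hz.1, h.convex₂.smul_mem_of_zero_mem h.zero_mem hz.2 ht⟩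
  have hd : ∀ t ∈ Set.Icc (0 : ℝ) 1, HasDerivAt φ 0 t := by
    intro t ht
    have hp : HasDerivAt (fun t : ℝ => (z.1, t • z.2)) ((0 : R4), z.2) t := by
      have h2 := (hasDerivAt_const t z.1).prodMk ((hasDerivAt_id t).smul_const z.2)
      rw [one_smul] at h2
      exact h2
    have hh := (h.differentiableAt_hor (hmem t ht)).hasFDerivAt.comp_hasDerivAt t hp
    have hu := hh.clm_apply (hasDerivAt_const t u)
    have hv := hh.clm_apply (hasDerivAt_const t v)
    simp only [map_zero, add_zero, Function.comp_apply] at hu hv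
    rw [h.fderiv_hor_vertical (hmem t ht)] at hu hv
    have := ((hasDerivAt_const t ipC).clm_apply hu).clm_apply hv
    refine this.congr_deriv ?_
    simp only [map_neg, add_apply, zero_apply, neg_apply, zero_add]
    rw [h.conn_skew (hmem t ht)]
    ring
  have hc := constant_of_has_deriv_right_zero (f := φ) (a := 0) (b := 1)
    (fun t ht => (hd t ht).continuousAt.continuousWithinAt)
    (fun t ht => (hd t ⟨ht.1, ht.2.le⟩).hasDerivWithinAt) 1 (by simp)
  simp only [φ, one_smul, zero_smul] at hc
  exact hc.symm

theorem isMetricOn (h : IsLeafFrame m f₀ B₁ B₂) : IsMetricOn m.baseMetric B₁ where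
  smooth := by
    have h1 : ContDiffOn ℝ ∞ (fun x : R4 => m.hor (x, 0)) B₁ :=
      h.contDiffOn_hor.comp (contDiff_id.prodMk contDiff_const).contDiffOn
        fun x hx => ⟨hx, h.zero_mem⟩
    have h2 : ∀ x, m.baseMetric x = (ContinuousLinearMap.flipₗᵢ ℝ R4 R4 ℝ)
        (((ContinuousLinearMap.flipₗᵢ ℝ R4 (ℂ × ℂ) ℝ) (ipC.comp (m.hor (x, 0)))).comp
          (m.hor (x, 0))) := fun x => by
      refine ContinuousLinearMap.ext fun u => ContinuousLinearMap.ext fun v => ?_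
      rfl
    rw [contDiffOn_congr fun x _ => h2 x]
    refine (ContinuousLinearMap.flipₗᵢ ℝ R4 R4 ℝ).toContinuousLinearEquiv.contDiff.comp_contDiffOn ?_
    exact ((ContinuousLinearMap.flipₗᵢ ℝ R4 (ℂ × ℂ) ℝ).toContinuousLinearEquiv.contDiff.comp_contDiffOn
      (contDiffOn_const.clm_comp h1)).clm_comp h1
  symm x _ u v := ipC_symm _ _
  pos x hx u hu := ipC_pos fun h0 => hu (h.hor_injective ⟨hx, h.zero_mem⟩ (h0.trans (map_zero _).symm))

/-- The coframe is parallel. -/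
theorem fderiv_hor (h : IsLeafFrame m f₀ B₁ B₂) {z : R4 × ℂ} (hz : z ∈ B₁ ×ˢ B₂) (X : R4 × ℂ)
    (k : R4) : fderiv ℝ m.hor z X k =
      m.hor z (christoffel m.baseMetric z.1 X.1 k) - m.conn f₀ z X (m.hor z k) := by
  -- The symbols for which the coframe is parallel, computed at `z`. They are symmetric since `conn`
  -- has no torsion and metric since it is skew, so they are the Christoffel symbols at `z.1`,
  -- whatever the point of the fibre.
  let Γ : R4 → R4 → R4 := fun u v =>
    (m.hor z).inverse (fderiv ℝ m.hor z (u, 0) v + m.conn f₀ z (u, 0) (m.hor z v))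
  have hΓ : ∀ u v, m.hor z (Γ u v) =
      fderiv ℝ m.hor z (u, 0) v + m.conn f₀ z (u, 0) (m.hor z v) := fun u v => h.hor_inverse hz _
  have hc : ∀ u v, christoffel m.baseMetric z.1 u v = Γ u v := by
    refine fun u v => christoffel_unique (h.isMetricOn.pos z.1 hz.1) (h.isMetricOn.symm z.1 hz.1)
      (fun u v => ?_) (fun u v w => ?_) u v
    · refine h.hor_injective hz ?_
      rw [hΓ, hΓ]
      linear_combination (norm := module) h.torsion hz (u, 0) (v, 0)
    · have hG := h.isMetricOn.differentiableAt h.open₁ hz.1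
      have e1 := (hasDerivAt_line_apply hG u v).clm_apply (hasDerivAt_const 0 w)
      have e2 := ((hasDerivAt_const 0 ipC).clm_apply
        (hasDerivAt_line_apply (h.differentiableAt_hor hz) (u, 0) v)).clm_apply
        (hasDerivAt_line_apply (h.differentiableAt_hor hz) (u, 0) w)
      have e3 := e1.unique (e2.congr_of_eventuallyEq ?_)
      · simp only [map_zero, add_zero, zero_smul, add_apply, zero_apply, zero_add] at e3
        rw [e3, h.baseMetric_eq hz, h.baseMetric_eq hz, hΓ, hΓ]
        simp only [map_add, add_apply]
        rw [h.conn_skew hz]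
        ring
      · have hc : ContinuousAt (fun t : ℝ => z + t • ((u, 0) : R4 × ℂ)) 0 := by fun_prop
        filter_upwards [hc.preimage_mem_nhds (h.isOpen.mem_nhds (by simpa using hz))] with t ht
        exact h.baseMetric_eq ht v w
  have hX : X = (X.1, 0) + (0, X.2) := by simp
  rw [hc, hΓ]
  conv_lhs => rw [hX]
  conv_rhs => rw [hX]
  rw [map_add, map_add, add_apply, add_apply, h.fderiv_hor_vertical hz]
  simp only [Prod.fst_add, add_zero]
  abel

/-- The second structure equation. -/
theorem curvature_eq (h : IsLeafFrame m f₀ B₁ B₂) {z : R4 × ℂ} (hz : z ∈ B₁ ×ˢ B₂) (X Y : R4 × ℂ)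
    (k : R4) : m.hor z (curvature m.baseMetric z.1 X.1 Y.1 k) =
      fderiv ℝ (m.conn f₀) z X Y (m.hor z k) - fderiv ℝ (m.conn f₀) z Y X (m.hor z k) +
        (m.conn f₀ z X (m.conn f₀ z Y (m.hor z k)) - m.conn f₀ z Y (m.conn f₀ z X (m.hor z k))) := by
  have hO := h.isOpen
  have hcd : ContDiffAt ℝ ∞ m.hor z := h.contDiffOn_hor.contDiffAt (hO.mem_nhds hz)
  have hsym : IsSymmSndFDerivAt ℝ m.hor z :=
    hcd.isSymmSndFDerivAt (by simp only [minSmoothness_of_isRCLikeNormedField]; exact two_le_infty)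
  have hd2 : DifferentiableAt ℝ (fderiv ℝ m.hor) z :=
    (hcd.fderiv_right (m := 1) two_le_infty).differentiableAt (by simp)
  have hdG : DifferentiableAt ℝ (christoffel m.baseMetric) z.1 :=
    IsMovingFrame.differentiableAt_of h.open₁ (h.isMetricOn.contDiffOn_christoffel h.open₁) hz.1
  have hdC : DifferentiableAt ℝ (m.conn f₀) z :=
    IsMovingFrame.differentiableAt_of hO h.contDiffOn_conn hz
  -- The equation of parallelism `fderiv_hor` is differentiated once more; symmetry of the second
  -- derivative of the coframe then compares the two curvatures.
  have key : ∀ X Y : R4 × ℂ, fderiv ℝ (fderiv ℝ m.hor) z Y X k =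
      m.hor z (fderiv ℝ (christoffel m.baseMetric) z.1 Y.1 X.1 k) +
        fderiv ℝ m.hor z Y (christoffel m.baseMetric z.1 X.1 k) -
      (fderiv ℝ (m.conn f₀) z Y X (m.hor z k) + m.conn f₀ z X (fderiv ℝ m.hor z Y k)) := by
    intro X Y
    have e1 := (hasDerivAt_line_apply hd2 Y X).clm_apply (hasDerivAt_const 0 k)
    have e2 := (hasDerivAt_line (h.differentiableAt_hor hz) Y).clm_apply
      ((hasDerivAt_line_apply hdG Y.1 X.1).clm_apply (hasDerivAt_const 0 k))
    have e3 := (hasDerivAt_line_apply hdC Y X).clm_apply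
      (hasDerivAt_line_apply (h.differentiableAt_hor hz) Y k)
    have e4 := e1.unique ((e2.sub e3).congr_of_eventuallyEq ?_)
    · simp only [map_zero, add_zero, zero_smul] at e4
      rw [e4]
      abel
    · have hc : ContinuousAt (fun t : ℝ => z + t • Y) 0 := by fun_prop
      filter_upwards [hc.preimage_mem_nhds (hO.mem_nhds (by simpa using hz))] with t ht
      exact h.fderiv_hor ht X k
  have h1 := key X Y
  have h2 := key Y X
  rw [hsym.eq] at h1
  rw [h1] at h2
  simp only [h.fderiv_hor hz, map_sub, map_add] at h2
  simp only [curvature, add_apply, sub_apply, mul_apply_eq_comp, map_add, map_sub]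
  linear_combination (norm := module) -h2

end IsLeafFrame

/-! ### Curvature of the leaf space -/

/-- An endomorphism of `ℂ²`, transported to the leaf space by the coframe. -/
def FrameData.conjHor (m : FrameData (R4 × ℂ)) (z : R4 × ℂ) (A : EndV (ℂ × ℂ)) : EndV R4 :=
  (m.hor z).inverse.comp (A.comp (m.hor z))

/-- The complex structure on the tangent spaces of the leaf space. -/
def FrameData.cs (m : FrameData (R4 × ℂ)) (z : R4 × ℂ) : EndV R4 := m.conjHor z (selfDual 1 0)

theorem trace_omL_mul (a b c s : ℂ) : LinearMap.trace ℝ (ℂ × ℂ)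
    (omL (a, b, c, s) * selfDual 1 0).toLinearMap = -2 * (a + c).im := by
  rw [trace_C2]
  simp only [mul_apply_eq_comp, selfDual_apply, omL_apply]
  simp
  ring

theorem trace_selfDual_mul (s t : ℂ) : LinearMap.trace ℝ (ℂ × ℂ)
    (selfDual 0 s * selfDual 0 t).toLinearMap = -4 * (s * cj t).re := by
  rw [trace_C2]
  simp only [mul_apply_eq_comp, selfDual_apply]
  simp
  ring

namespace IsLeafFrame

variable {m : FrameData (R4 × ℂ)} {f₀ : ℂ} {B₁ : Set R4} {B₂ : Set ℂ}

theorem hor_conjHor (h : IsLeafFrame m f₀ B₁ B₂) {z : R4 × ℂ} (hz : z ∈ B₁ ×ˢ B₂)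
    (A : EndV (ℂ × ℂ)) (k : R4) : m.hor z (m.conjHor z A k) = A (m.hor z k) :=
  h.hor_inverse hz _

theorem conjHor_mul (h : IsLeafFrame m f₀ B₁ B₂) {z : R4 × ℂ} (hz : z ∈ B₁ ×ˢ B₂)
    (A B : EndV (ℂ × ℂ)) : m.conjHor z A * m.conjHor z B = m.conjHor z (A * B) := by
  refine ContinuousLinearMap.ext fun k => h.hor_injective hz ?_
  rw [mul_apply_eq_comp, h.hor_conjHor hz, h.hor_conjHor hz, h.hor_conjHor hz, mul_apply_eq_comp]

theorem eq_conjHor (h : IsLeafFrame m f₀ B₁ B₂) {z : R4 × ℂ} (hz : z ∈ B₁ ×ˢ B₂) {R : EndV R4}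
    {A : EndV (ℂ × ℂ)} (hR : ∀ k, m.hor z (R k) = A (m.hor z k)) : R = m.conjHor z A :=
  ContinuousLinearMap.ext fun k => h.hor_injective hz (by rw [hR, h.hor_conjHor hz])

theorem trace_conjHor (h : IsLeafFrame m f₀ B₁ B₂) {z : R4 × ℂ} (hz : z ∈ B₁ ×ˢ B₂)
    (A : EndV (ℂ × ℂ)) : LinearMap.trace ℝ R4 (m.conjHor z A).toLinearMap =
      LinearMap.trace ℝ (ℂ × ℂ) A.toLinearMap := by
  have h1 := LinearMap.trace_comp_comm' (R := ℝ) (A.comp (m.hor z)).toLinearMap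
    (m.hor z).inverse.toLinearMap
  refine h1.trans ?_
  congr 1
  refine LinearMap.ext fun w => ?_
  change A (m.hor z ((m.hor z).inverse w)) = A w
  rw [h.hor_inverse hz]

theorem contDiffOn_inverse (h : IsLeafFrame m f₀ B₁ B₂) :
    ContDiffOn ℝ ∞ (fun z => (m.hor z).inverse) (B₁ ×ˢ B₂) := by
  intro z hz
  obtain ⟨e, he⟩ := h.exists_equiv hz
  have h2 := contDiffAt_map_inverse (n := ∞) e
  rw [he] at h2
  exact (h2.comp z (h.contDiffOn_hor.contDiffAt (h.isOpen.mem_nhds hz))).contDiffWithinAt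

theorem contDiffOn_conjHor (h : IsLeafFrame m f₀ B₁ B₂) (A : EndV (ℂ × ℂ)) :
    ContDiffOn ℝ ∞ (fun z => m.conjHor z A) (B₁ ×ˢ B₂) :=
  h.contDiffOn_inverse.clm_comp (contDiffOn_const.clm_comp h.contDiffOn_hor)

theorem differentiableAt_cs (h : IsLeafFrame m f₀ B₁ B₂) {z : R4 × ℂ} (hz : z ∈ B₁ ×ˢ B₂) :
    DifferentiableAt ℝ m.cs z :=
  IsMovingFrame.differentiableAt_of h.isOpen (h.contDiffOn_conjHor _) hz

/-- The covariant derivative of the complex structure. -/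
theorem fderiv_cs (h : IsLeafFrame m f₀ B₁ B₂) {z : R4 × ℂ} (hz : z ∈ B₁ ×ˢ B₂) (X : R4 × ℂ) :
    fderiv ℝ m.cs z X + (christoffel m.baseMetric z.1 X.1 * m.cs z -
      m.cs z * christoffel m.baseMetric z.1 X.1) =
      m.conjHor z (selfDual 0 (-2 * Complex.I * (f₀ * cj (m.θ₃ z X)))) := by
  refine h.eq_conjHor hz fun k => ?_
  have hj : ∀ k, m.hor z (m.cs z k) = selfDual 1 0 (m.hor z k) := h.hor_conjHor hz _
  have e1 := (hasDerivAt_line (h.differentiableAt_hor hz) X).clm_apply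
    (hasDerivAt_line_apply (h.differentiableAt_cs hz) X k)
  have e2 := (hasDerivAt_const 0 (selfDual 1 0)).clm_apply
    (hasDerivAt_line_apply (h.differentiableAt_hor hz) X k)
  have e3 := e1.unique (e2.congr_of_eventuallyEq ?_)
  · simp only [zero_apply, add_zero, zero_smul, zero_add] at e3
    rw [h.fderiv_hor hz, h.fderiv_hor hz, hj] at e3
    -- Since the coframe is parallel, the covariant derivative of `cs` is the commutator of `conn`
    -- with multiplication by `i`. Only the antilinear entry fails to commute.
    rw [← omL_commutator (m.a z X) (m.b z X) (m.c z X), ← FrameData.conn_apply]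
    simp only [add_apply, sub_apply, mul_apply_eq_comp, map_add, map_sub, hj] at e3 ⊢
    linear_combination (norm := module) e3
  · have hc : ContinuousAt (fun t : ℝ => z + t • X) 0 := by fun_prop
    filter_upwards [hc.preimage_mem_nhds (h.isOpen.mem_nhds (by simpa using hz))] with t ht
    exact h.hor_conjHor ht _ k

theorem fderiv_conn (h : IsLeafFrame m f₀ B₁ B₂) {z : R4 × ℂ} (hz : z ∈ B₁ ×ˢ B₂) (X Y : R4 × ℂ) :
    fderiv ℝ (m.conn f₀) z X Y - fderiv ℝ (m.conn f₀) z Y X =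
      omL (extd m.a z X Y, extd m.b z X Y, extd m.c z X Y, f₀ * cj (extd m.θ₃ z X Y)) := by
  have key : ∀ X Y : R4 × ℂ, fderiv ℝ (m.conn f₀) z X Y =
      omL (fderiv ℝ m.a z X Y, fderiv ℝ m.b z X Y, fderiv ℝ m.c z X Y,
        f₀ * cj (fderiv ℝ m.θ₃ z X Y)) := by
    intro X Y
    have e1 := hasDerivAt_line_apply
      (IsMovingFrame.differentiableAt_of h.isOpen h.contDiffOn_conn hz) X Y
    have da := hasDerivAt_line_apply
      (IsMovingFrame.differentiableAt_of h.isOpen h.moving.smooth_a hz) X Y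
    have db := hasDerivAt_line_apply
      (IsMovingFrame.differentiableAt_of h.isOpen h.moving.smooth_b hz) X Y
    have dc := hasDerivAt_line_apply
      (IsMovingFrame.differentiableAt_of h.isOpen h.moving.smooth_c hz) X Y
    have dθ := (hasDerivAt_conj (hasDerivAt_line_apply
      (IsMovingFrame.differentiableAt_of h.isOpen h.moving.smooth_θ₃ hz) X Y)).const_mul f₀
    have e2 := omL.hasFDerivAt.comp_hasDerivAt 0 (da.prodMk (db.prodMk (dc.prodMk dθ)))
    refine e1.unique (e2.congr_of_eventuallyEq (Filter.Eventually.of_forall fun t => ?_))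
    exact FrameData.conn_apply _ _ _ _
  rw [key, key, ← map_sub]
  congr 1
  simp only [extd, Prod.mk_sub_mk, map_sub, mul_sub]

theorem conj_extd (h : IsLeafFrame m f₀ B₁ B₂) {z : R4 × ℂ} (hz : z ∈ B₁ ×ˢ B₂)
    {α : R4 × ℂ → (R4 × ℂ) →L[ℝ] ℂ} (hα : ContDiffOn ℝ ∞ α (B₁ ×ˢ B₂))
    (hc : ∀ z ∈ B₁ ×ˢ B₂, ∀ X, cj (α z X) = -α z X) (X Y : R4 × ℂ) :
    cj (extd α z X Y) = -extd α z X Y := by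
  have key : ∀ X Y, cj (fderiv ℝ α z X Y) = -fderiv ℝ α z X Y := by
    intro X Y
    have e1 := hasDerivAt_line_apply (IsMovingFrame.differentiableAt_of h.isOpen hα hz) X Y
    refine (hasDerivAt_conj e1).unique (e1.neg.congr_of_eventuallyEq ?_)
    have hc' : ContinuousAt (fun t : ℝ => z + t • X) 0 := by fun_prop
    filter_upwards [hc'.preimage_mem_nhds (h.isOpen.mem_nhds (by simpa using hz))] with t ht
    exact hc _ ht Y
  rw [extd, map_sub, key, key]
  ring

theorem curvature_skew (h : IsLeafFrame m f₀ B₁ B₂) {x : R4} (hx : x ∈ B₁) (u v w y : R4) :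
    curvature4 m.baseMetric x u v w y = -curvature4 m.baseMetric x u v y w := by
  have hz : (x, (0 : ℂ)) ∈ B₁ ×ˢ B₂ := ⟨hx, h.zero_mem⟩
  have h1 := h.curvature_eq hz (u, 0) (v, 0)
  simp only [← sub_apply, h.fderiv_conn hz] at h1
  simp only [curvature4]
  rw [h.isMetricOn.symm x hx (curvature m.baseMetric x u v y) w]
  change ipC (m.hor (x, 0) _) (m.hor (x, 0) _) = -ipC (m.hor (x, 0) _) (m.hor (x, 0) _)
  rw [h1, h1]
  simp only [map_add, map_sub, add_apply, sub_apply]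
  rw [omL_skew (h.conj_extd hz h.moving.smooth_a h.moving.conj_a _ _)
    (h.conj_extd hz h.moving.smooth_c h.moving.conj_c _ _), h.conn_skew hz, h.conn_skew hz,
    h.conn_skew hz, h.conn_skew hz]
  ring

/-- For horizontal lifts of `u` and `v` the entry `θ̄₃` of `conn` vanishes, so `conn` commutes with
`i` and the quadratic part of the curvature has no trace against `cs`. What remains is the imaginary
part of `da + dc`, known from `extd_trace`. -/
theorem trace_curvature_cs (h : IsLeafFrame m f₀ B₁ B₂) {z : R4 × ℂ} (hz : z ∈ B₁ ×ˢ B₂) (u v : R4) :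
    LinearMap.trace ℝ R4 (curvature m.baseMetric z.1 u v * m.cs z).toLinearMap =
      4 * Complex.normSq f₀ * m.baseMetric z.1 (m.cs z u) v := by
  obtain ⟨d, hd⟩ := h.exists_lift hz u
  obtain ⟨e, he⟩ := h.exists_lift hz v
  have h1 := h.curvature_eq hz (u, d) (v, e)
  simp only [← sub_apply, h.fderiv_conn hz] at h1
  have hcomm : ∀ d u, m.θ₃ z (u, d) = 0 → ∀ w, m.conn f₀ z (u, d) (selfDual 1 0 w) =
      selfDual 1 0 (m.conn f₀ z (u, d) w) := by
    intro d u hd w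
    have := omL_commutator (m.a z (u, d)) (m.b z (u, d)) (m.c z (u, d)) 0 w
    rw [FrameData.conn_apply, hd, map_zero, mul_zero]
    refine sub_eq_zero.1 (this.trans ?_)
    rw [selfDual_apply]
    simp
  set A := m.conn f₀ z (u, d) with hA
  set B := m.conn f₀ z (v, e) with hB
  set W := omL (extd m.a z (u, d) (v, e), extd m.b z (u, d) (v, e), extd m.c z (u, d) (v, e),
    f₀ * cj (extd m.θ₃ z (u, d) (v, e))) with hW
  have h2 : curvature m.baseMetric z.1 u v * m.cs z =
      m.conjHor z (W * selfDual 1 0 + (A * (B * selfDual 1 0) - (B * selfDual 1 0) * A)) := by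
    refine h.eq_conjHor hz fun k => ?_
    rw [mul_apply_eq_comp, h1, FrameData.cs, h.hor_conjHor hz]
    simp only [add_apply, sub_apply, mul_apply_eq_comp]
    rw [hcomm d u hd]
  have ht : LinearMap.trace ℝ (ℂ × ℂ) (A * (B * selfDual 1 0) - (B * selfDual 1 0) * A).toLinearMap
      = 0 := by
    change LinearMap.trace ℝ (ℂ × ℂ) (A.toLinearMap * (B * selfDual 1 0).toLinearMap -
      (B * selfDual 1 0).toLinearMap * A.toLinearMap) = 0
    rw [map_sub, LinearMap.trace_mul_comm, sub_self]
  rw [h2, h.trace_conjHor hz]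
  change LinearMap.trace ℝ (ℂ × ℂ) ((W * selfDual 1 0).toLinearMap +
    (A * (B * selfDual 1 0) - (B * selfDual 1 0) * A).toLinearMap) = _
  rw [map_add, ht, add_zero, hW, trace_omL_mul, h.moving.extd_trace h.isOpen hz hd he, h.f_eq z hz,
    h.baseMetric_eq hz, FrameData.cs, h.hor_conjHor hz, Complex.mul_conj]
  have e1 := h.hor_eq hz (u, d)
  have e2 := h.hor_eq hz (v, e)
  simp only at e1 e2
  rw [e1, e2, Complex.im_ofReal_mul, selfDual_apply, ipC_apply]
  simp
  ring

/-- Over a fixed point of the base, the relation of `trace_curvature_cs` is linear in the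
endomorphism and holds for `cs` at all points of the fibre. Hence it also holds for the fibre
derivatives of `cs`, which together with `cs` span the self-dual endomorphisms because `f₀ ≠ 0`. -/
theorem trace_curvature_selfDual (h : IsLeafFrame m f₀ B₁ B₂) {z : R4 × ℂ} (hz : z ∈ B₁ ×ˢ B₂)
    (t : ℝ) (s : ℂ) (u v : R4) :
    LinearMap.trace ℝ R4 (curvature m.baseMetric z.1 u v * m.conjHor z (selfDual t s)).toLinearMap =
      4 * Complex.normSq f₀ * m.baseMetric z.1 (m.conjHor z (selfDual t s) u) v := by
  let ℓ : EndV R4 →ₗ[ℝ] ℝ :=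
    { toFun := fun A => LinearMap.trace ℝ R4 (curvature m.baseMetric z.1 u v * A).toLinearMap -
        4 * Complex.normSq f₀ * m.baseMetric z.1 (A u) v
      map_add' := fun A B => by
        change LinearMap.trace ℝ R4 ((curvature m.baseMetric z.1 u v).toLinearMap *
          (A.toLinearMap + B.toLinearMap)) - _ = LinearMap.trace ℝ R4
          ((curvature m.baseMetric z.1 u v).toLinearMap * A.toLinearMap) - _ +
          (LinearMap.trace ℝ R4 ((curvature m.baseMetric z.1 u v).toLinearMap * B.toLinearMap) - _)
        rw [mul_add, map_add, add_apply, map_add, add_apply]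
        ring
      map_smul' := fun r A => by
        change LinearMap.trace ℝ R4 ((curvature m.baseMetric z.1 u v).toLinearMap *
          (r • A.toLinearMap)) - _ = r * (LinearMap.trace ℝ R4
          ((curvature m.baseMetric z.1 u v).toLinearMap * A.toLinearMap) - _)
        rw [mul_smul_comm, map_smul, smul_apply, map_smul, smul_apply, smul_eq_mul, smul_eq_mul]
        ring }
  have hℓ : ∀ A, ℓ A = LinearMap.trace ℝ R4 (curvature m.baseMetric z.1 u v * A).toLinearMap -
        4 * Complex.normSq f₀ * m.baseMetric z.1 (A u) v := fun A => rfl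
  suffices hs : ℓ (m.conjHor z (selfDual t s)) = 0 by
    rw [hℓ] at hs
    exact sub_eq_zero.1 hs
  have h1 : ℓ (m.cs z) = 0 := by rw [hℓ, h.trace_curvature_cs hz, sub_self]
  have h2 : ∀ s, ℓ (m.conjHor z (selfDual 0 s)) = 0 := by
    intro s
    -- The fibre direction is chosen so that the derivative of `cs` is the prescribed endomorphism:
    -- `-2i f₀ θ̄₃(w) = s`.
    obtain ⟨w, hw⟩ := (h.theta₃_bijective hz).2 (cj (s / (-2 * Complex.I * f₀)))
    have e := h.fderiv_cs hz (0, w)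
    have hw' : m.θ₃ z (0, w) = cj (s / (-2 * Complex.I * f₀)) := hw
    simp only [map_zero, zero_mul, mul_zero, sub_self, add_zero] at e
    rw [hw', Complex.conj_conj, show -2 * Complex.I * (f₀ * (s / (-2 * Complex.I * f₀))) = s by
      field_simp [h.f_ne, Complex.I_ne_zero]] at e
    rw [← e]
    have d := (LinearMap.toContinuousLinearMap ℓ).hasFDerivAt.comp_hasDerivAt 0
      (hasDerivAt_line (h.differentiableAt_cs hz) (0, w))
    refine d.unique ((hasDerivAt_const 0 0).congr_of_eventuallyEq ?_)
    have hc : ContinuousAt (fun t : ℝ => z + t • ((0, w) : R4 × ℂ)) 0 := by fun_prop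
    filter_upwards [hc.preimage_mem_nhds (h.isOpen.mem_nhds (by simpa using hz))] with t ht
    have hz1 : (z + t • ((0, w) : R4 × ℂ)).1 = z.1 := by simp
    have := h.trace_curvature_cs ht u v
    rw [hz1] at this
    change ℓ (m.cs (z + t • ((0, w) : R4 × ℂ))) = 0
    rw [hℓ, this, sub_self]
  have h3 : m.conjHor z (selfDual t s) = t • m.cs z + m.conjHor z (selfDual 0 s) := by
    refine (h.eq_conjHor hz fun k => ?_).symm
    rw [add_apply, smul_apply, map_add, map_smul, FrameData.cs, h.hor_conjHor hz, h.hor_conjHor hz]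
    refine Prod.ext ?_ ?_ <;> simp [selfDual_apply] <;> ring
  rw [h3, map_add, map_smul, h1, h2, smul_zero, add_zero]

theorem isQuaternionic (h : IsLeafFrame m f₀ B₁ B₂) {z : R4 × ℂ} (hz : z ∈ B₁ ×ˢ B₂) :
    IsQuaternionic (m.baseMetric z.1) (m.conjHor z (selfDual 1 0)) (m.conjHor z (selfDual 0 1))
      (m.conjHor z (selfDual 0 Complex.I)) := by
  have hsk : ∀ t s u v, m.baseMetric z.1 (m.conjHor z (selfDual t s) u) v =
      -m.baseMetric z.1 u (m.conjHor z (selfDual t s) v) := fun t s u v => by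
    rw [h.baseMetric_eq hz, h.baseMetric_eq hz, h.hor_conjHor hz, h.hor_conjHor hz, selfDual_skew]
  have hsq : ∀ t s, t ^ 2 + Complex.normSq s = 1 → ∀ u,
      m.conjHor z (selfDual t s) (m.conjHor z (selfDual t s) u) = -u := fun t s hts u => by
    refine h.hor_injective hz ?_
    rw [h.hor_conjHor hz, h.hor_conjHor hz, selfDual_sq, hts, map_neg]
    simp
  refine ⟨hsk 1 0, hsk 0 1, hsk 0 Complex.I, hsq 1 0 (by simp), hsq 0 1 (by simp),
    hsq 0 Complex.I (by simp), fun u => ?_, fun u => ?_, fun u => ?_⟩ <;>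
  · refine h.hor_injective hz ?_
    rw [h.hor_conjHor hz, h.hor_conjHor hz, h.hor_conjHor hz]
    refine Prod.ext ?_ ?_ <;> simp [selfDual_apply] <;> rw [← mul_assoc] <;> simp

/-! ### The Einstein equation and anti-self-duality of the leaf space. -/

theorem ricci_eq (h : IsLeafFrame m f₀ B₁ B₂) {x : R4} (hx : x ∈ B₁) (u v : R4) :
    ricci m.baseMetric x u v = 3 * (4 * Complex.normSq f₀) / 2 * m.baseMetric x u v := by
  have hz : (x, (0 : ℂ)) ∈ B₁ ×ˢ B₂ := ⟨hx, h.zero_mem⟩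
  have hE : Module.finrank ℝ R4 = 4 := finrank_euclideanSpace_fin
  have hq := h.isQuaternionic hz
  have t₁ := h.trace_curvature_selfDual hz 1 0
  have t₂ := h.trace_curvature_selfDual hz 0 1
  have t₃ := h.trace_curvature_selfDual hz 0 Complex.I
  simp only at hq t₁ t₂ t₃
  exact ricci_eq_of_quaternionic hE h.isMetricOn h.open₁ hx (h.curvature_skew hx) hq t₁ t₂ t₃ u v

theorem scal_eq (h : IsLeafFrame m f₀ B₁ B₂) {x : R4} (hx : x ∈ B₁) :
    scal m.baseMetric x = 4 * (3 * (4 * Complex.normSq f₀) / 2) :=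
  scal_eq_of_ricci finrank_euclideanSpace_fin h.isMetricOn hx (h.ricci_eq hx)

/-- Orthogonal complex structures on the leaf space that induce the orientation. -/
theorem exists_selfDual (h : IsLeafFrame m f₀ B₁ B₂) {z : R4 × ℂ} (hz : z ∈ B₁ ×ˢ B₂) {q : EndV R4}
    (hq : ∀ u v, m.baseMetric z.1 (q u) (q v) = m.baseMetric z.1 u v) (hq2 : ∀ u, q (q u) = -u)
    (hpos : ∀ u v, 0 ≤ stdBasis.det ![u, q u, v, q v]) :
    ∃ t s, t ^ 2 + Complex.normSq s = 1 ∧ q = m.conjHor z (selfDual t s) := by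
  have hi := h.inverse_hor hz
  have hi' := h.hor_inverse hz
  obtain ⟨t, s, hts, hqs⟩ := exists_selfDual_of_positive
    (q := (m.hor z).comp (q.comp (m.hor z).inverse)) (fun w y => by
      have := hq ((m.hor z).inverse w) ((m.hor z).inverse y)
      rw [h.baseMetric_eq hz, h.baseMetric_eq hz, hi', hi'] at this
      exact this) (fun w => by
      change m.hor z (q ((m.hor z).inverse (m.hor z (q ((m.hor z).inverse w))))) = -w
      rw [hi, hq2, map_neg, hi']) (fun w y => by
      have h1 := stdBasis.det_comp
        (kappa.symm.toContinuousLinearMap.comp (m.hor z)).toLinearMap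
        ![(m.hor z).inverse w, q ((m.hor z).inverse w), (m.hor z).inverse y,
          q ((m.hor z).inverse y)]
      have h2 : (kappa.symm.toContinuousLinearMap.comp (m.hor z)).toLinearMap ∘
          ![(m.hor z).inverse w, q ((m.hor z).inverse w), (m.hor z).inverse y,
          q ((m.hor z).inverse y)] = ![kappa.symm w, kappa.symm (m.hor z (q ((m.hor z).inverse w))),
            kappa.symm y, kappa.symm (m.hor z (q ((m.hor z).inverse y)))] := by
        refine funext fun i => ?_
        fin_cases i
        · exact congrArg kappa.symm (hi' w)
        · rfl
        · exact congrArg kappa.symm (hi' y)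
        · rfl
      rw [h2] at h1
      change 0 ≤ stdBasis.det ![kappa.symm w, kappa.symm (m.hor z (q ((m.hor z).inverse w))),
            kappa.symm y, kappa.symm (m.hor z (q ((m.hor z).inverse y)))]
      rw [h1]
      exact mul_nonneg (h.det_pos z hz).le (hpos _ _))
  refine ⟨t, s, hts, h.eq_conjHor hz fun k => ?_⟩
  rw [← hqs]
  change _ = m.hor z (q ((m.hor z).inverse (m.hor z k)))
  rw [hi]

/-- The rotation attached to a positive orthonormal frame is an orthogonal complex structure
inducing the orientation. It is therefore self-dual in the coframe and falls under the trace
relation. -/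
theorem isAntiSelfDualOn (h : IsLeafFrame m f₀ B₁ B₂) : IsAntiSelfDualOn stdBasis m.baseMetric B₁ := by
  intro x hx f hf u v
  have hz : (x, (0 : ℂ)) ∈ B₁ ×ˢ B₂ := ⟨hx, h.zero_mem⟩
  have hE : Module.finrank ℝ R4 = 4 := finrank_euclideanSpace_fin
  obtain ⟨b', hb', -⟩ := exists_basis_of_orthonormal (m.baseMetric x) hf.1 hE.symm
  have hqf : ∀ i, frameRotation (m.baseMetric x) f (f i) = (![f 1, -f 0, f 3, -f 2] : Fin 4 → R4) i :=
    fun i => by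
    rw [frameRotation_apply]
    fin_cases i <;> simp [hf.1]
  have hq2 : ∀ u, frameRotation (m.baseMetric x) f (frameRotation (m.baseMetric x) f u) = -u := by
    intro u
    have : (frameRotation (m.baseMetric x) f * frameRotation (m.baseMetric x) f).toLinearMap =
        (-1 : EndV R4).toLinearMap := by
      refine b'.ext fun i => ?_
      rw [hb']
      change frameRotation (m.baseMetric x) f (frameRotation (m.baseMetric x) f (f i)) = -(f i)
      rw [hqf]
      fin_cases i <;> simp [hqf]
    exact LinearMap.congr_fun this u
  have hsk : ∀ u v, m.baseMetric x (frameRotation (m.baseMetric x) f u) v =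
      -m.baseMetric x u (frameRotation (m.baseMetric x) f v) := by
    intro u v
    rw [frameRotation_apply, frameRotation_apply]
    simp only [map_add, map_sub, map_smul, add_apply, sub_apply, smul_apply, smul_eq_mul]
    simp only [h.isMetricOn.symm x hx v]
    ring
  obtain ⟨t, s, -, hts⟩ := h.exists_selfDual hz (q := frameRotation (m.baseMetric x) f)
    (fun u v => by rw [hsk, hq2, map_neg, neg_neg]) hq2 (det_frameRotation_nonneg hE stdBasis hf)
  exact weyl_add_eq_zero hE h.isMetricOn h.open₁ hx (h.curvature_skew hx) (h.ricci_eq hx) hf.1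
    (fun u v => by rw [hts]; exact h.trace_curvature_selfDual hz t s u v) u v

end IsLeafFrame

/-! ### The map to the twistor space -/

/-- The map to the twistor space of the leaf space. -/
def FrameData.lift (m : FrameData (R4 × ℂ)) (z : R4 × ℂ) : R4 × EndV R4 := (z.1, m.cs z)

/-- The determinant of `z, iz, w, iw` is `|z₁w₂ - z₂w₁|²`. -/
theorem det_complex_nonneg (z w : ℂ × ℂ) : 0 ≤ stdBasis.det ![kappa.symm z,
    kappa.symm (selfDual 1 0 z), kappa.symm w, kappa.symm (selfDual 1 0 w)] := by
  have hk : ∀ z, kappa.symm z = !₂[z.1.re, z.1.im, z.2.re, z.2.im] := fun z => rfl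
  have hs : ∀ z : ℂ × ℂ, selfDual 1 0 z = (Complex.I * z.1, Complex.I * z.2) := fun z => by
    rw [selfDual_apply]; simp
  rw [Module.Basis.det_apply, det_fin_four]
  simp only [Module.Basis.toMatrix_apply, OrthonormalBasis.coe_toBasis_repr_apply,
    EuclideanSpace.basisFun_repr]
  simp [hk, hs]
  have := Complex.normSq_nonneg (z.1 * w.2 - z.2 * w.1)
  rw [Complex.normSq_apply] at this
  simp at this
  linarith

theorem IsMovingFrame.mono {E : Type*} [NormedAddCommGroup E] [NormedSpace ℝ E] {m : FrameData E}
    {Ω Ω' : Set E} (h : IsMovingFrame m Ω) (hs : Ω' ⊆ Ω) : IsMovingFrame m Ω' where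
  smooth_θ₁ := h.smooth_θ₁.mono hs
  smooth_θ₂ := h.smooth_θ₂.mono hs
  smooth_θ₃ := h.smooth_θ₃.mono hs
  smooth_a := h.smooth_a.mono hs
  smooth_b := h.smooth_b.mono hs
  smooth_c := h.smooth_c.mono hs
  smooth_f := h.smooth_f.mono hs
  bijective x hx := h.bijective x (hs hx)
  conj_a x hx := h.conj_a x (hs hx)
  conj_c x hx := h.conj_c x (hs hx)
  d₁ x hx := h.d₁ x (hs hx)
  d₂ x hx := h.d₂ x (hs hx)
  d₃ x hx := h.d₃ x (hs hx)

/-! ### The lift to the twistor space: metric and almost complex structure. -/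

namespace IsLeafFrame

variable {m : FrameData (R4 × ℂ)} {f₀ : ℂ} {B₁ : Set R4} {B₂ : Set ℂ}

theorem mono (h : IsLeafFrame m f₀ B₁ B₂) {C₁ : Set R4} {C₂ : Set ℂ} (h₁ : C₁ ⊆ B₁) (h₂ : C₂ ⊆ B₂)
    (o₁ : IsOpen C₁) (o₂ : IsOpen C₂) (c₂ : Convex ℝ C₂) (z₂ : (0 : ℂ) ∈ C₂) :
    IsLeafFrame m f₀ C₁ C₂ where
  open₁ := o₁
  open₂ := o₂
  convex₂ := c₂
  zero_mem := z₂
  moving := h.moving.mono (Set.prod_mono h₁ h₂)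
  vertical₁ z hz := h.vertical₁ z (Set.prod_mono h₁ h₂ hz)
  vertical₂ z hz := h.vertical₂ z (Set.prod_mono h₁ h₂ hz)
  f_eq z hz := h.f_eq z (Set.prod_mono h₁ h₂ hz)
  f_ne := h.f_ne
  det_pos z hz := h.det_pos z (Set.prod_mono h₁ h₂ hz)

theorem contDiffOn_lift (h : IsLeafFrame m f₀ B₁ B₂) : ContDiffOn ℝ ∞ m.lift (B₁ ×ˢ B₂) :=
  contDiff_fst.contDiffOn.prodMk (h.contDiffOn_conjHor _)

theorem fderiv_lift (h : IsLeafFrame m f₀ B₁ B₂) {z : R4 × ℂ} (hz : z ∈ B₁ ×ˢ B₂) (X : R4 × ℂ) :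
    fderiv ℝ m.lift z X = (X.1, fderiv ℝ m.cs z X) := by
  have : HasFDerivAt m.lift _ z := hasFDerivAt_fst.prodMk (h.differentiableAt_cs hz).hasFDerivAt
  rw [this.fderiv]
  rfl

theorem lift_mem (h : IsLeafFrame m f₀ B₁ B₂) {z : R4 × ℂ} (hz : z ∈ B₁ ×ˢ B₂) :
    m.lift z ∈ twistorSpace stdBasis m.baseMetric B₁ := by
  have hq := h.isQuaternionic hz
  refine ⟨hz.1, fun u v => ?_, ContinuousLinearMap.ext fun u => ?_, fun u v => ?_⟩
  · change m.baseMetric z.1 (m.cs z u) (m.cs z v) = m.baseMetric z.1 u v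
    rw [FrameData.cs, hq.skew₁, hq.sq₁, map_neg, neg_neg]
  · exact hq.sq₁ u
  · change 0 ≤ stdBasis.det ![u, m.cs z u, v, m.cs z v]
    have h1 := stdBasis.det_comp
      (kappa.symm.toContinuousLinearMap.comp (m.hor z)).toLinearMap ![u, m.cs z u, v, m.cs z v]
    have h2 : (kappa.symm.toContinuousLinearMap.comp (m.hor z)).toLinearMap ∘
        ![u, m.cs z u, v, m.cs z v] = ![kappa.symm (m.hor z u), kappa.symm (selfDual 1 0 (m.hor z u)),
          kappa.symm (m.hor z v), kappa.symm (selfDual 1 0 (m.hor z v))] := by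
      refine funext fun i => ?_
      fin_cases i
      · rfl
      · exact congrArg kappa.symm (h.hor_conjHor hz _ u)
      · rfl
      · exact congrArg kappa.symm (h.hor_conjHor hz _ v)
    rw [h2] at h1
    have h3 := det_complex_nonneg (m.hor z u) (m.hor z v)
    rw [h1] at h3
    exact nonneg_of_mul_nonneg_right h3 (h.det_pos z hz)

/-- Subtracting the horizontal lift turns the derivative of `cs` into its covariant derivative. -/
theorem verticalPart_lift (h : IsLeafFrame m f₀ B₁ B₂) {z : R4 × ℂ} (hz : z ∈ B₁ ×ˢ B₂)
    (X : R4 × ℂ) : verticalPart m.baseMetric (m.lift z) (fderiv ℝ m.lift z X) =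
      m.conjHor z (selfDual 0 (-2 * Complex.I * (f₀ * cj (m.θ₃ z X)))) := by
  rw [h.fderiv_lift hz, ← h.fderiv_cs hz]
  exact sub_neg_eq_add _ _

/-- The vertical part is `selfDual 0 s` with `|s| = 2|f₀||θ₃|`, and `-tr` of its square is `4|s|² =
16|f₀|²|θ₃|²`. This forces `λ = 16|f₀|²`. -/
theorem twistorMetric_lift (h : IsLeafFrame m f₀ B₁ B₂) {z : R4 × ℂ} (hz : z ∈ B₁ ×ˢ B₂)
    (X Y : R4 × ℂ) : twistorMetric m.baseMetric (16 * Complex.normSq f₀) (m.lift z)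
      (fderiv ℝ m.lift z X) (fderiv ℝ m.lift z Y) =
      (m.θ₁ z X * cj (m.θ₁ z Y) + m.θ₂ z X * cj (m.θ₂ z Y) + m.θ₃ z X * cj (m.θ₃ z Y)).re := by
  have hf : Complex.normSq f₀ ≠ 0 := Complex.normSq_eq_zero.not.2 h.f_ne
  rw [twistorMetric, h.verticalPart_lift hz, h.verticalPart_lift hz, h.conjHor_mul hz,
    h.trace_conjHor hz, trace_selfDual_mul, h.fderiv_lift hz, h.fderiv_lift hz]
  change m.baseMetric z.1 X.1 Y.1 + _ = _
  rw [h.baseMetric_eq hz, h.hor_eq hz, h.hor_eq hz, ipC_eq_re]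
  have e : -2 * Complex.I * (f₀ * cj (m.θ₃ z X)) * cj (-2 * Complex.I * (f₀ * cj (m.θ₃ z Y))) =
      ((4 * Complex.normSq f₀ : ℝ) : ℂ) * cj (m.θ₃ z X * cj (m.θ₃ z Y)) := by
    push_cast
    rw [← Complex.mul_conj]
    simp only [map_mul, map_neg, map_ofNat, Complex.conj_I, Complex.conj_conj]
    linear_combination -4 * f₀ * cj f₀ * cj (m.θ₃ z X) * m.θ₃ z Y * Complex.I_mul_I
  rw [e, Complex.re_ofReal_mul, Complex.conj_re, Complex.add_re (_ + _)]
  field_simp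
  ring

/-- Here `Y` plays the role of `JX`. The vertical part depends on `θ̄₃`, so multiplying `θ₃` by `i`
multiplies its coefficient by `-i`, which is the action `A ↦ -jA`; horizontally `i` acts as `j`. -/
theorem fderiv_lift_eq_twistorJminus (h : IsLeafFrame m f₀ B₁ B₂) {z : R4 × ℂ} (hz : z ∈ B₁ ×ˢ B₂)
    {X Y : R4 × ℂ} (h₁ : m.θ₁ z Y = Complex.I * m.θ₁ z X) (h₂ : m.θ₂ z Y = Complex.I * m.θ₂ z X)
    (h₃ : m.θ₃ z Y = Complex.I * m.θ₃ z X) :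
    fderiv ℝ m.lift z Y = twistorJminus m.baseMetric (m.lift z) (fderiv ℝ m.lift z X) := by
  have hY : Y.1 = m.cs z X.1 := by
    refine h.hor_injective hz ?_
    rw [FrameData.cs, h.hor_conjHor hz, h.hor_eq hz, h.hor_eq hz, selfDual_apply, h₁, h₂]
    simp
  rw [twistorJminus, h.verticalPart_lift hz, h.fderiv_lift hz, h.fderiv_lift hz]
  change _ = horizontalLift m.baseMetric (m.lift z) (m.cs z X.1) + (0, -(m.cs z * _))
  rw [← hY]
  refine Prod.ext (add_zero _).symm ?_
  change fderiv ℝ m.cs z Y = -(christoffel m.baseMetric z.1 Y.1 * m.cs z -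
    m.cs z * christoffel m.baseMetric z.1 Y.1) + -(m.cs z * _)
  have e := h.fderiv_cs hz Y
  have e2 : m.cs z * m.conjHor z (selfDual 0 (-2 * Complex.I * (f₀ * cj (m.θ₃ z X)))) =
      -m.conjHor z (selfDual 0 (-2 * Complex.I * (f₀ * cj (m.θ₃ z Y)))) := by
    rw [FrameData.cs, h.conjHor_mul hz]
    refine (h.eq_conjHor hz fun k => ?_).symm
    rw [neg_apply, map_neg, h.hor_conjHor hz, h₃, mul_apply_eq_comp, selfDual_apply, selfDual_apply,
      selfDual_apply]
    refine Prod.ext ?_ ?_ <;>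
      simp only [Prod.fst_neg, Prod.snd_neg, map_mul, Complex.conj_I, Complex.ofReal_zero,
        Complex.ofReal_one] <;> ring
  rw [e2, ← e]
  abel

end IsLeafFrame

/-! ### Coordinates on the twistor space -/

/-- The coordinates `(x, s)` of the endomorphism of `TₓN` given by `selfDual t s` in the coframe. -/
def FrameData.coord (m : FrameData (R4 × ℂ)) (y : R4 × EndV R4) : R4 × ℂ :=
  (y.1, (m.hor (y.1, 0) (y.2 ((m.hor (y.1, 0)).inverse (0, 1)))).1)

/-- The coordinate `t` of the endomorphism of `TₓN` given by `selfDual t s` in the coframe. -/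
def FrameData.height (m : FrameData (R4 × ℂ)) (y : R4 × EndV R4) : ℝ :=
  (m.hor (y.1, 0) (y.2 ((m.hor (y.1, 0)).inverse (0, 1)))).2.im

namespace IsLeafFrame

variable {m : FrameData (R4 × ℂ)} {f₀ : ℂ} {B₁ : Set R4} {B₂ : Set ℂ}

theorem contDiffOn_coord_aux (h : IsLeafFrame m f₀ B₁ B₂) :
    ContDiffOn ℝ ∞ (fun y : R4 × EndV R4 =>
      m.hor (y.1, 0) (y.2 ((m.hor (y.1, 0)).inverse (0, 1)))) (B₁ ×ˢ Set.univ) := by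
  have hm : Set.MapsTo (fun y : R4 × EndV R4 => (y.1, (0 : ℂ))) (B₁ ×ˢ Set.univ) (B₁ ×ˢ B₂) :=
    fun y hy => ⟨hy.1, h.zero_mem⟩
  have hs : ContDiffOn ℝ ∞ (fun y : R4 × EndV R4 => (y.1, (0 : ℂ))) (B₁ ×ˢ Set.univ) :=
    (contDiff_fst.prodMk contDiff_const).contDiffOn
  have h1 := h.contDiffOn_hor.comp hs hm
  have h2 := h.contDiffOn_inverse.comp hs hm
  exact h1.clm_apply (contDiff_snd.contDiffOn.clm_apply (h2.clm_apply contDiffOn_const))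

theorem contDiffOn_coord (h : IsLeafFrame m f₀ B₁ B₂) :
    ContDiffOn ℝ ∞ m.coord (B₁ ×ˢ Set.univ) :=
  contDiff_fst.contDiffOn.prodMk (contDiff_fst.comp_contDiffOn h.contDiffOn_coord_aux)

theorem continuousOn_height (h : IsLeafFrame m f₀ B₁ B₂) :
    ContinuousOn m.height (B₁ ×ˢ Set.univ) :=
  Complex.continuous_im.comp_continuousOn
    (continuous_snd.comp_continuousOn h.contDiffOn_coord_aux.continuousOn)

theorem coord_selfDual (h : IsLeafFrame m f₀ B₁ B₂) {x : R4} (hx : x ∈ B₁) (t : ℝ) (s : ℂ) :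
    m.coord (x, m.conjHor (x, 0) (selfDual t s)) = (x, s) ∧
      m.height (x, m.conjHor (x, 0) (selfDual t s)) = t := by
  have hz : (x, (0 : ℂ)) ∈ B₁ ×ˢ B₂ := ⟨hx, h.zero_mem⟩
  simp only [FrameData.coord, FrameData.height]
  rw [h.hor_conjHor hz, h.hor_inverse hz, selfDual_apply]
  simp

/-- The twistor space is the upper hemisphere in the coordinates `coord` and `height`. -/
theorem coord_injOn (h : IsLeafFrame m f₀ B₁ B₂) {y y' : R4 × EndV R4}
    (hy : y ∈ twistorSpace stdBasis m.baseMetric B₁) (hy' : y' ∈ twistorSpace stdBasis m.baseMetric B₁)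
    (hp : 0 < m.height y) (hp' : 0 < m.height y') (hc : m.coord y = m.coord y') : y = y' := by
  have key : ∀ y ∈ twistorSpace stdBasis m.baseMetric B₁, ∃ t s, t ^ 2 + Complex.normSq s = 1 ∧
      y = (y.1, m.conjHor (y.1, 0) (selfDual t s)) := by
    rintro ⟨x, q⟩ ⟨hx, hq, hq2, hpos⟩
    obtain ⟨t, s, hts, e⟩ := h.exists_selfDual (z := (x, 0)) ⟨hx, h.zero_mem⟩ (q := q) hq
      (fun u => by simpa using congrArg (fun A : EndV R4 => A u) hq2) hpos
    exact ⟨t, s, hts, by rw [← e]⟩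
  obtain ⟨t, s, hts, e⟩ := key y hy
  obtain ⟨t', s', hts', e'⟩ := key y' hy'
  obtain ⟨c1, c2⟩ := h.coord_selfDual hy.1 t s
  obtain ⟨c1', c2'⟩ := h.coord_selfDual hy'.1 t' s'
  rw [← e] at c1 c2
  rw [← e'] at c1' c2'
  rw [c1, c1', Prod.mk.injEq] at hc
  rw [c2] at hp
  rw [c2'] at hp'
  have ht : t = t' := by
    have : t ^ 2 = t' ^ 2 := by rw [hc.2] at hts; linarith
    exact (pow_left_inj₀ hp.le hp'.le two_ne_zero).1 this
  rw [e, e', hc.1, hc.2, ht]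

/-- The leaf coordinates are local coordinates of the twistor space. -/
theorem exists_diffeo (h : IsLeafFrame m f₀ B₁ B₂) (h0 : (0 : R4) ∈ B₁) :
    ∃ ε > 0, Metric.ball (0 : R4) ε ⊆ B₁ ∧ Metric.ball (0 : ℂ) ε ⊆ B₂ ∧
      ∃ (W : Set (R4 × EndV R4)) (Ψ : R4 × EndV R4 → R4 × ℂ), IsOpen W ∧
        m.lift '' (Metric.ball (0 : R4) ε ×ˢ Metric.ball (0 : ℂ) ε) =
          twistorSpace stdBasis m.baseMetric (Metric.ball (0 : R4) ε) ∩ W ∧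
        ContDiffOn ℝ ∞ Ψ W ∧
        Set.MapsTo Ψ W (Metric.ball (0 : R4) ε ×ˢ Metric.ball (0 : ℂ) ε) ∧
        ∀ z ∈ Metric.ball (0 : R4) ε ×ˢ Metric.ball (0 : ℂ) ε, Ψ (m.lift z) = z := by
  have hz : (0 : R4 × ℂ) ∈ B₁ ×ˢ B₂ := ⟨h0, h.zero_mem⟩
  have hlm : Set.MapsTo m.lift (B₁ ×ˢ B₂) (B₁ ×ˢ Set.univ) := fun z hz => ⟨hz.1, trivial⟩
  -- The lift lands in a submanifold of `R4 × EndV R4`. Composing with `coord` gives a map between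
  -- spaces of equal dimension, to which the inverse function theorem applies.
  have hsm : ContDiffOn ℝ ∞ (m.coord ∘ m.lift) (B₁ ×ˢ B₂) := h.contDiffOn_coord.comp h.contDiffOn_lift hlm
  have hd : DifferentiableAt ℝ (m.coord ∘ m.lift) 0 :=
    IsMovingFrame.differentiableAt_of h.isOpen hsm hz
  set T := fderiv ℝ (m.coord ∘ m.lift) 0 with hT
  have hT1 : ∀ X, (T X).1 = X.1 := by
    intro X
    have e1 := (ContinuousLinearMap.fst ℝ R4 ℂ).hasFDerivAt.comp_hasDerivAt 0 (hasDerivAt_line hd X)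
    have e2 : HasDerivAt (fun t : ℝ => ((0 : R4 × ℂ) + t • X).1) X.1 0 := by
      have := (ContinuousLinearMap.fst ℝ R4 ℂ).hasFDerivAt.comp_hasDerivAt 0
        (((hasDerivAt_id (0 : ℝ)).smul_const X).const_add 0)
      rw [one_smul] at this
      exact this
    exact e1.unique e2
  -- In the fibre direction the derivative is that of `cs`, read off from the image of `(0, 1)`; it
  -- is injective because `f₀ ≠ 0` and `θ₃` is injective on the fibre.
  have hT2 : ∀ w, (T (0, w)).2 = -2 * Complex.I * (f₀ * cj (m.θ₃ 0 (0, w))) := by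
    intro w
    have e1 := (ContinuousLinearMap.snd ℝ R4 ℂ).hasFDerivAt.comp_hasDerivAt 0
      (hasDerivAt_line hd (0, w))
    have e3 := (ContinuousLinearMap.fst ℝ ℂ ℂ).hasFDerivAt.comp_hasDerivAt 0
      (((hasDerivAt_const (0 : ℝ) (m.hor 0)).clm_apply
      ((hasDerivAt_line_apply (h.differentiableAt_cs hz) (0, w) ((m.hor 0).inverse (0, 1))))))
    have e4 := e1.unique (e3.congr_of_eventuallyEq (Filter.Eventually.of_forall fun t => ?_))
    · refine e4.trans ?_
      have e5 := h.fderiv_cs hz (0, w)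
      simp only [map_zero, zero_mul, mul_zero, sub_self, add_zero] at e5
      simp only [zero_apply, zero_add]
      rw [e5, h.hor_conjHor hz, h.hor_inverse hz, selfDual_apply]
      simp
    · simp only [Function.comp_apply, FrameData.coord, FrameData.lift, Prod.fst_add, Prod.smul_mk,
        Prod.fst_zero, smul_zero, add_zero]
      rfl
  have hinj : Function.Injective T := by
    refine (injective_iff_map_eq_zero _).2 fun X hX => ?_
    have h1 : X.1 = 0 := by rw [← hT1, hX]; rfl
    have h2 : X = (0, X.2) := Prod.ext h1 rfl
    have h3 := hT2 X.2
    rw [← h2, hX] at h3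
    have h4 : m.θ₃ 0 X = 0 := by
      have : (0 : ℂ) = -2 * Complex.I * (f₀ * cj (m.θ₃ 0 X)) := h3
      simpa [h.f_ne, Complex.I_ne_zero] using this.symm
    have h5 : X.2 = 0 := (h.theta₃_bijective hz).1 (by
      change m.θ₃ 0 (0, X.2) = m.θ₃ 0 (0, 0)
      rw [← h2, h4]
      exact (map_zero _).symm)
    exact Prod.ext h1 h5
  let e : (R4 × ℂ) ≃L[ℝ] R4 × ℂ :=
    (LinearEquiv.ofInjectiveEndo T.toLinearMap hinj).toContinuousLinearEquiv
  have he : (e : (R4 × ℂ) →L[ℝ] R4 × ℂ) = T := rfl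
  obtain ⟨Θ, hΘ0, hΘs, hΘ, hΘi⟩ := exists_smooth_inverse h.isOpen hsm hz e (by
    rw [he]; exact hd.hasFDerivAt)
  have hcont : ContinuousAt (m.height ∘ m.lift) 0 :=
    (h.continuousOn_height.comp h.contDiffOn_lift.continuousOn hlm).continuousAt (h.isOpen.mem_nhds hz)
  have hh0 : (m.height ∘ m.lift) 0 = 1 := (h.coord_selfDual h0 1 0).2
  have hN : {z | z ∈ Θ.source ∧ 0 < m.height (m.lift z)} ∈ 𝓝 (0 : R4 × ℂ) :=
    Filter.inter_mem (Θ.open_source.mem_nhds hΘ0)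
      (hcont.eventually (lt_mem_nhds (by rw [hh0]; exact one_pos)))
  obtain ⟨ε, hε, hb⟩ := Metric.mem_nhds_iff.1 hN
  have hb' : ∀ z ∈ Metric.ball (0 : R4) ε ×ˢ Metric.ball (0 : ℂ) ε,
      z ∈ Θ.source ∧ 0 < m.height (m.lift z) := fun z hz => hb (by
    rw [← ball_prod_same] at *
    exact hz)
  have s₁ : Metric.ball (0 : R4) ε ⊆ B₁ := fun x hx =>
    (hΘs (hb' (x, 0) ⟨hx, Metric.mem_ball_self hε⟩).1).1
  have s₂ : Metric.ball (0 : ℂ) ε ⊆ B₂ := fun x hx =>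
    (hΘs (hb' (0, x) ⟨Metric.mem_ball_self hε, hx⟩).1).2
  have hleaf := h.mono s₁ s₂ Metric.isOpen_ball Metric.isOpen_ball (convex_ball _ _)
    (Metric.mem_ball_self hε)
  let O : Set (R4 × ℂ) := Metric.ball (0 : R4) ε ×ˢ Metric.ball (0 : ℂ) ε
  have hOs : O ⊆ Θ.source := fun z hz => (hb' z hz).1
  have hO : IsOpen (Θ '' O) := Θ.isOpen_image_of_subset_source hleaf.isOpen hOs
  have hu : IsOpen (Metric.ball (0 : R4) ε ×ˢ (Set.univ : Set (EndV R4))) :=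
    Metric.isOpen_ball.prod isOpen_univ
  -- On the twistor fibre `t² + |s|² = 1` holds, so `(x, s)` determines the point only where `t >
  -- 0`. The condition on `height` selects this hemisphere, which contains the lift because its
  -- height is `1` at the origin and stays positive on the small ball.
  let W : Set (R4 × EndV R4) :=
    ((Metric.ball (0 : R4) ε ×ˢ (Set.univ : Set (EndV R4))) ∩ m.coord ⁻¹' (Θ '' O)) ∩
      ((Metric.ball (0 : R4) ε ×ˢ (Set.univ : Set (EndV R4))) ∩ m.height ⁻¹' Set.Ioi 0)
  have hΨ : ∀ z ∈ O, Θ.symm (m.coord (m.lift z)) = z := fun z hz => by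
    have := hΘ z
    rw [Function.comp_apply] at this
    rw [← this, Θ.left_inv (hOs hz)]
  refine ⟨ε, hε, s₁, s₂, W, Θ.symm ∘ m.coord, ?_, ?_, ?_, ?_, hΨ⟩
  · exact (hleaf.contDiffOn_coord.continuousOn.isOpen_inter_preimage hu hO).inter
      (hleaf.continuousOn_height.isOpen_inter_preimage hu isOpen_Ioi)
  · refine Set.Subset.antisymm ?_ ?_
    · rintro _ ⟨z, hz, rfl⟩
      exact ⟨hleaf.lift_mem hz, ⟨⟨hz.1, trivial⟩, z, hz, hΘ z⟩, ⟨hz.1, trivial⟩, (hb' z hz).2⟩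
    · rintro y ⟨hy, ⟨-, z, hz, hzy⟩, -, hyp⟩
      rw [hΘ] at hzy
      exact ⟨z, hz, hleaf.coord_injOn (hleaf.lift_mem hz) hy (hb' z hz).2 hyp hzy⟩
  · refine hΘi.comp (hleaf.contDiffOn_coord.mono fun y hy => hy.1.1) fun y hy => ?_
    obtain ⟨z, hz, hzy⟩ := hy.1.2
    rw [← hzy]
    exact Θ.map_source (hOs hz)
  · intro y hy
    obtain ⟨z, hz, hzy⟩ := hy.1.2
    rw [Function.comp_apply, ← hzy, Θ.left_inv (hOs hz)]
    exact hz

end IsLeafFrame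

/-- A moving frame in leaf coordinates is a leaf frame near the origin. -/
theorem IsMovingFrame.exists_isLeafFrame {m : FrameData (R4 × ℂ)} {O : Set (R4 × ℂ)} (hO : IsOpen O)
    (hm : IsMovingFrame m O) (h0 : 0 ∈ O) (hv₁ : ∀ z ∈ O, ∀ w, m.θ₁ z (0, w) = 0)
    (hv₂ : ∀ z ∈ O, ∀ w, m.θ₂ z (0, w) = 0)
    (hk : ∀ k, (m.θ₁ 0 (k, 0), m.θ₂ 0 (k, 0)) = kappa k) (hf : m.f 0 ≠ 0) :
    ∃ ε > 0, Metric.ball (0 : R4) ε ×ˢ Metric.ball (0 : ℂ) ε ⊆ O ∧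
      IsLeafFrame m (m.f 0) (Metric.ball 0 ε) (Metric.ball 0 ε) := by
  have hsm : ContDiffOn ℝ ∞ m.hor O :=
    (contDiffOn_const.clm_comp (hm.smooth_θ₁.clm_comp contDiffOn_const)).add
      (contDiffOn_const.clm_comp (hm.smooth_θ₂.clm_comp contDiffOn_const))
  have hcont : ContinuousAt (fun z => (kappa.symm.toContinuousLinearMap.comp (m.hor z)).det) 0 :=
    ContinuousLinearMap.continuous_det.continuousAt.comp
      (continuousAt_const.clm_comp (hsm.continuousOn.continuousAt (hO.mem_nhds h0)))
  have hd0 : (kappa.symm.toContinuousLinearMap.comp (m.hor 0)).det = 1 := by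
    have : kappa.symm.toContinuousLinearMap.comp (m.hor 0) = ContinuousLinearMap.id ℝ R4 := by
      refine ContinuousLinearMap.ext fun k => ?_
      change kappa.symm (m.hor 0 k) = k
      rw [FrameData.hor_apply, hk]
      exact kappa.symm_apply_apply k
    rw [this]
    exact LinearMap.det_id
  have hN : {z | z ∈ O ∧ 0 < (kappa.symm.toContinuousLinearMap.comp (m.hor z)).det} ∈
      𝓝 (0 : R4 × ℂ) := Filter.inter_mem (hO.mem_nhds h0)
    (hcont.eventually (lt_mem_nhds (one_pos.trans_eq hd0.symm)))
  obtain ⟨ε, hε, hb⟩ := Metric.mem_nhds_iff.1 hN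
  have hbp : Metric.ball (0 : R4) ε ×ˢ Metric.ball (0 : ℂ) ε = Metric.ball (0 : R4 × ℂ) ε :=
    ball_prod_same _ _ _
  have hbO : Metric.ball (0 : R4) ε ×ˢ Metric.ball (0 : ℂ) ε ⊆ O := fun z hz => (hb (hbp ▸ hz)).1
  refine ⟨ε, hε, hbO, Metric.isOpen_ball, Metric.isOpen_ball, convex_ball _ _,
    Metric.mem_ball_self hε, hm.mono hbO, fun z hz => hv₁ z (hbO hz), fun z hz => hv₂ z (hbO hz),
    fun z hz => ?_, hf, fun z hz => (hb (hbp ▸ hz)).2⟩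
  refine Metric.isOpen_ball.is_const_of_fderiv_eq_zero (s := Metric.ball (0 : R4 × ℂ) ε) (𝕜 := ℝ)
    (convex_ball _ _).isPreconnected
    (fun y hy => (IsMovingFrame.differentiableAt_of hO hm.smooth_f
      (hb hy).1).differentiableWithinAt) (fun y hy => hm.fderiv_f hO (hb hy).1) (hbp ▸ hz)
    (Metric.mem_ball_self hε)

/-! ### The local isomorphism with the twistor space -/

section Assembly

variable {E : Type*} [NormedAddCommGroup E] [NormedSpace ℝ E] {M : Type*} [TopologicalSpace M]
  [ChartedSpace E M] [IsManifold 𝓘(ℝ, E) ∞ M] {g : RiemMetric E M} {J : EndField E M}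

/-- The differential of a map that is given in a chart. -/
theorem mfderiv_comp_extChartAt {V : Type*} [NormedAddCommGroup V] [NormedSpace ℝ V] {φ : E → V}
    {p x : M} (hx : x ∈ (extChartAt 𝓘(ℝ, E) p).source)
    (hφ : DifferentiableAt ℝ φ (extChartAt 𝓘(ℝ, E) p x)) (v : E) :
    (mfderiv 𝓘(ℝ, E) 𝓘(ℝ, V) (fun x => φ (extChartAt 𝓘(ℝ, E) p x)) x : E →L[ℝ] V) v =
      fderiv ℝ φ (extChartAt 𝓘(ℝ, E) p x) (dC p x v) := by
  have h1 : MDifferentiableAt 𝓘(ℝ, E) 𝓘(ℝ, E) (extChartAt 𝓘(ℝ, E) p) x :=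
    mdifferentiableAt_extChartAt (by rwa [← extChartAt_source 𝓘(ℝ, E)])
  have h2 := mfderiv_comp x hφ.mdifferentiableAt h1
  rw [mfderiv_eq_fderiv] at h2
  exact congrArg (fun A : E →L[ℝ] V => A v) h2

theorem IsAdaptedFrame.inner_eq {p : M} {L : Submodule ℝ E} {r : ℝ} {m : FrameData E}
    (h : IsAdaptedFrame g J p L r m) {x : M} (hx : x ∈ (extChartAt 𝓘(ℝ, E) p).source)
    (hxb : extChartAt 𝓘(ℝ, E) p x ∈ Metric.ball (extChartAt 𝓘(ℝ, E) p p) r) (u v : E) :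
    innerE g x u v = (m.θ₁ (extChartAt 𝓘(ℝ, E) p x) (dC p x u) *
      cj (m.θ₁ (extChartAt 𝓘(ℝ, E) p x) (dC p x v)) +
      m.θ₂ (extChartAt 𝓘(ℝ, E) p x) (dC p x u) * cj (m.θ₂ (extChartAt 𝓘(ℝ, E) p x) (dC p x v)) +
      m.θ₃ (extChartAt 𝓘(ℝ, E) p x) (dC p x u) *
        cj (m.θ₃ (extChartAt 𝓘(ℝ, E) p x) (dC p x v))).re := by
  rw [← h.metric _ hxb, chartMetric_apply, dCI_dC' hx, dCI_dC' hx,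
    (extChartAt 𝓘(ℝ, E) p).left_inv hx]

theorem chartEnd_dC (J : EndField E M) {p x : M} (hx : x ∈ (extChartAt 𝓘(ℝ, E) p).source) (u : E) :
    chartEnd J p (extChartAt 𝓘(ℝ, E) p x) (dC p x u) = dC p x (endE J x u) := by
  rw [chartEnd_apply, dCI_dC' hx, (extChartAt 𝓘(ℝ, E) p).left_inv hx]

/-- An adapted frame defines a local isomorphism with a twistor space. -/
theorem IsAdaptedFrame.exists_twistorIsomorphism [FiniteDimensional ℝ E] (hJ : IsAlmostHermitian g J)
    {p : M} {L : Submodule ℝ E} {r : ℝ} (hr : 0 < r) {m : FrameData E}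
    (hA : IsAdaptedFrame g J p L r m) (hf : m.f (extChartAt 𝓘(ℝ, E) p p) ≠ 0) :
    ∃ (U : Set M) (Ω : Set R4) (G : R4 → Bil R4) (lam : ℝ) (F : M → R4 × EndV R4),
      IsOpen U ∧ IsConnected U ∧ p ∈ U ∧ IsParallelDistributionOn g J U (frameDistribution m p) ∧
        IsOpen Ω ∧ IsMetricOn G Ω ∧
        IsLeafSpaceSubmersion g U (frameDistribution m p) G Ω (fun x => (F x).1) ∧
        IsEinsteinOn G Ω ∧ IsAntiSelfDualOn stdBasis G Ω ∧
        0 < lam ∧ (∀ x ∈ Ω, lam = 2 * scal G x / 3) ∧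
        IsTwistorIsomorphism g J U G Ω lam F := by
  obtain ⟨Λ, hΛ0, hΛp, hΛt, hΛ, hΛi, hmov, hvert, hkap⟩ :=
    hA.moving.exists_leaf_coordinates Metric.isOpen_ball (Metric.mem_ball_self hr)
  set n : FrameData (R4 × ℂ) := m.pullback Λ with hn
  have hf0 : n.f 0 ≠ 0 := by
    change m.f (Λ 0) ≠ 0
    rwa [hΛp]
  obtain ⟨ε₀, hε₀, hs₀, hleaf₀⟩ := hmov.exists_isLeafFrame Λ.open_source hΛ0
    (fun z hz w => (hvert z hz w).1) (fun z hz w => (hvert z hz w).2) hkap hf0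
  obtain ⟨ε, hε, hs₁, hs₂, W, Ψ, hW, himg, hΨ, hΨm, hΨl⟩ :=
    hleaf₀.exists_diffeo (Metric.mem_ball_self hε₀)
  have hl := hleaf₀.mono hs₁ hs₂ Metric.isOpen_ball Metric.isOpen_ball (convex_ball _ _)
    (Metric.mem_ball_self hε)
  set f₀ := n.f 0 with hf₀
  set b₁ := Metric.ball (0 : R4) ε with hb₁
  set b₂ := Metric.ball (0 : ℂ) ε with hb₂
  have hOs : b₁ ×ˢ b₂ ⊆ Λ.source := (Set.prod_mono hs₁ hs₂).trans hs₀
  have h0O : (0 : R4 × ℂ) ∈ b₁ ×ˢ b₂ := ⟨Metric.mem_ball_self hε, Metric.mem_ball_self hε⟩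
  set χ := extChartAt 𝓘(ℝ, E) p with hχ
  have hΛO : IsOpen (Λ '' (b₁ ×ˢ b₂)) := Λ.isOpen_image_of_subset_source hl.isOpen hOs
  have hΛb : ∀ z ∈ b₁ ×ˢ b₂, Λ z ∈ Metric.ball (χ p) r := fun z hz => hΛt (Λ.map_source (hOs hz))
  have hΛχ : ∀ z ∈ b₁ ×ˢ b₂, Λ z ∈ χ.target := fun z hz => hA.ball_subset (hΛb z hz)
  -- `U` corresponds to a product of balls under the inverse maps `ζ` and `σ`, which makes `U` and
  -- all fibres of the submersion connected.
  let U : Set M := χ.source ∩ χ ⁻¹' (Λ '' (b₁ ×ˢ b₂))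
  let ζ : M → R4 × ℂ := fun x => Λ.symm (χ x)
  let σ : R4 × ℂ → M := fun z => χ.symm (Λ z)
  have hζ : ∀ x ∈ U, ζ x ∈ b₁ ×ˢ b₂ ∧ Λ (ζ x) = χ x := by
    rintro x ⟨-, z, hz, hzx⟩
    have : ζ x = z := by
      change Λ.symm (χ x) = z
      rw [← hzx, Λ.left_inv (hOs hz)]
    rw [this]
    exact ⟨hz, hzx⟩
  have hσζ : ∀ x ∈ U, σ (ζ x) = x := fun x hx => by
    change χ.symm (Λ (ζ x)) = x
    rw [(hζ x hx).2, χ.left_inv hx.1]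
  have hσU : ∀ z ∈ b₁ ×ˢ b₂, σ z ∈ U := fun z hz =>
    ⟨χ.map_target (hΛχ z hz), z, hz, (χ.right_inv (hΛχ z hz)).symm⟩
  have hζσ : ∀ z ∈ b₁ ×ˢ b₂, ζ (σ z) = z := fun z hz => by
    change Λ.symm (χ (χ.symm (Λ z))) = z
    rw [χ.right_inv (hΛχ z hz), Λ.left_inv (hOs hz)]
  have hσc : ContinuousOn σ (b₁ ×ˢ b₂) :=
    (continuousOn_extChartAt_symm p).comp (Λ.continuousOn.mono hOs) hΛχ
  have hUb : ∀ x ∈ U, χ x ∈ Metric.ball (χ p) r := fun x hx => by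
    rw [← (hζ x hx).2]
    exact hΛb _ (hζ x hx).1
  let F : M → R4 × EndV R4 := fun x => n.lift (ζ x)
  let dζ : M → E →L[ℝ] R4 × ℂ := fun x => (fderiv ℝ Λ.symm (χ x)).comp (dC p x)
  have hbij : ∀ x ∈ U, ∀ w, fderiv ℝ Λ (ζ x) (fderiv ℝ Λ.symm (χ x) w) = w := fun x hx w => by
    obtain ⟨hb, hi⟩ := bijective_fderiv_of_openPartialHomeomorph Λ hΛ hΛi (hOs (hζ x hx).1)
    obtain ⟨u, rfl⟩ := hb.2 w
    have := hi u
    rw [(hζ x hx).2] at this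
    rw [this]
  have hθ : ∀ x ∈ U, ∀ (θ : E → E →L[ℝ] ℂ) v,
      pullbackForm Λ θ (ζ x) (dζ x v) = θ (χ x) (dC p x v) := fun x hx θ v => by
    change θ (Λ (ζ x)) (fderiv ℝ Λ (ζ x) (fderiv ℝ Λ.symm (χ x) (dC p x v))) = _
    rw [hbij x hx, (hζ x hx).2]
  have hdsurj : ∀ x ∈ U, Function.Surjective (dζ x) := fun x hx z => by
    obtain ⟨-, hi⟩ := bijective_fderiv_of_openPartialHomeomorph Λ hΛ hΛi (hOs (hζ x hx).1)
    refine ⟨dCI p (χ x) (fderiv ℝ Λ (ζ x) z), ?_⟩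
    change fderiv ℝ Λ.symm (χ x) (dC p x (dCI p (χ x) _)) = z
    rw [dC_dCI' hx.1, ← (hζ x hx).2, hi]
  have hΛd : ∀ x ∈ U, DifferentiableAt ℝ Λ.symm (χ x) := fun x hx =>
    IsMovingFrame.differentiableAt_of Λ.open_target hΛi (by
      rw [← (hζ x hx).2]; exact Λ.map_source (hOs (hζ x hx).1))
  have hlc : ∀ x ∈ U, DifferentiableAt ℝ n.lift (Λ.symm (χ x)) := fun x hx =>
    IsMovingFrame.differentiableAt_of hl.isOpen hl.contDiffOn_lift (hζ x hx).1
  have hdF : ∀ x ∈ U, ∀ v : E, (mfderiv 𝓘(ℝ, E) 𝓘(ℝ, R4 × EndV R4) F x : E →L[ℝ] R4 × EndV R4) v =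
      fderiv ℝ n.lift (ζ x) (dζ x v) := fun x hx v => by
    have h1 := mfderiv_comp_extChartAt hx.1 ((hlc x hx).comp (χ x) (hΛd x hx)) v
    rw [fderiv_comp _ (hlc x hx) (hΛd x hx)] at h1
    exact h1
  have hdπ : ∀ x ∈ U, ∀ v : E, (mfderiv 𝓘(ℝ, E) 𝓘(ℝ, R4) (fun x => (F x).1) x : E →L[ℝ] R4) v =
      (dζ x v).1 := fun x hx v => by
    have h1 := mfderiv_comp_extChartAt (φ := fun y => (Λ.symm y).1) hx.1 (hΛd x hx).fst v
    rw [(hΛd x hx).hasFDerivAt.fst.fderiv] at h1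
    exact h1
  have hin : ∀ x ∈ U, ∀ u v : E, innerE g x u v =
      (n.θ₁ (ζ x) (dζ x u) * cj (n.θ₁ (ζ x) (dζ x v)) +
        n.θ₂ (ζ x) (dζ x u) * cj (n.θ₂ (ζ x) (dζ x v)) +
        n.θ₃ (ζ x) (dζ x u) * cj (n.θ₃ (ζ x) (dζ x v))).re := fun x hx u v => by
    rw [hA.inner_eq hx.1 (hUb x hx), ← hθ x hx, ← hθ x hx, ← hθ x hx, ← hθ x hx, ← hθ x hx,
      ← hθ x hx]
    rfl
  have hmem : ∀ x ∈ U, ∀ v : E, v ∈ frameDistribution m p x ↔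
      n.θ₁ (ζ x) (dζ x v) = 0 ∧ n.θ₂ (ζ x) (dζ x v) = 0 := fun x hx v => by
    rw [mem_frameDistribution, ← hθ x hx, ← hθ x hx]
    rfl
  have hsmF : ContMDiffOn 𝓘(ℝ, E) 𝓘(ℝ, R4 × EndV R4) ∞ F U := by
    have h1 : ContDiffOn ℝ ∞ (n.lift ∘ Λ.symm) (Λ '' (b₁ ×ˢ b₂)) := by
      refine hl.contDiffOn_lift.comp (hΛi.mono ?_) ?_
      · rintro _ ⟨z, hz, rfl⟩
        exact Λ.map_source (hOs hz)
      · rintro _ ⟨z, hz, rfl⟩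
        rw [Λ.left_inv (hOs hz)]
        exact hz
    exact h1.contMDiffOn.comp ((contMDiffOn_extChartAt (I := 𝓘(ℝ, E)) (n := ∞) (x := p)).mono
      fun x hx => by rw [← extChartAt_source 𝓘(ℝ, E)]; exact hx.1) fun x hx => hx.2
  have hpU : p ∈ U := by
    have := hσU 0 h0O
    have h2 : σ 0 = p := by
      change χ.symm (Λ 0) = p
      rw [hΛp]
      exact extChartAt_to_inv p
    rwa [h2] at this
  have hUσ : σ '' (b₁ ×ˢ b₂) = U := by
    refine Set.Subset.antisymm ?_ fun x hx => ⟨ζ x, (hζ x hx).1, hσζ x hx⟩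
    rintro _ ⟨z, hz, rfl⟩
    exact hσU z hz
  have hnpos : 0 < Complex.normSq f₀ := Complex.normSq_pos.2 hf0
  refine ⟨U, b₁, n.baseMetric, 16 * Complex.normSq f₀, F, ?_, ?_, hpU, ?_, hl.open₁, hl.isMetricOn,
    ?_, ⟨_, fun x hx => hl.ricci_eq hx⟩, hl.isAntiSelfDualOn, by positivity, fun x hx => ?_, ?_⟩
  · exact (continuousOn_extChartAt p).isOpen_inter_preimage (isOpen_extChartAt_source p) hΛO
  · rw [← hUσ]
    exact ((convex_ball (0 : R4) ε).prod (convex_ball (0 : ℂ) ε)).isConnected ⟨0, h0O⟩ |>.image σ hσc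
  · exact hA.isParallelDistributionOn hJ fun x hx => ⟨hx.1, hUb x hx⟩
  · refine ⟨(contDiff_fst (𝕜 := ℝ) (n := ∞) (E := R4) (F := EndV R4)).contMDiff.comp_contMDiffOn hsmF, ?_,
      fun x hx => ?_, fun x hx (v : E) => ?_, fun x hx (u v : E) hu hv => ?_, fun y hy => ?_⟩
    · refine Set.Subset.antisymm ?_ fun y hy => ?_
      · rintro _ ⟨x, hx, rfl⟩
        exact (hζ x hx).1.1
      · have hz : (y, (0 : ℂ)) ∈ b₁ ×ˢ b₂ := ⟨hy, Metric.mem_ball_self hε⟩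
        exact ⟨σ (y, 0), hσU _ hz, congrArg Prod.fst (hζσ _ hz)⟩
    · intro k
      obtain ⟨v, hv⟩ := hdsurj x hx (k, 0)
      exact ⟨v, (hdπ x hx v).trans (by rw [hv])⟩
    · refine Iff.trans ?_ (hmem x hx v).symm
      have h1 := hl.hor_eq (hζ x hx).1 (dζ x v)
      have h2 : (mfderiv 𝓘(ℝ, E) 𝓘(ℝ, R4) (fun x => (F x).1) x : E →L[ℝ] R4) v = 0 ↔
          (dζ x v).1 = 0 :=
        ⟨fun e => (hdπ x hx v).symm.trans e, fun e => (hdπ x hx v).trans e⟩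
      refine h2.trans ?_
      constructor
      · intro h3
        rw [h3, map_zero] at h1
        exact ⟨(congrArg Prod.fst h1).symm, (congrArg Prod.snd h1).symm⟩
      · rintro ⟨h3, h4⟩
        rw [h3, h4] at h1
        exact hl.hor_injective (hζ x hx).1 (h1.trans (map_zero _).symm)
    -- A vector orthogonal to the distribution is tested against the vertical `w` with `θ₃(w) =
    -- θ₃(u)`; their inner product is `|θ₃(u)|²`.
    · have key : ∀ u : E, (∀ w ∈ frameDistribution m p x, innerE g x u w = 0) →
          n.θ₃ (ζ x) (dζ x u) = 0 := by
        intro u hu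
        obtain ⟨X, hX⟩ := (hl.moving.bijective _ (hζ x hx).1).2 (0, 0, n.θ₃ (ζ x) (dζ x u))
        obtain ⟨w, rfl⟩ := hdsurj x hx X
        simp only [Prod.mk.injEq] at hX
        have := hu w ((hmem x hx w).2 ⟨hX.1, hX.2.1⟩)
        rw [hin x hx, hX.1, hX.2.1, hX.2.2] at this
        simp only [map_zero, mul_zero, zero_add, Complex.mul_conj, Complex.ofReal_re] at this
        exact Complex.normSq_eq_zero.1 this
      have hu' := key u hu
      refine (congrArg₂ (fun a b : R4 => n.baseMetric (ζ x).1 a b) (hdπ x hx u) (hdπ x hx v)).trans ?_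
      change n.baseMetric (ζ x).1 (dζ x u).1 (dζ x v).1 = innerE g x u v
      rw [hl.baseMetric_eq (hζ x hx).1, hl.hor_eq (hζ x hx).1,
        hl.hor_eq (hζ x hx).1, ipC_eq_re, hin x hx, hu', zero_mul, add_zero]
    · have : U ∩ (fun x => (F x).1) ⁻¹' {y} = σ '' ({y} ×ˢ b₂) := by
        refine Set.Subset.antisymm ?_ ?_
        · rintro x ⟨hx, hxy⟩
          exact ⟨ζ x, ⟨hxy, (hζ x hx).1.2⟩, hσζ x hx⟩
        · rintro _ ⟨z, ⟨hz1, hz2⟩, rfl⟩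
          have hz : z ∈ b₁ ×ˢ b₂ := ⟨by rw [Set.mem_singleton_iff.1 hz1]; exact hy, hz2⟩
          refine ⟨hσU z hz, ?_⟩
          change (ζ (σ z)).1 ∈ ({y} : Set R4)
          rw [hζσ z hz]
          exact hz1
      rw [this]
      have hc : Convex ℝ (({y} : Set R4) ×ˢ b₂) := (convex_singleton y).prod (convex_ball 0 ε)
      exact (hc.isConnected ⟨(y, 0), rfl, Metric.mem_ball_self hε⟩).image σ
        (hσc.mono (Set.prod_mono (Set.singleton_subset_iff.2 hy) subset_rfl))
  -- The scalar curvature is `24|f₀|²`, and two thirds of it is `16|f₀|²`.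
  · rw [hl.scal_eq hx]
    ring
  · refine ⟨hsmF, ⟨W, fun y => σ (Ψ y), hW, ?_, ?_, fun x hx => ?_⟩, fun x hx (u v : E) => ?_,
      fun x hx (u : E) => ?_⟩
    · rw [← himg]
      refine Set.Subset.antisymm ?_ ?_
      · rintro _ ⟨x, hx, rfl⟩
        exact ⟨ζ x, (hζ x hx).1, rfl⟩
      · rintro _ ⟨z, hz, rfl⟩
        exact ⟨σ z, hσU z hz, congrArg n.lift (hζσ z hz)⟩
    · have h1 : ContDiffOn ℝ ∞ (fun y => Λ (Ψ y)) W :=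
        (hΛ.mono hOs).comp hΨ hΨm
      exact (contMDiffOn_extChartAt_symm (I := 𝓘(ℝ, E)) (n := ∞) p).comp h1.contMDiffOn
        fun y hy => hΛχ _ (hΨm hy)
    · change σ (Ψ (n.lift (ζ x))) = x
      rw [hΨl _ (hζ x hx).1, hσζ x hx]
    · refine (congrArg₂ (fun a b : R4 × EndV R4 => twistorMetric n.baseMetric
        (16 * Complex.normSq f₀) (n.lift (ζ x)) a b) (hdF x hx u) (hdF x hx v)).trans ?_
      change twistorMetric n.baseMetric (16 * Complex.normSq f₀) (n.lift (ζ x))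
        (fderiv ℝ n.lift (ζ x) (dζ x u)) (fderiv ℝ n.lift (ζ x) (dζ x v)) = innerE g x u v
      rw [hl.twistorMetric_lift (hζ x hx).1, hin x hx]
    · refine (hdF x hx (endE J x u)).trans (Eq.trans ?_ (congrArg (fun a : R4 × EndV R4 =>
        twistorJminus n.baseMetric (n.lift (ζ x)) a) (hdF x hx u)).symm)
      have hc := chartEnd_dC J hx.1 u
      refine hl.fderiv_lift_eq_twistorJminus (hζ x hx).1 ?_ ?_ ?_
      · change pullbackForm Λ m.θ₁ _ _ = _ * pullbackForm Λ m.θ₁ _ _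
        rw [hθ x hx, hθ x hx, ← hc, hA.complex₁ _ (hUb x hx)]
      · change pullbackForm Λ m.θ₂ _ _ = _ * pullbackForm Λ m.θ₂ _ _
        rw [hθ x hx, hθ x hx, ← hc, hA.complex₂ _ (hUb x hx)]
      · change pullbackForm Λ m.θ₃ _ _ = _ * pullbackForm Λ m.θ₃ _ _
        rw [hθ x hx, hθ x hx, ← hc, hA.complex₃ _ (hUb x hx)]

end Assembly

end GrayTwistor

end

/-! ### Conclusion: the local isomorphism around every point. -/

theorem mainTheorem2 {E : Type*} [NormedAddCommGroup E] [NormedSpace ℝ E] [FiniteDimensional ℝ E]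
    (hE : Module.finrank ℝ E = 6)
    {M : Type*} [TopologicalSpace M] [T2Space M] [SecondCountableTopology M]
    [ConnectedSpace M] [ChartedSpace E M] [IsManifold 𝓘(ℝ, E) ∞ M]
    (g : RiemMetric E M) (J : EndField E M) (hGray : IsStrictNearlyKahler g J)
    (q : M) (L : Submodule ℝ (TangentSpace 𝓘(ℝ, E) q)) (hL : IsComplexLine J q L)
    (hhol : holonomyAlgebra g J q ⊆ specialUnitarySplit g J q L) (p : M) :
    (∃ P, IsTransport g J q p P) ∧
    ∀ P : TangentSpace 𝓘(ℝ, E) q →L[ℝ] TangentSpace 𝓘(ℝ, E) p, IsTransport g J q p P →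
      ∃ (U : Set M) (D : (x : M) → Submodule ℝ (TangentSpace 𝓘(ℝ, E) x))
        (Ω : Set R4) (G : R4 → Bil R4) (lam : ℝ) (F : M → R4 × EndV R4),
        IsOpen U ∧ IsConnected U ∧ p ∈ U ∧
        IsParallelDistributionOn g J U D ∧ D p = L.map P.toLinearMap ∧
        IsOpen Ω ∧ IsMetricOn G Ω ∧
        IsLeafSpaceSubmersion g U D G Ω (fun x => (F x).1) ∧
        IsEinsteinOn G Ω ∧ IsAntiSelfDualOn stdBasis G Ω ∧
        0 < lam ∧ (∀ x ∈ Ω, lam = 2 * scal G x / 3) ∧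
        IsTwistorIsomorphism g J U G Ω lam F := by
  have hJ := hGray.toIsAlmostHermitian
  refine ⟨exists_transport hJ q p, fun P hP => ?_⟩
  obtain ⟨r, hr, m, hA⟩ := exists_adaptedFrame (E := E) hGray.toIsNearlyKahler hE hP hL hhol
  -- A zero of the torsion function at `p` would be a zero of `∇J`, which strictness and
  -- connectedness exclude.
  have hf : m.f (extChartAt 𝓘(ℝ, E) p p) ≠ 0 := fun h0 =>
    hGray.exists_nablaJ_ne_zero hE hL hhol p
      ((hA.f_eq_zero_iff _ (Metric.mem_ball_self hr)).1 h0)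
  obtain ⟨U, Ω, G, lam, F, hU, hUc, hpU, hpar, hΩ, hG, hsub, hEin, hW, hlam, hscal, hiso⟩ :=
    hA.exists_twistorIsomorphism hJ hr hf
  exact ⟨U, frameDistribution m p, Ω, G, lam, F, hU, hUc, hpU, hpar, hA.frameDistribution_self, hΩ, hG,
    hsub, hEin, hW, hlam, hscal, hiso⟩
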